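/- **Setting.** Let $M$ be a smooth oriented manifold (Hausdorff, $\sigma$-compact, without boundary) of real dimension $2n$, and $H$ a closed real 3-form. On $T\oplus T^*$ put $\langle X+\xi,Y+\eta\rangle=\tfrac12(\xi(Y)+\eta(X))$, and let it act on complex differential forms by $(X+\xi)\cdot\rho=i_X\rho+\xi\wedge\rho$. Let $d_H=d+H\wedge\cdot$; the Courant bracket $[A,B]_H$ is the derived bracket, $[A,B]_H\cdot\rho=[[d_H,A\cdot],B\cdot]\rho$. A generalized complex structure is a smooth orthogonal endomorphism $\mathcal J$ of $T\oplus T^*$ with $\mathcal J^2=-1$ whose $+i$-eigenbundle in $(T\oplus T^*)\otimes\mathbb C$ is closed under $[\,,]_H$. A generalized Kähler structure is a pair $(\mathcal J_1,\mathcal J_2)$ of commuting generalized complex structures such that, with $G=-\mathcal J_1\mathcal J_2$, $\langle GA,A\rangle>0$ for all $A\neq0$. The endomorphisms $\mathcal J_i\in\mathfrak{so}(T\oplus T^*)$ act on forms by the spin representation; $U_k$ denotes the $ik$-eigenspace of $\mathcal J_1$ (or of $\mathcal J_2$), and $U_{p,q}$ the intersection of the $ip$-eigenspace of $\mathcal J_1$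 and the $iq$-eigenspace of $\mathcal J_2$. Let $\bar\partial_j,\partial_j$ ($j=1,2$) be the parts of $d_H$ raising, respectively lowering, the eigenvalue index of $\mathcal J_j$ by one, and let $$\bar\partial_+:U_{p,q}\to U_{p+1,q+1},\quad \bar\partial_-:U_{p,q}\to U_{p+1,q-1},\quad \partial_+:U_{p,q}\to U_{p-1,q-1},\quad \partial_-:U_{p,q}\to U_{p-1,q+1}$$ be the corresponding components of $d_H$. Let $*=a_1\cdots a_{2n}$ be the Clifford product of an oriented orthonormal basis of the $+1$-eigenbundle $C_+$ of $G$ (oriented by the projection $C_+\cong T$), let $\sigma$ be the anti-automorphism reversing products, and $\langle\alpha,\beta\rangle=[\alpha\wedge\sigma(\beta)]_{2n}$. The Born–Infeld inner product is $h(\alpha,\beta)=\int_M\langle\alpha,\sigma(*)\bar\beta\rangle$. The adjoint $D^*$ of an operator $D$ on smooth forms is the operator on smooth forms with $h(D\alpha,\beta)=h(\alpha,D^*\beta)$ for all smooth $\alpha,\beta$ at least one of which has compact support (no restriction if $M$ is compact), and $\Delta_D=DD^*+D^*D$. **Proposition (generalized Kähler identities).** For every generalized Kähler structure as above, on smooth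 forms $$d_H=\partial_++\partial_-+\bar\partial_++\bar\partial_-,$$ the operators $d_H,\bar\partial_1,\bar\partial_2,\partial_1,\partial_2,\bar\partial_\pm,\partial_\pm$ all have adjoints, $$\bar\partial_+^*=-\partial_+,\qquad \bar\partial_-^*=\partial_-,$$ and all the Laplacians agree up to constants: $$\Delta_{d_H}=2\Delta_{\bar\partial_1}=2\Delta_{\bar\partial_2}=2\Delta_{\partial_1}=2\Delta_{\partial_2}=4\Delta_{\bar\partial_+}=4\Delta_{\bar\partial_-}=4\Delta_{\partial_+}=4\Delta_{\partial_-}.$$ -/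

import Mathlib

open scoped Manifold ContDiff

noncomputable section

namespace GenKahler

/-! ### Linear algebra of `V ⊕ V*` and of complex exterior forms on a real vector space `V` -/

section Fibre

variable {V : Type*} [AddCommGroup V] [Module ℝ V] [TopologicalSpace V]

/-- The fibre `V ⊕ V*` of the generalized tangent bundle. -/
abbrev Gen (V : Type*) [AddCommGroup V] [Module ℝ V] [TopologicalSpace V] : Type _ :=
  V × (V →L[ℝ] ℝ)

/-- Complex exterior forms of mixed degree on `V`: a form of degree `k` for every `k`
(if `V` has dimension `d`, the components of degree `k > d` vanish automatically). -/
abbrev Spinor (V : Type*) [AddCommGroup V] [Module ℝ V] [TopologicalSpace V] : Type _ :=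
  ∀ k : ℕ, V [⋀^Fin k]→L[ℝ] ℂ

/-- The inner product `⟨X + ξ, Y + η⟩ = (ξ(Y) + η(X)) / 2` on `V ⊕ V*`. -/
def pairing (A B : Gen V) : ℝ := (1 / 2 : ℝ) * (A.2 B.1 + B.2 A.1)

/-- The interior product `(i_X η)(v₁, …, v_k) = η(X, v₁, …, v_k)`. -/
def contraction (X : V) {k : ℕ} (η : V [⋀^Fin (k + 1)]→L[ℝ] ℂ) : V [⋀^Fin k]→L[ℝ] ℂ :=
  { η.toAlternatingMap.curryLeft X with
    cont := η.cont.comp (Continuous.finCons continuous_const continuous_id) }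

/-- The multilinear map `(v₁, …, v_{a+b}) ↦ α(v₁, …, v_a) β(v_{a+1}, …, v_{a+b})`. -/
def tensor {a b : ℕ} (α : V [⋀^Fin a]→L[ℝ] ℂ) (β : V [⋀^Fin b]→L[ℝ] ℂ) :
    ContinuousMultilinearMap ℝ (fun _ : Fin (a + b) => V) ℂ where
  toMultilinearMap :=
    ((LinearMap.mul' ℝ ℂ).compMultilinearMap
      (α.toAlternatingMap.toMultilinearMap.domCoprod
        β.toAlternatingMap.toMultilinearMap)).domDomCongr finSumFinEquiv
  cont := by
    have hα : Continuous fun v : Fin (a + b) → V => α (fun i => v (Fin.castAdd b i)) :=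
      α.cont.comp (continuous_pi fun i => continuous_apply _)
    have hβ : Continuous fun v : Fin (a + b) → V => β (fun j => v (Fin.natAdd a j)) :=
      β.cont.comp (continuous_pi fun j => continuous_apply _)
    exact hα.mul hβ

/-- The wedge product of homogeneous forms,
`(α ∧ β)(v) = 1/(a! b!) ∑_σ sign(σ) α(v_{σ(1)}, …, v_{σ(a)}) β(v_{σ(a+1)}, …, v_{σ(a+b)})`. -/
def wedgeHom {a b : ℕ} (α : V [⋀^Fin a]→L[ℝ] ℂ) (β : V [⋀^Fin b]→L[ℝ] ℂ) :
    V [⋀^Fin (a + b)]→L[ℝ] ℂ :=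
  ((a.factorial * b.factorial : ℝ)⁻¹) • ContinuousMultilinearMap.alternatization (tensor α β)

/-- A form of degree `a`, regarded as a form of degree `b = a`. -/
def castDegree {a b : ℕ} (h : a = b) (η : V [⋀^Fin a]→L[ℝ] ℂ) : V [⋀^Fin b]→L[ℝ] ℂ :=
  { η.toAlternatingMap.domDomCongr (finCongr h) with
    cont := η.cont.comp (continuous_pi fun _ => continuous_apply _) }

/-- The wedge product of forms of mixed degree. -/
def wedge (α β : Spinor V) : Spinor V := fun k =>
  ∑ a : Fin (k + 1),
    castDegree (Nat.add_sub_cancel' (Nat.le_of_lt_succ a.isLt)) (wedgeHom (α a) (β (k - a)))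

/-- A homogeneous form of degree `k`, regarded as a form of mixed degree. -/
def homog (k : ℕ) (η : V [⋀^Fin k]→L[ℝ] ℂ) : Spinor V := Pi.single k η

/-- A real form, regarded as a complex form. -/
def complexify {k : ℕ} (η : V [⋀^Fin k]→L[ℝ] ℝ) : V [⋀^Fin k]→L[ℝ] ℂ :=
  Complex.ofRealCLM.compContinuousAlternatingMap η

/-- A covector, regarded as a complex form of degree one. -/
def covector (ξ : V →L[ℝ] ℝ) : Spinor V :=
  homog 1 (complexify (ContinuousAlternatingMap.ofSubsingleton ℝ V ℝ (0 : Fin 1) ξ))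

/-- The spin representation `(X + ξ) · ρ = i_X ρ + ξ ∧ ρ`. -/
def cliff (A : Gen V) (ρ : Spinor V) : Spinor V :=
  (fun k => contraction A.1 (ρ (k + 1))) + wedge (covector A.2) ρ

/-- The anti-automorphism `σ` reversing the order of wedge products: it is multiplication by
`(-1)^{k(k-1)/2}` in degree `k`. -/
def reversal (ρ : Spinor V) : Spinor V := fun k => ((-1 : ℂ) ^ (k * (k - 1) / 2)) • ρ k

/-- Complex conjugation of forms. -/
def conjForm (ρ : Spinor V) : Spinor V := fun k =>
  (Complex.conjCLE : ℂ →L[ℝ] ℂ).compContinuousAlternatingMap (ρ k)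

/-- The bilinear form `⟨α, β⟩ = [α ∧ σ(β)]_d` with values in forms of top degree `d`. -/
def mukai (d : ℕ) (α β : Spinor V) : V [⋀^Fin d]→L[ℝ] ℂ := wedge α (reversal β) d

/-- The spin action of `J ∈ so(V ⊕ V*)`, i.e. of the element of the Clifford algebra whose
commutator with `A ∈ V ⊕ V*` is `J A`.  For dual frames `e_k`, `ε_k` of `V` and `V*` it is
`½ ∑_k (J(e_k) ε_k + J(ε_k) e_k)`, because `2 ε_k`, `2 e_k` is the frame dual to
`e_k`, `ε_k` for the inner product of `V ⊕ V*`. -/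
def spinAction {d : ℕ} (e : Fin d → V) (ε : Fin d → V →L[ℝ] ℝ) (J : Gen V →ₗ[ℝ] Gen V)
    (ρ : Spinor V) : Spinor V :=
  (1 / 2 : ℂ) • ∑ k : Fin d,
    (cliff (J (e k, 0)) (cliff (0, ε k) ρ) + cliff (J (0, ε k)) (cliff (e k, 0) ρ))

/-- The sign of a frame with respect to an orientation. -/
def frameSign {d : ℕ} (o : Orientation ℝ V (Fin d)) (v : Fin d → V) : ℝ :=
  SignType.sign (o.someVector v)

/-- `a` is an orthonormal frame of `C₊`, the `+1` eigenspace of `G`. -/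
def IsOrthonormalFrame {d : ℕ} (G : Gen V →ₗ[ℝ] Gen V) (a : Fin d → Gen V) : Prop :=
  (∀ i, G (a i) = a i) ∧ ∀ i j, pairing (a i) (a j) = if i = j then 1 else 0

/-- The action of `σ(∗) = a_d ⋯ a_1`, where `∗ = a_1 ⋯ a_d` is the product of an oriented
orthonormal frame of `C₊`; the isomorphism `C₊ → V` given by the projection carries the
orientation of `V` to `C₊`.  A negatively oriented frame is used with a minus sign. -/
def revStar {d : ℕ} (o : Orientation ℝ V (Fin d)) (G : Gen V →ₗ[ℝ] Gen V) (ρ : Spinor V) :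
    Spinor V :=
  let a : Fin d → Gen V := Classical.epsilon (IsOrthonormalFrame G)
  ((frameSign o fun i => (a i).1 : ℝ) : ℂ) • (List.ofFn a).foldl (fun τ v => cliff v τ) ρ

open Classical in
/-- The component of index `i` of the vector `v` with respect to a (direct) sum of the
subspaces `U i`: the `i`-th term of an expression of `v` as a finite sum of elements of the
`U i` (and zero if there is none). -/
def component {ι S : Type*} [AddCommMonoid S] (U : ι → Set S) (i : ι) (v : S) : S :=
  if h : ∃ c : ι →₀ S, (∀ j, c j ∈ U j) ∧ c.sum (fun _ w => w) = v then h.choose i else 0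

end Fibre

/-! ### Differential forms on a manifold of dimension `d` -/

/-- The model space `ℝᵈ`. -/
abbrev Mod (d : ℕ) : Type := EuclideanSpace ℝ (Fin d)

section Forms

variable {d : ℕ} {M : Type*} [TopologicalSpace M] [ChartedSpace (Mod d) M]

/-- Tangent spaces of `M`. -/
abbrev Tan (d : ℕ) {M : Type*} [TopologicalSpace M] [ChartedSpace (Mod d) M] (x : M) : Type :=
  TangentSpace (𝓡 d) x

/-- Differential forms of degree `k` with values in `F` (not assumed smooth). -/
abbrev KForm (d : ℕ) (M : Type*) [TopologicalSpace M] [ChartedSpace (Mod d) M]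
    (F : Type*) [NormedAddCommGroup F] [NormedSpace ℝ F] (k : ℕ) : Type _ :=
  ∀ x : M, Tan d x [⋀^Fin k]→L[ℝ] F

/-- Complex differential forms of mixed degree (not assumed smooth). -/
abbrev Form (d : ℕ) (M : Type*) [TopologicalSpace M] [ChartedSpace (Mod d) M] : Type _ :=
  ∀ x : M, Spinor (Tan d x)

/-- Sections of `T ⊕ T*` (not assumed smooth). -/
abbrev GenSec (d : ℕ) (M : Type*) [TopologicalSpace M] [ChartedSpace (Mod d) M] : Type _ :=
  ∀ x : M, Gen (Tan d x)

/-- Fields of endomorphisms of `T ⊕ T*` (not assumed smooth). -/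
abbrev GenEnd (d : ℕ) (M : Type*) [TopologicalSpace M] [ChartedSpace (Mod d) M] : Type _ :=
  ∀ x : M, Gen (Tan d x) →ₗ[ℝ] Gen (Tan d x)

/-- The differential at `y ∈ ℝᵈ` of the inverse of the chart at `x₀`. -/
def chartInvDeriv (x₀ : M) (y : Mod d) :
    Mod d →L[ℝ] Tan d ((extChartAt (𝓡 d) x₀).symm y) :=
  mfderiv 𝓘(ℝ, Mod d) (𝓡 d) (extChartAt (𝓡 d) x₀).symm y

/-- The differential at `x ∈ M` of the chart at `x₀`. -/
def chartDeriv (x₀ x : M) : Tan d x →L[ℝ] Mod d :=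
  mfderiv (𝓡 d) 𝓘(ℝ, Mod d) (extChartAt (𝓡 d) x₀) x

section
variable {F : Type*} [NormedAddCommGroup F] [NormedSpace ℝ F]

/-- The form `η` in the chart at `x₀`, i.e. its pullback under the inverse of the chart. -/
def localRep {k : ℕ} (η : KForm d M F k) (x₀ : M) (y : Mod d) : Mod d [⋀^Fin k]→L[ℝ] F :=
  (η ((extChartAt (𝓡 d) x₀).symm y)).compContinuousLinearMap (chartInvDeriv x₀ y)

/-- Smooth forms of degree `k`. -/
def KForm.IsSmooth {k : ℕ} (η : KForm d M F k) : Prop :=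
  ∀ x₀ : M, ContDiffOn ℝ ∞ (localRep η x₀) (extChartAt (𝓡 d) x₀).target

/-- The exterior derivative, computed at `x` in the chart at `x`. -/
def KForm.extD {k : ℕ} (η : KForm d M F k) : KForm d M F (k + 1) := fun x =>
  (extDeriv (localRep η x) (extChartAt (𝓡 d) x x)).compContinuousLinearMap (chartDeriv x x)

end

/-- Smooth forms of mixed degree. -/
def Form.IsSmooth (ρ : Form d M) : Prop :=
  ∀ k, KForm.IsSmooth (F := ℂ) fun x => ρ x k

/-- The exterior derivative of forms of mixed degree. -/
def Form.extD (ρ : Form d M) : Form d M := fun x k =>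
  match k with
  | 0 => 0
  | k + 1 => KForm.extD (F := ℂ) (fun x => ρ x k) x

/-- The twisted exterior derivative `d_H = d + H ∧ ·`. -/
def dH (H : KForm d M ℝ 3) (ρ : Form d M) : Form d M := fun x =>
  Form.extD ρ x + wedge (homog 3 (complexify (H x))) (ρ x)

/-- Forms with compact support. -/
def HasCompactSupp (ρ : Form d M) : Prop := IsCompact (closure {x | ρ x ≠ 0})

/-- Smooth sections of `T ⊕ T*`. -/
def GenSec.IsSmooth (A : GenSec d M) : Prop :=
  ∀ x₀ : M,
    ContDiffOn ℝ ∞ (fun y : Mod d =>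
        chartDeriv x₀ ((extChartAt (𝓡 d) x₀).symm y) (A ((extChartAt (𝓡 d) x₀).symm y)).1)
      (extChartAt (𝓡 d) x₀).target ∧
    ContDiffOn ℝ ∞ (fun y : Mod d =>
        (A ((extChartAt (𝓡 d) x₀).symm y)).2.comp (chartInvDeriv x₀ y))
      (extChartAt (𝓡 d) x₀).target

/-- A field of endomorphisms of `T ⊕ T*` is smooth if it preserves smoothness of sections. -/
def GenEnd.IsSmooth (J : GenEnd d M) : Prop :=
  ∀ A : GenSec d M, A.IsSmooth → GenSec.IsSmooth fun x => J x (A x)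

/-! ### Orientations and integration -/

/-- An orientation of `M`: the given orientations of the tangent spaces are locally constant
when compared with the coordinate frames of charts. -/
def IsOrientation (o : ∀ x : M, Orientation ℝ (Tan d x) (Fin d)) : Prop :=
  ∀ x₀ : M, ContinuousOn (fun y : Mod d =>
      frameSign (o ((extChartAt (𝓡 d) x₀).symm y))
        fun i => chartInvDeriv x₀ y (EuclideanSpace.single i 1))
    (extChartAt (𝓡 d) x₀).target

/-- A smooth partition of unity subordinate to the chart domains. -/
def chartPartition (d : ℕ) (M : Type*) [TopologicalSpace M] [ChartedSpace (Mod d) M]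
    [IsManifold (𝓡 d) ∞ M] [T2Space M] [SigmaCompactSpace M] :
    SmoothPartitionOfUnity M (𝓡 d) M Set.univ :=
  (SmoothPartitionOfUnity.exists_isSubordinate_chartAt_source (𝓡 d) M).choose

/-- The integral over the oriented manifold `M` of a form of top degree (with compact support).
The coefficient of the form in each chart is integrated for Lebesgue measure, with a minus sign
where the chart reverses orientation. -/
def integral [IsManifold (𝓡 d) ∞ M] [T2Space M] [SigmaCompactSpace M]
    (o : ∀ x : M, Orientation ℝ (Tan d x) (Fin d)) (η : KForm d M ℂ d) : ℂ :=
  ∑ᶠ x₀ : M, ∫ y in (extChartAt (𝓡 d) x₀).target,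
    ((chartPartition d M x₀ ((extChartAt (𝓡 d) x₀).symm y) *
        frameSign (o ((extChartAt (𝓡 d) x₀).symm y))
          (fun i => chartInvDeriv x₀ y (EuclideanSpace.single i 1)) : ℝ) : ℂ) *
      localRep η x₀ y fun i => EuclideanSpace.single i 1

/-- The Born–Infeld inner product `h(α, β) = ∫_M ⟨α, σ(∗) β̄⟩` of the generalized Riemannian
metric with involution `G`. -/
def bornInfeld [IsManifold (𝓡 d) ∞ M] [T2Space M] [SigmaCompactSpace M]
    (o : ∀ x : M, Orientation ℝ (Tan d x) (Fin d)) (G : GenEnd d M) (α β : Form d M) : ℂ :=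
  integral o fun x => mukai d (α x) (revStar (o x) (G x) (conjForm (β x)))

/-- `D'` is adjoint to `D` for the Born–Infeld inner product, on smooth forms (one of the two
arguments being compactly supported, which is automatic if `M` is compact). -/
def IsFormalAdjoint [IsManifold (𝓡 d) ∞ M] [T2Space M] [SigmaCompactSpace M]
    (o : ∀ x : M, Orientation ℝ (Tan d x) (Fin d)) (G : GenEnd d M)
    (D D' : Form d M → Form d M) : Prop :=
  (∀ β, β.IsSmooth → (D' β).IsSmooth) ∧
  ∀ α β : Form d M, α.IsSmooth → β.IsSmooth → (HasCompactSupp α ∨ HasCompactSupp β) →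
    bornInfeld o G (D α) β = bornInfeld o G α (D' β)

/-- The Born–Infeld adjoint of an operator on forms (junk if there is none). -/
def adjoint [IsManifold (𝓡 d) ∞ M] [T2Space M] [SigmaCompactSpace M]
    (o : ∀ x : M, Orientation ℝ (Tan d x) (Fin d)) (G : GenEnd d M)
    (D : Form d M → Form d M) : Form d M → Form d M :=
  Classical.epsilon (IsFormalAdjoint o G D)

/-- The Laplacian `Δ_D = D D* + D* D` of an operator on forms. -/
def laplacian [IsManifold (𝓡 d) ∞ M] [T2Space M] [SigmaCompactSpace M]
    (o : ∀ x : M, Orientation ℝ (Tan d x) (Fin d)) (G : GenEnd d M)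
    (D : Form d M → Form d M) (ρ : Form d M) : Form d M :=
  D (adjoint o G D ρ) + adjoint o G D (D ρ)

/-! ### Generalized complex and generalized Kähler structures -/

/-- A section `A + iB` of `(T ⊕ T*) ⊗ ℂ`, given by its real and imaginary parts. -/
abbrev CGenSec (d : ℕ) (M : Type*) [TopologicalSpace M] [ChartedSpace (Mod d) M] : Type _ :=
  GenSec d M × GenSec d M

/-- The section `A` of `(T ⊕ T*) ⊗ ℂ` lies in the `+i` eigenbundle of `J`. -/
def InEigenbundle (J : GenEnd d M) (A : CGenSec d M) : Prop :=
  ∀ x, J x (A.1 x) = -A.2 x ∧ J x (A.2 x) = A.1 x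

/-- Clifford action of sections of `(T ⊕ T*) ⊗ ℂ` on forms. -/
def ccliff (A : CGenSec d M) (ρ : Form d M) : Form d M := fun x =>
  cliff (A.1 x) (ρ x) + Complex.I • cliff (A.2 x) (ρ x)

/-- The graded commutator `[d_H, A] = d_H ∘ A + A ∘ d_H` as an operator on forms. -/
def dHComm (H : KForm d M ℝ 3) (A : CGenSec d M) (ρ : Form d M) : Form d M :=
  dH H (ccliff A ρ) + ccliff A (dH H ρ)

/-- `C` is the Courant bracket `[A, B]_H`, the derived bracket of `d_H`:
`[A, B]_H · ρ = [[d_H, A], B] ρ` for all smooth forms `ρ`. -/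
def IsCourantBracket (H : KForm d M ℝ 3) (A B C : CGenSec d M) : Prop :=
  ∀ ρ : Form d M, ρ.IsSmooth →
    ccliff C ρ = dHComm H A (ccliff B ρ) - ccliff B (dHComm H A ρ)

/-- (Twisted) generalized complex structures: orthogonal complex structures on `T ⊕ T*` whose
`+i` eigenbundle is closed under the Courant bracket. -/
structure IsGeneralizedComplex (H : KForm d M ℝ 3) (J : GenEnd d M) : Prop where
  smooth : J.IsSmooth
  sq : ∀ x A, J x (J x A) = -A
  orthogonal : ∀ x A B, pairing (J x A) (J x B) = pairing A B
  involutive : ∀ A B : CGenSec d M, A.1.IsSmooth → A.2.IsSmooth → B.1.IsSmooth → B.2.IsSmooth →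
    InEigenbundle J A → InEigenbundle J B →
      ∃ C : CGenSec d M, InEigenbundle J C ∧ IsCourantBracket H A B C

/-- The involution `G = -J₁ J₂`. -/
def metricInvolution (J₁ J₂ : GenEnd d M) : GenEnd d M := fun x => -(J₁ x ∘ₗ J₂ x)

/-- (Twisted) generalized Kähler structures: commuting generalized complex structures such that
`⟨G A, B⟩`, `G = -J₁ J₂`, is a positive-definite metric on `T ⊕ T*`. -/
structure IsGeneralizedKahler (H : KForm d M ℝ 3) (J₁ J₂ : GenEnd d M) : Prop where
  smooth_H : KForm.IsSmooth H
  closed_H : ∀ x, KForm.extD H x = 0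
  complex₁ : IsGeneralizedComplex H J₁
  complex₂ : IsGeneralizedComplex H J₂
  commute : ∀ x A, J₁ x (J₂ x A) = J₂ x (J₁ x A)
  positive : ∀ x A, A ≠ 0 → 0 < pairing (metricInvolution J₁ J₂ x A) A

/-! ### The decompositions of forms and of `d_H` -/

/-- The spin action of an endomorphism field on forms, at the point `x`. -/
def spinAt (J : GenEnd d M) (x : M) : Spinor (Tan d x) → Spinor (Tan d x) :=
  spinAction (d := d) (fun k => (EuclideanSpace.single k 1 : Mod d))
    (fun k => (EuclideanSpace.proj k : Mod d →L[ℝ] ℝ)) (J x)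

/-- `U_k`: the `ik`-eigenspace of `J` on forms at `x`. -/
def eigenU (J : GenEnd d M) (x : M) (k : ℤ) : Set (Spinor (Tan d x)) :=
  {ρ | spinAt J x ρ = (Complex.I * k) • ρ}

/-- `U_{p,q}`: the intersection of the `ip`-eigenspace of `J₁` and the `iq`-eigenspace of `J₂`. -/
def eigenUU (J₁ J₂ : GenEnd d M) (x : M) (pq : ℤ × ℤ) : Set (Spinor (Tan d x)) :=
  eigenU J₁ x pq.1 ∩ eigenU J₂ x pq.2

/-- The `U_k`-component of a form. -/
def proj₁ (J : GenEnd d M) (k : ℤ) (ρ : Form d M) : Form d M := fun x =>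
  component (eigenU J x) k (ρ x)

/-- The `U_{p,q}`-component of a form. -/
def proj₂ (J₁ J₂ : GenEnd d M) (p q : ℤ) (ρ : Form d M) : Form d M := fun x =>
  component (eigenUU J₁ J₂ x) (p, q) (ρ x)

/-- The part of `d_H` that maps sections of `U_k` to sections of `U_{k+r}`, for all `k`
(the index range contains all `k` with `U_k ≠ 0`). -/
def dPart₁ (H : KForm d M ℝ 3) (J : GenEnd d M) (r : ℤ) (ρ : Form d M) : Form d M :=
  ∑ k ∈ Finset.Icc (-d : ℤ) d, proj₁ J (k + r) (dH H (proj₁ J k ρ))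

/-- The part of `d_H` that maps sections of `U_{p,q}` to sections of `U_{p+r,q+s}`, for all
`p, q` (the index range contains all `p, q` with `U_{p,q} ≠ 0`). -/
def dPart₂ (H : KForm d M ℝ 3) (J₁ J₂ : GenEnd d M) (r s : ℤ) (ρ : Form d M) : Form d M :=
  ∑ p ∈ Finset.Icc (-d : ℤ) d, ∑ q ∈ Finset.Icc (-d : ℤ) d,
    proj₂ J₁ J₂ (p + r) (q + s) (dH H (proj₂ J₁ J₂ p q ρ))

/-- `∂̄ : U_k → U_{k+1}` of a generalized complex structure. -/
def delbar (H : KForm d M ℝ 3) (J : GenEnd d M) : Form d M → Form d M := dPart₁ H J 1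

/-- `∂ : U_k → U_{k-1}` of a generalized complex structure. -/
def del (H : KForm d M ℝ 3) (J : GenEnd d M) : Form d M → Form d M := dPart₁ H J (-1)

/-- `∂̄₊ : U_{p,q} → U_{p+1,q+1}`. -/
def delbarPlus (H : KForm d M ℝ 3) (J₁ J₂ : GenEnd d M) : Form d M → Form d M :=
  dPart₂ H J₁ J₂ 1 1

/-- `∂̄₋ : U_{p,q} → U_{p+1,q-1}`. -/
def delbarMinus (H : KForm d M ℝ 3) (J₁ J₂ : GenEnd d M) : Form d M → Form d M :=
  dPart₂ H J₁ J₂ 1 (-1)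

/-- `∂₊ : U_{p,q} → U_{p-1,q-1}`. -/
def delPlus (H : KForm d M ℝ 3) (J₁ J₂ : GenEnd d M) : Form d M → Form d M :=
  dPart₂ H J₁ J₂ (-1) (-1)

/-- `∂₋ : U_{p,q} → U_{p-1,q+1}`. -/
def delMinus (H : KForm d M ℝ 3) (J₁ J₂ : GenEnd d M) : Form d M → Form d M :=
  dPart₂ H J₁ J₂ (-1) 1

end Forms

end GenKahler

end

/-! The forms at a point are an irreducible module over the Clifford algebra of `T ⊕ T*`, and
Schur's lemma for this module does most of the pointwise work. The spin actions `N₁`, `N₂` of the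
two structures commute and are diagonalizable with eigenvalues `i k`. For `A` in `T ⊕ T*` the
element `A - i J A` raises the degree by one and `A + i J A` lowers it by one.

Decomposition of `d_H`. The operation `adSq N T = [N, [N, T]] + T` multiplies the part of `T` of
degree `r` by `1 - r²`, so it kills Clifford elements. The commutator of `d_H` with a function is
Clifford multiplication by a complex covector; hence `adSq N d_H` is linear over functions, that is,
a tensor. By a count of weights (`dbr_adSq_eq_zero`), involutivity of the `±i` eigenbundles makes
the derived bracket of this tensor with two elements of the same eigenbundle vanish. An odd
endomorphism of the spinors with this property is a Clifford element
(`IsCliffordModule.adSq_eq_zero`), so `adSq N (adSq N d_H) = 0` and only the degrees `r = ±1` occur.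
Applied to both gradings this yields the four components (`IsBigrading.eq_sum_bipart`).

Adjoints. The product `σ(∗)` anticommutes with `C₊` and commutes with `C₋`, and so does the operator
`i^(p+q)` on `U_{p,q}`. By Schur's lemma they are proportional, and the factor is a locally constant
sign. By Stokes' theorem `d_H` is its own transpose for the integrated Mukai pairing. The `N_j` are
skew for that pairing, so the projections to `U_{p,q}` and `U_{-p,-q}` are transposes of each other,
and every homogeneous part of `d_H` is again its own transpose. Complex conjugation exchanges the
bidegrees `(r, s)` and `(-r, -s)`, and passing `i^(p+q)` costs a factor `i^(r+s)`. So the adjoint of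
the part of bidegree `(r, s)` is the part of bidegree `(-r, -s)`, with sign `-1` if `r = s = ±1` and
`+1` if `r = -s = ±1`. The integrated pairing is nondegenerate, which makes adjoints unique on
smooth forms (`isFormalAdjoint_unique`); the chosen `adjoint` is therefore the one just found.

Laplacians. Sorting `d_H² = 0` by bidegree (`IsBigrading.square_relations`) makes the four parts
square to zero, makes the anticommutators of neighbouring parts vanish, and gives `{∂̄₊, ∂₊} + {∂̄₋,
∂₋} = 0`. With the adjoints inserted, every Laplacian is a multiple of `{∂̄₋, ∂₋}`. -/

noncomputable section
set_option linter.unusedSectionVars false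
namespace GenKahler

/-! ### Alternating sums and exterior multiplication by covectors -/

section Wedge

section Functions

variable {V : Type*}

/-- The signed sum of a function of `n` vectors over all permutations of its arguments. -/
def altSum {n : ℕ} (F : (Fin n → V) → ℂ) (v : Fin n → V) : ℂ :=
  ∑ σ : Equiv.Perm (Fin n), ((Equiv.Perm.sign σ : ℤ) : ℂ) * F (v ∘ σ)

/-- The product of functions of `a` and `b` vectors, as a function of `a + b` vectors. -/
def fnTensor {a b : ℕ} (F : (Fin a → V) → ℂ) (F' : (Fin b → V) → ℂ) (v : Fin (a + b) → V) : ℂ :=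
  F (v ∘ Fin.castAdd b) * F' (v ∘ Fin.natAdd a)

lemma altSum_comp_perm {n : ℕ} (F : (Fin n → V) → ℂ) (τ : Equiv.Perm (Fin n)) (v : Fin n → V) :
    altSum (fun w => F (w ∘ τ)) v = ((Equiv.Perm.sign τ : ℤ) : ℂ) * altSum F v := by
  unfold altSum
  rw [Finset.mul_sum, ← Equiv.sum_comp (Equiv.mulRight τ)
    (fun σ => ((Equiv.Perm.sign τ : ℤ) : ℂ) * (((Equiv.Perm.sign σ : ℤ) : ℂ) * F (v ∘ σ)))]
  refine Finset.sum_congr rfl fun σ _ => ?_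
  have h : ((Equiv.Perm.sign τ : ℤ) : ℂ) * ((Equiv.Perm.sign τ : ℤ) : ℂ) = 1 := by
    rcases Int.units_eq_one_or (Equiv.Perm.sign τ) with h | h <;> simp [h]
  simp only [Equiv.coe_mulRight, Equiv.Perm.sign_mul, Equiv.Perm.coe_mul, Function.comp_assoc,
    Units.val_mul, Int.cast_mul]
  linear_combination (-((Equiv.Perm.sign σ : ℤ) : ℂ) * F (v ∘ (σ ∘ τ))) * h

lemma altSum_sum {n : ℕ} {ι : Type*} (s : Finset ι) (c : ι → ℂ) (F : ι → (Fin n → V) → ℂ)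
    (v : Fin n → V) :
    altSum (fun w => ∑ i ∈ s, c i * F i w) v = ∑ i ∈ s, c i * altSum (F i) v := by
  unfold altSum
  simp_rw [Finset.mul_sum]
  rw [Finset.sum_comm]
  exact Finset.sum_congr rfl fun _ _ => Finset.sum_congr rfl fun _ _ => by ring

lemma sign_mul_self_complex {n : ℕ} (τ : Equiv.Perm (Fin n)) :
    ((Equiv.Perm.sign τ : ℤ) : ℂ) * ((Equiv.Perm.sign τ : ℤ) : ℂ) = 1 := by
  rcases Int.units_eq_one_or (Equiv.Perm.sign τ) with h | h <;> simp [h]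

/-- A permutation of the first block extends to a permutation of all `a + b` places with the same
sign, which the outer sum absorbs. So the `a!` terms of the inner sum all contribute equally. -/
lemma altSum_fnTensor_altSum_left {a b : ℕ} (F : (Fin a → V) → ℂ) (F' : (Fin b → V) → ℂ)
    (v : Fin (a + b) → V) :
    altSum (fnTensor (altSum F) F') v = (a.factorial : ℂ) * altSum (fnTensor F F') v := by
  have h : fnTensor (altSum F) F' = fun w => ∑ σ : Equiv.Perm (Fin a),
      ((Equiv.Perm.sign σ : ℤ) : ℂ) *
        fnTensor F F' (w ∘ (finSumFinEquiv.permCongr (Equiv.Perm.sumCongr σ 1))) := by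
    funext w
    simp only [fnTensor, altSum, Finset.sum_mul]
    refine Finset.sum_congr rfl fun σ _ => ?_
    rw [mul_assoc]
    congr 3
    · ext i; simp [Equiv.permCongr_apply]
    · ext i; simp [Equiv.permCongr_apply]
  rw [h, altSum_sum]
  simp_rw [altSum_comp_perm, Equiv.Perm.sign_permCongr, Equiv.Perm.sign_sumCongr,
    Equiv.Perm.sign_one, mul_one, ← mul_assoc, sign_mul_self_complex, one_mul]
  simp [Fintype.card_perm]

lemma altSum_cast {n m : ℕ} (h : n = m) (F : (Fin n → V) → ℂ) (v : Fin m → V) :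
    altSum F (v ∘ Fin.cast h) = altSum (fun w => F (w ∘ Fin.cast h)) v := by
  subst h; rfl

lemma altSum_cons_altSum {k : ℕ} (F : V → ℂ) (F' : (Fin k → V) → ℂ) (v : Fin (k + 1) → V) :
    altSum (fun w : Fin (k + 1) → V => F (w 0) * altSum F' (w ∘ Fin.succ)) v =
      (k.factorial : ℂ) * altSum (fun w : Fin (k + 1) → V => F (w 0) * F' (w ∘ Fin.succ)) v := by
  have h : (fun w : Fin (k + 1) → V => F (w 0) * altSum F' (w ∘ Fin.succ)) =
      fun w => ∑ σ : Equiv.Perm (Fin k), ((Equiv.Perm.sign σ : ℤ) : ℂ) *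
        (fun u : Fin (k + 1) → V => F (u 0) * F' (u ∘ Fin.succ))
          (w ∘ (Equiv.Perm.decomposeFin.symm (0, σ))) := by
    funext w
    simp only [altSum, Finset.mul_sum]
    refine Finset.sum_congr rfl fun σ _ => ?_
    rw [mul_left_comm]
    congr 3
  rw [h, altSum_sum]
  simp_rw [altSum_comp_perm (fun u : Fin (k + 1) → V => F (u 0) * F' (u ∘ Fin.succ)),
    Equiv.Perm.decomposeFin.symm_sign, if_true, one_mul, ← mul_assoc, sign_mul_self_complex,
    one_mul]
  simp [Fintype.card_perm]

end Functions

variable {V : Type*} [AddCommGroup V] [Module ℝ V] [TopologicalSpace V]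

lemma altSum_alternating {n : ℕ} (η : V [⋀^Fin n]→L[ℝ] ℂ) (v : Fin n → V) :
    altSum η v = (n.factorial : ℂ) * η v := by
  unfold altSum
  have : ∀ σ : Equiv.Perm (Fin n), ((Equiv.Perm.sign σ : ℤ) : ℂ) * η (v ∘ σ) = η v := fun σ => by
    have := η.toAlternatingMap.map_perm v σ
    simp only [ContinuousAlternatingMap.coe_toAlternatingMap] at this
    rw [this, Units.smul_def, zsmul_eq_mul, ← mul_assoc, sign_mul_self_complex, one_mul]
  simp [this, Fintype.card_perm]

lemma wedgeHom_apply {a b : ℕ} (α : V [⋀^Fin a]→L[ℝ] ℂ) (β : V [⋀^Fin b]→L[ℝ] ℂ)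
    (v : Fin (a + b) → V) :
    wedgeHom α β v = ((a.factorial * b.factorial : ℝ)⁻¹ : ℂ) * altSum (fnTensor α β) v := by
  have h : ∀ w, tensor α β w = fnTensor α β w := fun w => rfl
  simp only [wedgeHom, ContinuousAlternatingMap.smul_apply,
    ContinuousMultilinearMap.alternatization_apply_apply, h, altSum, Units.smul_def, zsmul_eq_mul,
    Complex.real_smul]
  push_cast
  rfl

@[simp] lemma castDegree_apply {a b : ℕ} (h : a = b) (η : V [⋀^Fin a]→L[ℝ] ℂ) (v : Fin b → V) :
    castDegree h η v = η (v ∘ Fin.cast h) := rfl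

@[simp] lemma castDegree_rfl {a : ℕ} (η : V [⋀^Fin a]→L[ℝ] ℂ) : castDegree rfl η = η := rfl

@[simp] lemma contraction_apply {k : ℕ} (X : V) (η : V [⋀^Fin (k + 1)]→L[ℝ] ℂ) (v : Fin k → V) :
    contraction X η v = η (Fin.cons X v) := rfl

/-- The alternating sum of a covector times a `k`-form. -/
lemma altSum_covector_tensor {k : ℕ} (ξ : V →L[ℝ] ℝ) (η : V [⋀^Fin k]→L[ℝ] ℂ)
    (v : Fin (k + 1) → V) :
    altSum (fun w : Fin (k + 1) → V => (ξ (w 0) : ℂ) * η (fun j => w j.succ)) v =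
      (k.factorial : ℂ) *
        ∑ i : Fin (k + 1), (-1) ^ (i : ℕ) * ((ξ (v i) : ℂ) * η (i.removeNth v)) := by
  set f : V →ₗ[ℝ] V [⋀^Fin k]→ₗ[ℝ] ℂ := (ξ : V →ₗ[ℝ] ℝ).smulRight η.toAlternatingMap with hf
  set g := AlternatingMap.alternatizeUncurryFin f with hg
  have hgv : ∀ v, g v = ∑ i : Fin (k + 1), (-1) ^ (i : ℕ) * ((ξ (v i) : ℂ) * η (i.removeNth v)) := by
    intro v
    rw [hg, AlternatingMap.alternatizeUncurryFin_apply]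
    refine Finset.sum_congr rfl fun i _ => ?_
    simp [hf]
  rw [← hgv]
  -- The alternating sum of `g` is computed twice. Since `g` is alternating it is `(k + 1)! g`; and
  -- each of the `k + 1` terms of `g` is the tensor product composed with a cycle whose sign cancels
  -- the sign of the term, which gives `k + 1` equal contributions.
  have h1 : altSum (fun w => g w) v = ((k + 1).factorial : ℂ) * g v := by
    unfold altSum
    have : ∀ σ : Equiv.Perm (Fin (k + 1)),
        ((Equiv.Perm.sign σ : ℤ) : ℂ) * g (v ∘ σ) = g v := fun σ => by
      rw [g.map_perm v σ, Units.smul_def, zsmul_eq_mul, ← mul_assoc, sign_mul_self_complex, one_mul]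
    simp [this, Fintype.card_perm]
  have h2 : altSum (fun w => g w) v = ((k : ℂ) + 1) *
      altSum (fun w : Fin (k + 1) → V => (ξ (w 0) : ℂ) * η (fun j => w j.succ)) v := by
    have : (fun w => g w) = fun w => ∑ i : Fin (k + 1), (-1 : ℂ) ^ (i : ℕ) *
        (fun u : Fin (k + 1) → V => (ξ (u 0) : ℂ) * η (fun j => u j.succ))
          (w ∘ (Fin.cycleRange i).symm) := by
      funext w
      rw [hgv]
      refine Finset.sum_congr rfl fun i _ => ?_
      simp only [Function.comp, Fin.cycleRange_symm_zero, Fin.cycleRange_symm_succ]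
      rfl
    rw [this, altSum_sum _ _ fun i w =>
      (fun u : Fin (k + 1) → V => (ξ (u 0) : ℂ) * η (fun j => u j.succ))
          (w ∘ (Fin.cycleRange i).symm)]
    have h3 : ∀ i : Fin (k + 1), (-1 : ℂ) ^ (i : ℕ) *
        altSum (fun w => (fun u : Fin (k + 1) → V => (ξ (u 0) : ℂ) * η (fun j => u j.succ))
          (w ∘ (Fin.cycleRange i).symm)) v =
        altSum (fun w : Fin (k + 1) → V => (ξ (w 0) : ℂ) * η (fun j => w j.succ)) v := fun i => by
      rw [altSum_comp_perm fun u : Fin (k + 1) → V => (ξ (u 0) : ℂ) * η (fun j => u j.succ),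
        Equiv.Perm.sign_symm, Fin.sign_cycleRange, ← mul_assoc]
      push_cast
      rw [← mul_pow]; simp
    rw [Finset.sum_congr rfl fun i _ => h3 i]
    simp
  have h4 : ((k : ℂ) + 1) ≠ 0 := by exact_mod_cast Nat.succ_ne_zero k
  apply mul_left_cancel₀ h4
  rw [← h2, h1, Nat.factorial_succ]
  push_cast
  ring

lemma covector_one_apply (ξ : V →L[ℝ] ℝ) (v : Fin 1 → V) : covector ξ 1 v = (ξ (v 0) : ℂ) := by
  simp [covector, homog, complexify]

lemma covector_ne (ξ : V →L[ℝ] ℝ) {k : ℕ} (h : k ≠ 1) : covector ξ k = 0 := by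
  simp [covector, homog, h]

@[simp] lemma wedgeHom_zero_left {a b : ℕ} (β : V [⋀^Fin b]→L[ℝ] ℂ) :
    wedgeHom (0 : V [⋀^Fin a]→L[ℝ] ℂ) β = 0 := by
  ext v
  simp [wedgeHom_apply, altSum, fnTensor]

@[simp] lemma castDegree_zero {a b : ℕ} (h : a = b) :
    castDegree h (0 : V [⋀^Fin a]→L[ℝ] ℂ) = 0 := by
  subst h; rfl

lemma wedge_apply (α β : Spinor V) (k : ℕ) (v : Fin k → V) :
    wedge α β k v = ∑ a : Fin (k + 1), castDegree (Nat.add_sub_cancel' (Nat.le_of_lt_succ a.isLt))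
      (wedgeHom (α a) (β (k - a))) v := by
  simp [wedge]

lemma covector_wedge_zero (ξ : V →L[ℝ] ℝ) (ρ : Spinor V) : wedge (covector ξ) ρ 0 = 0 := by
  ext v
  rw [wedge_apply]
  simp [covector_ne]

lemma covector_wedge_succ (ξ : V →L[ℝ] ℝ) (ρ : Spinor V) (k : ℕ) (v : Fin (k + 1) → V) :
    wedge (covector ξ) ρ (k + 1) v =
      ∑ i : Fin (k + 1), (-1) ^ (i : ℕ) * ((ξ (v i) : ℂ) * ρ k (i.removeNth v)) := by
  rw [wedge_apply, Finset.sum_eq_single (1 : Fin (k + 2))]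
  -- The degree `k + 1 - 1` is replaced by a variable `m`, so that `m = k` can be substituted in the
  -- dependent types.
  · have key : ∀ (m : ℕ) (hm : 1 + m = k + 1) , castDegree hm (wedgeHom (covector ξ 1) (ρ m)) v =
        ∑ i : Fin (k + 1), (-1) ^ (i : ℕ) * ((ξ (v i) : ℂ) * ρ k (i.removeNth v)) := by
      intro m hm
      obtain rfl : m = k := by omega
      rw [castDegree_apply, wedgeHom_apply]
      have : altSum (fnTensor (covector ξ 1) (ρ m)) (v ∘ Fin.cast hm) =
          altSum (fun w : Fin (m + 1) → V => (ξ (w 0) : ℂ) * ρ m (fun j => w j.succ)) v := by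
        rw [altSum_cast]
        congr 1
        funext w
        simp only [fnTensor, covector_one_apply, Function.comp_def]
        have : ∀ j : Fin m, Fin.cast hm (Fin.natAdd 1 j) = j.succ := fun j => by
          ext; simp
        simp only [this]
        rfl
      rw [this, altSum_covector_tensor, ← mul_assoc]
      have hm : (m.factorial : ℂ) ≠ 0 := by exact_mod_cast m.factorial_ne_zero
      push_cast
      rw [Nat.factorial_one, Nat.cast_one, one_mul, inv_mul_cancel₀ hm, one_mul]
    exact key _ _
  · intro b _ hb
    have : (b : ℕ) ≠ 1 := fun h => hb (Fin.ext (by simpa using h))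
    simp [covector_ne ξ this]
  · simp

/-- Up to factorials both sides are the alternating sum of `ξ ⊗ α ⊗ β`: on the left the inner
alternation over `ξ ⊗ α` is absorbed, on the right the one over `α ⊗ β`. -/
lemma covector_wedgeHom {a b : ℕ} (ξ : V →L[ℝ] ℝ) (α : V [⋀^Fin a]→L[ℝ] ℂ)
    (γ : V [⋀^Fin (a + 1)]→L[ℝ] ℂ) (β : V [⋀^Fin b]→L[ℝ] ℂ)
    (hγ : ∀ v, γ v = ∑ i : Fin (a + 1), (-1) ^ (i : ℕ) * ((ξ (v i) : ℂ) * α (i.removeNth v)))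
    {k : ℕ} (h : a + b = k) (h' : a + 1 + b = k + 1) (v : Fin (k + 1) → V) :
    castDegree h' (wedgeHom γ β) v = ∑ i : Fin (k + 1), (-1) ^ (i : ℕ) *
      ((ξ (v i) : ℂ) * castDegree h (wedgeHom α β) (i.removeNth v)) := by
  subst h
  have ha : (a.factorial : ℂ) ≠ 0 := by exact_mod_cast a.factorial_ne_zero
  have hb : (b.factorial : ℂ) ≠ 0 := by exact_mod_cast b.factorial_ne_zero
  have hab : ((a + b).factorial : ℂ) ≠ 0 := by exact_mod_cast (a + b).factorial_ne_zero
  have ha1 : ((a + 1).factorial : ℂ) ≠ 0 := by exact_mod_cast (a + 1).factorial_ne_zero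
  set A : ℂ := altSum (fun w : Fin (a + b + 1) → V => (ξ (w 0) : ℂ) *
    fnTensor α β (w ∘ Fin.succ)) v with hA
  have hl : altSum (fnTensor γ β) (v ∘ Fin.cast h') =
      ((a.factorial : ℂ))⁻¹ * ((a + 1).factorial * A) := by
    have h1 : ∀ w, γ w = (a.factorial : ℂ)⁻¹ *
        altSum (fun w : Fin (a + 1) → V => (ξ (w 0) : ℂ) * α (fun j => w j.succ)) w := fun w => by
      rw [altSum_covector_tensor, hγ, ← mul_assoc, inv_mul_cancel₀ ha, one_mul]
    have h2 : fnTensor γ β = fun u => ∑ i ∈ ({0} : Finset ℕ), (a.factorial : ℂ)⁻¹ *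
        fnTensor (altSum (fun w : Fin (a + 1) → V => (ξ (w 0) : ℂ) * α (fun j => w j.succ))) β u := by
      funext u
      simp only [fnTensor, h1, Finset.sum_singleton, mul_assoc]
    rw [h2, altSum_sum _ _ fun _ : ℕ => fnTensor (altSum (fun w : Fin (a + 1) → V =>
      (ξ (w 0) : ℂ) * α (fun j => w j.succ))) β, Finset.sum_singleton,
      altSum_fnTensor_altSum_left, altSum_cast, hA]
    congr 3
    funext w
    simp only [fnTensor, Function.comp_def]
    rw [mul_assoc]
    congr 3
    · funext j
      congr 1
      ext; simp; omega
  have hr : ∑ i : Fin (a + b + 1), (-1) ^ (i : ℕ) *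
      ((ξ (v i) : ℂ) * wedgeHom α β (i.removeNth v)) =
      ((a + b).factorial : ℂ)⁻¹ * (((a.factorial * b.factorial : ℝ)⁻¹ : ℂ) *
        ((a + b).factorial * A)) := by
    rw [hA, ← altSum_cons_altSum (fun u => (ξ u : ℂ)) (fnTensor α β)]
    have h3 := altSum_covector_tensor ξ (wedgeHom α β) v
    have h4 : (fun w : Fin (a + b + 1) → V => (ξ (w 0) : ℂ) * wedgeHom α β (fun j => w j.succ)) =
        fun w => ∑ i ∈ ({0} : Finset ℕ), ((a.factorial * b.factorial : ℝ)⁻¹ : ℂ) *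
          ((ξ (w 0) : ℂ) * altSum (fnTensor α β) (w ∘ Fin.succ)) := by
      funext w
      rw [wedgeHom_apply, Finset.sum_singleton, mul_left_comm]
      rfl
    rw [h4, altSum_sum _ _ fun (_ : ℕ) (w : Fin (a + b + 1) → V) =>
      (ξ (w 0) : ℂ) * altSum (fnTensor α β) (w ∘ Fin.succ), Finset.sum_singleton] at h3
    rw [h3, ← mul_assoc, inv_mul_cancel₀ hab, one_mul]
  simp only [castDegree_apply]
  have hr' : ∑ i : Fin (a + b + 1), (-1) ^ (i : ℕ) *
      ((ξ (v i) : ℂ) * (wedgeHom α β) (i.removeNth v ∘ Fin.cast rfl)) = _ := hr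
  rw [hr', wedgeHom_apply, hl]
  push_cast
  field_simp

/-- Associativity is needed by hand only when the first factor is a covector; forms are generated
from `1` by covectors, so the general case follows by induction in `IsDualFrame.wedge_assoc`. -/
lemma covector_wedge_assoc (ξ : V →L[ℝ] ℝ) (α β : Spinor V) :
    wedge (covector ξ) (wedge α β) = wedge (wedge (covector ξ) α) β := by
  funext k
  rcases k with _ | k
  · ext v
    rw [covector_wedge_zero, wedge_apply]
    simp [covector_wedge_zero]
  · ext v
    rw [covector_wedge_succ, wedge_apply _ β, Fin.sum_univ_succ (n := k + 1)]
    have h0 : ∀ (a m : ℕ) (h : a + m = k + 1), a = 0 →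
        castDegree h (wedgeHom (wedge (covector ξ) α a) (β m)) v = 0 := by
      rintro a m h rfl
      rw [covector_wedge_zero, wedgeHom_zero_left, castDegree_zero]
      rfl
    refine Eq.trans ?_ (congrArg₂ (· + ·) (h0 _ _ _ rfl).symm rfl)
    rw [zero_add]
    simp only [wedge_apply, Finset.mul_sum]
    rw [Finset.sum_comm]
    refine Finset.sum_congr rfl fun a _ => ?_
    have key : ∀ (m : ℕ) (hm : m = k - a) (h1 : (a : ℕ) + 1 + m = k + 1) (h2 : (a : ℕ) + m = k),
        ∑ i : Fin (k + 1), (-1) ^ (i : ℕ) * ((ξ (v i) : ℂ) *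
          castDegree h2 (wedgeHom (α a) (β m)) (i.removeNth v)) =
        castDegree h1 (wedgeHom (wedge (covector ξ) α (a + 1)) (β m)) v := by
      intro m hm h1 h2
      rw [covector_wedgeHom ξ (α a) _ (β m) (fun w => covector_wedge_succ ξ α a w) h2 h1]
    have ha := a.isLt
    rw [key (k - a) rfl (by omega) (by omega)]
    have cast_eq : ∀ (a' m' : ℕ) (p : (a : ℕ) + 1 + (k - a) = k + 1) (q : a' + m' = k + 1),
        a' = a + 1 → m' = k - a →
        castDegree p (wedgeHom (wedge (covector ξ) α (a + 1)) (β (k - a))) v =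
          castDegree q (wedgeHom (wedge (covector ξ) α a') (β m')) v := by
      rintro a' m' p q rfl rfl
      rfl
    exact cast_eq _ _ _ _ (Fin.val_succ a) (by simp)

end Wedge

/-! ### The Clifford action on forms and its relations -/

section Clifford

variable {V : Type*} [AddCommGroup V] [Module ℝ V] [TopologicalSpace V]

lemma Spinor.ext {α β : Spinor V} (h : ∀ k v, α k v = β k v) : α = β :=
  funext fun k => ContinuousAlternatingMap.ext (h k)

lemma altSum_congr_lin {n : ℕ} {F G K : (Fin n → V) → ℂ} {c : ℂ}
    (h : ∀ w, F w = c * G w + K w) (v : Fin n → V) : altSum F v = c * altSum G v + altSum K v := by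
  unfold altSum
  rw [Finset.mul_sum, ← Finset.sum_add_distrib]
  exact Finset.sum_congr rfl fun σ _ => by rw [h]; ring

lemma wedgeHom_lin_left {a b : ℕ} (c : ℂ) (α α' : V [⋀^Fin a]→L[ℝ] ℂ) (β : V [⋀^Fin b]→L[ℝ] ℂ) :
    wedgeHom (c • α + α') β = c • wedgeHom α β + wedgeHom α' β := by
  ext v
  rw [ContinuousAlternatingMap.add_apply, ContinuousAlternatingMap.smul_apply]
  simp only [wedgeHom_apply]
  rw [altSum_congr_lin (c := c) (G := fnTensor α β) (K := fnTensor α' β)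
    (fun w => by simp [fnTensor]; ring)]
  simp only [smul_eq_mul]
  ring

lemma wedgeHom_lin_right {a b : ℕ} (c : ℂ) (α : V [⋀^Fin a]→L[ℝ] ℂ) (β β' : V [⋀^Fin b]→L[ℝ] ℂ) :
    wedgeHom α (c • β + β') = c • wedgeHom α β + wedgeHom α β' := by
  ext v
  rw [ContinuousAlternatingMap.add_apply, ContinuousAlternatingMap.smul_apply]
  simp only [wedgeHom_apply]
  rw [altSum_congr_lin (c := c) (G := fnTensor α β) (K := fnTensor α β')
    (fun w => by simp [fnTensor]; ring)]
  simp only [smul_eq_mul]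
  ring

lemma wedge_lin_left (c : ℂ) (α α' β : Spinor V) :
    wedge (c • α + α') β = c • wedge α β + wedge α' β := by
  refine Spinor.ext fun k v => ?_
  simp only [Pi.add_apply, Pi.smul_apply, ContinuousAlternatingMap.add_apply,
    ContinuousAlternatingMap.smul_apply, wedge_apply, wedgeHom_lin_left, castDegree_apply,
    Finset.smul_sum, Finset.sum_add_distrib]

lemma wedge_lin_right (c : ℂ) (α β β' : Spinor V) :
    wedge α (c • β + β') = c • wedge α β + wedge α β' := by
  refine Spinor.ext fun k v => ?_
  simp only [Pi.add_apply, Pi.smul_apply, ContinuousAlternatingMap.add_apply,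
    ContinuousAlternatingMap.smul_apply, wedge_apply, wedgeHom_lin_right, castDegree_apply,
    Finset.smul_sum, Finset.sum_add_distrib]

/-- The wedge product as a bilinear map. -/
def wedgeLin : Spinor V →ₗ[ℂ] Spinor V →ₗ[ℂ] Spinor V :=
  LinearMap.mk₂ ℂ wedge
    (fun α α' β => by simpa using wedge_lin_left 1 α α' β)
    (fun c α β => by
      have h0 : wedge (0 : Spinor V) β = 0 := by simpa using wedge_lin_left 1 0 0 β
      simpa [h0] using wedge_lin_left c α 0 β)
    (fun α β β' => by simpa using wedge_lin_right 1 α β β')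
    (fun c α β => by
      have h0 : wedge α (0 : Spinor V) = 0 := by simpa using wedge_lin_right 1 α 0 0
      simpa [h0] using wedge_lin_right c α β 0)

lemma wedgeLin_apply (α β : Spinor V) : wedgeLin α β = wedge α β := rfl

lemma covector_add (ξ η : V →L[ℝ] ℝ) : covector (ξ + η) = covector ξ + covector η := by
  refine Spinor.ext fun k v => ?_
  by_cases h : k = 1
  · subst h; simp [covector_one_apply]
  · simp [covector_ne _ h]

lemma covector_smul (r : ℝ) (ξ : V →L[ℝ] ℝ) : covector (r • ξ) = (r : ℂ) • covector ξ := by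
  refine Spinor.ext fun k v => ?_
  by_cases h : k = 1
  · subst h; simp [covector_one_apply]
  · simp [covector_ne _ h]

lemma fin_cons_update {k : ℕ} (X : V) (v : Fin k → V) :
    (Fin.cons X v : Fin (k + 1) → V) = Function.update (Fin.cons 0 v : Fin (k + 1) → V) 0 X := by
  simp

lemma form_cons_add {k : ℕ} (η : V [⋀^Fin (k + 1)]→L[ℝ] ℂ) (X Y : V) (v : Fin k → V) :
    η (Fin.cons (X + Y) v) = η (Fin.cons X v) + η (Fin.cons Y v) := by
  rw [fin_cons_update X, fin_cons_update Y, fin_cons_update (X + Y), η.map_update_add]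

lemma form_cons_smul {k : ℕ} (η : V [⋀^Fin (k + 1)]→L[ℝ] ℂ) (r : ℝ) (X : V) (v : Fin k → V) :
    η (Fin.cons (r • X) v) = (r : ℂ) * η (Fin.cons X v) := by
  rw [fin_cons_update X, fin_cons_update (r • X), η.map_update_smul, Complex.real_smul]

/-- The Clifford action of `V ⊕ V*` as a linear map into the endomorphisms of spinors. -/
def cl : Gen V →ₗ[ℝ] Module.End ℂ (Spinor V) where
  toFun A :=
    { toFun := cliff A
      map_add' := fun ρ τ => by
        refine Spinor.ext fun k v => ?_
        simp only [cliff, ← wedgeLin_apply, map_add, Pi.add_apply,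
          ContinuousAlternatingMap.add_apply, contraction_apply]
        ring
      map_smul' := fun c ρ => by
        refine Spinor.ext fun k v => ?_
        simp only [cliff, ← wedgeLin_apply, map_smul, Pi.add_apply, Pi.smul_apply,
          ContinuousAlternatingMap.add_apply, contraction_apply, ContinuousAlternatingMap.smul_apply,
          RingHom.id_apply, smul_eq_mul]
        ring }
  map_add' A B := by
    refine LinearMap.ext fun ρ => Spinor.ext fun k v => ?_
    simp only [cliff, ← wedgeLin_apply, map_add, Pi.add_apply, covector_add, Prod.fst_add,
      Prod.snd_add, LinearMap.coe_mk, AddHom.coe_mk, LinearMap.add_apply,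
      ContinuousAlternatingMap.add_apply, contraction_apply, form_cons_add]
    ring
  map_smul' r A := by
    refine LinearMap.ext fun ρ => Spinor.ext fun k v => ?_
    simp only [cliff, ← wedgeLin_apply, map_smul, Pi.add_apply, covector_smul, Prod.smul_fst,
      Prod.smul_snd, LinearMap.coe_mk, AddHom.coe_mk, LinearMap.smul_apply, Pi.smul_apply,
      ContinuousAlternatingMap.add_apply, contraction_apply, form_cons_smul,
      ContinuousAlternatingMap.smul_apply, Complex.real_smul, RingHom.id_apply, smul_eq_mul]
    ring

lemma cl_apply (A : Gen V) (ρ : Spinor V) : cl A ρ = cliff A ρ := rfl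

lemma cl_vector_apply (X : V) (ρ : Spinor V) (k : ℕ) (v : Fin k → V) :
    cl (X, 0) ρ k v = ρ (k + 1) (Fin.cons X v) := by
  have h : covector (0 : V →L[ℝ] ℝ) = 0 := by
    have := covector_smul (0 : ℝ) (0 : V →L[ℝ] ℝ)
    rwa [zero_smul, Complex.ofReal_zero, zero_smul ℂ (covector (0 : V →L[ℝ] ℝ))] at this
  simp [cl_apply, cliff, ← wedgeLin_apply, h]

lemma cl_covector (ξ : V →L[ℝ] ℝ) (ρ : Spinor V) : cl (0, ξ) ρ = wedge (covector ξ) ρ := by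
  refine Spinor.ext fun k v => ?_
  have h : ρ (k + 1) (Fin.cons 0 v) = 0 := by simpa using form_cons_smul (ρ (k + 1)) 0 0 v
  simp [cl_apply, cliff, h]

lemma cl_covector_zero (ξ : V →L[ℝ] ℝ) (ρ : Spinor V) : cl (0, ξ) ρ 0 = 0 := by
  rw [cl_covector, covector_wedge_zero]

lemma cl_covector_succ (ξ : V →L[ℝ] ℝ) (ρ : Spinor V) (k : ℕ) (v : Fin (k + 1) → V) :
    cl (0, ξ) ρ (k + 1) v =
      ∑ i : Fin (k + 1), (-1) ^ (i : ℕ) * ((ξ (v i) : ℂ) * ρ k (i.removeNth v)) := by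
  rw [cl_covector, covector_wedge_succ]

lemma cl_split (A : Gen V) : cl A = cl (A.1, 0) + cl (0, A.2) := by
  rw [← map_add]; simp

lemma cl_vector_covector (X : V) (ξ : V →L[ℝ] ℝ) (ρ : Spinor V) :
    cl (X, 0) (cl (0, ξ) ρ) + cl (0, ξ) (cl (X, 0) ρ) = (ξ X : ℂ) • ρ := by
  refine Spinor.ext fun k v => ?_
  rw [Pi.add_apply, ContinuousAlternatingMap.add_apply, cl_vector_apply, cl_covector_succ,
    Fin.sum_univ_succ]
  rcases k with _ | k
  · rw [cl_covector_zero]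
    simp
  · rw [cl_covector_succ]
    simp only [cl_vector_apply, Fin.val_zero, pow_zero, Fin.cons_zero, one_mul, Fin.val_succ,
      Fin.cons_succ, pow_succ, Pi.smul_apply, ContinuousAlternatingMap.smul_apply, smul_eq_mul]
    rw [add_assoc, ← Finset.sum_add_distrib, Finset.sum_eq_zero, add_zero]
    · rfl
    · intro i _
      have : (i.succ.removeNth (Fin.cons X v : Fin (k + 2) → V)) = Fin.cons X (i.removeNth v) := by
        funext j
        refine Fin.cases ?_ (fun j => ?_) j
        · simp [Fin.removeNth]
        · simp [Fin.removeNth]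
      rw [this]
      ring

lemma form_eq_zero_of_contraction {k : ℕ} {η : V [⋀^Fin (k + 1)]→L[ℝ] ℂ}
    (h : ∀ X v, η (Fin.cons X v) = 0) : η = 0 := by
  ext v
  have := h (v 0) (Fin.tail v)
  rwa [Fin.cons_self_tail] at this

lemma cl_vector_vector (X Y : V) (ρ : Spinor V) :
    cl (X, 0) (cl (Y, 0) ρ) + cl (Y, 0) (cl (X, 0) ρ) = 0 := by
  refine Spinor.ext fun k v => ?_
  simp only [Pi.add_apply, ContinuousAlternatingMap.add_apply, cl_vector_apply]
  have := (ρ (k + 2)).toAlternatingMap.map_swap (Fin.cons Y (Fin.cons X v)) (Fin.zero_ne_one)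
  have h2 : (Fin.cons Y (Fin.cons X v) : Fin (k + 2) → V) ∘ Equiv.swap 0 1 =
      Fin.cons X (Fin.cons Y v) := by
    funext j
    refine Fin.cases ?_ (fun j => Fin.cases ?_ (fun j => ?_) j) j
    · simp
    · simp
    · rw [Function.comp, Equiv.swap_apply_of_ne_of_ne] <;> simp [Fin.ext_iff]
  rw [h2] at this
  simp only [ContinuousAlternatingMap.coe_toAlternatingMap] at this
  rw [this]; simp

/-- A form of positive degree is determined by its contractions. By `cl_vector_covector` a
contraction commutes with the symmetrized product of two covectors, the scalar terms cancelling, so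
induction on the degree applies. -/
lemma cl_covector_covector (ξ η : V →L[ℝ] ℝ) (ρ : Spinor V) :
    cl (0, ξ) (cl (0, η) ρ) + cl (0, η) (cl (0, ξ) ρ) = 0 := by
  funext k
  induction k generalizing ρ with
  | zero => simp [cl_covector_zero]
  | succ k ih =>
    refine form_eq_zero_of_contraction fun X v => ?_
    have e1 := cl_vector_covector X ξ (cl (0, η) ρ)
    have e2 := cl_vector_covector X η (cl (0, ξ) ρ)
    have e3 := congrArg (cl (0, ξ)) (cl_vector_covector X η ρ)
    have e4 := congrArg (cl (0, η)) (cl_vector_covector X ξ ρ)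
    have e5 := ih (cl (X, 0) ρ)
    rw [map_add, map_smul] at e3 e4
    have e : cl (X, 0) (cl (0, ξ) (cl (0, η) ρ) + cl (0, η) (cl (0, ξ) ρ)) =
        cl (0, ξ) (cl (0, η) (cl (X, 0) ρ)) + cl (0, η) (cl (0, ξ) (cl (X, 0) ρ)) := by
      rw [map_add]
      linear_combination (norm := module) e1 + e2 - e3 - e4
    rw [← cl_vector_apply, e, e5]; rfl

/-- The Clifford relation. -/
lemma cl_mul_add (A B : Gen V) :
    cl A * cl B + cl B * cl A = ((2 * pairing A B : ℝ) : ℂ) • (1 : Module.End ℂ (Spinor V)) := by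
  refine LinearMap.ext fun ρ => ?_
  have e1 := cl_vector_covector A.1 B.2 ρ
  have e2 := cl_vector_covector B.1 A.2 ρ
  have e3 := cl_vector_vector A.1 B.1 ρ
  have e4 := cl_covector_covector A.2 B.2 ρ
  rw [cl_split A, cl_split B]
  simp only [LinearMap.add_apply, Module.End.mul_apply, map_add, LinearMap.smul_apply,
    Module.End.one_apply, pairing]
  have : ((2 * ((1 / 2 : ℝ) * (A.2 B.1 + B.2 A.1)) : ℝ) : ℂ) • ρ =
      ((A.2 B.1 : ℝ) : ℂ) • ρ + ((B.2 A.1 : ℝ) : ℂ) • ρ := by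
    rw [← add_smul ((A.2 B.1 : ℝ) : ℂ) ((B.2 A.1 : ℝ) : ℂ) ρ]; congr 1; push_cast; ring
  rw [this]
  linear_combination (norm := module) e1 + e2 + e3 + e4

end Clifford

/-- The frames `e` of `V` and `ε` of `V*` are dual to each other. -/
structure IsDualFrame {V : Type*} [AddCommGroup V] [Module ℝ V] [TopologicalSpace V] {d : ℕ}
    (e : Fin d → V) (ε : Fin d → V →L[ℝ] ℝ) : Prop where
  dual : ∀ i j, ε i (e j) = if i = j then 1 else 0
  span : ∀ v, ∑ i, ε i v • e i = v

/-- `J` is skew for the inner product of `V ⊕ V*`. -/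
def IsSkew {V : Type*} [AddCommGroup V] [Module ℝ V] [TopologicalSpace V]
    (J : Gen V →ₗ[ℝ] Gen V) : Prop := ∀ A B, pairing (J A) B = -pairing A (J B)

/-- A nonzero finite-dimensional irreducible module over the Clifford algebra of `V ⊕ V*`. -/
structure IsCliffordModule {V S : Type*} [AddCommGroup V] [Module ℝ V] [TopologicalSpace V]
    [AddCommGroup S] [Module ℂ S] (c : Gen V →ₗ[ℝ] Module.End ℂ S) : Prop where
  rel : ∀ A B, c A * c B + c B * c A = ((2 * pairing A B : ℝ) : ℂ) • (1 : Module.End ℂ S)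
  irreducible : ∀ W : Submodule ℂ S, (∀ A, ∀ w ∈ W, c A w ∈ W) → W = ⊥ ∨ W = ⊤
  finite : FiniteDimensional ℂ S
  nontrivial : Nontrivial S

/-! ### Dual frames and traces over `V ⊕ V*` -/

section Frames

variable {V : Type*} [AddCommGroup V] [Module ℝ V] [TopologicalSpace V] {d : ℕ}

lemma pairing_comm (A B : Gen V) : pairing A B = pairing B A := by
  simp only [pairing]; ring

lemma pairing_add_left (A B C : Gen V) : pairing (A + B) C = pairing A C + pairing B C := by
  simp [pairing]; ring

lemma pairing_smul_left (r : ℝ) (A C : Gen V) : pairing (r • A) C = r * pairing A C := by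
  simp [pairing]; ring

lemma pairing_neg_right (A C : Gen V) : pairing A (-C) = -pairing A C := by
  simp [pairing]; ring

lemma IsDualFrame.span_dual {e : Fin d → V} {ε : Fin d → V →L[ℝ] ℝ} (h : IsDualFrame e ε)
    (ξ : V →L[ℝ] ℝ) : ∑ i, ξ (e i) • ε i = ξ := by
  ext v
  conv_rhs => rw [← h.span v]
  simp [mul_comm]

lemma IsDualFrame.expand {e : Fin d → V} {ε : Fin d → V →L[ℝ] ℝ} (h : IsDualFrame e ε)
    (A : Gen V) : ∑ i, (A.2 (e i) • ((0, ε i) : Gen V) + ε i A.1 • ((e i, 0) : Gen V)) = A := by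
  refine Prod.ext ?_ ?_
  · simpa [Prod.fst_sum] using h.span A.1
  · simpa [Prod.snd_sum] using h.span_dual A.2

/-- The trace-type sum `∑_k B(e_k, ε_k) + B(ε_k, e_k)` of a bilinear map on `V ⊕ V*`. -/
def frameTrace {R : Type*} [AddCommMonoid R] [Module ℝ R] (e : Fin d → V) (ε : Fin d → V →L[ℝ] ℝ)
    (B : Gen V →ₗ[ℝ] Gen V →ₗ[ℝ] R) : R :=
  ∑ k, (B (e k, 0) (0, ε k) + B (0, ε k) (e k, 0))

/-- The coefficients are those of `A` in the frame `e_k`, `ε_k`, whose dual frame for the pairing is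
`2 ε_k`, `2 e_k`. -/
lemma frameTrace_expand_left {R : Type*} [AddCommMonoid R] [Module ℝ R] {e : Fin d → V}
    {ε : Fin d → V →L[ℝ] ℝ} (h : IsDualFrame e ε) (B : Gen V →ₗ[ℝ] Gen V →ₗ[ℝ] R)
    (A : Gen V) (C : Gen V) :
    ∑ k, ((2 * pairing A (0, ε k)) • B (e k, 0) C + (2 * pairing A (e k, 0)) • B (0, ε k) C)
      = B A C := by
  conv_rhs => rw [← h.expand A]
  simp only [map_sum, map_add, map_smul, LinearMap.sum_apply, LinearMap.add_apply,
    LinearMap.smul_apply]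
  refine Finset.sum_congr rfl fun i _ => ?_
  rw [add_comm]
  simp [pairing]

lemma frameTrace_expand_right {R : Type*} [AddCommMonoid R] [Module ℝ R] {e : Fin d → V}
    {ε : Fin d → V →L[ℝ] ℝ} (h : IsDualFrame e ε) (B : Gen V →ₗ[ℝ] Gen V →ₗ[ℝ] R)
    (A : Gen V) (C : Gen V) :
    ∑ k, ((2 * pairing C (0, ε k)) • B A (e k, 0) + (2 * pairing C (e k, 0)) • B A (0, ε k))
      = B A C :=
  frameTrace_expand_left h B.flip C A

/-- If `J'` is adjoint to `J`, it can be moved to the other argument in a frame trace taken with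
respect to possibly different frames. -/
lemma frameTrace_adjoint {R : Type*} [AddCommMonoid R] [Module ℝ R] {e e' : Fin d → V}
    {ε ε' : Fin d → V →L[ℝ] ℝ} (h : IsDualFrame e ε) (h' : IsDualFrame e' ε')
    {J J' : Gen V →ₗ[ℝ] Gen V} (hJ : ∀ A B, pairing (J A) B = pairing A (J' B))
    (B : Gen V →ₗ[ℝ] Gen V →ₗ[ℝ] R) :
    frameTrace e ε (B ∘ₗ J) = frameTrace e' ε' (B.compl₂ J') := by
  have hl : frameTrace e ε (B ∘ₗ J) = ∑ k, ∑ j,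
      (((2 * pairing (J (e k, 0)) (0, ε' j)) • B (e' j, 0) (0, ε k) +
        (2 * pairing (J (e k, 0)) (e' j, 0)) • B (0, ε' j) (0, ε k)) +
      ((2 * pairing (J (0, ε k)) (0, ε' j)) • B (e' j, 0) (e k, 0) +
        (2 * pairing (J (0, ε k)) (e' j, 0)) • B (0, ε' j) (e k, 0))) := by
    unfold frameTrace
    refine Finset.sum_congr rfl fun k _ => ?_
    rw [Finset.sum_add_distrib, frameTrace_expand_left h', frameTrace_expand_left h']
    rfl
  have hr : frameTrace e' ε' (B.compl₂ J') = ∑ j, ∑ k,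
      (((2 * pairing (J' (0, ε' j)) (0, ε k)) • B (e' j, 0) (e k, 0) +
        (2 * pairing (J' (0, ε' j)) (e k, 0)) • B (e' j, 0) (0, ε k)) +
      ((2 * pairing (J' (e' j, 0)) (0, ε k)) • B (0, ε' j) (e k, 0) +
        (2 * pairing (J' (e' j, 0)) (e k, 0)) • B (0, ε' j) (0, ε k))) := by
    unfold frameTrace
    refine Finset.sum_congr rfl fun k _ => ?_
    rw [Finset.sum_add_distrib, frameTrace_expand_right h, frameTrace_expand_right h]
    rfl
  rw [hl, hr, Finset.sum_comm]
  refine Finset.sum_congr rfl fun j _ => Finset.sum_congr rfl fun k _ => ?_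
  simp only [hJ, pairing_comm (J' _)]
  abel

end Frames

/-! ### The spin action on an irreducible Clifford module and its extreme eigenvalues -/

section Module

variable {V S : Type*} [AddCommGroup V] [Module ℝ V] [TopologicalSpace V] {d : ℕ}
  [AddCommGroup S] [Module ℂ S] {c : Gen V →ₗ[ℝ] Module.End ℂ S}
  {e : Fin d → V} {ε : Fin d → V →L[ℝ] ℝ} {J : Gen V →ₗ[ℝ] Gen V}

/-- The product of two Clifford elements as a bilinear map. -/
def clMul (c : Gen V →ₗ[ℝ] Module.End ℂ S) : Gen V →ₗ[ℝ] Gen V →ₗ[ℝ] Module.End ℂ S :=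
  (LinearMap.mul ℝ (Module.End ℂ S)).compl₁₂ c c

/-- The spin action of `J`. -/
def spinEnd (c : Gen V →ₗ[ℝ] Module.End ℂ S) (e : Fin d → V) (ε : Fin d → V →L[ℝ] ℝ)
    (J : Gen V →ₗ[ℝ] Gen V) : Module.End ℂ S :=
  (1 / 2 : ℂ) • frameTrace e ε (clMul c ∘ₗ J)

lemma spinEnd_eq : spinEnd c e ε J = (1 / 2 : ℂ) • ∑ k,
    (c (J (e k, 0)) * c (0, ε k) + c (J (0, ε k)) * c (e k, 0)) := rfl

/-- Independence of the frame allows the spin action, defined with the standard frame of the model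
space, to be computed in the coordinate frame of any chart. -/
lemma spinEnd_frame {e' : Fin d → V} {ε' : Fin d → V →L[ℝ] ℝ} (h : IsDualFrame e ε)
    (h' : IsDualFrame e' ε') : spinEnd c e ε J = spinEnd c e' ε' J := by
  have h1 := frameTrace_adjoint h h' (J := LinearMap.id) (J' := LinearMap.id) (fun _ _ => rfl)
    (clMul c ∘ₗ J)
  unfold spinEnd
  congr 1

lemma c_real_smul (r : ℝ) (A : Gen V) : c (r • A) = (r : ℂ) • c A := by
  rw [map_smul]; rfl

/-- The Clifford relation gives `[X Y, A] = 2⟨A, Y⟩ X - 2⟨A, X⟩ Y`. Summed over the frame the first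
terms give `J A`; the second give `J A` once more because `J` is skew. The factor `1/2` compensates.
-/
lemma IsCliffordModule.spinEnd_comm (hc : IsCliffordModule c) (h : IsDualFrame e ε)
    (hJ : IsSkew J) (A : Gen V) :
    spinEnd c e ε J * c A - c A * spinEnd c e ε J = c (J A) := by
  have key : ∀ X Y : Gen V, c X * c Y * c A - c A * (c X * c Y) =
      ((2 * pairing A Y : ℝ) : ℂ) • c X - ((2 * pairing A X : ℝ) : ℂ) • c Y := by
    intro X Y
    have h1 := hc.rel A X
    have h2 := hc.rel A Y
    have e1 : ((2 * pairing A Y : ℝ) : ℂ) • c X = c X * (c A * c Y + c Y * c A) := by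
      rw [h2]; simp
    have e2 : ((2 * pairing A X : ℝ) : ℂ) • c Y = (c A * c X + c X * c A) * c Y := by
      rw [h1]; simp
    rw [e1, e2]; noncomm_ring
  have s1 : ∑ k, (((2 * pairing A (0, ε k) : ℝ) : ℂ) • c (J (e k, 0)) +
      ((2 * pairing A (e k, 0) : ℝ) : ℂ) • c (J (0, ε k))) = c (J A) := by
    have := h.expand A
    conv_rhs => rw [← this]
    simp only [map_sum, map_add, map_smul]
    refine Finset.sum_congr rfl fun k _ => ?_
    rw [add_comm]
    simp only [← c_real_smul]
    simp [pairing]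
  have s2 : ∑ k, (((2 * pairing A (J (e k, 0)) : ℝ) : ℂ) • c (0, ε k) +
      ((2 * pairing A (J (0, ε k)) : ℝ) : ℂ) • c (e k, 0)) = -c (J A) := by
    have := h.expand (J A)
    conv_rhs => rw [← this]
    simp only [map_sum, map_add, ← Finset.sum_neg_distrib]
    refine Finset.sum_congr rfl fun k _ => ?_
    have a1 : pairing A (J (e k, 0)) = -pairing (J A) (e k, 0) := by rw [hJ]; simp
    have a2 : pairing A (J (0, ε k)) = -pairing (J A) (0, ε k) := by rw [hJ]; simp
    rw [a1, a2]
    simp only [← c_real_smul, ← map_add, ← map_neg]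
    congr 1
    simp [pairing]
    module
  rw [spinEnd_eq, smul_mul_assoc, mul_smul_comm, ← smul_sub, Finset.sum_mul, Finset.mul_sum,
    ← Finset.sum_sub_distrib]
  have : ∀ k, (c (J (e k, 0)) * c (0, ε k) + c (J (0, ε k)) * c (e k, 0)) * c A -
      c A * (c (J (e k, 0)) * c (0, ε k) + c (J (0, ε k)) * c (e k, 0)) =
      (((2 * pairing A (0, ε k) : ℝ) : ℂ) • c (J (e k, 0)) +
        ((2 * pairing A (e k, 0) : ℝ) : ℂ) • c (J (0, ε k))) -
      (((2 * pairing A (J (e k, 0)) : ℝ) : ℂ) • c (0, ε k) +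
        ((2 * pairing A (J (0, ε k)) : ℝ) : ℂ) • c (e k, 0)) := fun k => by
    have k1 := key (J (e k, 0)) (0, ε k)
    have k2 := key (J (0, ε k)) (e k, 0)
    rw [add_mul, mul_add, add_sub_add_comm, k1, k2]
    abel
  simp_rw [this]
  rw [Finset.sum_sub_distrib, s1, s2, sub_neg_eq_add, ← two_smul ℂ (c (J A)), smul_smul]
  norm_num

/-- An eigenspace of `T` is invariant under the Clifford action and nonzero, hence everything. -/
lemma IsCliffordModule.schur (hc : IsCliffordModule c) {T : Module.End ℂ S}
    (hT : ∀ A, T * c A = c A * T) : ∃ z : ℂ, T = z • 1 := by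
  have := hc.finite
  have := hc.nontrivial
  obtain ⟨z, hz⟩ := Module.End.exists_eigenvalue T
  refine ⟨z, ?_⟩
  have hinv : ∀ A, ∀ w ∈ T.eigenspace z, c A w ∈ T.eigenspace z := fun A w hw => by
    rw [Module.End.mem_eigenspace_iff] at hw ⊢
    have := LinearMap.congr_fun (hT A) w
    simp only [Module.End.mul_apply] at this
    rw [this, hw, map_smul]
  rcases hc.irreducible _ hinv with h | h
  · exact absurd h hz
  · refine LinearMap.ext fun v => ?_
    have : v ∈ T.eigenspace z := h ▸ Submodule.mem_top
    simpa using Module.End.mem_eigenspace_iff.1 this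

/-- The element `A - i J A` of the `+i` eigenspace of `J`. -/
def raise (c : Gen V →ₗ[ℝ] Module.End ℂ S) (J : Gen V →ₗ[ℝ] Gen V) (A : Gen V) :
    Module.End ℂ S := c A - Complex.I • c (J A)

/-- The element `A + i J A` of the `-i` eigenspace of `J`. -/
def lower (c : Gen V →ₗ[ℝ] Module.End ℂ S) (J : Gen V →ₗ[ℝ] Gen V) (A : Gen V) :
    Module.End ℂ S := c A + Complex.I • c (J A)

lemma raise_add_lower (A : Gen V) : raise c J A + lower c J A = (2 : ℂ) • c A := by
  simp only [raise, lower]; module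

/-- `N` acts on the Clifford elements through `J`. -/
def IsSpinOf (c : Gen V →ₗ[ℝ] Module.End ℂ S) (J : Gen V →ₗ[ℝ] Gen V) (N : Module.End ℂ S) :
    Prop := ∀ A, N * c A - c A * N = c (J A)

lemma IsSpinOf.raise_comm {N : Module.End ℂ S} (hN : IsSpinOf c J N) (hJ2 : ∀ A, J (J A) = -A)
    (A : Gen V) : N * raise c J A - raise c J A * N = Complex.I • raise c J A := by
  have h1 := hN A
  have h2 := hN (J A)
  rw [hJ2, map_neg] at h2
  simp only [raise]
  have : N * (c A - Complex.I • c (J A)) - (c A - Complex.I • c (J A)) * N =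
      (N * c A - c A * N) - Complex.I • (N * c (J A) - c (J A) * N) := by
    simp only [mul_sub, sub_mul, mul_smul_comm, smul_mul_assoc, smul_sub]; abel
  rw [this, h1, h2, smul_sub, smul_smul, Complex.I_mul_I]
  module

lemma IsSpinOf.lower_comm {N : Module.End ℂ S} (hN : IsSpinOf c J N) (hJ2 : ∀ A, J (J A) = -A)
    (A : Gen V) : N * lower c J A - lower c J A * N = -(Complex.I • lower c J A) := by
  have h1 := hN A
  have h2 := hN (J A)
  rw [hJ2, map_neg] at h2
  simp only [lower]
  have : N * (c A + Complex.I • c (J A)) - (c A + Complex.I • c (J A)) * N =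
      (N * c A - c A * N) + Complex.I • (N * c (J A) - c (J A) * N) := by
    simp only [mul_add, add_mul, mul_smul_comm, smul_mul_assoc, smul_sub]; abel
  rw [this, h1, h2, smul_add, smul_smul, Complex.I_mul_I]
  module

lemma mem_eigenspace_of_comm {N T : Module.End ℂ S} {μ z : ℂ} (h : N * T - T * N = z • T)
    {v : S} (hv : v ∈ N.eigenspace μ) : T v ∈ N.eigenspace (μ + z) := by
  rw [Module.End.mem_eigenspace_iff] at hv ⊢
  have h1 := LinearMap.congr_fun h v
  simp only [LinearMap.sub_apply, Module.End.mul_apply, hv, map_smul, LinearMap.smul_apply] at h1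
  rw [sub_eq_iff_eq_add] at h1
  rw [h1]; module

/-- Reordering each product by the Clifford relation, the scalars `⟨J e_k, ε_k⟩` and `⟨J ε_k, e_k⟩`
cancel by skewness and `{e_k, ε_k} = 1` leaves `-z v`. There are `d` indices and a factor `1/2`. -/
lemma IsCliffordModule.spinEnd_of_killed (hc : IsCliffordModule c) (h : IsDualFrame e ε)
    (hJ : IsSkew J) {z : ℂ} {v : S} (hv : ∀ A, c (J A) v = z • c A v) :
    spinEnd c e ε J v = (-z * (d / 2 : ℂ)) • v := by
  rw [spinEnd_eq, LinearMap.smul_apply, LinearMap.sum_apply]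
  have key : ∀ X Y : Gen V, c (J X) (c Y v) =
      -(z • c Y (c X v)) + ((2 * pairing (J X) Y : ℝ) : ℂ) • v := fun X Y => by
    have := LinearMap.congr_fun (hc.rel (J X) Y) v
    simp only [LinearMap.add_apply, Module.End.mul_apply, hv, map_smul, LinearMap.smul_apply,
      Module.End.one_apply] at this
    rw [← this]; abel
  have : ∀ k, (c (J (e k, 0)) * c (0, ε k) + c (J (0, ε k)) * c (e k, 0)) v = -z • v := fun k => by
    have h1 := LinearMap.congr_fun (hc.rel (0, ε k) (e k, 0)) v
    have h2 : pairing (J (0, ε k)) (e k, 0) = - pairing (J (e k, 0)) (0, ε k) := by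
      rw [hJ, pairing_comm]
    have h3 : pairing ((0, ε k) : Gen V) (e k, 0) = 1 / 2 := by
      simp [pairing, h.dual]
    rw [h3] at h1
    simp only [LinearMap.add_apply, Module.End.mul_apply, LinearMap.smul_apply,
      Module.End.one_apply] at h1 ⊢
    rw [key, key, h2]
    have h4 : -(z • (c (0, ε k)) ((c (e k, 0)) v)) + -(z • (c (e k, 0)) ((c (0, ε k)) v)) =
        -z • v := by
      rw [← neg_add, ← smul_add, h1]; norm_num
    rw [← h4]; push_cast; module
  simp_rw [this]
  rw [Finset.sum_const, Finset.card_univ, Fintype.card_fin, ← Nat.cast_smul_eq_nsmul ℂ, smul_smul,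
    smul_smul]
  congr 1; ring

/-- An eigenvector whose eigenvalue has maximal imaginary part is killed by all raising elements,
and `IsCliffordModule.spinEnd_of_killed` evaluates its eigenvalue as `i d/2`; similarly the minimum
is `-i d/2`. The vector in the first clause is the seed for the grading in
`IsCliffordModule.isGrading`. -/
lemma IsCliffordModule.eigenvalue_im_le (hc : IsCliffordModule c) (h : IsDualFrame e ε)
    (hJ : IsSkew J) (hJ2 : ∀ A, J (J A) = -A) :
    (∃ v ≠ 0, v ∈ (spinEnd c e ε J).eigenspace (Complex.I * (d / 2 : ℂ))) ∧
    (∀ μ, (spinEnd c e ε J).HasEigenvalue μ → μ.im ≤ d / 2) ∧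
    (∀ μ, (spinEnd c e ε J).HasEigenvalue μ → -(d / 2 : ℝ) ≤ μ.im) := by
  have := hc.finite
  have := hc.nontrivial
  set N := spinEnd c e ε J
  have hN : IsSpinOf c J N := hc.spinEnd_comm h hJ
  have hfin : {μ | N.HasEigenvalue μ}.Finite := Module.End.finite_hasEigenvalue N
  obtain ⟨μ₀, hμ₀⟩ := Module.End.exists_eigenvalue N
  obtain ⟨μ, hμ, hmax⟩ := hfin.exists_maximalFor Complex.im _ ⟨μ₀, hμ₀⟩
  obtain ⟨ν, hν, hmin⟩ := hfin.exists_minimalFor Complex.im _ ⟨μ₀, hμ₀⟩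
  obtain ⟨v, hv⟩ := hμ.exists_hasEigenvector
  obtain ⟨w, hw⟩ := hν.exists_hasEigenvector
  have hv0 : ∀ A, raise c J A v = 0 := fun A => by
    by_contra h0
    have h1 := mem_eigenspace_of_comm (hN.raise_comm hJ2 A) hv.1
    have := hmax (Module.End.hasEigenvalue_of_hasEigenvector ⟨h1, h0⟩)
    simp at this
    linarith
  have hw0 : ∀ A, lower c J A w = 0 := fun A => by
    by_contra h0
    have h1 := mem_eigenspace_of_comm (z := -Complex.I)
      ((hN.lower_comm hJ2 A).trans (by module)) hw.1
    have := hmin (Module.End.hasEigenvalue_of_hasEigenvector ⟨h1, h0⟩)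
    simp at this
    linarith
  have hv1 : N v = (- -Complex.I * (d / 2 : ℂ)) • v := by
    refine hc.spinEnd_of_killed h hJ fun A => ?_
    have := hv0 A
    simp only [raise, LinearMap.sub_apply, LinearMap.smul_apply, sub_eq_zero] at this
    rw [this, smul_smul]; simp
  have hw1 : N w = (-Complex.I * (d / 2 : ℂ)) • w := by
    refine hc.spinEnd_of_killed h hJ fun A => ?_
    have := hw0 A
    simp only [lower, LinearMap.add_apply, LinearMap.smul_apply, add_eq_zero_iff_eq_neg] at this
    rw [this, smul_neg, smul_smul]; simp
  have hμ1 : μ = Complex.I * (d / 2 : ℂ) := by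
    have := Module.End.mem_eigenspace_iff.1 hv.1
    rw [hv1] at this
    have := smul_left_injective ℂ hv.2 this
    simpa using this.symm
  have hν1 : ν = -Complex.I * (d / 2 : ℂ) := by
    have := Module.End.mem_eigenspace_iff.1 hw.1
    rw [hw1] at this
    exact (smul_left_injective ℂ hw.2 this).symm
  have i1 : μ.im = d / 2 := by rw [hμ1]; simp
  have i2 : ν.im = -(d / 2 : ℝ) := by rw [hν1]; simp
  refine ⟨⟨v, hv.2, hμ1 ▸ hv.1⟩, fun κ hκ => ?_, fun κ hκ => ?_⟩
  · rw [← i1]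
    by_contra hlt
    exact hlt (hmax hκ (not_le.1 hlt).le)
  · rw [← i2]
    by_contra hlt
    exact hlt (hmin hκ (not_le.1 hlt).le)

end Module

/-! ### Gradings by commuting operators and the degrees of endomorphisms -/

section Grading

variable {S : Type*} [AddCommGroup S] [Module ℂ S] {N N₁ N₂ : Module.End ℂ S} {d : ℕ}

/-- `S` is the sum of the eigenspaces of `N` for the eigenvalues `i k`, `-d ≤ k ≤ d`. -/
def IsGrading (d : ℕ) (N : Module.End ℂ S) : Prop :=
  ∀ v, v ∈ ⨆ k ∈ Finset.Icc (-d : ℤ) d, N.eigenspace (Complex.I * (k : ℂ))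

/-- The projection onto the eigenspace of `N` for the eigenvalue `i k`, as a polynomial in `N`. -/
def wproj (d : ℕ) (N : Module.End ℂ S) (k : ℤ) : Module.End ℂ S :=
  Polynomial.aeval N
    (Lagrange.basis (Finset.Icc (-d : ℤ) d) (fun j : ℤ => Complex.I * (j : ℂ)) k)

lemma node_injective : Function.Injective (fun j : ℤ => Complex.I * (j : ℂ)) := fun a b h => by
  have := mul_left_cancel₀ Complex.I_ne_zero h
  exact_mod_cast this

lemma IsGrading.ext {S' : Type*} [AddCommGroup S'] [Module ℂ S'] (h : IsGrading d N)
    {f g : S →ₗ[ℂ] S'}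
    (hfg : ∀ k : ℤ, ∀ v ∈ N.eigenspace (Complex.I * (k : ℂ)), f v = g v) : f = g := by
  refine LinearMap.ext fun v => ?_
  have hle : ⨆ k ∈ Finset.Icc (-d : ℤ) d, N.eigenspace (Complex.I * (k : ℂ)) ≤
      LinearMap.eqLocus f g := iSup₂_le fun k _ v hv => hfg k v hv
  exact hle (h v)

lemma wproj_of_mem_aux {j : ℤ} {v : S} (hv : v ∈ N.eigenspace (Complex.I * (j : ℂ))) (k : ℤ) :
    wproj d N k v = ((Lagrange.basis (Finset.Icc (-d : ℤ) d)
      (fun j : ℤ => Complex.I * (j : ℂ)) k).eval (Complex.I * (j : ℂ))) • v := by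
  by_cases h0 : v = 0
  · simp [h0]
  · exact Module.End.aeval_apply_of_hasEigenvector ⟨hv, h0⟩

lemma wproj_comm_of_comm {T : Module.End ℂ S} (hT : T * N = N * T) (k : ℤ) :
    T * wproj d N k = wproj d N k * T := by
  unfold wproj
  induction Lagrange.basis (Finset.Icc (-d : ℤ) d) (fun j : ℤ => Complex.I * (j : ℂ)) k
    using Polynomial.induction_on with
  | C a => simp [Algebra.commutes]
  | add p q hp hq => rw [map_add, mul_add, add_mul, hp, hq]
  | monomial n a h =>
    rw [pow_succ, ← mul_assoc, map_mul, Polynomial.aeval_X, ← mul_assoc, h, mul_assoc, hT,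
      mul_assoc]

lemma IsGrading.mul_wproj (h : IsGrading d N) (k : ℤ) :
    N * wproj d N k = (Complex.I * (k : ℂ)) • wproj d N k := by
  have hs : ∀ j ∈ Finset.Icc (-d : ℤ) d, ∀ v ∈ N.eigenspace (Complex.I * (j : ℂ)),
      (N * wproj d N k) v = ((Complex.I * (k : ℂ)) • wproj d N k) v := by
    intro j hj v hv
    rw [Module.End.mul_apply, LinearMap.smul_apply, wproj_of_mem_aux hv, map_smul,
      Module.End.mem_eigenspace_iff.1 hv]
    by_cases hjk : j = k
    · subst hjk; rw [smul_comm]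
    · rw [Lagrange.eval_basis_of_ne (v := fun j : ℤ => Complex.I * (j : ℂ)) (Ne.symm hjk) hj]
      simp
  refine LinearMap.ext fun v => ?_
  have hle : ⨆ j ∈ Finset.Icc (-d : ℤ) d, N.eigenspace (Complex.I * (j : ℂ)) ≤
      LinearMap.eqLocus (N * wproj d N k) ((Complex.I * (k : ℂ)) • wproj d N k) :=
    iSup₂_le fun j hj v hv => hs j hj v hv
  exact hle (h v)

lemma IsGrading.wproj_mem (h : IsGrading d N) (k : ℤ) (v : S) :
    wproj d N k v ∈ N.eigenspace (Complex.I * (k : ℂ)) :=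
  Module.End.mem_eigenspace_iff.2 (LinearMap.congr_fun (h.mul_wproj k) v)

lemma wproj_sum (d : ℕ) (N : Module.End ℂ S) :
    ∑ k ∈ Finset.Icc (-d : ℤ) d, wproj d N k = 1 := by
  unfold wproj
  rw [← map_sum, Lagrange.sum_basis node_injective.injOn ⟨0, by simp⟩, map_one]

lemma IsGrading.wproj_apply_ne (h : IsGrading d N) {j k : ℤ} (hjk : j ≠ k) {v : S}
    (hv : v ∈ N.eigenspace (Complex.I * (j : ℂ))) : wproj d N k v = 0 := by
  have h1 := Module.End.mem_eigenspace_iff.1 (h.wproj_mem k v)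
  have h2 := LinearMap.congr_fun (wproj_comm_of_comm (d := d) (rfl : N * N = N * N) k) v
  simp only [Module.End.mul_apply, Module.End.mem_eigenspace_iff.1 hv, map_smul] at h2
  rw [h1] at h2
  by_contra h0
  exact hjk (node_injective (smul_left_injective ℂ h0 h2)).symm

lemma IsGrading.wproj_apply_self (h : IsGrading d N) {k : ℤ} {v : S}
    (hv : v ∈ N.eigenspace (Complex.I * (k : ℂ))) : wproj d N k v = v := by
  have h1 := LinearMap.congr_fun (wproj_sum d N) v
  rw [LinearMap.sum_apply] at h1
  by_cases hk : k ∈ Finset.Icc (-d : ℤ) d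
  · rw [Finset.sum_eq_single_of_mem k hk fun j _ hj => h.wproj_apply_ne hj.symm hv] at h1
    exact h1
  · have : v = 0 := by
      rw [Finset.sum_eq_zero fun j hj => h.wproj_apply_ne (fun e : k = j => hk (e.symm ▸ hj)) hv] at h1
      exact h1.symm
    rw [this, map_zero]

lemma IsGrading.wproj_eq_zero (h : IsGrading d N) {k : ℤ} (hk : k ∉ Finset.Icc (-d : ℤ) d) :
    wproj d N k = 0 := by
  refine LinearMap.ext fun v => ?_
  have h1 := LinearMap.congr_fun (wproj_sum d N) (wproj d N k v)
  rw [LinearMap.sum_apply, Finset.sum_eq_zero fun j hj =>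
    h.wproj_apply_ne (fun e : k = j => hk (e.symm ▸ hj)) (h.wproj_mem k v)] at h1
  exact h1.symm

lemma IsGrading.sum_superset (h : IsGrading d N) {t : Finset ℤ} (ht : Finset.Icc (-d : ℤ) d ⊆ t) :
    ∑ k ∈ t, wproj d N k = 1 := by
  rw [← wproj_sum d N]
  exact (Finset.sum_subset ht fun k _ hk => h.wproj_eq_zero hk).symm

lemma IsGrading.of_proj {P : ℤ → Module.End ℂ S}
    (hP : ∀ k v, N (P k v) = (Complex.I * (k : ℂ)) • P k v)
    (hsum : ∀ v, ∑ k ∈ Finset.Icc (-d : ℤ) d, P k v = v) : IsGrading d N := fun v => by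
  rw [← hsum v]
  exact Submodule.sum_mem _ fun k hk => Submodule.mem_iSup_of_mem k
    (Submodule.mem_iSup_of_mem hk (Module.End.mem_eigenspace_iff.2 (hP k v)))

/-! ### Bigradings -/

/-- Two commuting gradings. -/
structure IsBigrading (d : ℕ) (N₁ N₂ : Module.End ℂ S) : Prop where
  fst : IsGrading d N₁
  snd : IsGrading d N₂
  comm : N₁ * N₂ = N₂ * N₁

/-- The space of vectors of bidegree `(p, q)`. -/
def bispace (N₁ N₂ : Module.End ℂ S) (p q : ℤ) : Submodule ℂ S :=
  N₁.eigenspace (Complex.I * (p : ℂ)) ⊓ N₂.eigenspace (Complex.I * (q : ℂ))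

/-- The projection onto the vectors of bidegree `(p, q)`. -/
def biproj (d : ℕ) (N₁ N₂ : Module.End ℂ S) (p q : ℤ) : Module.End ℂ S :=
  wproj d N₁ p * wproj d N₂ q

lemma IsBigrading.biproj_mem (h : IsBigrading d N₁ N₂) (p q : ℤ) (v : S) :
    biproj d N₁ N₂ p q v ∈ bispace N₁ N₂ p q := by
  refine ⟨h.fst.wproj_mem p _, ?_⟩
  have : biproj d N₁ N₂ p q = wproj d N₂ q * wproj d N₁ p := by
    unfold biproj
    exact (wproj_comm_of_comm (wproj_comm_of_comm h.comm.symm p).symm q)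
  rw [this]
  exact h.snd.wproj_mem q _

lemma IsBigrading.ext {S' : Type*} [AddCommGroup S'] [Module ℂ S'] (h : IsBigrading d N₁ N₂)
    {f g : S →ₗ[ℂ] S'} (hfg : ∀ p q : ℤ, ∀ v ∈ bispace N₁ N₂ p q, f v = g v) : f = g := by
  have hsum : ∀ v : S, v = ∑ p ∈ Finset.Icc (-d : ℤ) d, ∑ q ∈ Finset.Icc (-d : ℤ) d,
      biproj d N₁ N₂ p q v := fun v => by
    have h1 := LinearMap.congr_fun (wproj_sum d N₁) v
    have h2 := LinearMap.congr_fun (wproj_sum d N₂) v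
    simp only [LinearMap.sum_apply, Module.End.one_apply] at h1 h2
    conv_lhs => rw [← h1, ← h2]
    simp [biproj]
  refine LinearMap.ext fun v => ?_
  rw [hsum v]
  simp only [map_sum]
  exact Finset.sum_congr rfl fun p _ => Finset.sum_congr rfl fun q _ =>
    hfg p q _ (h.biproj_mem p q v)

lemma IsBigrading.biproj_self (h : IsBigrading d N₁ N₂) {p q : ℤ} {v : S}
    (hv : v ∈ bispace N₁ N₂ p q) : biproj d N₁ N₂ p q v = v := by
  rw [biproj, Module.End.mul_apply, h.snd.wproj_apply_self hv.2, h.fst.wproj_apply_self hv.1]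

lemma IsBigrading.biproj_ne (h : IsBigrading d N₁ N₂) {p q p' q' : ℤ} {v : S}
    (hv : v ∈ bispace N₁ N₂ p q) (hne : (p, q) ≠ (p', q')) : biproj d N₁ N₂ p' q' v = 0 := by
  rw [biproj, Module.End.mul_apply]
  by_cases hq : q = q'
  · subst hq
    have hp : p ≠ p' := fun hp => hne (by rw [hp])
    rw [h.snd.wproj_apply_self hv.2, h.fst.wproj_apply_ne hp hv.1]
  · rw [h.snd.wproj_apply_ne hq hv.2, map_zero]

lemma IsBigrading.biproj_eq_zero (h : IsBigrading d N₁ N₂) {p q : ℤ}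
    (hpq : ¬ (p ∈ Finset.Icc (-d : ℤ) d ∧ q ∈ Finset.Icc (-d : ℤ) d)) :
    biproj d N₁ N₂ p q = 0 := by
  rw [biproj]
  by_cases hp : p ∈ Finset.Icc (-d : ℤ) d
  · rw [h.snd.wproj_eq_zero fun hq => hpq ⟨hp, hq⟩, mul_zero]
  · rw [h.fst.wproj_eq_zero hp, zero_mul]

lemma biproj_sum_apply (d : ℕ) (N₁ N₂ : Module.End ℂ S) (v : S) :
    ∑ p ∈ Finset.Icc (-d : ℤ) d, ∑ q ∈ Finset.Icc (-d : ℤ) d, biproj d N₁ N₂ p q v = v := by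
  have h1 := LinearMap.congr_fun (wproj_sum d N₁) v
  have h2 := LinearMap.congr_fun (wproj_sum d N₂) v
  simp only [LinearMap.sum_apply, Module.End.one_apply] at h1 h2
  conv_rhs => rw [← h1, ← h2]
  simp [biproj]

/-- The part of `T` of degree `r`. -/
def gpart (d : ℕ) (N : Module.End ℂ S) (r : ℤ) (T : Module.End ℂ S) : Module.End ℂ S :=
  ∑ k ∈ Finset.Icc (-d : ℤ) d, wproj d N (k + r) * T * wproj d N k

/-- The part of `T` of bidegree `(r, s)`. -/
def bipart (d : ℕ) (N₁ N₂ : Module.End ℂ S) (r s : ℤ) (T : Module.End ℂ S) : Module.End ℂ S :=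
  ∑ p ∈ Finset.Icc (-d : ℤ) d, ∑ q ∈ Finset.Icc (-d : ℤ) d,
    biproj d N₁ N₂ (p + r) (q + s) * T * biproj d N₁ N₂ p q

/-- `T` maps vectors of bidegree `(p, q)` to vectors of bidegree `(p + r, q + s)`. -/
def HasBidegree (N₁ N₂ : Module.End ℂ S) (r s : ℤ) (T : Module.End ℂ S) : Prop :=
  ∀ p q v, v ∈ bispace N₁ N₂ p q → T v ∈ bispace N₁ N₂ (p + r) (q + s)

lemma IsGrading.gpart_apply (h : IsGrading d N) (r : ℤ) (T : Module.End ℂ S) {k : ℤ} {v : S}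
    (hv : v ∈ N.eigenspace (Complex.I * (k : ℂ))) : gpart d N r T v = wproj d N (k + r) (T v) := by
  rw [gpart, LinearMap.sum_apply]
  by_cases hk : k ∈ Finset.Icc (-d : ℤ) d
  · rw [Finset.sum_eq_single_of_mem k hk fun j _ hj => by
      rw [Module.End.mul_apply, h.wproj_apply_ne hj.symm hv, map_zero]]
    rw [Module.End.mul_apply, h.wproj_apply_self hv, Module.End.mul_apply]
  · have : v = 0 := by rw [← h.wproj_apply_self hv, h.wproj_eq_zero hk]; rfl
    simp [this]

lemma IsBigrading.bipart_apply (h : IsBigrading d N₁ N₂) (r s : ℤ) (T : Module.End ℂ S) {p q : ℤ}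
    {v : S} (hv : v ∈ bispace N₁ N₂ p q) :
    bipart d N₁ N₂ r s T v = biproj d N₁ N₂ (p + r) (q + s) (T v) := by
  simp only [bipart, LinearMap.sum_apply, Module.End.mul_apply]
  by_cases hpq : p ∈ Finset.Icc (-d : ℤ) d ∧ q ∈ Finset.Icc (-d : ℤ) d
  · rw [Finset.sum_eq_single_of_mem p hpq.1, Finset.sum_eq_single_of_mem q hpq.2,
      h.biproj_self hv]
    · intro q' _ hq'
      rw [h.biproj_ne hv fun he => hq' (Prod.ext_iff.1 he).2.symm, map_zero, map_zero]
    · intro p' _ hp'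
      refine Finset.sum_eq_zero fun q' _ => ?_
      rw [h.biproj_ne hv fun he => hp' (Prod.ext_iff.1 he).1.symm, map_zero, map_zero]
  · have : v = 0 := by rw [← h.biproj_self hv, h.biproj_eq_zero hpq]; rfl
    simp [this]

lemma IsBigrading.hasBidegree_bipart (h : IsBigrading d N₁ N₂) (r s : ℤ) (T : Module.End ℂ S) :
    HasBidegree N₁ N₂ r s (bipart d N₁ N₂ r s T) := fun p q v hv => by
  rw [h.bipart_apply r s T hv]; exact h.biproj_mem _ _ _

lemma IsBigrading.gpart_fst_self (h : IsBigrading d N₁ N₂) {r s : ℤ} {T : Module.End ℂ S}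
    (hT : HasBidegree N₁ N₂ r s T) : gpart d N₁ r T = T :=
  h.ext fun p q v hv => by
    rw [h.fst.gpart_apply r T hv.1, h.fst.wproj_apply_self (hT p q v hv).1]

lemma IsBigrading.gpart_fst_ne (h : IsBigrading d N₁ N₂) {r s r' : ℤ} {T : Module.End ℂ S}
    (hT : HasBidegree N₁ N₂ r s T) (hne : r ≠ r') : gpart d N₁ r' T = 0 :=
  h.ext fun p q v hv => by
    rw [h.fst.gpart_apply r' T hv.1, h.fst.wproj_apply_ne _ (hT p q v hv).1]
    · rfl
    · simpa using hne

lemma IsBigrading.gpart_snd_self (h : IsBigrading d N₁ N₂) {r s : ℤ} {T : Module.End ℂ S}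
    (hT : HasBidegree N₁ N₂ r s T) : gpart d N₂ s T = T :=
  h.ext fun p q v hv => by
    rw [h.snd.gpart_apply s T hv.2, h.snd.wproj_apply_self (hT p q v hv).2]

lemma IsBigrading.gpart_snd_ne (h : IsBigrading d N₁ N₂) {r s s' : ℤ} {T : Module.End ℂ S}
    (hT : HasBidegree N₁ N₂ r s T) (hne : s ≠ s') : gpart d N₂ s' T = 0 :=
  h.ext fun p q v hv => by
    rw [h.snd.gpart_apply s' T hv.2, h.snd.wproj_apply_ne _ (hT p q v hv).2]
    · rfl
    · simpa using hne

lemma gpart_add (r : ℤ) (T T' : Module.End ℂ S) :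
    gpart d N r (T + T') = gpart d N r T + gpart d N r T' := by
  simp [gpart, mul_add, add_mul, Finset.sum_add_distrib]

lemma HasBidegree.mul {r s r' s' : ℤ} {T T' : Module.End ℂ S} (hT : HasBidegree N₁ N₂ r s T)
    (hT' : HasBidegree N₁ N₂ r' s' T') : HasBidegree N₁ N₂ (r + r') (s + s') (T * T') :=
  fun p q v hv => by
    have := hT _ _ _ (hT' p q v hv)
    rwa [show p + (r + r') = p + r' + r by ring, show q + (s + s') = q + s' + s by ring]

lemma HasBidegree.add {r s : ℤ} {T T' : Module.End ℂ S} (hT : HasBidegree N₁ N₂ r s T)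
    (hT' : HasBidegree N₁ N₂ r s T') : HasBidegree N₁ N₂ r s (T + T') :=
  fun p q v hv => Submodule.add_mem _ (hT p q v hv) (hT' p q v hv)

/-- The double commutator with `N`, plus the identity, as an operator on endomorphisms: it
multiplies endomorphisms of degree `r` by `1 - r²`. -/
def adSq (N T : Module.End ℂ S) : Module.End ℂ S :=
  N * (N * T - T * N) - (N * T - T * N) * N + T

lemma adSq_apply {k : ℤ} {v : S} (hv : v ∈ N.eigenspace (Complex.I * (k : ℂ)))
    (T : Module.End ℂ S) : adSq N T v =
      N (N (T v)) - (2 * (Complex.I * (k : ℂ))) • N (T v) + (1 - (k : ℂ) ^ 2) • T v := by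
  have hv := Module.End.mem_eigenspace_iff.1 hv
  simp only [adSq, LinearMap.add_apply, LinearMap.sub_apply, Module.End.mul_apply, hv, map_smul,
    map_sub]
  have : Complex.I * k * (Complex.I * k) = -(k : ℂ) ^ 2 := by
    linear_combination (k : ℂ) ^ 2 * Complex.I_mul_I
  rw [smul_sub, smul_smul, this]
  module

lemma IsGrading.wproj_adSq (h : IsGrading d N) {k : ℤ} {v : S}
    (hv : v ∈ N.eigenspace (Complex.I * (k : ℂ))) (T : Module.End ℂ S) (r : ℤ) :
    wproj d N (k + r) (adSq N T v) = (1 - (r : ℂ) ^ 2) • wproj d N (k + r) (T v) := by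
  have hc : ∀ w, wproj d N (k + r) (N w) = (Complex.I * ((k + r : ℤ) : ℂ)) • wproj d N (k + r) w :=
    fun w => by
      rw [← Module.End.mul_apply, ← wproj_comm_of_comm rfl, h.mul_wproj]; rfl
  rw [adSq_apply hv]
  simp only [map_add, map_sub, map_smul, hc, smul_smul]
  rw [← sub_smul, ← add_smul]
  congr 1
  push_cast
  linear_combination ((k : ℂ) + r) * ((k : ℂ) + r) * Complex.I_mul_I -
    2 * k * ((k : ℂ) + r) * Complex.I_mul_I

/-- In degree `r` the hypothesis becomes multiplication by `(1 - r²)²`, a nonzero integer unless `r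
= ±1`. The square appears because the integrability argument shows directly only that `adSq N d_H`
is a Clifford element, which a second `adSq` kills. -/
lemma IsGrading.wproj_eq_zero_of_adSq (h : IsGrading d N) {T : Module.End ℂ S}
    (hT : adSq N (adSq N T) = 0) {k r : ℤ} {v : S}
    (hv : v ∈ N.eigenspace (Complex.I * (k : ℂ))) (h1 : r ≠ 1) (h2 : r ≠ -1) :
    wproj d N (k + r) (T v) = 0 := by
  have h3 := congrArg (wproj d N (k + r)) (LinearMap.congr_fun hT v)
  rw [h.wproj_adSq hv, h.wproj_adSq hv, LinearMap.zero_apply, map_zero, smul_smul] at h3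
  refine (smul_eq_zero.1 h3).resolve_left ?_
  have : ((1 - (r : ℂ) ^ 2) * (1 - (r : ℂ) ^ 2)) = ((((1 - r) * (1 + r)) ^ 2 : ℤ) : ℂ) := by
    push_cast; ring
  rw [this]
  norm_cast
  apply pow_ne_zero
  apply mul_ne_zero <;> omega

lemma IsGrading.sum_pm (h : IsGrading d N) {T : Module.End ℂ S} (hT : adSq N (adSq N T) = 0)
    {k : ℤ} {v : S} (hv : v ∈ N.eigenspace (Complex.I * (k : ℂ))) :
    wproj d N (k + 1) (T v) + wproj d N (k + -1) (T v) = T v := by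
  -- The indices `k ± 1` may leave the range `[-d, d]`; the range is enlarged by them, where the
  -- extra projections are zero.
  have h1 := LinearMap.congr_fun (h.sum_superset
    (t := Finset.Icc (-d : ℤ) d ∪ {k + 1, k + -1}) Finset.subset_union_left) (T v)
  rw [LinearMap.sum_apply, ← Finset.sum_subset (s₁ := {k + 1, k + -1}) Finset.subset_union_right,
    Finset.sum_pair (by omega)] at h1
  · exact h1
  · intro j _ hj
    simp only [Finset.mem_insert, Finset.mem_singleton, not_or] at hj
    have := h.wproj_eq_zero_of_adSq hT hv (r := j - k) (by omega) (by omega)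
    rwa [add_sub_cancel] at this

/-- An endomorphism annihilated by the squares of `adSq` is the sum of its parts of bidegree
`(±1, ±1)`. -/
lemma IsBigrading.eq_sum_bipart (h : IsBigrading d N₁ N₂) {T : Module.End ℂ S}
    (h₁ : adSq N₁ (adSq N₁ T) = 0) (h₂ : adSq N₂ (adSq N₂ T) = 0) :
    T = bipart d N₁ N₂ (-1) (-1) T + bipart d N₁ N₂ (-1) 1 T + bipart d N₁ N₂ 1 1 T +
      bipart d N₁ N₂ 1 (-1) T :=
  h.ext fun p q v hv => by
    have e2 := h.snd.sum_pm h₂ hv.2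
    have e1 := h.fst.sum_pm h₁ hv.1
    conv_lhs => rw [← e1, ← e2]
    simp only [LinearMap.add_apply, h.bipart_apply _ _ T hv, biproj, Module.End.mul_apply, map_add]
    abel

open Classical in
-- The definition of `component` takes an arbitrary decomposition into elements of the `U i`.
-- Applying `P i` to that decomposition singles out its `i`-th term, so the choice is immaterial.
lemma component_eq {ι : Type*} (U : ι → Set S) (P : ι → Module.End ℂ S) (t : Finset ι)
    (h1 : ∀ i, ∀ v ∈ U i, P i v = v) (h2 : ∀ i j, i ≠ j → ∀ v ∈ U j, P i v = 0)
    (h3 : ∀ i v, P i v ∈ U i) (h4 : ∀ v, ∑ i ∈ t, P i v = v) (i : ι) (v : S) :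
    component U i v = P i v := by
  have hex : ∃ c : ι →₀ S, (∀ j, c j ∈ U j) ∧ c.sum (fun _ w => w) = v := by
    refine ⟨Finsupp.onFinset t (fun j => if j ∈ t then P j v else 0) (fun j hj => ?_), ?_, ?_⟩
    · by_contra hjt
      exact hj (if_neg hjt)
    · intro j
      simp only [Finsupp.onFinset_apply]
      split_ifs
      · exact h3 j v
      · simpa using h3 j 0
    · rw [Finsupp.onFinset_sum _ (fun _ => rfl)]
      conv_rhs => rw [← h4 v]
      exact Finset.sum_congr rfl fun j hj => if_pos hj
  rw [component, dif_pos hex]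
  obtain ⟨hc1, hc2⟩ := hex.choose_spec
  set c := hex.choose
  conv_rhs => rw [← hc2]
  rw [Finsupp.sum, map_sum, Finset.sum_eq_single i]
  · exact (h1 i _ (hc1 i)).symm
  · intro j _ hj
    exact h2 i j hj.symm _ (hc1 j)
  · intro hi
    rw [Finsupp.notMem_support_iff.1 hi, map_zero]

end Grading

/-! ### Integrality of the weights, odd endomorphisms, and the star operator -/

section Module

variable {V S : Type*} [AddCommGroup V] [Module ℝ V] [TopologicalSpace V] {d : ℕ}
  [AddCommGroup S] [Module ℂ S] {c : Gen V →ₗ[ℝ] Module.End ℂ S}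
  {e : Fin d → V} {ε : Fin d → V →L[ℝ] ℝ} {J J₁ J₂ : Gen V →ₗ[ℝ] Gen V}
  {N N₁ N₂ : Module.End ℂ S}

lemma raise_mem (hN : IsSpinOf c J N) (hJ2 : ∀ A, J (J A) = -A) (A : Gen V) {k : ℤ} {v : S}
    (hv : v ∈ N.eigenspace (Complex.I * (k : ℂ))) :
    raise c J A v ∈ N.eigenspace (Complex.I * ((k + 1 : ℤ) : ℂ)) := by
  have := mem_eigenspace_of_comm (hN.raise_comm hJ2 A) hv
  convert this using 2
  push_cast; ring

lemma lower_mem (hN : IsSpinOf c J N) (hJ2 : ∀ A, J (J A) = -A) (A : Gen V) {k : ℤ} {v : S}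
    (hv : v ∈ N.eigenspace (Complex.I * (k : ℂ))) :
    lower c J A v ∈ N.eigenspace (Complex.I * ((k + -1 : ℤ) : ℂ)) := by
  have := mem_eigenspace_of_comm (z := -Complex.I) ((hN.lower_comm hJ2 A).trans (by module)) hv
  convert this using 2
  push_cast; ring

lemma c_eq_half (J : Gen V →ₗ[ℝ] Gen V) (A : Gen V) :
    c A = (1 / 2 : ℂ) • (raise c J A + lower c J A) := by
  rw [raise_add_lower, smul_smul]; norm_num

/-- The span of the eigenspaces with eigenvalue `i k`, `k` an integer, is preserved by raising and
lowering, hence by the Clifford action. It contains the extreme eigenvector, whose weight `d/2 = n`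
is an integer because `d = 2 n`, so by irreducibility it is everything. The weights lie in `[-n,
n]`, well inside the range used. -/
lemma IsCliffordModule.isGrading {n : ℕ} {e : Fin (2 * n) → V} {ε : Fin (2 * n) → V →L[ℝ] ℝ}
    (hc : IsCliffordModule c) (h : IsDualFrame e ε)
    (hJ : IsSkew J) (hJ2 : ∀ A, J (J A) = -A) : IsGrading (2 * n) (spinEnd c e ε J) := by
  obtain ⟨⟨v, hv0, hv⟩, hle, hge⟩ := hc.eigenvalue_im_le h hJ hJ2
  set N := spinEnd c e ε J
  have hN : IsSpinOf c J N := hc.spinEnd_comm h hJ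
  set W : Submodule ℂ S := ⨆ k : ℤ, N.eigenspace (Complex.I * (k : ℂ)) with hW
  have hv' : v ∈ N.eigenspace (Complex.I * ((n : ℤ) : ℂ)) := by
    convert hv using 3
    push_cast
    ring
  have hinv : ∀ A, ∀ w ∈ W, c A w ∈ W := fun A => by
    have : W ≤ W.comap (c A) := iSup_le fun k w hw => by
      rw [Submodule.mem_comap, c_eq_half J A]
      refine W.smul_mem _ (W.add_mem ?_ ?_)
      · exact Submodule.mem_iSup_of_mem _ (raise_mem hN hJ2 A hw)
      · exact Submodule.mem_iSup_of_mem _ (lower_mem hN hJ2 A hw)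
    exact this
  have htop : W = ⊤ := (hc.irreducible W hinv).resolve_left fun hbot =>
    hv0 ((Submodule.mem_bot ℂ).1 (hbot ▸ Submodule.mem_iSup_of_mem (n : ℤ) hv'))
  have hle' : W ≤ ⨆ k ∈ Finset.Icc (-(2 * n : ℕ) : ℤ) (2 * n : ℕ),
      N.eigenspace (Complex.I * (k : ℂ)) := iSup_le fun k => by
    by_cases hk : k ∈ Finset.Icc (-(2 * n : ℕ) : ℤ) (2 * n : ℕ)
    · exact le_iSup₂_of_le k hk le_rfl
    · have : N.eigenspace (Complex.I * (k : ℂ)) = ⊥ := by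
        by_contra hne
        have h1 := hle _ hne
        have h2 := hge _ hne
        simp at h1 h2
        have h1' : k ≤ n := by exact_mod_cast h1
        have h2' : -(n : ℤ) ≤ k := by exact_mod_cast h2
        apply hk
        rw [Finset.mem_Icc]
        push_cast
        constructor <;> omega
      rw [this]; exact bot_le
  exact fun w => hle' (htop ▸ Submodule.mem_top)

/-! ### Odd endomorphisms with vanishing double brackets -/

/-- The product `T P` commutes with the Clifford action, so it is a scalar `z` and `T = z P`. Such a
`T` commutes with `P`, while it is supposed to anticommute; so `z = 0`. -/
lemma IsCliffordModule.eq_zero_of_odd (hc : IsCliffordModule c) {P T : Module.End ℂ S}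
    (hP : ∀ A, P * c A = -(c A * P)) (hP2 : P * P = 1) (hT : ∀ A, T * c A = -(c A * T))
    (hTP : T * P = -(P * T)) : T = 0 := by
  obtain ⟨z, hz⟩ := hc.schur (T := T * P) fun A => by
    rw [mul_assoc, hP, mul_neg, ← mul_assoc, hT, neg_mul, neg_neg, mul_assoc]
  have h1 : T = z • P := by
    rw [← mul_one T, ← hP2, ← mul_assoc, hz, smul_mul_assoc, one_mul]
  have h2 : z • (1 : Module.End ℂ S) = -(z • 1) := by
    conv_lhs => rw [← hz, hTP, h1, mul_smul_comm, hP2]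
  have h3 : (2 * z) • (1 : Module.End ℂ S) = 0 := by
    rw [two_mul, add_smul]; nth_rw 1 [h2]; exact neg_add_cancel _
  have := hc.nontrivial
  have h4 : 2 * z = 0 := (smul_eq_zero.1 h3).resolve_right one_ne_zero
  have h5 : z = 0 := by simpa using h4
  rw [h1, h5, zero_smul]

/-- The double bracket `[{Z, a}, b]`. -/
def dbr {R : Type*} [Ring R] (Z a b : R) : R := (Z * a + a * Z) * b - b * (Z * a + a * Z)

/-- The sum of the two brackets is `[Z, {a, b}]`, and `{a, b}` is a scalar. -/
lemma dbr_symm {R : Type*} [Ring R] [Algebra ℂ R] (Z a b : R) {s : ℂ} (h : a * b + b * a = s • 1) :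
    dbr Z a b + dbr Z b a = 0 := by
  have : dbr Z a b + dbr Z b a = Z * (a * b + b * a) - (a * b + b * a) * Z := by
    unfold dbr; noncomm_ring
  rw [this, h]; simp

/-- The sum is the commutator of `{Z, a}` with the scalar `{b, x}`. Together with `dbr_symm` this
says that `{[{Z, a}, b], x}` is antisymmetric in its three Clifford arguments. -/
lemma dbr_anti {R : Type*} [Ring R] [Algebra ℂ R] (Z a b x : R) {s : ℂ}
    (h : b * x + x * b = s • 1) :
    dbr Z a b * x + x * dbr Z a b + (dbr Z a x * b + b * dbr Z a x) = 0 := by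
  have : dbr Z a b * x + x * dbr Z a b + (dbr Z a x * b + b * dbr Z a x) =
      (Z * a + a * Z) * (b * x + x * b) - (b * x + x * b) * (Z * a + a * Z) := by
    unfold dbr; noncomm_ring
  rw [this, h]; simp

lemma IsCliffordModule.lin_anticomm (hc : IsCliffordModule c) (A A' B B' : Gen V) (z w : ℂ) :
    ∃ s : ℂ, (c A + z • c A') * (c B + w • c B') + (c B + w • c B') * (c A + z • c A') = s • 1 := by
  refine ⟨((2 * pairing A B : ℝ) : ℂ) + w * ((2 * pairing A B' : ℝ) : ℂ) +
    z * ((2 * pairing A' B : ℝ) : ℂ) + z * w * ((2 * pairing A' B' : ℝ) : ℂ), ?_⟩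
  simp only [add_smul, mul_smul, ← hc.rel]
  simp only [mul_add, add_mul, smul_mul_assoc, mul_smul_comm, smul_add]
  module

lemma raise_eq (A : Gen V) : raise c J A = c A + (-Complex.I) • c (J A) := by
  rw [raise, neg_smul, sub_eq_add_neg]

lemma dbr_odd {R : Type*} [Ring R] {Z a b P : R} (hZ : Z * P = -(P * Z)) (ha : a * P = -(P * a))
    (hb : b * P = -(P * b)) : dbr Z a b * P = -(P * dbr Z a b) := by
  have h3 : ∀ x y z : R, x * P = -(P * x) → y * P = -(P * y) → z * P = -(P * z) →
      x * y * z * P = -(P * (x * y * z)) := fun x y z hx hy hz => by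
    rw [mul_assoc, hz, mul_neg, ← mul_assoc, mul_assoc x, hy, mul_neg, ← mul_assoc, hx]
    noncomm_ring
  have e1 := h3 Z a b hZ ha hb
  have e2 := h3 a Z b ha hZ hb
  have e3 := h3 b Z a hb hZ ha
  have e4 := h3 b a Z hb ha hZ
  have : dbr Z a b = Z * a * b + a * Z * b - b * Z * a - b * a * Z := by unfold dbr; noncomm_ring
  rw [this, sub_mul, sub_mul, add_mul, e1, e2, e3, e4]
  noncomm_ring

/-- Let `U` be the mixed bracket. By the antisymmetry of `{[{Z, a}, b], x}`, its anticommutator with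
a raising element can be rewritten through a bracket of two raising elements, and the one with a
lowering element through a bracket of two lowering elements; both vanish. So `U` is odd and
anticommutes with all Clifford elements, hence is zero. -/
lemma IsCliffordModule.dbr_raise_lower (hc : IsCliffordModule c) {P Z : Module.End ℂ S}
    (hP : ∀ A, P * c A = -(c A * P)) (hP2 : P * P = 1) (hZP : Z * P = -(P * Z))
    (hr : ∀ A B, dbr Z (raise c J A) (raise c J B) = 0)
    (hl : ∀ A B, dbr Z (lower c J A) (lower c J B) = 0) (A B : Gen V) :
    dbr Z (raise c J A) (lower c J B) = 0 := by
  have odd_r : ∀ A, raise c J A * P = -(P * raise c J A) := fun A => by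
    rw [raise, sub_mul, mul_sub, smul_mul_assoc, mul_smul_comm, hP, hP]; module
  have odd_l : ∀ A, lower c J A * P = -(P * lower c J A) := fun A => by
    rw [lower, add_mul, mul_add, smul_mul_assoc, mul_smul_comm, hP, hP]; module
  refine hc.eq_zero_of_odd hP hP2 (fun X => ?_) (dbr_odd hZP (odd_r A) (odd_l B))
  set U := dbr Z (raise c J A) (lower c J B) with hU
  obtain ⟨s1, hs1⟩ := hc.lin_anticomm B (J B) X (J X) Complex.I (-Complex.I)
  obtain ⟨s2, hs2⟩ := hc.lin_anticomm A (J A) X (J X) (-Complex.I) Complex.I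
  obtain ⟨s3, hs3⟩ := hc.lin_anticomm A (J A) B (J B) (-Complex.I) Complex.I
  have e1 : U * raise c J X + raise c J X * U = 0 := by
    have := dbr_anti Z (raise c J A) (lower c J B) (raise c J X) (s := s1)
      (by rw [raise_eq]; exact hs1)
    rw [hr, zero_mul, mul_zero, add_zero, add_zero] at this
    exact this
  have hU' : U = -dbr Z (lower c J B) (raise c J A) :=
    eq_neg_of_add_eq_zero_left (dbr_symm Z _ _ (s := s3) (by rw [raise_eq]; exact hs3))
  have e2 : U * lower c J X + lower c J X * U = 0 := by
    have := dbr_anti Z (lower c J B) (raise c J A) (lower c J X) (s := s2)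
      (by rw [raise_eq]; exact hs2)
    rw [hl, zero_mul, mul_zero, add_zero, add_zero] at this
    rw [hU', neg_mul, mul_neg, ← neg_add, this, neg_zero]
  have : U * c X + c X * U = 0 := by
    rw [c_eq_half J X, mul_smul_comm, smul_mul_assoc, ← smul_add, mul_add, add_mul]
    rw [add_add_add_comm, e1, e2]; simp
  exact eq_neg_of_add_eq_zero_left this

lemma adSq_add (N T T' : Module.End ℂ S) : adSq N (T + T') = adSq N T + adSq N T' := by
  unfold adSq; noncomm_ring

lemma adSq_smul (N T : Module.End ℂ S) (z : ℂ) : adSq N (z • T) = z • adSq N T := by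
  simp only [adSq, mul_smul_comm, smul_mul_assoc, smul_add, smul_sub, mul_sub, sub_mul]

lemma adSq_sum {ι : Type*} (N : Module.End ℂ S) (s : Finset ι) (T : ι → Module.End ℂ S) :
    adSq N (∑ i ∈ s, T i) = ∑ i ∈ s, adSq N (T i) := by
  have h0 : adSq N (0 : Module.End ℂ S) = 0 := by simp [adSq]
  exact map_sum ({ toFun := adSq N, map_zero' := h0, map_add' := adSq_add N } :
    Module.End ℂ S →+ Module.End ℂ S) T s

lemma IsSpinOf.adSq_c (hN : IsSpinOf c J N) (hJ2 : ∀ A, J (J A) = -A) (A : Gen V) :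
    adSq N (c A) = 0 := by
  rw [adSq, hN, hN, hJ2, map_neg, neg_add_cancel]

/-- An odd endomorphism whose double brackets with two elements of the same eigenspace of `J`
vanish is a Clifford element. -/
lemma IsCliffordModule.adSq_eq_zero (hc : IsCliffordModule c) (h : IsDualFrame e ε)
    (hN : IsSpinOf c J N) (hJ2 : ∀ A, J (J A) = -A) {P Z : Module.End ℂ S}
    (hP : ∀ A, P * c A = -(c A * P)) (hP2 : P * P = 1) (hZP : Z * P = -(P * Z))
    (hr : ∀ A B, dbr Z (raise c J A) (raise c J B) = 0)
    (hl : ∀ A B, dbr Z (lower c J A) (lower c J B) = 0) : adSq N Z = 0 := by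
  have hrl := hc.dbr_raise_lower hP hP2 hZP hr hl
  have hlr : ∀ A B, dbr Z (lower c J A) (raise c J B) = 0 := fun A B => by
    obtain ⟨s3, hs3⟩ := hc.lin_anticomm B (J B) A (J A) (-Complex.I) Complex.I
    have := dbr_symm Z (raise c J B) (lower c J A) (s := s3) (by rw [raise_eq]; exact hs3)
    rwa [hrl, zero_add] at this
  have hcc : ∀ A B, dbr Z (c A) (c B) = 0 := fun A B => by
    have : (4 : ℂ) • dbr Z (c A) (c B) = dbr Z ((2 : ℂ) • c A) ((2 : ℂ) • c B) := by
      simp only [dbr, mul_smul_comm, smul_mul_assoc, smul_sub, smul_add, mul_add, add_mul]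
      module
    rw [← raise_add_lower (J := J) A, ← raise_add_lower (J := J) B] at this
    have h4 : dbr Z (raise c J A + lower c J A) (raise c J B + lower c J B) =
        dbr Z (raise c J A) (raise c J B) + dbr Z (raise c J A) (lower c J B) +
        dbr Z (lower c J A) (raise c J B) + dbr Z (lower c J A) (lower c J B) := by
      unfold dbr; noncomm_ring
    rw [h4, hr, hl, hrl, hlr] at this
    simpa using this
  -- All double brackets vanish, so each anticommutator `{Z, A}` commutes with the Clifford action
  -- and is a scalar by Schur's lemma.
  have hx : ∀ A, ∃ z : ℂ, Z * c A + c A * Z = z • 1 := fun A =>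
    hc.schur fun B => sub_eq_zero.1 (hcc A B)
  choose x hx using hx
  -- `W` is the Clifford element with the same anticommutators `{W, A} = {Z, A}`. The difference `Z
  -- - W` is odd and anticommutes with everything, so it vanishes.
  set W : Module.End ℂ S := ∑ k, (x (0, ε k) • c (e k, 0) + x (e k, 0) • c (0, ε k)) with hW
  have hWZ : Z - W = 0 := by
    refine hc.eq_zero_of_odd hP hP2 (fun A => ?_) ?_
    · have e1 : Z * c A + c A * Z = ∑ k, ((((A.2 (e k) : ℝ) : ℂ)) • x (0, ε k) • 1 +
          (((ε k A.1 : ℝ) : ℂ)) • x (e k, 0) • (1 : Module.End ℂ S)) := by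
        conv_lhs => rw [← h.expand A]
        simp only [map_sum, map_add, c_real_smul, Finset.mul_sum, Finset.sum_mul,
          ← Finset.sum_add_distrib, ← hx]
        refine Finset.sum_congr rfl fun k _ => ?_
        simp only [mul_add, add_mul, mul_smul_comm, smul_mul_assoc, smul_add]
        abel
      have e2 : W * c A + c A * W = ∑ k, ((((A.2 (e k) : ℝ) : ℂ)) • x (0, ε k) • 1 +
          (((ε k A.1 : ℝ) : ℂ)) • x (e k, 0) • (1 : Module.End ℂ S)) := by
        rw [hW, Finset.mul_sum, Finset.sum_mul, ← Finset.sum_add_distrib]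
        refine Finset.sum_congr rfl fun k _ => ?_
        have r1 := hc.rel (e k, 0) A
        have r2 := hc.rel (0, ε k) A
        have p1 : 2 * pairing ((e k, 0) : Gen V) A = A.2 (e k) := by simp [pairing]
        have p2 : 2 * pairing ((0, ε k) : Gen V) A = ε k A.1 := by simp [pairing]
        rw [p1] at r1
        rw [p2] at r2
        rw [smul_comm _ (x (0, ε k)), smul_comm _ (x (e k, 0)), ← r1, ← r2]
        simp only [mul_add, add_mul, mul_smul_comm, smul_mul_assoc, smul_add]
        abel
      rw [sub_mul, mul_sub, eq_neg_iff_add_eq_zero]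
      have : Z * c A - W * c A + (c A * Z - c A * W) =
        (Z * c A + c A * Z) - (W * c A + c A * W) := by abel
      rw [this, e1, e2, sub_self]
    · rw [sub_mul, mul_sub, hZP, hW, Finset.sum_mul, Finset.mul_sum, neg_sub', sub_right_inj,
        ← Finset.sum_neg_distrib]
      refine Finset.sum_congr rfl fun k _ => ?_
      simp only [mul_add, add_mul, mul_smul_comm, smul_mul_assoc, hP]
      module
  -- `adSq N` kills Clifford elements, since `[N, [N, A]] = J (J A) = -A`.
  rw [sub_eq_zero.1 hWZ, hW, adSq_sum]
  refine Finset.sum_eq_zero fun k _ => ?_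
  rw [adSq_add, adSq_smul, adSq_smul, hN.adSq_c hJ2, hN.adSq_c hJ2]; simp

/-! ### The star operator as a function of the bidegree -/

/-- The operator acting on vectors of bidegree `(p, q)` as `f (p + q)`. -/
def degOp (d : ℕ) (N₁ N₂ : Module.End ℂ S) (f : ℤ → ℂ) : Module.End ℂ S :=
  ∑ p ∈ Finset.Icc (-d : ℤ) d, ∑ q ∈ Finset.Icc (-d : ℤ) d, f (p + q) • biproj d N₁ N₂ p q

lemma IsBigrading.degOp_apply (h : IsBigrading d N₁ N₂) (f : ℤ → ℂ) {p q : ℤ} {v : S}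
    (hv : v ∈ bispace N₁ N₂ p q) : degOp d N₁ N₂ f v = f (p + q) • v := by
  simp only [degOp, LinearMap.sum_apply, LinearMap.smul_apply]
  by_cases hpq : p ∈ Finset.Icc (-d : ℤ) d ∧ q ∈ Finset.Icc (-d : ℤ) d
  · rw [Finset.sum_eq_single_of_mem p hpq.1, Finset.sum_eq_single_of_mem q hpq.2,
      h.biproj_self hv]
    · intro q' _ hq'
      rw [h.biproj_ne hv fun he => hq' (Prod.ext_iff.1 he).2.symm, smul_zero]
    · intro p' _ hp'
      refine Finset.sum_eq_zero fun q' _ => ?_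
      rw [h.biproj_ne hv fun he => hp' (Prod.ext_iff.1 he).1.symm, smul_zero]
  · have : v = 0 := by rw [← h.biproj_self hv, h.biproj_eq_zero hpq]; rfl
    simp [this]

/-- The operator acting on vectors of bidegree `(p, q)` as `i^(p + q)`. -/
def starOp (d : ℕ) (N₁ N₂ : Module.End ℂ S) : Module.End ℂ S :=
  degOp d N₁ N₂ fun k => Complex.I ^ k

/-- The operator acting on vectors of bidegree `(p, q)` as `i^(-(p + q))`. -/
def starInv (d : ℕ) (N₁ N₂ : Module.End ℂ S) : Module.End ℂ S :=
  degOp d N₁ N₂ fun k => Complex.I ^ (-k)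

lemma IsBigrading.starOp_mul_starInv (h : IsBigrading d N₁ N₂) :
    starOp d N₁ N₂ * starInv d N₁ N₂ = 1 := h.ext fun p q v hv => by
  rw [Module.End.mul_apply, starInv, h.degOp_apply _ hv, map_smul, starOp, h.degOp_apply _ hv,
    smul_smul, ← zpow_add₀ Complex.I_ne_zero]
  simp

lemma IsBigrading.starInv_mul_starOp (h : IsBigrading d N₁ N₂) :
    starInv d N₁ N₂ * starOp d N₁ N₂ = 1 := h.ext fun p q v hv => by
  rw [Module.End.mul_apply, starOp, h.degOp_apply _ hv, map_smul, starInv, h.degOp_apply _ hv,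
    smul_smul, ← zpow_add₀ Complex.I_ne_zero]
  simp

lemma IsBigrading.starOp_mul (h : IsBigrading d N₁ N₂) {r s : ℤ} {T : Module.End ℂ S}
    (hT : HasBidegree N₁ N₂ r s T) :
    starOp d N₁ N₂ * T = Complex.I ^ (r + s) • (T * starOp d N₁ N₂) := h.ext fun p q v hv => by
  rw [LinearMap.smul_apply, Module.End.mul_apply, Module.End.mul_apply, starOp,
    h.degOp_apply _ hv, h.degOp_apply _ (hT p q v hv), map_smul, smul_smul,
    ← zpow_add₀ Complex.I_ne_zero]
  congr 2
  ring

/-- On `C₊` the two structures agree and their raising elements coincide. On `C₋` they are opposite,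
so what raises the first degree lowers the second. -/
lemma hasBidegree_raise_plus (h₁ : IsSpinOf c J₁ N₁) (h₂ : IsSpinOf c J₂ N₂)
    (hJ₁ : ∀ A, J₁ (J₁ A) = -A) (hJ₂ : ∀ A, J₂ (J₂ A) = -A) {A : Gen V} (hA : J₁ A = J₂ A) :
    HasBidegree N₁ N₂ 1 1 (raise c J₁ A) := fun p q v hv => by
  refine ⟨raise_mem h₁ hJ₁ A hv.1, ?_⟩
  have : raise c J₁ A = raise c J₂ A := by rw [raise, raise, hA]
  rw [this]
  exact raise_mem h₂ hJ₂ A hv.2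

lemma hasBidegree_lower_plus (h₁ : IsSpinOf c J₁ N₁) (h₂ : IsSpinOf c J₂ N₂)
    (hJ₁ : ∀ A, J₁ (J₁ A) = -A) (hJ₂ : ∀ A, J₂ (J₂ A) = -A) {A : Gen V} (hA : J₁ A = J₂ A) :
    HasBidegree N₁ N₂ (-1) (-1) (lower c J₁ A) := fun p q v hv => by
  refine ⟨lower_mem h₁ hJ₁ A hv.1, ?_⟩
  have : lower c J₁ A = lower c J₂ A := by rw [lower, lower, hA]
  rw [this]
  exact lower_mem h₂ hJ₂ A hv.2

lemma hasBidegree_raise_minus (h₁ : IsSpinOf c J₁ N₁) (h₂ : IsSpinOf c J₂ N₂)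
    (hJ₁ : ∀ A, J₁ (J₁ A) = -A) (hJ₂ : ∀ A, J₂ (J₂ A) = -A) {A : Gen V} (hA : J₂ A = -J₁ A) :
    HasBidegree N₁ N₂ 1 (-1) (raise c J₁ A) := fun p q v hv => by
  refine ⟨raise_mem h₁ hJ₁ A hv.1, ?_⟩
  have : raise c J₁ A = lower c J₂ A := by rw [raise, lower, hA, map_neg]; module
  rw [this]
  exact lower_mem h₂ hJ₂ A hv.2

lemma hasBidegree_lower_minus (h₁ : IsSpinOf c J₁ N₁) (h₂ : IsSpinOf c J₂ N₂)
    (hJ₁ : ∀ A, J₁ (J₁ A) = -A) (hJ₂ : ∀ A, J₂ (J₂ A) = -A) {A : Gen V} (hA : J₂ A = -J₁ A) :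
    HasBidegree N₁ N₂ (-1) 1 (lower c J₁ A) := fun p q v hv => by
  refine ⟨lower_mem h₁ hJ₁ A hv.1, ?_⟩
  have : lower c J₁ A = raise c J₂ A := by rw [raise, lower, hA, map_neg]; module
  rw [this]
  exact raise_mem h₂ hJ₂ A hv.2

/-- The two halves of an element of `C₊` have bidegrees `(1, 1)` and `(-1, -1)`, and passing them
costs `i^(±2) = -1`. For `C₋` the total degree is `0` and the factor is `1`. -/
lemma IsBigrading.starOp_plus (h : IsBigrading d N₁ N₂) (h₁ : IsSpinOf c J₁ N₁)
    (h₂ : IsSpinOf c J₂ N₂) (hJ₁ : ∀ A, J₁ (J₁ A) = -A) (hJ₂ : ∀ A, J₂ (J₂ A) = -A) {A : Gen V}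
    (hA : J₁ A = J₂ A) : starOp d N₁ N₂ * c A = -(c A * starOp d N₁ N₂) := by
  rw [c_eq_half J₁ A, mul_smul_comm, mul_add,
    h.starOp_mul (hasBidegree_raise_plus h₁ h₂ hJ₁ hJ₂ hA),
    h.starOp_mul (hasBidegree_lower_plus h₁ h₂ hJ₁ hJ₂ hA), smul_mul_assoc, add_mul]
  have i1 : Complex.I ^ ((1 : ℤ) + 1) = -1 := by
    rw [zpow_add₀ Complex.I_ne_zero]; simp
  have i2 : Complex.I ^ ((-1 : ℤ) + -1) = -1 := by
    rw [zpow_add₀ Complex.I_ne_zero]; simp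
  rw [i1, i2]
  module

lemma IsBigrading.starOp_minus (h : IsBigrading d N₁ N₂) (h₁ : IsSpinOf c J₁ N₁)
    (h₂ : IsSpinOf c J₂ N₂) (hJ₁ : ∀ A, J₁ (J₁ A) = -A) (hJ₂ : ∀ A, J₂ (J₂ A) = -A) {A : Gen V}
    (hA : J₂ A = -J₁ A) : starOp d N₁ N₂ * c A = c A * starOp d N₁ N₂ := by
  rw [c_eq_half J₁ A, mul_smul_comm, mul_add,
    h.starOp_mul (hasBidegree_raise_minus h₁ h₂ hJ₁ hJ₂ hA),
    h.starOp_mul (hasBidegree_lower_minus h₁ h₂ hJ₁ hJ₂ hA), smul_mul_assoc, add_mul]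
  simp

/-- An endomorphism anticommuting with `C₊` and commuting with `C₋` is a multiple of `starOp`. -/
lemma IsCliffordModule.eq_smul_starOp (hc : IsCliffordModule c) (h : IsBigrading d N₁ N₂)
    (h₁ : IsSpinOf c J₁ N₁) (h₂ : IsSpinOf c J₂ N₂) (hJ₁ : ∀ A, J₁ (J₁ A) = -A)
    (hJ₂ : ∀ A, J₂ (J₂ A) = -A) (hJ : ∀ A, J₁ (J₂ A) = J₂ (J₁ A)) {s : Module.End ℂ S}
    (hp : ∀ A, J₁ A = J₂ A → s * c A = -(c A * s))
    (hm : ∀ A, J₂ A = -J₁ A → s * c A = c A * s) :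
    ∃ z : ℂ, s = z • starOp d N₁ N₂ := by
  set R := starOp d N₁ N₂
  set R' := starInv d N₁ N₂
  have hRR' : R * R' = 1 := h.starOp_mul_starInv
  have hR'R : R' * R = 1 := h.starInv_mul_starOp
  -- Both `s` and `R` anticommute with `C₊` and commute with `C₋`, so the signs cancel in `s R⁻¹`,
  -- to which Schur's lemma applies.
  have key : ∀ A, (s * R') * c A = c A * (s * R') := by
    have hplus : ∀ A, J₁ A = J₂ A → (s * R') * c A = c A * (s * R') := fun A hA => by
      have e1 := h.starOp_plus h₁ h₂ hJ₁ hJ₂ hA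
      have e2 := hp A hA
      have e3 : R' * c A = -(c A * R') := by
        calc R' * c A = R' * (c A * (R * R')) := by rw [hRR', mul_one]
          _ = -(R' * (-(c A * R)) * R') := by noncomm_ring
          _ = -(R' * (R * c A) * R') := by rw [e1]
          _ = -((R' * R) * c A * R') := by noncomm_ring
          _ = -(c A * R') := by rw [hR'R, one_mul]
      rw [mul_assoc, e3, mul_neg, ← mul_assoc, e2]; noncomm_ring
    have hminus : ∀ A, J₂ A = -J₁ A → (s * R') * c A = c A * (s * R') := fun A hA => by
      have e1 := h.starOp_minus h₁ h₂ hJ₁ hJ₂ hA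
      have e2 := hm A hA
      have e3 : R' * c A = c A * R' := by
        calc R' * c A = R' * (c A * (R * R')) := by rw [hRR', mul_one]
          _ = R' * (c A * R) * R' := by noncomm_ring
          _ = R' * (R * c A) * R' := by rw [e1]
          _ = (R' * R) * c A * R' := by noncomm_ring
          _ = c A * R' := by rw [hR'R, one_mul]
      rw [mul_assoc, e3, ← mul_assoc, e2, mul_assoc]
    intro A
    -- With `G = -J₁ J₂` these are the projections `(A ± G A) / 2` to `C₊` and `C₋`.
    have hA : A = (1 / 2 : ℝ) • ((A - J₁ (J₂ A)) + (A + J₁ (J₂ A))) := by module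
    have a1 : J₁ (A - J₁ (J₂ A)) = J₂ (A - J₁ (J₂ A)) := by
      rw [map_sub, map_sub, hJ₁, hJ A, hJ₂]; abel
    have a2 : J₂ (A + J₁ (J₂ A)) = -J₁ (A + J₁ (J₂ A)) := by
      rw [map_add, map_add, hJ₁, hJ A, hJ₂]; abel
    rw [hA, c_real_smul, map_add, mul_smul_comm, smul_mul_assoc, mul_add, hplus _ a1,
      hminus _ a2, add_mul]
  obtain ⟨z, hz⟩ := hc.schur key
  refine ⟨z, ?_⟩
  calc s = s * (R' * R) := by rw [hR'R, mul_one]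
    _ = z • R := by rw [← mul_assoc, hz, smul_mul_assoc, one_mul]

end Module

lemma spinEnd_semiconj {V : Type*} [AddCommGroup V] [Module ℝ V] [TopologicalSpace V] {d : ℕ}
    {S : Type*} [AddCommGroup S] [Module ℂ S] (c : Gen V →ₗ[ℝ] Module.End ℂ S)
    (e : Fin d → V) (ε : Fin d → V →L[ℝ] ℝ) (J : Gen V →ₗ[ℝ] Gen V) (f : S →+ S)
    (hf : ∀ (z : ℂ) v, f (z • v) = (starRingEnd ℂ) z • f v) (hc : ∀ A v, f (c A v) = c A (f v))
    (v : S) : f (spinEnd c e ε J v) = spinEnd c e ε J (f v) := by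
  rw [spinEnd_eq, LinearMap.smul_apply, LinearMap.smul_apply, hf, LinearMap.sum_apply,
    LinearMap.sum_apply, map_sum]
  congr 1
  · rw [map_div₀, map_one, map_ofNat]
  · refine Finset.sum_congr rfl fun k _ => ?_
    simp only [LinearMap.add_apply, Module.End.mul_apply, map_add, hc]

/-! ### Exterior forms as an irreducible Clifford module -/

section SpinorModule

variable {V : Type*} [AddCommGroup V] [Module ℝ V] [TopologicalSpace V] {d : ℕ}
  {e : Fin d → V} {ε : Fin d → V →L[ℝ] ℝ}

/-- The basis given by a frame with a dual frame. -/
def IsDualFrame.basis (h : IsDualFrame e ε) : Module.Basis (Fin d) ℝ V :=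
  Module.Basis.mk (v := e)
    (by
      rw [Fintype.linearIndependent_iff]
      intro g hg i
      have := congrArg (ε i) hg
      simpa [h.dual] using this)
    (by
      intro v _
      rw [← h.span v]
      exact Submodule.sum_mem _ fun i _ =>
        Submodule.smul_mem _ _ (Submodule.subset_span ⟨i, rfl⟩))

lemma IsDualFrame.basis_apply (h : IsDualFrame e ε) (i : Fin d) : h.basis i = e i := by
  simp [IsDualFrame.basis]

lemma IsDualFrame.form_ext (h : IsDualFrame e ε) {k : ℕ} {η η' : V [⋀^Fin k]→L[ℝ] ℂ}
    (hη : ∀ I : Fin k → Fin d, η (e ∘ I) = η' (e ∘ I)) : η = η' := by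
  apply ContinuousAlternatingMap.toAlternatingMap_injective
  refine Module.Basis.ext_alternating h.basis fun I _ => ?_
  have : (fun i => h.basis (I i)) = e ∘ I := funext fun i => h.basis_apply _
  rw [this]
  exact hη I

lemma IsDualFrame.form_eq_zero (h : IsDualFrame e ε) {k : ℕ} (hk : d < k)
    (η : V [⋀^Fin k]→L[ℝ] ℂ) : η = 0 := by
  refine h.form_ext fun I => ?_
  have hI : ¬ Function.Injective I := fun hI => by
    have := Fintype.card_le_of_injective I hI
    simp at this
    omega
  simp only [Function.Injective, not_forall] at hI
  obtain ⟨i, j, hij, hne⟩ := hI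
  rw [η.map_eq_zero_of_eq (e ∘ I) (by simp [hij]) hne]
  rfl

lemma homog_same (k : ℕ) (η : V [⋀^Fin k]→L[ℝ] ℂ) : homog k η k = η := by simp [homog]

lemma homog_ne {k m : ℕ} (hkm : m ≠ k) (η : V [⋀^Fin k]→L[ℝ] ℂ) : homog k η m = 0 := by
  simp [homog, hkm]

lemma IsDualFrame.sum_homog (h : IsDualFrame e ε) (ρ : Spinor V) :
    ∑ k ∈ Finset.range (d + 1), homog k (ρ k) = ρ := by
  funext m
  rw [Finset.sum_apply]
  by_cases hm : m ∈ Finset.range (d + 1)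
  · rw [Finset.sum_eq_single_of_mem m hm fun k _ hk => homog_ne hk.symm _, homog_same]
  · rw [Finset.sum_eq_zero fun k hk => homog_ne (fun e' : m = k => hm (e'.symm ▸ hk)) _,
      h.form_eq_zero (by simpa using hm) (ρ m)]

lemma IsDualFrame.finiteDimensional (h : IsDualFrame e ε) : FiniteDimensional ℂ (Spinor V) := by
  let f : Spinor V →ₗ[ℂ] (∀ k : Fin (d + 1), (Fin k → Fin d) → ℂ) :=
    { toFun := fun ρ k I => ρ k (e ∘ I)
      map_add' := fun _ _ => rfl
      map_smul' := fun _ _ => rfl }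
  refine FiniteDimensional.of_injective f fun ρ τ hρ => ?_
  rw [← h.sum_homog ρ, ← h.sum_homog τ]
  refine Finset.sum_congr rfl fun k hk => ?_
  congr 1
  exact h.form_ext fun I =>
    congrFun (congrFun hρ ⟨k, Finset.mem_range.1 hk⟩) I

/-- Euler's identity. -/
lemma IsDualFrame.euler (h : IsDualFrame e ε) (ρ : Spinor V) (k : ℕ) :
    (∑ j, cl (0, ε j) (cl (e j, 0) ρ)) k = (k : ℂ) • ρ k := by
  rw [Finset.sum_apply]
  rcases k with _ | k
  · simp only [cl_covector_zero]
    ext v; simp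
  · ext v
    rw [ContinuousAlternatingMap.sum_apply]
    simp only [cl_covector_succ, cl_vector_apply]
    rw [Finset.sum_comm]
    have : ∀ i : Fin (k + 1), ∑ j, (-1 : ℂ) ^ (i : ℕ) *
        ((ε j (v i) : ℂ) * ρ (k + 1) (Fin.cons (e j) (i.removeNth v))) = ρ (k + 1) v := fun i => by
      rw [← Finset.mul_sum]
      simp only [← form_cons_smul]
      have hl : ∑ j, ρ (k + 1) (Fin.cons (ε j (v i) • e j) (i.removeNth v)) =
          ρ (k + 1) (Fin.cons (v i) (i.removeNth v)) := by
        conv_rhs => rw [← h.span (v i)]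
        let f : V →+ ℂ :=
          { toFun := fun X => ρ (k + 1) (Fin.cons X (i.removeNth v))
            map_zero' := by simpa using form_cons_smul (ρ (k + 1)) 0 (0 : V) (i.removeNth v)
            map_add' := fun X Y => form_cons_add (ρ (k + 1)) X Y (i.removeNth v) }
        exact (map_sum f (fun j => ε j (v i) • e j) Finset.univ).symm
      rw [hl]
      have h3 := (ρ (k + 1)).toAlternatingMap.neg_one_pow_smul_map_insertNth i (v i)
        (i.removeNth v)
      rw [Fin.insertNth_self_removeNth] at h3
      simp only [ContinuousAlternatingMap.coe_toAlternatingMap] at h3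
      have h4 : ρ (k + 1) (Fin.cons (v i) (i.removeNth v)) = (-1 : ℂ) ^ (i : ℕ) * ρ (k + 1) v := by
        rw [Matrix.vecCons] at h3
        rw [← h3]
        simp
      rw [h4, ← mul_assoc, ← mul_pow]
      simp
    simp only [this]
    simp

/-- The form `1` of degree zero. -/
def unitForm (V : Type*) [AddCommGroup V] [Module ℝ V] [TopologicalSpace V] : Spinor V :=
  homog 0 (ContinuousAlternatingMap.constOfIsEmpty ℝ V (Fin 0) (1 : ℂ))

lemma homog_zero_eq (η : V [⋀^Fin 0]→L[ℝ] ℂ) : homog 0 η = η ![] • unitForm V := by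
  refine Spinor.ext fun k v => ?_
  rcases k with _ | k
  · rw [homog_same, Pi.smul_apply, ContinuousAlternatingMap.smul_apply, unitForm, homog_same,
      Subsingleton.elim v ![]]
    simp
  · rw [homog_ne (by omega), Pi.smul_apply, unitForm, homog_ne (by omega)]
    simp

lemma cl_vector_homog (X : V) {k : ℕ} (η : V [⋀^Fin (k + 1)]→L[ℝ] ℂ) :
    cl (X, 0) (homog (k + 1) η) = homog k (contraction X η) := by
  refine Spinor.ext fun m v => ?_
  rw [cl_vector_apply]
  by_cases hm : m = k
  · subst hm; rw [homog_same, homog_same, contraction_apply]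
  · rw [homog_ne (by omega), homog_ne hm]; rfl

/-- As long as the top component has positive degree, some contraction of it is nonzero. Repeated
contraction thus brings a nonzero element of `W` down to a nonzero constant. -/
lemma unitForm_mem_of_ne_zero {W : Submodule ℂ (Spinor V)} (hW : ∀ A, ∀ w ∈ W, cl A w ∈ W)
    (m : ℕ) : ∀ w ∈ W, w ≠ 0 → (∀ k, m < k → w k = 0) → unitForm V ∈ W := by
  induction m with
  | zero =>
    intro w hw h0 hk
    have h1 : w = w 0 ![] • unitForm V := by
      rw [← homog_zero_eq]
      funext k
      rcases k with _ | k
      · rw [homog_same]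
      · rw [homog_ne (by omega), hk _ (by omega)]
    have h2 : w 0 ![] ≠ 0 := fun h2 => h0 (by rw [h1, h2]; exact zero_smul ℂ (unitForm V))
    have h3 : unitForm V = (w 0 ![])⁻¹ • w := by
      conv_rhs => arg 2; rw [h1]
      rw [smul_smul, inv_mul_cancel₀ h2, one_smul]
    rw [h3]
    exact W.smul_mem _ hw
  | succ m ih =>
    intro w hw h0 hk
    by_cases hm : w (m + 1) = 0
    · refine ih w hw h0 fun k hk' => ?_
      rcases Nat.lt_or_ge (m + 1) k with h | h
      · exact hk k h
      · obtain rfl : k = m + 1 := by omega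
        exact hm
    · have : ∃ X v, w (m + 1) (Fin.cons X v) ≠ 0 := by
        by_contra hcon
        push Not at hcon
        exact hm (form_eq_zero_of_contraction hcon)
      obtain ⟨X, v, hXv⟩ := this
      refine ih (cl (X, 0) w) (hW _ w hw) (fun h => hXv ?_) fun k hk' => ?_
      · rw [← cl_vector_apply, h]; rfl
      · ext u
        rw [cl_vector_apply, hk _ (by omega)]
        rfl

/-- By Euler's identity a form of degree `k + 1` is `1 / (k + 1)` times the sum of the `ε_j ∧
i_{e_j} η`, and each contraction has degree `k`. -/
lemma IsDualFrame.homog_mem (h : IsDualFrame e ε) {W : Submodule ℂ (Spinor V)}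
    (hW : ∀ ξ, ∀ w ∈ W, cl (0, ξ) w ∈ W) (h1 : unitForm V ∈ W) (k : ℕ) :
    ∀ η : V [⋀^Fin k]→L[ℝ] ℂ, homog k η ∈ W := by
  induction k with
  | zero => intro η; rw [homog_zero_eq]; exact W.smul_mem _ h1
  | succ k ih =>
    intro η
    have hk : ((k + 1 : ℕ) : ℂ) ≠ 0 := by exact_mod_cast Nat.succ_ne_zero k
    have h2 : homog (k + 1) η = ((k + 1 : ℕ) : ℂ)⁻¹ •
        ∑ j, cl (0, ε j) (cl (e j, 0) (homog (k + 1) η)) := by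
      funext m
      rw [Pi.smul_apply, h.euler]
      by_cases hm : m = k + 1
      · subst hm; rw [homog_same, smul_smul, inv_mul_cancel₀ hk, one_smul]
      · rw [homog_ne hm]; ext v; simp
    rw [h2]
    refine W.smul_mem _ (W.sum_mem fun j _ => hW _ _ ?_)
    rw [cl_vector_homog]
    exact ih _

lemma IsDualFrame.isCliffordModule (h : IsDualFrame e ε) :
    IsCliffordModule (cl : Gen V →ₗ[ℝ] Module.End ℂ (Spinor V)) where
  rel := cl_mul_add
  irreducible W hW := by
    by_cases h0 : W = ⊥
    · exact Or.inl h0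
    · obtain ⟨w, hw, hw0⟩ := (Submodule.ne_bot_iff W).1 h0
      have h1 := unitForm_mem_of_ne_zero hW d w hw hw0 fun k hk => h.form_eq_zero hk _
      refine Or.inr (Submodule.eq_top_iff'.2 fun ρ => ?_)
      rw [← h.sum_homog ρ]
      exact W.sum_mem fun k _ => h.homog_mem (fun ξ => hW (0, ξ)) h1 k _
  finite := h.finiteDimensional
  nontrivial := ⟨⟨unitForm V, 0, fun h0 => by
    have h1 : unitForm V 0 ![] = 0 := by rw [h0]; rfl
    rw [unitForm, homog_same] at h1
    exact one_ne_zero (α := ℂ) h1⟩⟩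

/-! ### Parity, conjugation, reversal -/

/-- The operator multiplying forms of degree `k` by `(-1)^k`. -/
def parity : Module.End ℂ (Spinor V) where
  toFun ρ := fun k => (-1 : ℂ) ^ k • ρ k
  map_add' ρ τ := by funext k; simp
  map_smul' z ρ := by funext k; exact smul_comm ((-1 : ℂ) ^ k) z (ρ k)

lemma parity_apply (ρ : Spinor V) (k : ℕ) : parity ρ k = (-1 : ℂ) ^ k • ρ k := rfl

lemma parity_mul_self : (parity : Module.End ℂ (Spinor V)) * parity = 1 := by
  refine LinearMap.ext fun ρ => funext fun k => ?_
  rw [Module.End.mul_apply, parity_apply, parity_apply, smul_smul, ← mul_pow]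
  simp

lemma parity_cl (A : Gen V) : parity * cl A = -(cl A * parity) := by
  have h1 : ∀ (X : V) (ρ : Spinor V), parity (cl (X, 0) ρ) = -cl (X, 0) (parity ρ) := fun X ρ => by
    refine Spinor.ext fun k v => ?_
    rw [parity_apply, Pi.neg_apply, ContinuousAlternatingMap.neg_apply, cl_vector_apply,
      ContinuousAlternatingMap.smul_apply, cl_vector_apply, parity_apply,
      ContinuousAlternatingMap.smul_apply, pow_succ]
    simp
  have h2 : ∀ (ξ : V →L[ℝ] ℝ) (ρ : Spinor V), parity (cl (0, ξ) ρ) = -cl (0, ξ) (parity ρ) :=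
    fun ξ ρ => by
      refine Spinor.ext fun k v => ?_
      rcases k with _ | k
      · simp [parity_apply, cl_covector_zero]
      · rw [parity_apply, Pi.neg_apply, ContinuousAlternatingMap.neg_apply,
          ContinuousAlternatingMap.smul_apply, cl_covector_succ, cl_covector_succ, pow_succ,
          smul_eq_mul, Finset.mul_sum, ← Finset.sum_neg_distrib]
        refine Finset.sum_congr rfl fun i _ => ?_
        rw [parity_apply, ContinuousAlternatingMap.smul_apply, smul_eq_mul]
        ring
  refine LinearMap.ext fun ρ => ?_
  rw [cl_split A]
  simp only [Module.End.mul_apply, LinearMap.add_apply, LinearMap.neg_apply, map_add, h1, h2]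
  abel

lemma conjForm_apply (ρ : Spinor V) (k : ℕ) (v : Fin k → V) :
    conjForm ρ k v = (starRingEnd ℂ) (ρ k v) := rfl

lemma conjForm_conjForm (ρ : Spinor V) : conjForm (conjForm ρ) = ρ :=
  Spinor.ext fun k v => by simp [conjForm_apply]

lemma conjForm_add (ρ τ : Spinor V) : conjForm (ρ + τ) = conjForm ρ + conjForm τ :=
  Spinor.ext fun k v => by simp [conjForm_apply]

lemma conjForm_smul (z : ℂ) (ρ : Spinor V) :
    conjForm (z • ρ) = (starRingEnd ℂ) z • conjForm ρ :=
  Spinor.ext fun k v => by simp [conjForm_apply]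

lemma conjForm_zero : conjForm (0 : Spinor V) = 0 :=
  Spinor.ext fun k v => by simp [conjForm_apply]

lemma conjForm_cl (A : Gen V) (ρ : Spinor V) : conjForm (cl A ρ) = cl A (conjForm ρ) := by
  rw [cl_split A, LinearMap.add_apply, LinearMap.add_apply, conjForm_add]
  congr 1
  · exact Spinor.ext fun k v => by rw [conjForm_apply, cl_vector_apply, cl_vector_apply]; rfl
  · refine Spinor.ext fun k v => ?_
    rcases k with _ | k
    · simp [cl_covector_zero, conjForm_apply]
    · rw [conjForm_apply, cl_covector_succ, cl_covector_succ]
      simp [conjForm_apply]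

/-- Complex conjugation as an additive map. -/
def conjHom (V : Type*) [AddCommGroup V] [Module ℝ V] [TopologicalSpace V] :
    Spinor V →+ Spinor V where
  toFun := conjForm
  map_zero' := conjForm_zero
  map_add' := conjForm_add

lemma conjForm_spinEnd (J : Gen V →ₗ[ℝ] Gen V) (ρ : Spinor V) :
    conjForm (spinEnd cl e ε J ρ) = spinEnd cl e ε J (conjForm ρ) :=
  spinEnd_semiconj cl e ε J (conjHom V) conjForm_smul conjForm_cl ρ

end SpinorModule

/-! ### The exterior algebra, and the Mukai pairing in even dimension -/

section Wedge

variable {V : Type*} [AddCommGroup V] [Module ℝ V] [TopologicalSpace V] {d : ℕ}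
  {e : Fin d → V} {ε : Fin d → V →L[ℝ] ℝ}

/-- Forms are generated from `1` by exterior multiplication with covectors. -/
lemma IsDualFrame.covector_induction (h : IsDualFrame e ε) {p : Spinor V → Prop}
    (one : p (unitForm V)) (add : ∀ α β, p α → p β → p (α + β))
    (smul : ∀ (z : ℂ) α, p α → p (z • α))
    (cov : ∀ ξ α, p α → p (wedge (covector ξ) α)) (α : Spinor V) : p α := by
  let W : Submodule ℂ (Spinor V) :=
    { carrier := {α | p α}
      zero_mem' := by
        have := smul 0 _ one
        rwa [zero_smul ℂ (unitForm V)] at this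
      add_mem' := fun ha hb => add _ _ ha hb
      smul_mem' := fun z _ ha => smul z _ ha }
  have : α ∈ W := by
    rw [← h.sum_homog α]
    refine W.sum_mem fun k _ => h.homog_mem (W := W) (fun ξ w hw => ?_) one k _
    rw [cl_covector]
    exact cov ξ w hw
  exact this

lemma wedge_add_left (α β γ : Spinor V) : wedge (α + β) γ = wedge α γ + wedge β γ :=
  LinearMap.map_add₂ wedgeLin α β γ

lemma wedge_smul_left (z : ℂ) (α γ : Spinor V) : wedge (z • α) γ = z • wedge α γ :=
  LinearMap.map_smul₂ wedgeLin z α γ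

lemma wedge_add_right (α β γ : Spinor V) : wedge α (β + γ) = wedge α β + wedge α γ :=
  map_add (wedgeLin α) β γ

lemma wedge_smul_right (z : ℂ) (α γ : Spinor V) : wedge α (z • γ) = z • wedge α γ :=
  map_smul (wedgeLin α) z γ

lemma wedge_neg_left (α γ : Spinor V) : wedge (-α) γ = -wedge α γ :=
  LinearMap.map_neg₂ wedgeLin α γ

lemma wedge_neg_right (α γ : Spinor V) : wedge α (-γ) = -wedge α γ :=
  map_neg (wedgeLin α) γ

lemma unit_wedge (β : Spinor V) : wedge (unitForm V) β = β := by
  refine Spinor.ext fun k v => ?_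
  rw [wedge_apply, Finset.sum_eq_single_of_mem (0 : Fin (k + 1)) (Finset.mem_univ _)]
  · have key : ∀ (m : ℕ) (hm : 0 + m = k), castDegree hm (wedgeHom (unitForm V 0) (β m)) v =
        β k v := by
      intro m hm
      obtain rfl : m = k := by omega
      rw [castDegree_apply, wedgeHom_apply]
      have h1 : altSum (fnTensor (unitForm V 0) (β m)) (v ∘ Fin.cast hm) =
          altSum (β m) v := by
        have hm' : (Fin.natAdd 0 : Fin m → Fin (0 + m)) = Fin.cast hm.symm := by
          ext i; simp
        have h2 : (fnTensor (unitForm V 0) (β m)) = fun w => (β m) (w ∘ Fin.cast hm.symm) := by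
          funext w
          rw [fnTensor, unitForm, homog_same, hm']
          simp
        rw [h2, ← altSum_cast hm.symm]
        rfl
      rw [h1, altSum_alternating]
      have : (m.factorial : ℂ) ≠ 0 := by exact_mod_cast m.factorial_ne_zero
      push_cast
      field_simp
      simp
    exact key _ _
  · intro a _ ha
    have ha' : (a : ℕ) ≠ 0 := fun h => ha (Fin.ext h)
    rw [unitForm, homog_ne ha', wedgeHom_zero_left]
    rfl

lemma parity_unit : parity (unitForm V) = unitForm V := by
  refine Spinor.ext fun k v => ?_
  rw [parity_apply]
  rcases k with _ | k
  · simp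
  · rw [unitForm, homog_ne (by omega)]; simp

lemma parity_covector_wedge (ξ : V →L[ℝ] ℝ) (α : Spinor V) :
    parity (wedge (covector ξ) α) = -wedge (covector ξ) (parity α) := by
  rw [← cl_covector, ← cl_covector]
  exact LinearMap.congr_fun (parity_cl (0, ξ)) α

lemma covector_wedge_comm (ξ η : V →L[ℝ] ℝ) (α : Spinor V) :
    wedge (covector ξ) (wedge (covector η) α) = -wedge (covector η) (wedge (covector ξ) α) := by
  have := cl_covector_covector ξ η α
  simp only [cl_covector] at this
  exact eq_neg_of_add_eq_zero_left this

lemma IsDualFrame.wedge_covector_wedge (h : IsDualFrame e ε) (ξ : V →L[ℝ] ℝ) (α γ : Spinor V) :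
    wedge α (wedge (covector ξ) γ) = wedge (covector ξ) (wedge (parity α) γ) := by
  induction α using h.covector_induction with
  | one => rw [parity_unit, unit_wedge, unit_wedge]
  | add α β ha hb => rw [wedge_add_left, ha, hb, map_add, wedge_add_left, wedge_add_right]
  | smul z α ha => rw [wedge_smul_left, ha, map_smul, wedge_smul_left, wedge_smul_right]
  | cov η α ha =>
    rw [← covector_wedge_assoc, ha, covector_wedge_comm, parity_covector_wedge, wedge_neg_left,
      wedge_neg_right, ← covector_wedge_assoc]

lemma IsDualFrame.wedge_assoc (h : IsDualFrame e ε) (α β γ : Spinor V) :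
    wedge α (wedge β γ) = wedge (wedge α β) γ := by
  induction α using h.covector_induction with
  | one => rw [unit_wedge, unit_wedge]
  | add α β ha hb => rw [wedge_add_left, ha, hb, wedge_add_left, wedge_add_left]
  | smul z α ha => rw [wedge_smul_left, ha, wedge_smul_left, wedge_smul_left]
  | cov η α ha =>
    rw [← covector_wedge_assoc, ha, covector_wedge_assoc, covector_wedge_assoc]

lemma IsDualFrame.parity_wedge (h : IsDualFrame e ε) (α β : Spinor V) :
    parity (wedge α β) = wedge (parity α) (parity β) := by
  induction α using h.covector_induction with
  | one => rw [parity_unit, unit_wedge, unit_wedge]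
  | add α β ha hb => rw [wedge_add_left, map_add, ha, hb, map_add, wedge_add_left]
  | smul z α ha => rw [wedge_smul_left, map_smul, ha, map_smul, wedge_smul_left]
  | cov η α ha =>
    rw [← covector_wedge_assoc, parity_covector_wedge, ha, parity_covector_wedge, wedge_neg_left,
      covector_wedge_assoc]

/-- An odd form commutes with all forms up to sign. -/
lemma IsDualFrame.wedge_odd_wedge (h : IsDualFrame e ε) {η : Spinor V} (hη : parity η = -η)
    (α γ : Spinor V) : wedge α (wedge η γ) = wedge η (wedge (parity α) γ) := by
  induction α using h.covector_induction with
  | one => rw [parity_unit, unit_wedge, unit_wedge]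
  | add α β ha hb => rw [wedge_add_left, ha, hb, map_add, wedge_add_left, wedge_add_right]
  | smul z α ha => rw [wedge_smul_left, ha, map_smul, wedge_smul_left, wedge_smul_right]
  | cov ξ α ha =>
    rw [← covector_wedge_assoc, ha, parity_covector_wedge, wedge_neg_left, wedge_neg_right,
      ← covector_wedge_assoc, h.wedge_covector_wedge ξ η, hη, wedge_neg_left, wedge_neg_right,
      neg_neg]

lemma IsDualFrame.odd_wedge_odd_wedge (h : IsDualFrame e ε) {η : Spinor V} (hη : parity η = -η)
    (γ : Spinor V) : wedge η (wedge η γ) = 0 := by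
  have h1 := h.wedge_odd_wedge hη η γ
  rw [hη, wedge_neg_left, wedge_neg_right] at h1
  have h2 : (2 : ℂ) • wedge η (wedge η γ) = 0 := by
    rw [two_smul ℂ (wedge η (wedge η γ))]
    nth_rewrite 1 [h1]
    exact neg_add_cancel _
  exact (smul_eq_zero.1 h2).resolve_left two_ne_zero

/-- The interior product is an antiderivation. -/
lemma IsDualFrame.cl_vector_wedge (h : IsDualFrame e ε) (X : V) (α β : Spinor V) :
    cl (X, 0) (wedge α β) = wedge (cl (X, 0) α) β + wedge (parity α) (cl (X, 0) β) := by
  induction α using h.covector_induction with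
  | one =>
    have : cl (X, 0) (unitForm V) = 0 := Spinor.ext fun k v => by
      rw [cl_vector_apply, unitForm, homog_ne (by omega)]; rfl
    rw [this, parity_unit, unit_wedge, unit_wedge]
    have := wedge_smul_left 0 (0 : Spinor V) β
    rw [zero_smul ℂ (0 : Spinor V), zero_smul ℂ (wedge 0 β)] at this
    rw [this, zero_add]
  | add α α' ha hb =>
    rw [wedge_add_left, map_add, ha, hb, map_add, map_add, wedge_add_left, wedge_add_left]
    abel
  | smul z α ha =>
    rw [wedge_smul_left, map_smul, ha, map_smul, map_smul, wedge_smul_left, wedge_smul_left,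
      smul_add]
  | cov ξ α ha =>
    have e1 := cl_vector_covector X ξ (wedge α β)
    have e2 := cl_vector_covector X ξ α
    rw [cl_covector, cl_covector] at e1 e2
    rw [← covector_wedge_assoc, eq_sub_of_add_eq e1, eq_sub_of_add_eq e2, ha,
      parity_covector_wedge, sub_eq_add_neg, sub_eq_add_neg, wedge_add_left, wedge_smul_left,
      wedge_neg_left, wedge_neg_left, wedge_add_right, ← covector_wedge_assoc,
      ← covector_wedge_assoc]
    abel

lemma conjForm_unit : conjForm (unitForm V) = unitForm V := by
  refine Spinor.ext fun k v => ?_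
  rw [conjForm_apply]
  rcases k with _ | k
  · rw [unitForm, homog_same]; simp
  · rw [unitForm, homog_ne (by omega)]; simp

lemma IsDualFrame.conjForm_wedge (h : IsDualFrame e ε) (α β : Spinor V) :
    conjForm (wedge α β) = wedge (conjForm α) (conjForm β) := by
  induction α using h.covector_induction with
  | one => rw [conjForm_unit, unit_wedge, unit_wedge]
  | add α β ha hb => rw [wedge_add_left, conjForm_add, ha, hb, conjForm_add, wedge_add_left]
  | smul z α ha => rw [wedge_smul_left, conjForm_smul, ha, conjForm_smul, wedge_smul_left]
  | cov η α ha =>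
    rw [← covector_wedge_assoc, ← cl_covector, conjForm_cl, ha, ← cl_covector η α, conjForm_cl,
      cl_covector, cl_covector, covector_wedge_assoc]

/-! ### The Mukai pairing -/

/-- The reversal as a linear map. -/
def reversalLin (V : Type*) [AddCommGroup V] [Module ℝ V] [TopologicalSpace V] :
    Spinor V →ₗ[ℂ] Spinor V where
  toFun := reversal
  map_add' ρ τ := by funext k; exact smul_add ((-1 : ℂ) ^ (k * (k - 1) / 2)) (ρ k) (τ k)
  map_smul' z ρ := by funext k; exact smul_comm ((-1 : ℂ) ^ (k * (k - 1) / 2)) z (ρ k)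

lemma reversal_apply (ρ : Spinor V) (k : ℕ) :
    reversal ρ k = (-1 : ℂ) ^ (k * (k - 1) / 2) • ρ k := rfl

lemma reversal_sign_succ (k : ℕ) :
    (-1 : ℂ) ^ ((k + 1) * (k + 1 - 1) / 2) = (-1 : ℂ) ^ k * (-1 : ℂ) ^ (k * (k - 1) / 2) := by
  rw [← pow_add]
  congr 1
  rcases k with _ | k
  · simp
  · simp only [Nat.add_sub_cancel]
    have : (k + 1 + 1) * (k + 1) = 2 * (k + 1) + (k + 1) * k := by ring
    rw [this, Nat.mul_add_div two_pos]

lemma reversal_covector_wedge (ξ : V →L[ℝ] ℝ) (β : Spinor V) :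
    reversal (wedge (covector ξ) β) = wedge (covector ξ) (parity (reversal β)) := by
  refine Spinor.ext fun k v => ?_
  rcases k with _ | k
  · rw [reversal_apply, covector_wedge_zero, covector_wedge_zero]; simp
  · rw [reversal_apply, ContinuousAlternatingMap.smul_apply, covector_wedge_succ,
      covector_wedge_succ, smul_eq_mul, Finset.mul_sum]
    refine Finset.sum_congr rfl fun i _ => ?_
    rw [parity_apply, reversal_apply, smul_smul, ContinuousAlternatingMap.smul_apply,
      reversal_sign_succ, smul_eq_mul]
    ring

lemma cl_vector_reversal (X : V) (β : Spinor V) :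
    cl (X, 0) (reversal β) = parity (reversal (cl (X, 0) β)) := by
  refine Spinor.ext fun k v => ?_
  rw [cl_vector_apply, parity_apply, reversal_apply, reversal_apply, smul_smul,
    ContinuousAlternatingMap.smul_apply, ContinuousAlternatingMap.smul_apply, cl_vector_apply,
    reversal_sign_succ]

lemma homog_three_odd (η : V [⋀^Fin 3]→L[ℝ] ℂ) : parity (homog 3 η) = -homog 3 η := by
  refine Spinor.ext fun k v => ?_
  rw [parity_apply, Pi.neg_apply]
  by_cases hk : k = 3
  · subst hk; simp [homog_same]; norm_num
  · rw [homog_ne hk]; simp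

/-- The Mukai pairing as a bilinear map. -/
def mukaiLin (d : ℕ) (V : Type*) [AddCommGroup V] [Module ℝ V] [TopologicalSpace V] :
    Spinor V →ₗ[ℂ] Spinor V →ₗ[ℂ] V [⋀^Fin d]→L[ℝ] ℂ :=
  (wedgeLin.compl₂ (reversalLin V)).compr₂ (LinearMap.proj d)

lemma mukaiLin_apply (d : ℕ) (α β : Spinor V) : mukaiLin d V α β = mukai d α β := rfl

lemma parity_apply_even (hd : Even d) (α : Spinor V) : parity α d = α d := by
  rw [parity_apply, hd.neg_one_pow]
  exact one_smul ℂ (α d)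

/-- Contraction is an antiderivation and kills `α ∧ σ(β)` in degree `d`, since there are no forms of
degree `d + 1`; for covectors the reversal supplies the sign. Evenness of `d` is what makes the
parity operator trivial in top degree. -/
lemma IsDualFrame.mukai_cl (h : IsDualFrame e ε) (hd : Even d) (A : Gen V) (α β : Spinor V) :
    mukai d (cl A α) β = -mukai d α (cl A β) := by
  have h1 : ∀ X : V, mukai d (cl (X, 0) α) β = -mukai d α (cl (X, 0) β) := fun X => by
    have e1 := congrFun (h.cl_vector_wedge X α (reversal β)) d
    have e2 : cl (X, 0) (wedge α (reversal β)) d = 0 := by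
      ext v
      rw [cl_vector_apply, h.form_eq_zero (Nat.lt_succ_self d) (wedge α (reversal β) (d + 1))]
      rfl
    rw [e2, cl_vector_reversal, ← h.parity_wedge, Pi.add_apply, parity_apply_even hd] at e1
    exact eq_neg_of_add_eq_zero_left e1.symm
  have h2 : ∀ ξ : V →L[ℝ] ℝ, mukai d (cl (0, ξ) α) β = -mukai d α (cl (0, ξ) β) := fun ξ => by
    simp only [mukai, cl_covector]
    rw [reversal_covector_wedge, h.wedge_covector_wedge, ← h.parity_wedge, ← covector_wedge_assoc,
      ← parity_apply_even hd (wedge _ (wedge _ _)), parity_covector_wedge]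
    simp only [Pi.neg_apply]
  have h3 := h1 A.1
  have h4 := h2 A.2
  simp only [← mukaiLin_apply] at h3 h4 ⊢
  rw [cl_split A, LinearMap.add_apply, LinearMap.add_apply, map_add, map_add, LinearMap.add_apply,
    h3, h4, neg_add]

/-- Wedging with a form of degree `a` shifts degrees by `a`, so a scalar depending on the degree
passes through with its index shifted. It serves to move the sign of the reversal past a 3-form. -/
lemma homog_wedge_rescale {a : ℕ} (η : V [⋀^Fin a]→L[ℝ] ℂ) {β β' : Spinor V} (f g : ℕ → ℂ)
    (hβ : ∀ k, β' k = g k • β k) (hfg : ∀ k, f (k + a) = g k) (k : ℕ) :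
    wedge (homog a η) β' k = f k • wedge (homog a η) β k := by
  ext v
  rw [ContinuousAlternatingMap.smul_apply, wedge_apply, wedge_apply, Finset.smul_sum]
  refine Finset.sum_congr rfl fun i _ => ?_
  by_cases hi : (i : ℕ) = a
  · have h0 := wedgeHom_lin_right (f k) (homog a η i) (β (k - i)) 0
    have h1 : β' (k - i) = f k • β (k - i) + 0 := by
      rw [hβ, add_zero, ← hfg, ← hi, Nat.sub_add_cancel (Nat.le_of_lt_succ i.isLt)]
    have h2 : wedgeHom (homog a η i) (0 : V [⋀^Fin (k - i)]→L[ℝ] ℂ) = 0 := by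
      ext w
      rw [wedgeHom_apply]
      simp [altSum, fnTensor]
    rw [h1, h0, h2, add_zero]
    rfl
  · rw [homog_ne hi, wedgeHom_zero_left, wedgeHom_zero_left]
    simp

lemma reversal_three_wedge (η : V [⋀^Fin 3]→L[ℝ] ℂ) (β : Spinor V) :
    reversal (wedge (homog 3 η) β) = -wedge (homog 3 η) (parity (reversal β)) := by
  funext k
  have h1 := homog_wedge_rescale η (β := β) (β' := parity (reversal β))
    (fun k => -(-1 : ℂ) ^ (k * (k - 1) / 2)) (fun k => (-1 : ℂ) ^ k * (-1 : ℂ) ^ (k * (k - 1) / 2))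
    (fun k => by rw [parity_apply, reversal_apply, smul_smul])
    (fun k => by
      simp only [show k + 3 = k + 1 + 1 + 1 from rfl]
      rw [reversal_sign_succ, reversal_sign_succ, reversal_sign_succ]
      have : ((-1 : ℂ) ^ k) ^ 2 = 1 := by rw [← pow_mul, mul_comm, pow_mul]; simp
      linear_combination ((-1 : ℂ) ^ k * (-1 : ℂ) ^ (k * (k - 1) / 2)) * this) k
  rw [Pi.neg_apply, h1, reversal_apply]
  ext v
  simp

/-- The reversal of a 3-form is its negative, whereas a covector is its own reversal. So wedging
with `H` is symmetric, unlike wedging with a covector, and agrees in this with `d`. -/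
lemma IsDualFrame.mukai_three_wedge (h : IsDualFrame e ε) (hd : Even d) (η : V [⋀^Fin 3]→L[ℝ] ℂ)
    (α β : Spinor V) :
    mukai d (wedge (homog 3 η) α) β = mukai d α (wedge (homog 3 η) β) := by
  simp only [mukai]
  rw [reversal_three_wedge η, wedge_neg_right, h.wedge_odd_wedge (homog_three_odd η),
    ← h.parity_wedge, ← h.wedge_assoc,
    ← parity_apply_even hd (wedge _ (wedge _ _)), h.parity_wedge, homog_three_odd, wedge_neg_left]

/-- The volume form of a dual frame. -/
def frameVolume (ε : Fin d → V →L[ℝ] ℝ) : V [⋀^Fin d]→L[ℝ] ℝ :=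
  ({ (Matrix.detRowAlternating : (Fin d → ℝ) [⋀^Fin d]→ₗ[ℝ] ℝ) with
     cont := by
      have : Continuous fun M : Matrix (Fin d) (Fin d) ℝ => M.det := Continuous.matrix_det continuous_id
      exact this } : (Fin d → ℝ) [⋀^Fin d]→L[ℝ] ℝ).compContinuousLinearMap
    (ContinuousLinearMap.pi ε)

lemma frameVolume_apply (ε : Fin d → V →L[ℝ] ℝ) (v : Fin d → V) :
    frameVolume ε v = Matrix.det (Matrix.of fun i j => ε j (v i)) := rfl

lemma IsDualFrame.frameVolume_self (h : IsDualFrame e ε) : frameVolume ε e = 1 := by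
  rw [frameVolume_apply, ← Matrix.det_one (n := Fin d) (R := ℝ)]
  congr 1
  ext i j
  simp [h.dual, Matrix.one_apply, eq_comm]

lemma wedge_unit_of (h : IsDualFrame e ε) (α : Spinor V) : wedge α (unitForm V) = α := by
  induction α using h.covector_induction with
  | one => rw [unit_wedge]
  | add α β ha hb => rw [wedge_add_left, ha, hb]
  | smul z α ha => rw [wedge_smul_left, ha]
  | cov η α ha => rw [← covector_wedge_assoc, ha]

lemma reversal_unit : reversal (unitForm V) = unitForm V := by
  refine Spinor.ext fun k v => ?_
  rw [reversal_apply]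
  rcases k with _ | k
  · simp
  · rw [unitForm, homog_ne (by omega)]; simp

/-- The radical of the pairing is Clifford invariant by `IsDualFrame.mukai_cl`, hence zero or
everything. It is not everything because `1` pairs nontrivially with a volume form. -/
lemma IsDualFrame.eq_zero_of_mukai (h : IsDualFrame e ε) (hd : Even d) {β : Spinor V}
    (hβ : ∀ α, mukai d α β = 0) : β = 0 := by
  let W : Submodule ℂ (Spinor V) := LinearMap.ker (mukaiLin d V).flip
  have hW : ∀ β, β ∈ W ↔ ∀ α, mukai d α β = 0 := fun β => by
    rw [LinearMap.mem_ker]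
    exact ⟨fun hb α => LinearMap.congr_fun hb α, fun hb => LinearMap.ext hb⟩
  rcases h.isCliffordModule.irreducible W (fun A w hw => (hW _).2 fun α => by
    rw [← neg_eq_zero, ← h.mukai_cl hd]
    exact (hW w).1 hw _) with h0 | h1
  · have := (hW β).2 hβ
    rw [h0] at this
    exact (Submodule.mem_bot ℂ).1 this
  · exfalso
    have h2 := (hW (unitForm V)).1 (h1 ▸ Submodule.mem_top) (homog d (complexify (frameVolume ε)))
    rw [mukai, reversal_unit, wedge_unit_of h, homog_same] at h2
    have h3 : complexify (frameVolume ε) e = 0 := by rw [h2]; rfl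
    have h4 : complexify (frameVolume ε) e = ((frameVolume ε e : ℝ) : ℂ) := rfl
    rw [h4, h.frameVolume_self] at h3
    norm_num at h3

end Wedge

/-! ### Gradings under skew pairings and under conjugation -/

section SkewPairing

variable {S : Type*} [AddCommGroup S] [Module ℂ S] {d : ℕ} {N N₁ N₂ : Module.End ℂ S}
  {R : Type*} [AddCommGroup R] [Module ℂ R] {m : S →ₗ[ℂ] S →ₗ[ℂ] R}

/-- Skewness of `N` forces the eigenspaces of weights `k` and `l` to be orthogonal unless `k + l =
0`. -/
lemma IsGrading.pairing_wproj (h : IsGrading d N) (hm : ∀ a b, m (N a) b = -m a (N b)) (p : ℤ)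
    (a b : S) : m (wproj d N p a) b = m a (wproj d N (-p) b) := by
  have key : m ∘ₗ wproj d N p = m.compl₂ (wproj d N (-p)) := by
    refine h.ext fun k a ha => h.ext fun l b hb => ?_
    simp only [LinearMap.comp_apply, LinearMap.compl₂_apply]
    by_cases hkl : k + l = 0
    · obtain rfl : l = -k := by omega
      by_cases hp : k = p
      · subst hp
        rw [h.wproj_apply_self ha, h.wproj_apply_self hb]
      · rw [h.wproj_apply_ne hp ha, h.wproj_apply_ne (by omega) hb]
        simp
    · have h0 : m a b = 0 := by
        have h1 := hm a b
        rw [Module.End.mem_eigenspace_iff.1 ha, Module.End.mem_eigenspace_iff.1 hb, map_smul,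
          map_smul, LinearMap.smul_apply, ← sub_eq_zero, sub_neg_eq_add, ← add_smul] at h1
        refine (smul_eq_zero.1 h1).resolve_left ?_
        rw [← mul_add]
        refine mul_ne_zero Complex.I_ne_zero ?_
        exact_mod_cast hkl
      by_cases hp : k = p
      · rw [← hp, h.wproj_apply_self ha, h.wproj_apply_ne (by omega) hb, h0, map_zero]
      · rw [h.wproj_apply_ne hp ha, map_zero, LinearMap.zero_apply]
        by_cases hp' : l = -p
        · rw [← hp', h.wproj_apply_self hb, h0]
        · rw [h.wproj_apply_ne hp' hb, map_zero]
  exact LinearMap.congr_fun (LinearMap.congr_fun key a) b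

lemma IsBigrading.biproj_comm (h : IsBigrading d N₁ N₂) (p q : ℤ) :
    biproj d N₁ N₂ p q = wproj d N₂ q * wproj d N₁ p :=
  wproj_comm_of_comm (wproj_comm_of_comm h.comm.symm p).symm q

lemma IsBigrading.pairing_biproj (h : IsBigrading d N₁ N₂) (h₁ : ∀ a b, m (N₁ a) b = -m a (N₁ b))
    (h₂ : ∀ a b, m (N₂ a) b = -m a (N₂ b)) (p q : ℤ) (a b : S) :
    m (biproj d N₁ N₂ p q a) b = m a (biproj d N₁ N₂ (-p) (-q) b) := by
  rw [h.biproj_comm (-p), biproj, Module.End.mul_apply, Module.End.mul_apply,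
    h.fst.pairing_wproj h₁, h.snd.pairing_wproj h₂]

/-- An antilinear map commuting with `N` sends the eigenvalue `i k` to its conjugate, that is,
weight `k` to weight `-k`. -/
lemma IsGrading.wproj_semiconj (h : IsGrading d N) (f : S →+ S)
    (hf : ∀ (z : ℂ) v, f (z • v) = (starRingEnd ℂ) z • f v) (hN : ∀ v, f (N v) = N (f v)) (p : ℤ)
    (v : S) : f (wproj d N p v) = wproj d N (-p) (f v) := by
  have hmem : ∀ k, f (wproj d N k v) ∈ N.eigenspace (Complex.I * ((-k : ℤ) : ℂ)) := fun k => by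
    rw [Module.End.mem_eigenspace_iff, ← hN, Module.End.mem_eigenspace_iff.1 (h.wproj_mem k v), hf]
    congr 1
    simp
  have h1 := congrArg f (LinearMap.congr_fun (wproj_sum d N) v)
  rw [LinearMap.sum_apply, map_sum, Module.End.one_apply] at h1
  rw [← h1, map_sum]
  by_cases hp : p ∈ Finset.Icc (-d : ℤ) d
  · rw [Finset.sum_eq_single_of_mem p hp fun k _ hk => h.wproj_apply_ne (by omega) (hmem k),
      h.wproj_apply_self (hmem p)]
  · rw [Finset.sum_eq_zero fun k hk => h.wproj_apply_ne (j := -k) ?_ (hmem k), h.wproj_eq_zero hp]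
    · simp
    · rintro he
      exact hp (by rwa [← neg_injective he])

lemma IsBigrading.biproj_semiconj (h : IsBigrading d N₁ N₂) (f : S →+ S)
    (hf : ∀ (z : ℂ) v, f (z • v) = (starRingEnd ℂ) z • f v) (h₁ : ∀ v, f (N₁ v) = N₁ (f v))
    (h₂ : ∀ v, f (N₂ v) = N₂ (f v)) (p q : ℤ) (v : S) :
    f (biproj d N₁ N₂ p q v) = biproj d N₁ N₂ (-p) (-q) (f v) := by
  rw [biproj, biproj, Module.End.mul_apply, Module.End.mul_apply, h.fst.wproj_semiconj f hf h₁,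
    h.snd.wproj_semiconj f hf h₂]

/-- Conjugation replaces both the scalar `i^(p+q)` by `i^(-(p+q))` and the bidegree `(p, q)` by
`(-p, -q)`. These changes agree, so the star operator is real. -/
lemma IsBigrading.starOp_semiconj (h : IsBigrading d N₁ N₂) (f : S →+ S)
    (hf : ∀ (z : ℂ) v, f (z • v) = (starRingEnd ℂ) z • f v) (h₁ : ∀ v, f (N₁ v) = N₁ (f v))
    (h₂ : ∀ v, f (N₂ v) = N₂ (f v)) (v : S) :
    f (starOp d N₁ N₂ v) = starOp d N₁ N₂ (f v) := by
  have key : ∀ p q, f (starOp d N₁ N₂ (biproj d N₁ N₂ p q v)) =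
      starOp d N₁ N₂ (f (biproj d N₁ N₂ p q v)) := fun p q => by
    rw [starOp, h.degOp_apply _ (h.biproj_mem p q v), hf, h.biproj_semiconj f hf h₁ h₂,
      h.degOp_apply _ (h.biproj_mem (-p) (-q) (f v))]
    congr 1
    rw [map_zpow₀, Complex.conj_I, ← Complex.inv_I, inv_zpow', neg_add]
  conv_lhs => rw [← biproj_sum_apply d N₁ N₂ v]
  conv_rhs => rw [← biproj_sum_apply d N₁ N₂ v]
  simp only [map_sum, key]

end SkewPairing

/-! ### Products of orthogonal Clifford elements -/

section RevProd

variable {V S : Type*} [AddCommGroup V] [Module ℝ V] [TopologicalSpace V] [AddCommGroup S]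
  [Module ℂ S] {c : Gen V →ₗ[ℝ] Module.End ℂ S}

/-- The product of Clifford elements in reverse order. -/
def revProd (c : Gen V →ₗ[ℝ] Module.End ℂ S) : List (Gen V) → Module.End ℂ S
  | [] => 1
  | v :: l => revProd c l * c v

lemma foldl_eq_revProd (l : List (Gen V)) (ρ : S) :
    l.foldl (fun τ v => c v τ) ρ = revProd c l ρ := by
  induction l generalizing ρ with
  | nil => rfl
  | cons v l ih => rw [List.foldl_cons, ih]; rfl

lemma revProd_concat (l : List (Gen V)) (v : Gen V) :
    revProd c (l ++ [v]) = c v * revProd c l := by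
  induction l with
  | nil => simp [revProd]
  | cons w l ih => rw [List.cons_append, revProd, ih, revProd, mul_assoc]

lemma IsCliffordModule.anticomm (hc : IsCliffordModule c) {A B : Gen V} (h : pairing A B = 0) :
    c A * c B = -(c B * c A) := by
  have := hc.rel A B
  rw [h, mul_zero, Complex.ofReal_zero, zero_smul] at this
  exact eq_neg_of_add_eq_zero_left this

lemma IsCliffordModule.mul_revProd_of_orthogonal (hc : IsCliffordModule c) {A : Gen V}
    (l : List (Gen V)) (h : ∀ v ∈ l, pairing A v = 0) :
    c A * revProd c l = (-1 : ℂ) ^ l.length • (revProd c l * c A) := by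
  induction l with
  | nil => simp [revProd]
  | cons v l ih =>
    have h1 := ih fun w hw => h w (List.mem_cons_of_mem _ hw)
    rw [revProd, ← mul_assoc, h1, smul_mul_assoc, mul_assoc, hc.anticomm (h v List.mem_cons_self),
      List.length_cons, pow_succ, mul_assoc, mul_neg, mul_neg_one, neg_smul, smul_neg]

/-- Each factor orthogonal to `A` contributes a sign, and the one factor equal to `A` contributes
none. The exponent `length + 1` has the parity of `length - 1`. -/
lemma IsCliffordModule.mul_revProd_of_mem (hc : IsCliffordModule c) {A : Gen V}
    (l : List (Gen V)) (hl : l.Pairwise fun v w => pairing v w = 0) (h : A ∈ l) :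
    c A * revProd c l = (-1 : ℂ) ^ (l.length + 1) • (revProd c l * c A) := by
  induction l with
  | nil => simp at h
  | cons v l ih =>
    rw [List.pairwise_cons] at hl
    rcases List.mem_cons.1 h with rfl | h
    · rw [revProd, ← mul_assoc, hc.mul_revProd_of_orthogonal l hl.1, smul_mul_assoc,
        List.length_cons, pow_add, pow_succ]
      simp
    · rw [revProd, ← mul_assoc, ih hl.2 h, smul_mul_assoc, mul_assoc,
        hc.anticomm ((pairing_comm _ _).trans (hl.1 A h)), List.length_cons, pow_succ _ (_ + 1),
        mul_assoc, mul_neg, mul_neg_one, neg_smul, smul_neg]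

lemma IsCliffordModule.revProd_sq (hc : IsCliffordModule c) (l : List (Gen V))
    (hl : l.Pairwise fun v w => pairing v w = 0) (h1 : ∀ v ∈ l, pairing v v = 1) :
    ∃ z : ℂ, (z = 1 ∨ z = -1) ∧ revProd c l * revProd c l = z • 1 := by
  induction l with
  | nil => exact ⟨1, Or.inl rfl, by simp [revProd]⟩
  | cons v l ih =>
    rw [List.pairwise_cons] at hl
    obtain ⟨z, hz, h⟩ := ih hl.2 fun w hw => h1 w (List.mem_cons_of_mem _ hw)
    refine ⟨(-1) ^ l.length * z, ?_, ?_⟩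
    · rcases neg_one_pow_eq_or ℂ l.length with h | h <;> rcases hz with h' | h' <;>
        simp [h, h']
    · have h2 : c v * c v = 1 := by
        have := hc.rel v v
        rw [h1 v List.mem_cons_self, ← two_smul ℂ (c v * c v)] at this
        have h3 := congrArg (fun T => (1 / 2 : ℂ) • T) this
        simpa [smul_smul] using h3
      rw [revProd, mul_assoc, ← mul_assoc (c v), hc.mul_revProd_of_orthogonal l hl.1,
        smul_mul_assoc, mul_assoc, h2, mul_one, mul_smul_comm, h, smul_smul]

end RevProd

/-! ### Linear algebra of a generalized Kähler pair -/

section Fibre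

/-- The pointwise algebraic conditions on a generalized Kähler pair. -/
structure IsKahlerPair {V : Type*} [AddCommGroup V] [Module ℝ V] [TopologicalSpace V]
    (J₁ J₂ : Gen V →ₗ[ℝ] Gen V) : Prop where
  sq₁ : ∀ A, J₁ (J₁ A) = -A
  sq₂ : ∀ A, J₂ (J₂ A) = -A
  skew₁ : IsSkew J₁
  skew₂ : IsSkew J₂
  comm : ∀ A, J₁ (J₂ A) = J₂ (J₁ A)
  pos : ∀ A, A ≠ 0 → 0 < pairing ((-(J₁ ∘ₗ J₂)) A) A

variable {V : Type*} [AddCommGroup V] [Module ℝ V] [TopologicalSpace V] {d : ℕ}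
  {e : Fin d → V} {ε : Fin d → V →L[ℝ] ℝ} {J₁ J₂ : Gen V →ₗ[ℝ] Gen V}

/-- Coordinates on `V ⊕ V*` given by dual frames. -/
def IsDualFrame.genEquiv (h : IsDualFrame e ε) : Gen V ≃ₗ[ℝ] (Fin d → ℝ) × (Fin d → ℝ) where
  toFun A := (fun i => ε i A.1, fun i => A.2 (e i))
  invFun c := (∑ i, c.1 i • e i, ∑ i, c.2 i • ε i)
  map_add' A B := by ext <;> simp
  map_smul' r A := by ext <;> simp
  left_inv A := Prod.ext (h.span A.1) (h.span_dual A.2)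
  right_inv c := by ext <;> simp [h.dual]

lemma IsDualFrame.finite_gen (h : IsDualFrame e ε) : FiniteDimensional ℝ (Gen V) :=
  Module.Finite.equiv h.genEquiv.symm

lemma IsDualFrame.finite_vec (h : IsDualFrame e ε) : FiniteDimensional ℝ V :=
  Module.Finite.of_basis h.basis

lemma IsDualFrame.finrank_gen (h : IsDualFrame e ε) : Module.finrank ℝ (Gen V) = d + d := by
  rw [h.genEquiv.finrank_eq]; simp

lemma IsDualFrame.finrank_vec (h : IsDualFrame e ε) : Module.finrank ℝ V = d := by
  rw [Module.finrank_eq_card_basis h.basis]; simp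

/-- The subspace of `V ⊕ V*` where `G = s`. -/
def genEigen (G : Gen V →ₗ[ℝ] Gen V) (s : ℝ) : Submodule ℝ (Gen V) := LinearMap.ker (G - s • 1)

lemma mem_genEigen {G : Gen V →ₗ[ℝ] Gen V} {s : ℝ} {A : Gen V} :
    A ∈ genEigen G s ↔ G A = s • A := by
  rw [genEigen, LinearMap.mem_ker, LinearMap.sub_apply, sub_eq_zero]; rfl

lemma mem_plus {G : Gen V →ₗ[ℝ] Gen V} {A : Gen V} : A ∈ genEigen G 1 ↔ G A = A := by
  rw [mem_genEigen, one_smul]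

lemma mem_minus {G : Gen V →ₗ[ℝ] Gen V} {A : Gen V} : A ∈ genEigen G (-1) ↔ G A = -A := by
  rw [mem_genEigen, show (-1 : ℝ) • A = -A by module]

lemma IsKahlerPair.invol (K : IsKahlerPair J₁ J₂) (A : Gen V) :
    (-(J₁ ∘ₗ J₂)) ((-(J₁ ∘ₗ J₂)) A) = A := by
  simp only [LinearMap.neg_apply, LinearMap.comp_apply, map_neg, neg_neg]
  rw [← K.comm, K.sq₁, K.sq₂, neg_neg]

lemma IsKahlerPair.J₁_plus (K : IsKahlerPair J₁ J₂) {A : Gen V} :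
    (-(J₁ ∘ₗ J₂)) A = A ↔ J₁ A = J₂ A := by
  rw [LinearMap.neg_apply, LinearMap.comp_apply]
  constructor
  · intro h
    rw [← h, map_neg, K.sq₁, neg_neg, h]
  · intro h
    rw [← h, K.sq₁, neg_neg]

lemma pairing_zero_of_fst_eq_zero {A : Gen V} (h : A.1 = 0) : pairing A A = 0 := by
  simp [pairing, h]

/-- A nonzero `A` with no vector component is isotropic. In an eigenspace of `G` this contradicts
positivity of `⟨G A, A⟩`, so the eigenspaces of `G` inject into `V`. -/
lemma IsKahlerPair.fst_ne_zero (K : IsKahlerPair J₁ J₂) {s : ℝ} {A : Gen V}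
    (hA : A ∈ genEigen (-(J₁ ∘ₗ J₂)) s) (h : A.1 = 0) : A = 0 := by
  by_contra h0
  have := K.pos A h0
  rw [mem_genEigen.1 hA, pairing_smul_left, pairing_zero_of_fst_eq_zero h, mul_zero] at this
  exact lt_irrefl _ this

lemma IsKahlerPair.finrank_le (K : IsKahlerPair J₁ J₂) (h : IsDualFrame e ε) (s : ℝ) :
    Module.finrank ℝ (genEigen (-(J₁ ∘ₗ J₂)) s) ≤ d := by
  have := h.finite_vec
  rw [← h.finrank_vec]
  refine LinearMap.finrank_le_finrank_of_injective
    (f := LinearMap.fst ℝ V (V →L[ℝ] ℝ) ∘ₗ (genEigen (-(J₁ ∘ₗ J₂)) s).subtype) ?_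
  rw [injective_iff_map_eq_zero]
  intro A hA
  exact Subtype.ext (K.fst_ne_zero A.2 hA)

lemma IsKahlerPair.split (K : IsKahlerPair J₁ J₂) (A : Gen V) :
    (1 / 2 : ℝ) • (A + (-(J₁ ∘ₗ J₂)) A) ∈ genEigen (-(J₁ ∘ₗ J₂)) 1 ∧
    (1 / 2 : ℝ) • (A - (-(J₁ ∘ₗ J₂)) A) ∈ genEigen (-(J₁ ∘ₗ J₂)) (-1) := by
  rw [mem_plus, mem_minus, map_smul, map_smul, map_add, map_sub, K.invol]
  constructor <;> module

/-- Both eigenspaces inject into `V`, so their dimensions are at most `d`, and together they span a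
space of dimension `2 d`. -/
lemma IsKahlerPair.finrank_plus (K : IsKahlerPair J₁ J₂) (h : IsDualFrame e ε) :
    Module.finrank ℝ (genEigen (-(J₁ ∘ₗ J₂)) 1) = d := by
  have := h.finite_gen
  have h1 := K.finrank_le h 1
  have h2 := K.finrank_le h (-1)
  have h3 : genEigen (-(J₁ ∘ₗ J₂)) 1 ⊔ genEigen (-(J₁ ∘ₗ J₂)) (-1) = ⊤ := by
    rw [Submodule.eq_top_iff']
    intro A
    have := Submodule.add_mem_sup (K.split A).1 (K.split A).2
    convert this using 1
    module
  have h4 := Submodule.finrank_add_le_finrank_add_finrank (genEigen (-(J₁ ∘ₗ J₂)) 1)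
    (genEigen (-(J₁ ∘ₗ J₂)) (-1))
  rw [h3, finrank_top, h.finrank_gen] at h4
  omega

lemma IsKahlerPair.exists_frame (K : IsKahlerPair J₁ J₂) (h : IsDualFrame e ε) :
    ∃ a : Fin d → Gen V, IsOrthonormalFrame (-(J₁ ∘ₗ J₂)) a := by
  have := h.finite_gen
  let W := genEigen (-(J₁ ∘ₗ J₂)) 1
  have hpos : ∀ A : W, A ≠ 0 → 0 < pairing (A : Gen V) A := fun A hA => by
    have := K.pos A (fun h0 => hA (Subtype.ext h0))
    rwa [mem_plus.1 A.2] at this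
  have hnn : ∀ A : W, 0 ≤ pairing (A : Gen V) A := fun A => by
    by_cases hA : A = 0
    · rw [hA]; simp [pairing]
    · exact (hpos A hA).le
  let core : InnerProductSpace.Core ℝ W :=
    { inner := fun A B => pairing (A : Gen V) B
      conj_inner_symm := fun A B => pairing_comm _ _
      re_inner_nonneg := hnn
      add_left := fun A B C => pairing_add_left _ _ _
      smul_left := fun A B r => pairing_smul_left _ _ _
      definite := fun A hA => by
        by_contra h0
        exact (hpos A h0).ne' hA }
  let _ : NormedAddCommGroup W := core.toNormedAddCommGroup
  let _ : InnerProductSpace ℝ W := InnerProductSpace.ofCore core.toCore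
  have hd : Module.finrank ℝ W = d := K.finrank_plus h
  let b := (stdOrthonormalBasis ℝ W).reindex (finCongr hd)
  refine ⟨fun i => (b i : Gen V), fun i => mem_plus.1 (b i).2, fun i j => ?_⟩
  have := orthonormal_iff_ite.1 b.orthonormal i j
  exact this

variable {a : Fin d → Gen V}

lemma IsOrthonormalFrame.pairing_sum {G : Gen V →ₗ[ℝ] Gen V} (ha : IsOrthonormalFrame G a)
    (g : Fin d → ℝ) (j : Fin d) : pairing (∑ i, g i • a i) (a j) = g j := by
  let f : Gen V →+ ℝ :=
    { toFun := fun A => pairing A (a j)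
      map_zero' := by simp [pairing]
      map_add' := fun A B => pairing_add_left A B (a j) }
  have : f (∑ i, g i • a i) = ∑ i, g i * pairing (a i) (a j) := by
    rw [map_sum]
    exact Finset.sum_congr rfl fun i _ => pairing_smul_left _ _ _
  refine this.trans ?_
  simp [ha.2]

lemma IsOrthonormalFrame.linearIndependent {G : Gen V →ₗ[ℝ] Gen V} (ha : IsOrthonormalFrame G a) :
    LinearIndependent ℝ a := by
  rw [Fintype.linearIndependent_iff]
  intro g hg i
  rw [← ha.pairing_sum g i, hg]
  simp [pairing]

lemma IsOrthonormalFrame.expand (ha : IsOrthonormalFrame (-(J₁ ∘ₗ J₂)) a)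
    (K : IsKahlerPair J₁ J₂) (h : IsDualFrame e ε) {A : Gen V} (hA : (-(J₁ ∘ₗ J₂)) A = A) :
    ∃ g : Fin d → ℝ, A = ∑ i, g i • a i := by
  have := h.finite_gen
  have hle : Submodule.span ℝ (Set.range a) ≤ genEigen (-(J₁ ∘ₗ J₂)) 1 := by
    rw [Submodule.span_le]
    rintro _ ⟨i, rfl⟩
    exact mem_plus.2 (ha.1 i)
  have heq := Submodule.eq_of_le_of_finrank_eq hle (by
    rw [K.finrank_plus h, finrank_span_eq_card ha.linearIndependent, Fintype.card_fin])
  have hmem := mem_plus.2 hA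
  rw [← heq, Submodule.mem_span_range_iff_exists_fun] at hmem
  obtain ⟨g, hg⟩ := hmem
  exact ⟨g, hg.symm⟩

/-- The projections to `V` of an orthonormal frame of `C₊` form a basis. -/
lemma IsOrthonormalFrame.linearIndependent_fst (ha : IsOrthonormalFrame (-(J₁ ∘ₗ J₂)) a)
    (K : IsKahlerPair J₁ J₂) : LinearIndependent ℝ fun i => (a i).1 := by
  rw [Fintype.linearIndependent_iff]
  intro g hg
  have h1 : (∑ i, g i • a i) ∈ genEigen (-(J₁ ∘ₗ J₂)) 1 :=
    Submodule.sum_mem _ fun i _ => Submodule.smul_mem _ _ (mem_plus.2 (ha.1 i))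
  have h2 : (∑ i, g i • a i) = 0 := K.fst_ne_zero h1 (by rw [Prod.fst_sum]; exact hg)
  exact Fintype.linearIndependent_iff.1 ha.linearIndependent g h2

lemma IsOrthonormalFrame.pairwise {G : Gen V →ₗ[ℝ] Gen V} (ha : IsOrthonormalFrame G a) :
    (List.ofFn a).Pairwise fun v w => pairing v w = 0 := by
  rw [List.pairwise_ofFn]
  intro i j hij
  rw [ha.2, if_neg hij.ne]

lemma IsKahlerPair.pairing_plus_minus (K : IsKahlerPair J₁ J₂) {A B : Gen V}
    (hA : J₁ A = J₂ A) (hB : J₂ B = -J₁ B) : pairing A B = 0 := by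
  have h1 := K.skew₁ A (J₁ B)
  have h2 := K.skew₂ A (J₂ B)
  rw [K.sq₁, pairing_neg_right] at h1
  rw [K.sq₂, pairing_neg_right, hB, pairing_neg_right, ← hA] at h2
  linarith

section RevProd

variable {S : Type*} [AddCommGroup S] [Module ℂ S] {c : Gen V →ₗ[ℝ] Module.End ℂ S}

/-- A frame vector anticommutes with the other `d - 1` factors, an odd number. A vector of `C₋` is
orthogonal to all `d` factors, and therefore commutes with the product. -/
lemma IsOrthonormalFrame.revProd_plus (ha : IsOrthonormalFrame (-(J₁ ∘ₗ J₂)) a)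
    (K : IsKahlerPair J₁ J₂) (h : IsDualFrame e ε) (hc : IsCliffordModule c) (hd : Even d)
    {A : Gen V} (hA : J₁ A = J₂ A) :
    revProd c (List.ofFn a) * c A = -(c A * revProd c (List.ofFn a)) := by
  obtain ⟨g, hg⟩ := ha.expand K h (K.J₁_plus.2 hA)
  have h1 : ∀ i, revProd c (List.ofFn a) * c (a i) = -(c (a i) * revProd c (List.ofFn a)) :=
    fun i => by
      rw [hc.mul_revProd_of_mem _ ha.pairwise (by simp [List.mem_ofFn]), List.length_ofFn,
        pow_succ, hd.neg_one_pow]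
      simp
  rw [hg, map_sum, Finset.mul_sum, Finset.sum_mul, ← Finset.sum_neg_distrib]
  refine Finset.sum_congr rfl fun i _ => ?_
  rw [c_real_smul, mul_smul_comm, h1, smul_mul_assoc, smul_neg]

lemma IsOrthonormalFrame.revProd_minus (ha : IsOrthonormalFrame (-(J₁ ∘ₗ J₂)) a)
    (K : IsKahlerPair J₁ J₂) (hc : IsCliffordModule c) (hd : Even d)
    {A : Gen V} (hA : J₂ A = -J₁ A) :
    revProd c (List.ofFn a) * c A = c A * revProd c (List.ofFn a) := by
  rw [hc.mul_revProd_of_orthogonal, List.length_ofFn, hd.neg_one_pow, one_smul]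
  intro v hv
  obtain ⟨i, rfl⟩ := List.mem_ofFn.1 hv
  rw [pairing_comm]
  exact K.pairing_plus_minus (K.J₁_plus.1 (ha.1 i)) hA

end RevProd

end Fibre

/-! ### The bigrading of a generalized Kähler pair, and the star -/

section Bigrading

variable {V : Type*} [AddCommGroup V] [Module ℝ V] [TopologicalSpace V] {n : ℕ}
  {e : Fin (2 * n) → V} {ε : Fin (2 * n) → V →L[ℝ] ℝ} {J₁ J₂ : Gen V →ₗ[ℝ] Gen V}
  {S : Type*} [AddCommGroup S] [Module ℂ S] {c : Gen V →ₗ[ℝ] Module.End ℂ S}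

/-- Because `J₁` and `J₂` commute, `[N₁, N₂]` commutes with the Clifford action and is a scalar. A
commutator has trace zero, so the scalar is zero. -/
lemma IsCliffordModule.commute_of_isSpinOf (hc : IsCliffordModule c) {N₁ N₂ : Module.End ℂ S}
    (h₁ : IsSpinOf c J₁ N₁) (h₂ : IsSpinOf c J₂ N₂) (hJ : ∀ A, J₁ (J₂ A) = J₂ (J₁ A)) :
    N₁ * N₂ = N₂ * N₁ := by
  have hf := hc.finite
  have hn := hc.nontrivial
  obtain ⟨z, hz⟩ := hc.schur (T := N₁ * N₂ - N₂ * N₁) fun A => by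
    have e1 : (N₁ * N₂ - N₂ * N₁) * c A - c A * (N₁ * N₂ - N₂ * N₁) =
        N₁ * (N₂ * c A - c A * N₂) - (N₂ * c A - c A * N₂) * N₁ -
          (N₂ * (N₁ * c A - c A * N₁) - (N₁ * c A - c A * N₁) * N₂) := by noncomm_ring
    rw [h₁ A, h₂ A, h₁ (J₂ A), h₂ (J₁ A), hJ, sub_self] at e1
    exact sub_eq_zero.1 e1
  have h3 := congrArg (LinearMap.trace ℂ S) hz
  rw [map_sub, LinearMap.trace_mul_comm, sub_self, map_smul, LinearMap.trace_one, smul_eq_mul,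
    eq_comm] at h3
  have h4 : (Module.finrank ℂ S : ℂ) ≠ 0 := by
    exact_mod_cast (Module.finrank_pos (R := ℂ) (M := S)).ne'
  rw [(mul_eq_zero.1 h3).resolve_right h4, zero_smul] at hz
  exact sub_eq_zero.1 hz

lemma IsKahlerPair.isBigrading (K : IsKahlerPair J₁ J₂) (h : IsDualFrame e ε)
    (hc : IsCliffordModule c) :
    IsBigrading (2 * n) (spinEnd c e ε J₁) (spinEnd c e ε J₂) where
  fst := hc.isGrading h K.skew₁ K.sq₁
  snd := hc.isGrading h K.skew₂ K.sq₂
  comm := hc.commute_of_isSpinOf (hc.spinEnd_comm h K.skew₁) (hc.spinEnd_comm h K.skew₂) K.comm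

/-- The square of the product of an orthonormal frame is `±1`. Evaluated on a vector of bidegree
`(p, q)` this reads `z² i^(2(p+q)) = ±1`, which leaves `z² = ±1`; the value `-1` is excluded by
reality in `IsKahlerPair.revStar_eq`. -/
lemma IsOrthonormalFrame.revProd_eq {a : Fin (2 * n) → Gen V}
    (ha : IsOrthonormalFrame (-(J₁ ∘ₗ J₂)) a) (K : IsKahlerPair J₁ J₂) (h : IsDualFrame e ε)
    (hc : IsCliffordModule c) : ∃ z : ℂ, (z ^ 2 = 1 ∨ z ^ 2 = -1) ∧
      revProd c (List.ofFn a) = z • starOp (2 * n) (spinEnd c e ε J₁) (spinEnd c e ε J₂) := by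
  have hb := K.isBigrading h hc
  obtain ⟨z, hz⟩ := hc.eq_smul_starOp hb (hc.spinEnd_comm h K.skew₁) (hc.spinEnd_comm h K.skew₂)
    K.sq₁ K.sq₂ K.comm (s := revProd c (List.ofFn a))
    (fun A hA => ha.revProd_plus K h hc (even_two_mul n) hA)
    (fun A hA => ha.revProd_minus K hc (even_two_mul n) hA)
  refine ⟨z, ?_, hz⟩
  obtain ⟨w, hw, hsq⟩ := hc.revProd_sq _ ha.pairwise (fun v hv => by
    obtain ⟨i, rfl⟩ := List.mem_ofFn.1 hv
    rw [ha.2, if_pos rfl])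
  have hn := hc.nontrivial
  obtain ⟨v, hv⟩ := exists_ne (0 : S)
  have : ∃ p q, biproj (2 * n) (spinEnd c e ε J₁) (spinEnd c e ε J₂) p q v ≠ 0 := by
    by_contra hcon
    push Not at hcon
    apply hv
    rw [← biproj_sum_apply (2 * n) (spinEnd c e ε J₁) (spinEnd c e ε J₂) v]
    exact Finset.sum_eq_zero fun p _ => Finset.sum_eq_zero fun q _ => hcon p q
  obtain ⟨p, q, hpq⟩ := this
  set u := biproj (2 * n) (spinEnd c e ε J₁) (spinEnd c e ε J₂) p q v
  have hu : u ∈ bispace _ _ p q := hb.biproj_mem p q v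
  have h1 := LinearMap.congr_fun hsq u
  rw [hz, Module.End.mul_apply, LinearMap.smul_apply, LinearMap.smul_apply, starOp,
    hb.degOp_apply _ hu, map_smul, map_smul, hb.degOp_apply _ hu, LinearMap.smul_apply,
    Module.End.one_apply, smul_smul, smul_smul, smul_smul] at h1
  have h2 := smul_left_injective ℂ hpq h1
  have h3 : (Complex.I ^ (p + q)) ^ 2 = 1 ∨ (Complex.I ^ (p + q)) ^ 2 = -1 := by
    rw [← zpow_natCast, ← zpow_mul, mul_comm, zpow_mul]
    simp only [Nat.cast_ofNat, zpow_ofNat, Complex.I_sq]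
    rcases Int.even_or_odd (p + q) with h | h
    · left; exact h.neg_one_zpow
    · right; exact h.neg_one_zpow
  have h4 : z ^ 2 * (Complex.I ^ (p + q)) ^ 2 = w := by rw [← h2]; ring
  rcases h3 with h3 | h3 <;> rcases hw with hw | hw <;> rw [h3, hw] at h4
  · left; simpa using h4
  · right; simpa using h4
  · right; linear_combination -h4
  · left; linear_combination -h4

end Bigrading

/-! ### The top degree part of the star and its dependence on the orientation -/

section TopDegree

variable {V : Type*} [AddCommGroup V] [Module ℝ V] [TopologicalSpace V] {d : ℕ}

/-- Above the degree of `ρ` the contraction contributes nothing. Iterated, the top component of `a_d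
⋯ a_1 · 1` is the wedge product of the covector parts of the `a_i`, a determinant. -/
lemma cl_top_degree (A : Gen V) {ρ τ : Spinor V} {j : ℕ} (h0 : ∀ k, j < k → ρ k = 0)
    (h1 : ∀ k, j ≤ k → ρ k = τ k) :
    (∀ k, j + 1 < k → cl A ρ k = 0) ∧ ∀ k, j + 1 ≤ k → cl A ρ k = cl (0, A.2) τ k := by
  have key : ∀ k, j + 1 ≤ k → cl A ρ k = cl (0, A.2) τ k := fun k hk => by
    rw [cl_split A, LinearMap.add_apply, Pi.add_apply]
    have e1 : cl (A.1, 0) ρ k = 0 := by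
      ext v
      rw [cl_vector_apply, h0 _ (by omega)]; rfl
    rw [e1, zero_add]
    obtain ⟨k, rfl⟩ : ∃ m, k = m + 1 := ⟨k - 1, by omega⟩
    ext v
    rw [cl_covector_succ, cl_covector_succ, h1 k (by omega)]
  refine ⟨fun k hk => ?_, key⟩
  rw [key k hk.le]
  obtain ⟨k, rfl⟩ : ∃ m, k = m + 1 := ⟨k - 1, by omega⟩
  ext v
  rw [cl_covector_succ, ← h1 k (by omega), h0 k (by omega)]
  simp

lemma revProd_top_degree (l : List (Gen V)) {ρ τ : Spinor V} {j : ℕ} (h0 : ∀ k, j < k → ρ k = 0)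
    (h1 : ∀ k, j ≤ k → ρ k = τ k) : ∀ k, j + l.length ≤ k →
      revProd cl l ρ k = revProd cl (l.map fun A => ((0, A.2) : Gen V)) τ k := by
  induction l generalizing ρ τ j with
  | nil => exact h1
  | cons A l ih =>
    intro k hk
    have h2 := cl_top_degree A h0 h1
    rw [List.length_cons] at hk
    exact ih h2.1 h2.2 k (by omega)

/-- The last covector acts last and becomes the first row of the determinant, whence the reversed
index. Exterior multiplication by it is the expansion along that row. -/
lemma revProd_covectors {m : ℕ} (ξ : Fin m → V →L[ℝ] ℝ) (v : Fin m → V) :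
    revProd cl (List.ofFn fun i => ((0, ξ i) : Gen V)) (unitForm V) m v =
      ((Matrix.det (Matrix.of fun i j => ξ i.rev (v j)) : ℝ) : ℂ) := by
  induction m with
  | zero =>
    rw [Matrix.det_isEmpty]
    simp [revProd, unitForm, homog_same]
  | succ m ih =>
    rw [List.ofFn_succ', List.concat_eq_append, revProd_concat, Module.End.mul_apply,
      cl_covector_succ, Matrix.det_succ_row_zero]
    push_cast
    refine Finset.sum_congr rfl fun i _ => ?_
    rw [ih (fun i => ξ i.castSucc), mul_assoc]
    have hm : (Matrix.of fun a b => ξ a.rev.castSucc (i.removeNth v b)) =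
        (Matrix.of fun a b => ξ a.rev (v b)).submatrix Fin.succ i.succAbove := by
      ext a b
      simp [Matrix.submatrix, Fin.rev_succ, Fin.removeNth]
    rw [hm]
    simp

/-- The symmetric part of `A` is the identity, and the same holds for `1 + t (A - 1)`. Such matrices
have no kernel, since `⟨x, B x⟩ = |x|²`. The determinant thus cannot change sign on the segment from
`1` to `A`. -/
lemma det_pos_of_add_transpose {m : ℕ} (A : Matrix (Fin m) (Fin m) ℝ)
    (hA : ∀ i j, A i j + A j i = if i = j then 2 else 0) : 0 < A.det := by
  let B : ℝ → Matrix (Fin m) (Fin m) ℝ := fun t => 1 + t • (A - 1)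
  have hne : ∀ t, (B t).det ≠ 0 := fun t ht => by
    obtain ⟨x, hx, hBx⟩ := Matrix.exists_mulVec_eq_zero_iff.2 ht
    have h1 : ∑ i, x i * (∑ j, B t i j * x j) = 0 := by
      refine Finset.sum_eq_zero fun i _ => ?_
      have := congrFun hBx i
      rw [Matrix.mulVec, dotProduct] at this
      rw [this]; simp
    have h2 : ∀ i j, B t i j + B t j i = if i = j then 2 else 0 := fun i j => by
      have := hA i j
      by_cases hij : i = j
      · subst hij
        simp only [if_true] at this ⊢
        have h3 : A i i = 1 := by linarith
        simp [B, h3]; norm_num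
      · simp only [hij, if_false] at this ⊢
        simp only [B, Matrix.add_apply, Matrix.smul_apply, Matrix.sub_apply, smul_eq_mul,
          Matrix.one_apply, hij, Ne.symm hij, if_false]
        linear_combination t * this
    have h3 : ∑ i, x i * (∑ j, B t j i * x j) = 0 := by
      rw [← h1]
      simp only [Finset.mul_sum]
      rw [Finset.sum_comm]
      exact Finset.sum_congr rfl fun i _ => Finset.sum_congr rfl fun j _ => by ring
    have h4 : ∑ i, x i * x i = 0 := by
      have : ∑ i, 2 * (x i * x i) = 0 := by
        have e : ∀ i, 2 * (x i * x i) =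
            x i * (∑ j, B t i j * x j) + x i * (∑ j, B t j i * x j) := fun i => by
          rw [← mul_add, ← Finset.sum_add_distrib]
          simp only [← add_mul, h2]
          simp; ring
        rw [Finset.sum_congr rfl fun i _ => e i, Finset.sum_add_distrib, h1, h3, add_zero]
      rw [← Finset.mul_sum] at this
      linarith
    apply hx
    funext i
    have := (Finset.sum_eq_zero_iff_of_nonneg fun i _ => mul_self_nonneg (x i)).1 h4 i
      (Finset.mem_univ i)
    exact mul_self_eq_zero.1 this
  have hcont : Continuous fun t => (B t).det := by
    refine Continuous.matrix_det ?_
    fun_prop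
  have h0 : (B 0).det = 1 := by simp [B]
  have h1 : B 1 = A := by simp [B]
  rw [← h1]
  by_contra hneg
  push Not at hneg
  obtain ⟨t, -, ht⟩ := intermediate_value_Icc' (zero_le_one (α := ℝ)) hcont.continuousOn
    (show (0 : ℝ) ∈ Set.Icc ((B 1).det) ((B 0).det) from ⟨hneg, by rw [h0]; exact zero_le_one⟩)
  exact hne t ht

lemma alternating_ratio (b : Module.Basis (Fin d) ℝ V) (f g : V [⋀^Fin d]→ₗ[ℝ] ℝ)
    (w : Fin d → V) : f w * g b = f b * g w := by
  rw [f.eq_smul_basis_det b, g.eq_smul_basis_det b]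
  simp
  ring

lemma sign_cast_eq {x : ℝ} (hx : x ≠ 0) :
    ((SignType.sign x : ℝ) = 1 ∨ (SignType.sign x : ℝ) = -1) ∧ (SignType.sign x : ℝ) = |x|⁻¹ * x := by
  rcases hx.lt_or_gt with h | h
  · simp only [sign_neg h, abs_of_neg h]
    refine ⟨by simp, ?_⟩
    rw [inv_neg, neg_mul, inv_mul_cancel₀ hx]; simp
  · simp only [sign_pos h, abs_of_pos h]
    refine ⟨by simp, ?_⟩
    rw [inv_mul_cancel₀ hx]; simp

/-- The top degree part of the product of an orthonormal frame of `C₊`. -/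
lemma IsOrthonormalFrame.revProd_unit {J₁ J₂ : Gen V →ₗ[ℝ] Gen V} {a : Fin d → Gen V}
    (ha : IsOrthonormalFrame (-(J₁ ∘ₗ J₂)) a) (K : IsKahlerPair J₁ J₂) {e : Fin d → V}
    {ε : Fin d → V →L[ℝ] ℝ} (h : IsDualFrame e ε) (o : Orientation ℝ V (Fin d)) :
    (frameSign o (fun i => (a i).1) = 1 ∨ frameSign o (fun i => (a i).1) = -1) ∧
    ∀ w, ∃ t : ℝ, 0 < t ∧ ((frameSign o fun i => (a i).1 : ℝ) : ℂ) *
      revProd cl (List.ofFn a) (unitForm V) d w =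
        (((Equiv.Perm.sign (Fin.revPerm : Equiv.Perm (Fin d)) : ℤ) * t * o.someVector w : ℝ) : ℂ) := by
  have hfin := h.finite_vec
  let b : Module.Basis (Fin d) ℝ V := basisOfLinearIndependentOfCardEqFinrank'
    _ (ha.linearIndependent_fst K) (by rw [h.finrank_vec]; simp)
  have hb : ⇑b = fun i => (a i).1 := by simp [b]
  have ho : o.someVector b ≠ 0 :=
    (AlternatingMap.map_basis_ne_zero_iff b o.someVector).2 o.someVector_ne_zero
  rw [← hb]
  have hs := sign_cast_eq ho
  refine ⟨hs.1, fun w => ?_⟩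
  set f := frameVolume fun i : Fin d => (a i.rev).2 with hf
  have hfw : ∀ w, revProd cl (List.ofFn a) (unitForm V) d w = ((f w : ℝ) : ℂ) := fun w => by
    rw [revProd_top_degree (List.ofFn a) (τ := unitForm V) (j := 0)
      (fun k hk => by rw [unitForm, homog_ne (by omega)]) (fun _ _ => rfl) d (by simp),
      List.map_ofFn]
    refine (revProd_covectors (fun i => (a i).2) w).trans ?_
    rw [hf, frameVolume_apply, ← Matrix.det_transpose]
    rfl
  -- Orthonormality says that the matrix `ξ_i(X_j)`, where `a_i = X_i + ξ_i`, has the identity as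
  -- its symmetric part.
  set D := Matrix.det (Matrix.of fun i j => (a i).2 (a j).1)
  have hD : 0 < D := det_pos_of_add_transpose _ fun i j => by
    have := ha.2 i j
    rw [pairing] at this
    simp only [Matrix.of_apply]
    split_ifs at this ⊢ <;> linarith
  -- Reversing the order of the covectors costs the sign of the reversing permutation. This sign
  -- depends only on `d`, so it does not affect the comparison of orientations at different points.
  have hfb : f b = (Equiv.Perm.sign (Fin.revPerm : Equiv.Perm (Fin d)) : ℤ) * D := by
    rw [hf, frameVolume_apply, ← Matrix.det_transpose, ← Matrix.det_permute]
    rw [hb]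
    rfl
  have hr := alternating_ratio b f.toAlternatingMap o.someVector w
  simp only [ContinuousAlternatingMap.coe_toAlternatingMap] at hr
  refine ⟨|o.someVector b|⁻¹ * D, mul_pos (inv_pos.2 (abs_pos.2 ho)) hD, ?_⟩
  rw [hfw, ← Complex.ofReal_mul]
  congr 1
  rw [frameSign, hs.2]
  rw [hfb] at hr
  linear_combination |o.someVector b|⁻¹ * hr

end TopDegree

/-! ### The operator `σ(∗)` in terms of the bigrading -/

section Star

variable {V : Type*} [AddCommGroup V] [Module ℝ V] [TopologicalSpace V] {n : ℕ}
  {e : Fin (2 * n) → V} {ε : Fin (2 * n) → V →L[ℝ] ℝ} {J₁ J₂ : Gen V →ₗ[ℝ] Gen V}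

/-- The operator `i^(p+q)` on `U_{p,q}`. -/
def spinStar (e : Fin (2 * n) → V) (ε : Fin (2 * n) → V →L[ℝ] ℝ) (J₁ J₂ : Gen V →ₗ[ℝ] Gen V) :
    Module.End ℂ (Spinor V) :=
  starOp (2 * n) (spinEnd cl e ε J₁) (spinEnd cl e ε J₂)

lemma conjForm_revProd (l : List (Gen V)) (ρ : Spinor V) :
    conjForm (revProd cl l ρ) = revProd cl l (conjForm ρ) := by
  induction l generalizing ρ with
  | nil => rfl
  | cons A l ih => rw [revProd, Module.End.mul_apply, ih, conjForm_cl]; rfl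

lemma IsKahlerPair.conjForm_spinStar (K : IsKahlerPair J₁ J₂) (h : IsDualFrame e ε) (ρ : Spinor V) :
    conjForm (spinStar e ε J₁ J₂ ρ) = spinStar e ε J₁ J₂ (conjForm ρ) :=
  (K.isBigrading h h.isCliffordModule).starOp_semiconj (conjHom V) conjForm_smul
    (conjForm_spinEnd J₁) (conjForm_spinEnd J₂) ρ

/-- The operator `σ(∗)` is `±i^(p+q)` on `U_{p,q}`, the sign depending on the orientation. -/
lemma IsKahlerPair.revStar_eq (K : IsKahlerPair J₁ J₂) (h : IsDualFrame e ε)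
    (o : Orientation ℝ V (Fin (2 * n))) : ∃ z : ℝ, (z = 1 ∨ z = -1) ∧
      (∀ ρ, revStar o (-(J₁ ∘ₗ J₂)) ρ = (z : ℂ) • spinStar e ε J₁ J₂ ρ) ∧
      ∀ w, ∃ t : ℝ, 0 < t ∧ (z : ℂ) * spinStar e ε J₁ J₂ (unitForm V) (2 * n) w =
        (((Equiv.Perm.sign (Fin.revPerm : Equiv.Perm (Fin (2 * n))) : ℤ) * t *
          o.someVector w : ℝ) : ℂ) := by
  set a : Fin (2 * n) → Gen V := Classical.epsilon (IsOrthonormalFrame (-(J₁ ∘ₗ J₂))) with ha'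
  have ha : IsOrthonormalFrame (-(J₁ ∘ₗ J₂)) a := Classical.epsilon_spec (K.exists_frame h)
  have hc := h.isCliffordModule
  have hb := K.isBigrading h hc
  obtain ⟨z, hz2, hz⟩ := ha.revProd_eq K h hc
  obtain ⟨hκ, htop⟩ := ha.revProd_unit K h o
  set κ := frameSign o fun i => (a i).1
  have hz : ∀ ρ, revProd cl (List.ofFn a) ρ = z • spinStar e ε J₁ J₂ ρ := fun ρ => by rw [hz]; rfl
  -- Clifford multiplication by real vectors and the star operator both commute with conjugation, so
  -- their ratio `z` is real; combined with `z² = ±1` this forces `z = ±1`.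
  have hreal : (starRingEnd ℂ) z = z := by
    have hn := hc.nontrivial
    obtain ⟨v, hv⟩ := exists_ne (0 : Spinor V)
    have h1 := conjForm_revProd (List.ofFn a) v
    rw [hz, hz, conjForm_smul, K.conjForm_spinStar h] at h1
    refine smul_left_injective ℂ (m := spinStar e ε J₁ J₂ (conjForm v)) (fun h0 => hv ?_) h1
    have h2 : conjForm v = 0 := by
      have := congrArg (starInv (2 * n) (spinEnd cl e ε J₁) (spinEnd cl e ε J₂)) h0
      rw [map_zero] at this
      exact (LinearMap.congr_fun hb.starInv_mul_starOp (conjForm v)).symm.trans this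
    rw [← conjForm_conjForm v, h2, conjForm_zero]
  obtain ⟨r, rfl⟩ := Complex.conj_eq_iff_real.1 hreal
  have hr : r = 1 ∨ r = -1 := by
    rcases hz2 with h2 | h2
    · have : r ^ 2 = 1 := by exact_mod_cast h2
      exact mul_self_eq_one_iff.1 ((sq r).symm.trans this)
    · have : r ^ 2 = -1 := by exact_mod_cast h2
      nlinarith [sq_nonneg r]
  have hrev : ∀ ρ, revStar o (-(J₁ ∘ₗ J₂)) ρ = ((κ * r : ℝ) : ℂ) • spinStar e ε J₁ J₂ ρ := fun ρ => by
    have : revStar o (-(J₁ ∘ₗ J₂)) ρ = (κ : ℂ) • revProd cl (List.ofFn a) ρ := by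
      rw [← foldl_eq_revProd]; rfl
    rw [this, hz, smul_smul, Complex.ofReal_mul]
  refine ⟨κ * r, ?_, hrev, fun w => ?_⟩
  · rcases hκ with h1 | h1 <;> rcases hr with h2 | h2 <;> rw [h1, h2] <;> norm_num
  · obtain ⟨t, ht, hw⟩ := htop w
    refine ⟨t, ht, ?_⟩
    rw [← hw, hz, Pi.smul_apply, ContinuousAlternatingMap.smul_apply, Complex.ofReal_mul, smul_eq_mul,
      mul_assoc]

end Star

/-! ### Pullback of forms under linear maps -/

section Pullback

variable {V W Z : Type*} [AddCommGroup V] [Module ℝ V] [TopologicalSpace V]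
  [AddCommGroup W] [Module ℝ W] [TopologicalSpace W] [AddCommGroup Z] [Module ℝ Z]
  [TopologicalSpace Z]

/-- The pullback of forms under a linear map. -/
def pullback (L : V →L[ℝ] W) : Spinor W →ₗ[ℂ] Spinor V where
  toFun ρ := fun k => (ρ k).compContinuousLinearMap L
  map_add' _ _ := rfl
  map_smul' _ _ := rfl

lemma pullback_apply (L : V →L[ℝ] W) (ρ : Spinor W) (k : ℕ) :
    pullback L ρ k = (ρ k).compContinuousLinearMap L := rfl

lemma pullback_apply_apply (L : V →L[ℝ] W) (ρ : Spinor W) (k : ℕ) (v : Fin k → V) :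
    pullback L ρ k v = ρ k (L ∘ v) := rfl

lemma pullback_comp (L : V →L[ℝ] W) (L' : W →L[ℝ] Z) (ρ : Spinor Z) :
    pullback L (pullback L' ρ) = pullback (L'.comp L) ρ := rfl

lemma pullback_of_id {L : V →L[ℝ] V} (h : ∀ v, L v = v) (ρ : Spinor V) : pullback L ρ = ρ :=
  Spinor.ext fun k v => by
    rw [pullback_apply_apply]
    congr 1
    exact funext fun i => h _

lemma pullback_wedge (L : V →L[ℝ] W) (α β : Spinor W) :
    pullback L (wedge α β) = wedge (pullback L α) (pullback L β) := by
  refine Spinor.ext fun k v => ?_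
  rw [pullback_apply_apply, wedge_apply, wedge_apply]
  refine Finset.sum_congr rfl fun a _ => ?_
  rw [castDegree_apply, castDegree_apply, wedgeHom_apply, wedgeHom_apply]
  rfl

lemma pullback_homog (L : V →L[ℝ] W) {k : ℕ} (η : W [⋀^Fin k]→L[ℝ] ℂ) :
    pullback L (homog k η) = homog k (η.compContinuousLinearMap L) := by
  refine Spinor.ext fun m v => ?_
  rw [pullback_apply]
  by_cases hm : m = k
  · subst hm; rw [homog_same, homog_same]
  · rw [homog_ne hm, homog_ne hm]; rfl

lemma pullback_covector (L : V →L[ℝ] W) (ξ : W →L[ℝ] ℝ) :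
    pullback L (covector ξ) = covector (ξ.comp L) := by
  rw [covector, pullback_homog]; rfl

lemma pullback_cl (L : V →L[ℝ] W) (X : V) (ξ : W →L[ℝ] ℝ) (ρ : Spinor W) :
    pullback L (cl (L X, ξ) ρ) = cl (X, ξ.comp L) (pullback L ρ) := by
  rw [cl_split, cl_split (X, ξ.comp L), LinearMap.add_apply, LinearMap.add_apply, map_add,
    cl_covector, cl_covector, pullback_wedge, pullback_covector]
  congr 1
  refine Spinor.ext fun k v => ?_
  rw [pullback_apply_apply, cl_vector_apply, cl_vector_apply, pullback_apply_apply, Fin.comp_cons]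

lemma pullback_conjForm (L : V →L[ℝ] W) (ρ : Spinor W) :
    pullback L (conjForm ρ) = conjForm (pullback L ρ) := rfl

lemma pullback_parity (L : V →L[ℝ] W) (ρ : Spinor W) :
    pullback L (parity ρ) = parity (pullback L ρ) := rfl

lemma pullback_reversal (L : V →L[ℝ] W) (ρ : Spinor W) :
    pullback L (reversal ρ) = reversal (pullback L ρ) := rfl

end Pullback

section Expansion

variable {V : Type*} [AddCommGroup V] [Module ℝ V] [TopologicalSpace V] {d : ℕ}
  {e : Fin d → V} {ε : Fin d → V →L[ℝ] ℝ}

lemma IsDualFrame.form_expand {F : Type*} [NormedAddCommGroup F] [NormedSpace ℝ F]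
    (h : IsDualFrame e ε) {k : ℕ} (η : V [⋀^Fin k]→L[ℝ] F) (v : Fin k → V) :
    η v = ∑ I : Fin k → Fin d, (∏ i, ε (I i) (v i)) • η (e ∘ I) := by
  have h1 : v = fun i => ∑ j, ε j (v i) • e j := funext fun i => (h.span _).symm
  have h2 := η.toAlternatingMap.toMultilinearMap.map_sum (fun i j => ε j (v i) • e j)
  have h3 : ∀ I : Fin k → Fin d, η (fun i => ε (I i) (v i) • e (I i)) =
      (∏ i, ε (I i) (v i)) • η (e ∘ I) := fun I =>
    η.toAlternatingMap.toMultilinearMap.map_smul_univ (fun i => ε (I i) (v i)) (fun i => e (I i))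
  rw [← Finset.sum_congr rfl fun I _ => h3 I]
  conv_lhs => rw [h1]
  exact h2

end Expansion

/-! ### Smooth functions with values in forms on `ℝᵈ` -/

section Flat

/-- The standard frame of `ℝᵈ`. -/
def stdE (d : ℕ) (k : Fin d) : Mod d := EuclideanSpace.single k 1

/-- The dual of the standard frame of `ℝᵈ`. -/
def stdF (d : ℕ) (k : Fin d) : Mod d →L[ℝ] ℝ := EuclideanSpace.proj k

lemma stdF_apply {d : ℕ} (k : Fin d) (v : Mod d) : stdF d k v = v k := rfl

lemma stdFrame (d : ℕ) : IsDualFrame (stdE d) (stdF d) where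
  dual i j := by simp [stdE, stdF_apply]
  span v := by
    ext i
    simp [stdE, stdF_apply, Pi.single_apply]

variable {d : ℕ} {X : Type*} [NormedAddCommGroup X] [NormedSpace ℝ X]
  {F : Type*} [NormedAddCommGroup F] [NormedSpace ℝ F]

/-- Evaluation on tuples of frame vectors is an injective linear map into a finite-dimensional
space, with a linear left inverse that recovers the form from its coefficients. -/
lemma contDiffAt_form_iff [FiniteDimensional ℝ F] {k : ℕ} {n : WithTop ℕ∞}
    {f : X → Mod d [⋀^Fin k]→L[ℝ] F} {x : X} :
    ContDiffAt ℝ n f x ↔ ∀ v, ContDiffAt ℝ n (fun y => f y v) x := by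
  constructor
  · intro h v
    exact (ContinuousAlternatingMap.apply ℝ (Mod d) F v).contDiff.contDiffAt.comp x h
  · intro h
    let L : (Mod d [⋀^Fin k]→L[ℝ] F) →ₗ[ℝ] ((Fin k → Fin d) → F) :=
      { toFun := fun η I => η (stdE d ∘ I)
        map_add' := fun _ _ => rfl
        map_smul' := fun _ _ => rfl }
    have hL : LinearMap.ker L = ⊥ := LinearMap.ker_eq_bot'.2 fun η hη => by
      ext v
      rw [(stdFrame d).form_expand η v]
      refine Finset.sum_eq_zero fun I _ => ?_
      rw [show η (stdE d ∘ I) = 0 from congrFun hη I, smul_zero]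
    obtain ⟨R, hR⟩ := L.exists_leftInverse_of_injective hL
    have h1 : f = fun y => R.toContinuousLinearMap (L (f y)) :=
      funext fun y => (LinearMap.congr_fun hR (f y)).symm
    rw [h1]
    refine R.toContinuousLinearMap.contDiff.contDiffAt.comp x (contDiffAt_pi.2 fun I => ?_)
    exact h _

/-- Smoothness at a point of functions with values in forms. -/
def SmoothAt (α : X → Spinor (Mod d)) (x : X) : Prop := ∀ k, ContDiffAt ℝ ∞ (fun y => α y k) x

variable {α β : X → Spinor (Mod d)} {x : X}

lemma smoothAt_iff : SmoothAt α x ↔ ∀ k v, ContDiffAt ℝ ∞ (fun y => α y k v) x :=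
  forall_congr' fun _ => contDiffAt_form_iff

lemma SmoothAt.apply (h : SmoothAt α x) (k : ℕ) (v : Fin k → Mod d) :
    ContDiffAt ℝ ∞ (fun y => α y k v) x := smoothAt_iff.1 h k v

lemma SmoothAt.congr (h : SmoothAt α x) (he : α =ᶠ[nhds x] β) : SmoothAt β x := fun k =>
  (h k).congr_of_eventuallyEq (he.symm.mono fun _ hy => congrFun hy k)

lemma contDiffAt_form_apply {k : ℕ} {n : WithTop ℕ∞} {f : X → Mod d [⋀^Fin k]→L[ℝ] F}
    {v : X → Fin k → Mod d} (hf : ContDiffAt ℝ n f x)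
    (hv : ∀ i, ContDiffAt ℝ n (fun y => v y i) x) : ContDiffAt ℝ n (fun y => f y (v y)) x := by
  simp only [fun y => (stdFrame d).form_expand (f y) (v y)]
  refine ContDiffAt.sum fun I _ => ContDiffAt.smul (contDiffAt_prod fun i _ => ?_) ?_
  · exact (stdF d (I i)).contDiff.contDiffAt.comp x (hv i)
  · exact (ContinuousAlternatingMap.apply ℝ (Mod d) F (stdE d ∘ I)).contDiff.contDiffAt.comp x hf

lemma SmoothAt.apply' (h : SmoothAt α x) {k : ℕ} {v : X → Fin k → Mod d}
    (hv : ∀ i, ContDiffAt ℝ ∞ (fun y => v y i) x) : ContDiffAt ℝ ∞ (fun y => α y k (v y)) x :=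
  contDiffAt_form_apply (h k) hv

lemma SmoothAt.add (h : SmoothAt α x) (h' : SmoothAt β x) : SmoothAt (fun y => α y + β y) x :=
  fun k => (h k).add (h' k)

lemma SmoothAt.smul {f : X → ℂ} (hf : ContDiffAt ℝ ∞ f x) (h : SmoothAt α x) :
    SmoothAt (fun y => f y • α y) x :=
  smoothAt_iff.2 fun k v => hf.mul (h.apply k v)

lemma smoothAt_const (ρ : Spinor (Mod d)) : SmoothAt (fun _ : X => ρ) x := fun _ => contDiffAt_const

lemma SmoothAt.wedge (h : SmoothAt α x) (h' : SmoothAt β x) :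
    SmoothAt (fun y => wedge (α y) (β y)) x := smoothAt_iff.2 fun k v => by
  simp only [wedge_apply, castDegree_apply, wedgeHom_apply, altSum, fnTensor]
  refine ContDiffAt.sum fun a _ => contDiffAt_const.mul (ContDiffAt.sum fun σ _ =>
    contDiffAt_const.mul ((h.apply _ _).mul (h'.apply _ _)))

lemma SmoothAt.cl {A : X → Gen (Mod d)} (h : SmoothAt α x)
    (h₁ : ContDiffAt ℝ ∞ (fun y => (A y).1) x) (h₂ : ContDiffAt ℝ ∞ (fun y => (A y).2) x) :
    SmoothAt (fun y => cl (A y) (α y)) x := by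
  have e1 : SmoothAt (fun y => GenKahler.cl ((A y).1, 0) (α y)) x := smoothAt_iff.2 fun k v => by
    simp only [cl_vector_apply]
    refine h.apply' fun i => ?_
    refine Fin.cases ?_ (fun j => ?_) i
    · simpa using h₁
    · simpa using contDiffAt_const
  have e2 : SmoothAt (fun y => GenKahler.cl (0, (A y).2) (α y)) x := smoothAt_iff.2 fun k v => by
    rcases k with _ | k
    · simp only [cl_covector_zero]
      exact contDiffAt_const
    · simp only [cl_covector_succ]
      refine ContDiffAt.sum fun i _ => contDiffAt_const.mul (ContDiffAt.mul ?_ (h.apply _ _))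
      exact Complex.ofRealCLM.contDiff.contDiffAt.comp x (h₂.clm_apply contDiffAt_const)
  have e3 : (fun y => GenKahler.cl (A y) (α y)) =
      fun y => GenKahler.cl ((A y).1, 0) (α y) + GenKahler.cl (0, (A y).2) (α y) := by
    funext y
    rw [cl_split (A y), LinearMap.add_apply]
  rw [e3]
  exact e1.add e2

lemma SmoothAt.conjForm (h : SmoothAt α x) : SmoothAt (fun y => conjForm (α y)) x :=
  smoothAt_iff.2 fun k v => by
    simp only [conjForm_apply]
    exact Complex.conjCLE.contDiff.contDiffAt.comp x (h.apply k v)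

lemma SmoothAt.comp {Y : Type*} [NormedAddCommGroup Y] [NormedSpace ℝ Y] {f : Y → X} {y : Y}
    (h : SmoothAt α (f y)) (hf : ContDiffAt ℝ ∞ f y) : SmoothAt (fun z => α (f z)) y :=
  fun k => (h k).comp y hf

lemma SmoothAt.pullback {L : X → Mod d →L[ℝ] Mod d} (h : SmoothAt α x)
    (hL : ContDiffAt ℝ ∞ L x) : SmoothAt (fun y => pullback (L y) (α y)) x :=
  smoothAt_iff.2 fun k v => by
    simp only [pullback_apply_apply]
    exact h.apply' fun i => hL.clm_apply contDiffAt_const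

end Flat

/-! ### Partial derivatives and the exterior derivative on `ℝᵈ` -/

section Derivative

variable {d : ℕ} {α β : Mod d → Spinor (Mod d)} {x : Mod d}

/-- The partial derivatives of a function with values in forms. -/
def partialForm (i : Fin d) (α : Mod d → Spinor (Mod d)) (x : Mod d) : Spinor (Mod d) := fun k =>
  fderiv ℝ (fun y => α y k) x (stdE d i)

/-- The exterior derivative of forms of mixed degree on `ℝᵈ`. -/
def flatD (α : Mod d → Spinor (Mod d)) (x : Mod d) : Spinor (Mod d) := fun k =>
  match k with
  | 0 => 0
  | k + 1 => extDeriv (fun y => α y k) x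

lemma SmoothAt.differentiableAt (h : SmoothAt α x) (k : ℕ) :
    DifferentiableAt ℝ (fun y => α y k) x :=
  (h k).differentiableAt (by simp)

lemma SmoothAt.differentiableAt_apply (h : SmoothAt α x) (k : ℕ) (v : Fin k → Mod d) :
    DifferentiableAt ℝ (fun y => α y k v) x :=
  (h.apply k v).differentiableAt (by simp)

lemma partialForm_apply (h : SmoothAt α x) (i : Fin d) (k : ℕ) (v : Fin k → Mod d) :
    partialForm i α x k v = fderiv ℝ (fun y => α y k v) x (stdE d i) := by
  rw [fderiv_continuousAlternatingMap_apply_const_apply (h.differentiableAt k)]; rfl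

/-- With `d` written as the sum of the `ε_i ∧ ∂_i`, its derivation rules follow from those of the
`∂_i` and from Clifford algebra with constant covectors. -/
lemma flatD_eq (h : SmoothAt α x) :
    flatD α x = ∑ i, cl (0, stdF d i) (partialForm i α x) := by
  funext k
  rw [Finset.sum_apply]
  rcases k with _ | k
  · simp only [cl_covector_zero]; simp [flatD]
  · ext v
    rw [ContinuousAlternatingMap.sum_apply]
    simp only [cl_covector_succ]
    rw [Finset.sum_comm]
    change extDeriv (fun y => α y k) x v = _
    rw [extDeriv_apply (h.differentiableAt k)]
    refine Finset.sum_congr rfl fun i _ => ?_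
    rw [← Finset.mul_sum]
    have : fderiv ℝ (fun y => α y k (i.removeNth v)) x (v i) =
        ∑ j, ((stdF d j (v i) : ℝ) : ℂ) * partialForm j α x k (i.removeNth v) := by
      conv_lhs => rw [← (stdFrame d).span (v i), map_sum]
      refine Finset.sum_congr rfl fun j _ => ?_
      rw [map_smul, partialForm_apply h, Complex.real_smul]
    rw [this]
    simp

lemma SmoothAt.partialForm (h : SmoothAt α x) (i : Fin d) : SmoothAt (partialForm i α) x :=
  fun k => ((h k).fderiv_right (m := ∞) (by simp)).clm_apply contDiffAt_const

lemma partialForm_add (h : SmoothAt α x) (h' : SmoothAt β x) (i : Fin d) :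
    partialForm i (fun y => α y + β y) x = partialForm i α x + partialForm i β x := by
  funext k
  change fderiv ℝ (fun y => α y k + β y k) x (stdE d i) = _
  rw [fderiv_fun_add (h.differentiableAt k) (h'.differentiableAt k)]; rfl

lemma partialForm_smul {f : Mod d → ℂ} (hf : ContDiffAt ℝ ∞ f x) (h : SmoothAt α x) (i : Fin d) :
    partialForm i (fun y => f y • α y) x =
      fderiv ℝ f x (stdE d i) • α x + f x • partialForm i α x := by
  refine Spinor.ext fun k v => ?_
  rw [partialForm_apply (h.smul hf)]
  change fderiv ℝ (fun y => f y * α y k v) x (stdE d i) =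
    fderiv ℝ f x (stdE d i) * α x k v + f x * partialForm i α x k v
  rw [fderiv_fun_mul (hf.differentiableAt (by simp)) (h.differentiableAt_apply k v),
    partialForm_apply h]
  simp only [add_apply, smul_apply, smul_eq_mul]
  ring

lemma partialForm_wedge (h : SmoothAt α x) (h' : SmoothAt β x) (i : Fin d) :
    partialForm i (fun y => wedge (α y) (β y)) x =
      wedge (partialForm i α x) (β x) + wedge (α x) (partialForm i β x) := by
  refine Spinor.ext fun k v => ?_
  rw [partialForm_apply (h.wedge h'), Pi.add_apply, ContinuousAlternatingMap.add_apply]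
  simp only [wedge_apply, castDegree_apply, wedgeHom_apply, altSum, fnTensor]
  rw [← Finset.sum_add_distrib]
  have key : ∀ (a : Fin (k + 1)) (v : Fin (a + (k - a)) → Mod d),
      HasFDerivAt (fun y => (((a : ℕ).factorial * (k - a : ℕ).factorial : ℝ)⁻¹ : ℂ) *
        ∑ σ : Equiv.Perm (Fin (a + (k - a))), ((Equiv.Perm.sign σ : ℤ) : ℂ) *
          (α y a ((v ∘ σ) ∘ Fin.castAdd (k - a)) * β y (k - a) ((v ∘ σ) ∘ Fin.natAdd a)))
        ((((a : ℕ).factorial * (k - a : ℕ).factorial : ℝ)⁻¹ : ℂ) •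
        ∑ σ : Equiv.Perm (Fin (a + (k - a))), ((Equiv.Perm.sign σ : ℤ) : ℂ) •
          (α x a ((v ∘ σ) ∘ Fin.castAdd (k - a)) •
              fderiv ℝ (fun y => β y (k - a) ((v ∘ σ) ∘ Fin.natAdd a)) x +
            β x (k - a) ((v ∘ σ) ∘ Fin.natAdd a) •
              fderiv ℝ (fun y => α y a ((v ∘ σ) ∘ Fin.castAdd (k - a))) x)) x := fun a v =>
    HasFDerivAt.const_mul (HasFDerivAt.fun_sum fun σ _ => HasFDerivAt.const_mul
      ((h.differentiableAt_apply _ _).hasFDerivAt.mul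
        (h'.differentiableAt_apply _ _).hasFDerivAt) _) _
  rw [(HasFDerivAt.fun_sum fun a _ => key a _).fderiv, sum_apply]
  refine Finset.sum_congr rfl fun a _ => ?_
  rw [← mul_add, ← Finset.sum_add_distrib]
  simp only [smul_apply, sum_apply,
    add_apply, smul_eq_mul, partialForm_apply h, partialForm_apply h']
  congr 1
  exact Finset.sum_congr rfl fun σ _ => by ring

end Derivative

/-! ### Forms and the exterior derivative in charts -/

section Charts

variable {d : ℕ} {M : Type*} [TopologicalSpace M] [ChartedSpace (Mod d) M] [IsManifold (𝓡 d) ∞ M]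

lemma chartInvDeriv_eq_within (x₀ : M) (y : Mod d) :
    chartInvDeriv x₀ y =
      mfderivWithin 𝓘(ℝ, Mod d) (𝓡 d) (extChartAt (𝓡 d) x₀).symm (Set.range (𝓡 d)) y := by
  rw [ModelWithCorners.range_eq_univ, mfderivWithin_univ]; rfl

lemma manifold_one : IsManifold (𝓡 d) 1 M := IsManifold.of_le (n := ∞) (by simp)

lemma chartDeriv_chartInvDeriv (x₀ : M) {y : Mod d} (hy : y ∈ (extChartAt (𝓡 d) x₀).target)
    (v : Mod d) : chartDeriv x₀ ((extChartAt (𝓡 d) x₀).symm y) (chartInvDeriv x₀ y v) = v := by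
  have := manifold_one (d := d) (M := M)
  rw [chartInvDeriv_eq_within]
  exact DFunLike.congr_fun (mfderiv_extChartAt_comp_mfderivWithin_extChartAt_symm
    (I := 𝓡 d) hy) v

lemma chartInvDeriv_chartDeriv (x₀ : M) {y : Mod d} (hy : y ∈ (extChartAt (𝓡 d) x₀).target)
    (v : Tan d ((extChartAt (𝓡 d) x₀).symm y)) :
    chartInvDeriv x₀ y (chartDeriv x₀ ((extChartAt (𝓡 d) x₀).symm y) v) = v := by
  have := manifold_one (d := d) (M := M)
  rw [chartInvDeriv_eq_within]
  exact DFunLike.congr_fun (mfderivWithin_extChartAt_symm_comp_mfderiv_extChartAt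
    (I := 𝓡 d) hy) v

lemma mdifferentiableAt_chart (x₀ : M) {x : M} (hx : x ∈ (extChartAt (𝓡 d) x₀).source) :
    MDifferentiableAt (𝓡 d) 𝓘(ℝ, Mod d) (extChartAt (𝓡 d) x₀) x := by
  have := manifold_one (d := d) (M := M)
  exact mdifferentiableAt_extChartAt (by rwa [← extChartAt_source (𝓡 d)])

lemma mdifferentiableAt_chart_symm (x₀ : M) {y : Mod d} (hy : y ∈ (extChartAt (𝓡 d) x₀).target) :
    MDifferentiableAt 𝓘(ℝ, Mod d) (𝓡 d) (extChartAt (𝓡 d) x₀).symm y := by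
  have := manifold_one (d := d) (M := M)
  have h := mdifferentiableWithinAt_extChartAt_symm (I := 𝓡 d) hy
  rwa [ModelWithCorners.range_eq_univ, mdifferentiableWithinAt_univ] at h

/-- The coordinate frame of the chart at `x₀`, at the point `x`: the inverse of the differential of
the chart. -/
def chartFrame (x₀ x : M) : Mod d →L[ℝ] Tan d x := (chartDeriv x₀ x).inverse

/-- Indexing the coordinate frame by points of `M` instead of coordinates avoids transport between
the tangent spaces at `x` and at the image of its coordinates under the inverse chart. -/
lemma chartInvDeriv_eq_frame (x₀ : M) {y : Mod d} (hy : y ∈ (extChartAt (𝓡 d) x₀).target) :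
    chartInvDeriv x₀ y = chartFrame x₀ ((extChartAt (𝓡 d) x₀).symm y) := by
  refine (ContinuousLinearMap.inverse_eq ?_ ?_).symm
  · exact ContinuousLinearMap.ext (chartDeriv_chartInvDeriv x₀ hy)
  · exact ContinuousLinearMap.ext (chartInvDeriv_chartDeriv x₀ hy)

lemma chartDeriv_chartFrame (x₀ : M) {x : M} (hx : x ∈ (extChartAt (𝓡 d) x₀).source) (v : Mod d) :
    chartDeriv x₀ x (chartFrame x₀ x v) = v := by
  have hy := (extChartAt (𝓡 d) x₀).map_source hx
  have h := chartDeriv_chartInvDeriv x₀ hy v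
  rw [chartInvDeriv_eq_frame x₀ hy] at h
  rwa [(extChartAt (𝓡 d) x₀).left_inv hx] at h

lemma chartFrame_chartDeriv (x₀ : M) {x : M} (hx : x ∈ (extChartAt (𝓡 d) x₀).source)
    (v : Tan d x) : chartFrame x₀ x (chartDeriv x₀ x v) = v := by
  have hy := (extChartAt (𝓡 d) x₀).map_source hx
  have h := chartInvDeriv_chartDeriv x₀ hy
  rw [chartInvDeriv_eq_frame x₀ hy] at h
  rw [(extChartAt (𝓡 d) x₀).left_inv hx] at h
  exact h v

/-- The change of coordinates from the chart at `x₁` to the chart at `x₀`. -/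
def chartChange (x₁ x₀ : M) : Mod d → Mod d :=
  extChartAt (𝓡 d) x₀ ∘ (extChartAt (𝓡 d) x₁).symm

lemma contDiffAt_chartChange (x₁ x₀ : M) {x : M} (h₁ : x ∈ (extChartAt (𝓡 d) x₁).source)
    (h₀ : x ∈ (extChartAt (𝓡 d) x₀).source) :
    ContDiffAt ℝ ∞ (chartChange x₁ x₀ : Mod d → Mod d) (extChartAt (𝓡 d) x₁ x) := by
  have h := contDiffWithinAt_ext_coord_change (I := 𝓡 d) (n := ∞) x₀ x₁
    (y := extChartAt (𝓡 d) x₁ x) (by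
      rw [PartialEquiv.trans_source, PartialEquiv.symm_source]
      refine ⟨(extChartAt (𝓡 d) x₁).map_source h₁, ?_⟩
      rwa [Set.mem_preimage, (extChartAt (𝓡 d) x₁).left_inv h₁])
  rwa [ModelWithCorners.range_eq_univ, contDiffWithinAt_univ] at h

lemma chartChange_apply (x₁ x₀ : M) {x : M} (h₁ : x ∈ (extChartAt (𝓡 d) x₁).source) :
    (chartChange x₁ x₀ : Mod d → Mod d) (extChartAt (𝓡 d) x₁ x) = extChartAt (𝓡 d) x₀ x := by
  rw [chartChange, Function.comp_apply, (extChartAt (𝓡 d) x₁).left_inv h₁]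

lemma fderiv_chartChange (x₁ x₀ : M) {x : M} (h₁ : x ∈ (extChartAt (𝓡 d) x₁).source)
    (h₀ : x ∈ (extChartAt (𝓡 d) x₀).source) :
    fderiv ℝ (chartChange x₁ x₀ : Mod d → Mod d) (extChartAt (𝓡 d) x₁ x) =
      (chartDeriv x₀ x).comp (chartFrame x₁ x) := by
  have hy := (extChartAt (𝓡 d) x₁).map_source h₁
  have hi := (extChartAt (𝓡 d) x₁).left_inv h₁
  have h : mfderiv 𝓘(ℝ, Mod d) 𝓘(ℝ, Mod d) (chartChange x₁ x₀ : Mod d → Mod d)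
      (extChartAt (𝓡 d) x₁ x) = _ :=
    mfderiv_comp (extChartAt (𝓡 d) x₁ x) (I' := 𝓡 d) (g := extChartAt (𝓡 d) x₀)
      (mdifferentiableAt_chart x₀ (by rwa [hi])) (mdifferentiableAt_chart_symm x₁ hy)
  rw [mfderiv_eq_fderiv] at h
  rw [h]
  have h2 := chartInvDeriv_eq_frame x₁ hy
  rw [chartInvDeriv] at h2
  rw [h2]
  change (chartDeriv x₀ _).comp _ = _
  rw [hi]
  rfl

lemma eventually_chart (x₀ : M) {x : M} (hx : x ∈ (extChartAt (𝓡 d) x₀).source) {p : M → Prop}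
    (hp : ∀ᶠ z in nhds x, p z) :
    ∀ᶠ y in nhds (extChartAt (𝓡 d) x₀ x), y ∈ (extChartAt (𝓡 d) x₀).target ∧
      p ((extChartAt (𝓡 d) x₀).symm y) := by
  have hy := (extChartAt (𝓡 d) x₀).map_source hx
  have ht : ∀ᶠ y in nhds (extChartAt (𝓡 d) x₀ x), y ∈ (extChartAt (𝓡 d) x₀).target :=
    (isOpen_extChartAt_target x₀).mem_nhds hy
  refine ht.and ?_
  have hc := continuousAt_extChartAt_symm'' (I := 𝓡 d) hy
  have : Filter.Tendsto (extChartAt (𝓡 d) x₀).symm (nhds (extChartAt (𝓡 d) x₀ x)) (nhds x) := by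
    have h2 := hc.tendsto
    rwa [(extChartAt (𝓡 d) x₀).left_inv hx] at h2
  exact this.eventually hp

lemma eventually_source (x₀ : M) {x : M} (hx : x ∈ (extChartAt (𝓡 d) x₀).source) :
    ∀ᶠ z in nhds x, z ∈ (extChartAt (𝓡 d) x₀).source :=
  (isOpen_extChartAt_source x₀).mem_nhds hx

/-- The coordinate expression of a form in the chart at `x₀`, at the point `x`. -/
def rep (ρ : Form d M) (x₀ x : M) : Spinor (Mod d) := pullback (chartFrame x₀ x) (ρ x)

/-- The coordinate expression of a form in the chart at `x₀`, as a function of the coordinates. -/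
def loc (ρ : Form d M) (x₀ : M) (y : Mod d) : Spinor (Mod d) :=
  rep ρ x₀ ((extChartAt (𝓡 d) x₀).symm y)

lemma localRep_eq_loc (ρ : Form d M) (x₀ : M) {y : Mod d}
    (hy : y ∈ (extChartAt (𝓡 d) x₀).target) (k : ℕ) :
    localRep (fun x => ρ x k) x₀ y = loc ρ x₀ y k := by
  rw [localRep, chartInvDeriv_eq_frame x₀ hy]; rfl

lemma rep_change (ρ : Form d M) (x₀ x₁ : M) {x : M} (h₀ : x ∈ (extChartAt (𝓡 d) x₀).source)
    (h₁ : x ∈ (extChartAt (𝓡 d) x₁).source) : rep ρ x₁ x =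
      pullback (fderiv ℝ (chartChange x₁ x₀ : Mod d → Mod d) (extChartAt (𝓡 d) x₁ x))
        (rep ρ x₀ x) := by
  rw [fderiv_chartChange x₁ x₀ h₁ h₀, rep, rep, pullback_comp]
  congr 1
  congr 1
  ext1 v
  exact (chartFrame_chartDeriv x₀ h₀ _).symm

lemma loc_change (ρ : Form d M) (x₀ x₁ : M) {x : M} (h₀ : x ∈ (extChartAt (𝓡 d) x₀).source)
    (h₁ : x ∈ (extChartAt (𝓡 d) x₁).source) :
    loc ρ x₁ =ᶠ[nhds (extChartAt (𝓡 d) x₁ x)] fun y =>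
      pullback (fderiv ℝ (chartChange x₁ x₀ : Mod d → Mod d) y)
        (loc ρ x₀ (chartChange x₁ x₀ y)) := by
  filter_upwards [eventually_chart x₁ h₁ ((eventually_source x₀ h₀).and (eventually_source x₁ h₁))]
    with y hy
  have h := rep_change ρ x₀ x₁ hy.2.1 hy.2.2
  rw [(extChartAt (𝓡 d) x₁).right_inv hy.1] at h
  rw [loc, loc, h, chartChange, Function.comp_apply, (extChartAt (𝓡 d) x₀).left_inv hy.2.1]

/-- Smoothness of a form at a point. -/
def Form.SmoothAt (ρ : Form d M) (x : M) : Prop :=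
  GenKahler.SmoothAt (loc ρ x) (extChartAt (𝓡 d) x x)

lemma smoothAt_chart_change {ρ : Form d M} {x₀ x₁ x : M}
    (h₀ : x ∈ (extChartAt (𝓡 d) x₀).source) (h₁ : x ∈ (extChartAt (𝓡 d) x₁).source)
    (h : SmoothAt (loc ρ x₀) (extChartAt (𝓡 d) x₀ x)) :
    SmoothAt (loc ρ x₁) (extChartAt (𝓡 d) x₁ x) := by
  have hc := contDiffAt_chartChange x₁ x₀ h₁ h₀
  refine SmoothAt.congr ?_ (loc_change ρ x₀ x₁ h₀ h₁).symm
  refine SmoothAt.pullback ?_ (hc.fderiv_right (m := ∞) (by simp))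
  refine SmoothAt.comp ?_ hc
  rwa [chartChange_apply x₁ x₀ h₁]

lemma Form.smoothAt_iff {ρ : Form d M} (x₀ : M) {x : M}
    (h₀ : x ∈ (extChartAt (𝓡 d) x₀).source) :
    ρ.SmoothAt x ↔ GenKahler.SmoothAt (loc ρ x₀) (extChartAt (𝓡 d) x₀ x) :=
  ⟨smoothAt_chart_change (mem_extChartAt_source x) h₀,
    smoothAt_chart_change h₀ (mem_extChartAt_source x)⟩

lemma contDiffOn_iff_contDiffAt_of_eq {F : Type*} [NormedAddCommGroup F] [NormedSpace ℝ F]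
    (f : Mod d → F) (g : Mod d → F) {s : Set (Mod d)} (hs : IsOpen s) (h : ∀ y ∈ s, f y = g y) :
    ContDiffOn ℝ ∞ f s ↔ ∀ y ∈ s, ContDiffAt ℝ ∞ g y := by
  rw [contDiffOn_congr h]
  exact ⟨fun h' y hy => h'.contDiffAt (hs.mem_nhds hy), fun h' y hy => (h' y hy).contDiffWithinAt⟩

lemma Form.isSmooth_iff {ρ : Form d M} : ρ.IsSmooth ↔ ∀ x, ρ.SmoothAt x := by
  constructor
  · intro h x k
    exact (contDiffOn_iff_contDiffAt_of_eq _ _ (isOpen_extChartAt_target x)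
      (fun y hy => localRep_eq_loc ρ x hy k)).1 (h k x) _ (mem_extChartAt_target x)
  · intro h k x₀
    refine (contDiffOn_iff_contDiffAt_of_eq _ _ (isOpen_extChartAt_target x₀)
      (fun y hy => localRep_eq_loc ρ x₀ hy k)).2 fun y hy => ?_
    have h1 := (smoothAt_iff x₀ ((extChartAt (𝓡 d) x₀).map_target hy)).1 (h _) k
    rwa [(extChartAt (𝓡 d) x₀).right_inv hy] at h1

lemma Form.IsSmooth.loc {ρ : Form d M} (h : ρ.IsSmooth) (x₀ : M) {y : Mod d}
    (hy : y ∈ (extChartAt (𝓡 d) x₀).target) : GenKahler.SmoothAt (loc ρ x₀) y := by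
  have h1 := (Form.smoothAt_iff x₀ ((extChartAt (𝓡 d) x₀).map_target hy)).1 (isSmooth_iff.1 h _)
  rwa [(extChartAt (𝓡 d) x₀).right_inv hy] at h1

lemma Form.SmoothAt.congr {ρ τ : Form d M} {x : M} (h : ρ.SmoothAt x) (he : ∀ᶠ z in nhds x, ρ z = τ z) :
    τ.SmoothAt x := by
  refine GenKahler.SmoothAt.congr h ?_
  filter_upwards [eventually_chart x (mem_extChartAt_source (I := 𝓡 d) x) he] with y hy
  rw [GenKahler.loc, GenKahler.loc, rep, rep, hy.2]

/-! ### The exterior derivative in charts -/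

lemma rep_extD_self (ρ : Form d M) (x : M) :
    rep (Form.extD ρ) x x = flatD (loc ρ x) (extChartAt (𝓡 d) x x) := by
  funext k
  rcases k with _ | k
  · rfl
  · change ((extDeriv (localRep (fun x => ρ x k) x)
      (extChartAt (𝓡 d) x x)).compContinuousLinearMap (chartDeriv x x)).compContinuousLinearMap
        (chartFrame x x) = extDeriv (fun y => loc ρ x y k) (extChartAt (𝓡 d) x x)
    have he : localRep (fun x => ρ x k) x =ᶠ[nhds (extChartAt (𝓡 d) x x)]
        fun y => loc ρ x y k := by
      filter_upwards [(isOpen_extChartAt_target x).mem_nhds (mem_extChartAt_target (I := 𝓡 d) x)]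
        with y hy using localRep_eq_loc ρ x hy k
    rw [he.extDeriv_eq]
    ext v
    change extDeriv (fun y => loc ρ x y k) (extChartAt (𝓡 d) x x)
      (fun i => chartDeriv x x (chartFrame x x (v i))) = _
    simp only [chartDeriv_chartFrame x (mem_extChartAt_source (I := 𝓡 d) x)]

lemma flatD_congr {α β : Mod d → Spinor (Mod d)} {y : Mod d} (h : α =ᶠ[nhds y] β) :
    flatD α y = flatD β y := by
  funext k
  rcases k with _ | k
  · rfl
  · exact Filter.EventuallyEq.extDeriv_eq (h.mono fun _ hz => congrFun hz k)

lemma flatD_pullback {α : Mod d → Spinor (Mod d)} {f : Mod d → Mod d} {y : Mod d}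
    (hα : SmoothAt α (f y)) (hf : ContDiffAt ℝ ∞ f y) :
    flatD (fun z => pullback (fderiv ℝ f z) (α (f z))) y =
      pullback (fderiv ℝ f y) (flatD α (f y)) := by
  funext k
  rcases k with _ | k
  · rfl
  · exact extDeriv_pullback (hα.differentiableAt k) hf (by
      rw [minSmoothness_of_isRCLikeNormedField]; exact ENat.LEInfty.out)

/-- The derivative at `x` is defined in the chart at `x`. Naturality of `d` under the change of
coordinates shows that any other chart around `x` computes it too. -/
lemma rep_extD {ρ : Form d M} {x₀ x : M} (h₀ : x ∈ (extChartAt (𝓡 d) x₀).source)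
    (h : ρ.SmoothAt x) :
    rep (Form.extD ρ) x₀ x = flatD (loc ρ x₀) (extChartAt (𝓡 d) x₀ x) := by
  have hx := mem_extChartAt_source (I := 𝓡 d) x
  rw [rep_change _ x x₀ hx h₀, rep_extD_self, flatD_congr (loc_change ρ x x₀ hx h₀),
    flatD_pullback _ (contDiffAt_chartChange x₀ x h₀ hx), chartChange_apply x₀ x h₀]
  rw [chartChange_apply x₀ x h₀]
  exact h

lemma loc_extD {ρ : Form d M} (h : ρ.IsSmooth) (x₀ : M) {y : Mod d}
    (hy : y ∈ (extChartAt (𝓡 d) x₀).target) : loc (Form.extD ρ) x₀ y = flatD (loc ρ x₀) y := by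
  have := rep_extD ((extChartAt (𝓡 d) x₀).map_target hy) (Form.isSmooth_iff.1 h _)
  rwa [(extChartAt (𝓡 d) x₀).right_inv hy] at this

lemma SmoothAt.sum {X : Type*} [NormedAddCommGroup X] [NormedSpace ℝ X] {ι : Type*} (s : Finset ι)
    {α : ι → X → Spinor (Mod d)} {x : X} (h : ∀ i, SmoothAt (α i) x) :
    SmoothAt (fun y => ∑ i ∈ s, α i y) x := by
  classical
  induction s using Finset.induction_on with
  | empty => simpa using smoothAt_const 0
  | insert i s hi ih => simpa [Finset.sum_insert hi] using (h i).add ih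

lemma Form.IsSmooth.extD {ρ : Form d M} (h : ρ.IsSmooth) : (Form.extD ρ).IsSmooth := by
  refine isSmooth_iff.2 fun x => ?_
  have hx := mem_extChartAt_target (I := 𝓡 d) x
  have he : ∀ᶠ y in nhds (extChartAt (𝓡 d) x x), y ∈ (extChartAt (𝓡 d) x).target :=
    (isOpen_extChartAt_target x).mem_nhds hx
  refine GenKahler.SmoothAt.congr (α := fun y => ∑ i, cl (0, stdF d i) (partialForm i (GenKahler.loc ρ x) y))
    (SmoothAt.sum _ fun i => ?_) ?_
  · exact ((h.loc x hx).partialForm i).cl contDiffAt_const contDiffAt_const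
  · filter_upwards [he] with y hy
    rw [loc_extD h x hy, flatD_eq (h.loc x hy)]

end Charts

/-! ### Smooth sections of `T ⊕ T*` in charts -/

section Sections

variable {d : ℕ} {M : Type*} [TopologicalSpace M] [ChartedSpace (Mod d) M] [IsManifold (𝓡 d) ∞ M]

lemma pullback_rep (ρ : Form d M) (x₀ : M) {x : M} (hx : x ∈ (extChartAt (𝓡 d) x₀).source) :
    pullback (chartDeriv x₀ x) (rep ρ x₀ x) = ρ x := by
  rw [rep, pullback_comp]
  exact pullback_of_id (fun v => chartFrame_chartDeriv x₀ hx v) _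

lemma eq_of_rep_eq {ρ τ : Form d M} (x₀ : M) {x : M} (hx : x ∈ (extChartAt (𝓡 d) x₀).source)
    (h : rep ρ x₀ x = rep τ x₀ x) : ρ x = τ x := by
  rw [← pullback_rep ρ x₀ hx, h, pullback_rep τ x₀ hx]

lemma Form.SmoothAt.add {ρ τ : Form d M} {x : M} (h : ρ.SmoothAt x) (h' : τ.SmoothAt x) :
    Form.SmoothAt (fun z => ρ z + τ z) x :=
  (GenKahler.SmoothAt.add h h').congr (Filter.Eventually.of_forall fun _ => (map_add _ _ _).symm)

lemma contDiffAt_of_contMDiffAt {F : Type*} [NormedAddCommGroup F] [NormedSpace ℝ F] {f : M → F}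
    {x₀ x : M} (hx : x ∈ (extChartAt (𝓡 d) x₀).source)
    (hf : ContMDiffAt (𝓡 d) 𝓘(ℝ, F) ∞ f x) :
    ContDiffAt ℝ ∞ (f ∘ (extChartAt (𝓡 d) x₀).symm) (extChartAt (𝓡 d) x₀ x) := by
  rw [contMDiffAt_iff_source_of_mem_source (x := x₀) (by rwa [← extChartAt_source (𝓡 d)]),
    ModelWithCorners.range_eq_univ, contMDiffWithinAt_univ, contMDiffAt_iff_contDiffAt] at hf
  exact hf

lemma contMDiffAt_of_contDiffAt {F : Type*} [NormedAddCommGroup F] [NormedSpace ℝ F] {f : M → F}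
    {x₀ x : M} (hx : x ∈ (extChartAt (𝓡 d) x₀).source)
    (hf : ContDiffAt ℝ ∞ (f ∘ (extChartAt (𝓡 d) x₀).symm) (extChartAt (𝓡 d) x₀ x)) :
    ContMDiffAt (𝓡 d) 𝓘(ℝ, F) ∞ f x := by
  rw [contMDiffAt_iff_source_of_mem_source (x := x₀) (by rwa [← extChartAt_source (𝓡 d)]),
    ModelWithCorners.range_eq_univ, contMDiffWithinAt_univ, contMDiffAt_iff_contDiffAt]
  exact hf

lemma Form.SmoothAt.fsmul {f : M → ℂ} {ρ : Form d M} {x : M}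
    (hf : ContMDiffAt (𝓡 d) 𝓘(ℝ, ℂ) ∞ f x) (h : ρ.SmoothAt x) :
    Form.SmoothAt (fun z => f z • ρ z) x :=
  (GenKahler.SmoothAt.smul (contDiffAt_of_contMDiffAt (mem_extChartAt_source x) hf) h).congr
    (Filter.Eventually.of_forall fun _ => (map_smul (pullback _) _ _).symm)

lemma Form.SmoothAt.smul (c : ℂ) {ρ : Form d M} {x : M} (h : ρ.SmoothAt x) :
    Form.SmoothAt (fun z => c • ρ z) x := h.fsmul contMDiffAt_const

lemma Form.SmoothAt.wedge {ρ τ : Form d M} {x : M} (h : ρ.SmoothAt x) (h' : τ.SmoothAt x) :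
    Form.SmoothAt (fun z => wedge (ρ z) (τ z)) x :=
  (GenKahler.SmoothAt.wedge h h').congr
    (Filter.Eventually.of_forall fun _ => (pullback_wedge _ _ _).symm)

lemma Form.SmoothAt.conjForm {ρ : Form d M} {x : M} (h : ρ.SmoothAt x) :
    Form.SmoothAt (fun z => conjForm (ρ z)) x :=
  (GenKahler.SmoothAt.conjForm h).congr
    (Filter.Eventually.of_forall fun _ => (pullback_conjForm _ _).symm)

lemma form_smoothAt_zero (x : M) : Form.SmoothAt (0 : Form d M) x :=
  (smoothAt_const (0 : Spinor (Mod d))).congr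
    (Filter.Eventually.of_forall fun _ => (map_zero (pullback _)).symm)

lemma Form.SmoothAt.parity {ρ : Form d M} {x : M} (h : ρ.SmoothAt x) :
    Form.SmoothAt (fun z => parity (ρ z)) x := by
  refine GenKahler.SmoothAt.congr (α := fun y => GenKahler.parity (loc ρ x y)) ?_
    (Filter.Eventually.of_forall fun _ => (pullback_parity _ _).symm)
  exact GenKahler.smoothAt_iff.2 fun k v => by
    simp only [parity_apply]
    exact contDiffAt_const.mul (GenKahler.SmoothAt.apply h k v)

/-! ### Sections of the generalized tangent bundle in charts -/

/-- The coordinate expression of a section of `T ⊕ T*` in the chart at `x₀`, at the point `x`. -/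
def repG (A : GenSec d M) (x₀ x : M) : Gen (Mod d) :=
  (chartDeriv x₀ x (A x).1, (A x).2.comp (chartFrame x₀ x))

/-- The coordinate expression of a section of `T ⊕ T*` as a function of the coordinates. -/
def locG (A : GenSec d M) (x₀ : M) (y : Mod d) : Gen (Mod d) :=
  repG A x₀ ((extChartAt (𝓡 d) x₀).symm y)

lemma rep_cl (A : GenSec d M) (ρ : Form d M) (x₀ : M) {x : M}
    (hx : x ∈ (extChartAt (𝓡 d) x₀).source) :
    rep (fun z => cl (A z) (ρ z)) x₀ x = cl (repG A x₀ x) (rep ρ x₀ x) := by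
  have h : (A x) = (chartFrame x₀ x (chartDeriv x₀ x (A x).1), (A x).2) :=
    Prod.ext (chartFrame_chartDeriv x₀ hx _).symm rfl
  unfold rep
  beta_reduce
  conv_lhs => rw [h]
  exact pullback_cl _ _ _ _

/-- Smoothness of a section of `T ⊕ T*` at a point. -/
def GenSec.SmoothAt (A : GenSec d M) (x : M) : Prop :=
  ContDiffAt ℝ ∞ (locG A x) (extChartAt (𝓡 d) x x)

lemma locG_change (A : GenSec d M) (x₀ x₁ : M) {x : M} (h₀ : x ∈ (extChartAt (𝓡 d) x₀).source)
    (h₁ : x ∈ (extChartAt (𝓡 d) x₁).source) :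
    locG A x₁ =ᶠ[nhds (extChartAt (𝓡 d) x₁ x)] fun y =>
      (fderiv ℝ (chartChange x₀ x₁ : Mod d → Mod d) (chartChange x₁ x₀ y)
        (locG A x₀ (chartChange x₁ x₀ y)).1,
        (locG A x₀ (chartChange x₁ x₀ y)).2.comp
          (fderiv ℝ (chartChange x₁ x₀ : Mod d → Mod d) y)) := by
  filter_upwards [eventually_chart x₁ h₁ ((eventually_source x₀ h₀).and (eventually_source x₁ h₁))]
    with y hy
  obtain ⟨hy, hz₀, hz₁⟩ := hy
  have e1 := fderiv_chartChange x₁ x₀ hz₁ hz₀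
  have e2 := fderiv_chartChange x₀ x₁ hz₀ hz₁
  rw [(extChartAt (𝓡 d) x₁).right_inv hy] at e1
  have e3 : locG A x₀ (chartChange x₁ x₀ y) = repG A x₀ ((extChartAt (𝓡 d) x₁).symm y) := by
    rw [locG, chartChange, Function.comp_apply, (extChartAt (𝓡 d) x₀).left_inv hz₀]
  have e4 : (chartChange x₁ x₀ : Mod d → Mod d) y =
      extChartAt (𝓡 d) x₀ ((extChartAt (𝓡 d) x₁).symm y) := rfl
  rw [e1, e3, e4, e2, locG]
  refine Prod.ext ?_ ?_
  · change chartDeriv x₁ _ _ = chartDeriv x₁ _ (chartFrame x₀ _ (chartDeriv x₀ _ _))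
    rw [chartFrame_chartDeriv x₀ hz₀]
  · ext v
    change (A _).2 (chartFrame x₁ _ v) = (A _).2 (chartFrame x₀ _ (chartDeriv x₀ _
      (chartFrame x₁ _ v)))
    rw [chartFrame_chartDeriv x₀ hz₀]

lemma smoothAtG_chart_change {A : GenSec d M} {x₀ x₁ x : M}
    (h₀ : x ∈ (extChartAt (𝓡 d) x₀).source) (h₁ : x ∈ (extChartAt (𝓡 d) x₁).source)
    (h : ContDiffAt ℝ ∞ (locG A x₀) (extChartAt (𝓡 d) x₀ x)) :
    ContDiffAt ℝ ∞ (locG A x₁) (extChartAt (𝓡 d) x₁ x) := by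
  have hc := contDiffAt_chartChange x₁ x₀ h₁ h₀
  have hc' := contDiffAt_chartChange x₀ x₁ h₀ h₁
  have e := chartChange_apply x₁ x₀ h₁
  refine ContDiffAt.congr_of_eventuallyEq ?_ (locG_change A x₀ x₁ h₀ h₁)
  rw [← e] at h hc'
  have h2 := h.comp _ hc
  refine ContDiffAt.prodMk ?_ ?_
  · exact ((hc'.fderiv_right (m := ∞) (by simp)).comp _ hc).clm_apply
      (contDiff_fst.contDiffAt.comp _ h2)
  · exact (contDiff_snd.contDiffAt.comp _ h2).clm_comp (hc.fderiv_right (m := ∞) (by simp))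

lemma GenSec.smoothAt_iff {A : GenSec d M} (x₀ : M) {x : M}
    (h₀ : x ∈ (extChartAt (𝓡 d) x₀).source) :
    A.SmoothAt x ↔ ContDiffAt ℝ ∞ (locG A x₀) (extChartAt (𝓡 d) x₀ x) :=
  ⟨smoothAtG_chart_change (mem_extChartAt_source x) h₀,
    smoothAtG_chart_change h₀ (mem_extChartAt_source x)⟩

lemma GenSec.isSmooth_iff {A : GenSec d M} : A.IsSmooth ↔ ∀ x, A.SmoothAt x := by
  have key : ∀ x₀, (ContDiffOn ℝ ∞ (fun y : Mod d =>
        chartDeriv x₀ ((extChartAt (𝓡 d) x₀).symm y) (A ((extChartAt (𝓡 d) x₀).symm y)).1)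
      (extChartAt (𝓡 d) x₀).target ∧
    ContDiffOn ℝ ∞ (fun y : Mod d =>
        (A ((extChartAt (𝓡 d) x₀).symm y)).2.comp (chartInvDeriv x₀ y))
      (extChartAt (𝓡 d) x₀).target) ↔
      ∀ y ∈ (extChartAt (𝓡 d) x₀).target, ContDiffAt ℝ ∞ (locG A x₀) y := fun x₀ => by
    refine (and_congr (contDiffOn_iff_contDiffAt_of_eq _ (fun y => (locG A x₀ y).1)
        (isOpen_extChartAt_target x₀) fun y _ => rfl)
      (contDiffOn_iff_contDiffAt_of_eq _ (fun y => (locG A x₀ y).2)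
        (isOpen_extChartAt_target x₀) fun y hy => by
          rw [chartInvDeriv_eq_frame x₀ hy]; rfl)).trans ?_
    exact ⟨fun h y hy => (h.1 y hy).prodMk (h.2 y hy), fun h =>
      ⟨fun y hy => contDiff_fst.contDiffAt.comp _ (h y hy),
        fun y hy => contDiff_snd.contDiffAt.comp _ (h y hy)⟩⟩
  constructor
  · intro h x
    exact (key x).1 (h x) _ (mem_extChartAt_target x)
  · intro h x₀
    refine (key x₀).2 fun y hy => ?_
    have h1 := (smoothAt_iff x₀ ((extChartAt (𝓡 d) x₀).map_target hy)).1 (h _)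
    rwa [(extChartAt (𝓡 d) x₀).right_inv hy] at h1

lemma Form.SmoothAt.cl {A : GenSec d M} {ρ : Form d M} {x : M} (hA : A.SmoothAt x)
    (h : ρ.SmoothAt x) : Form.SmoothAt (fun z => cl (A z) (ρ z)) x := by
  refine (GenKahler.SmoothAt.cl (A := locG A x) h (contDiff_fst.contDiffAt.comp _ hA)
    (contDiff_snd.contDiffAt.comp _ hA)).congr ?_
  filter_upwards [eventually_chart x (mem_extChartAt_source (I := 𝓡 d) x)
    (eventually_source x (mem_extChartAt_source (I := 𝓡 d) x))] with y hy
  exact (rep_cl A ρ x hy.2).symm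

lemma Form.SmoothAt.sum {ι : Type*} (s : Finset ι) {ρ : ι → Form d M} {x : M}
    (h : ∀ i, (ρ i).SmoothAt x) : Form.SmoothAt (fun z => ∑ i ∈ s, ρ i z) x := by
  classical
  induction s using Finset.induction_on with
  | empty => exact form_smoothAt_zero x
  | insert i s hi ih => simpa [Finset.sum_insert hi] using (h i).add ih

lemma GenSec.IsSmooth.neg {A : GenSec d M} (h : A.IsSmooth) :
    GenSec.IsSmooth (fun x => -A x) := by
  refine GenSec.isSmooth_iff.2 fun x => ?_
  have := (GenSec.isSmooth_iff.1 h x).neg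
  refine this.congr_of_eventuallyEq (Filter.Eventually.of_forall fun y => ?_)
  exact Prod.ext (map_neg _ _) (by ext v; rfl)

/-! ### Extension of vectors to sections -/

/-- The form with coefficients `f • ρ₀` in the chart at `x₀`. -/
def extendForm (x₀ : M) (f : M → ℂ) (ρ₀ : Spinor (Mod d)) : Form d M := fun x =>
  f x • pullback (chartDeriv x₀ x) ρ₀

/-- The section of `T ⊕ T*` with coefficients `f • A₀` in the chart at `x₀`. -/
def extendGen (x₀ : M) (f : M → ℝ) (A₀ : Gen (Mod d)) : GenSec d M := fun x =>
  f x • (chartFrame x₀ x A₀.1, A₀.2.comp (chartDeriv x₀ x))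

lemma rep_extendForm (x₀ : M) (f : M → ℂ) (ρ₀ : Spinor (Mod d)) {x : M}
    (hx : x ∈ (extChartAt (𝓡 d) x₀).source) : rep (extendForm x₀ f ρ₀) x₀ x = f x • ρ₀ := by
  rw [rep, extendForm, map_smul, pullback_comp]
  congr 1
  exact pullback_of_id (fun v => chartDeriv_chartFrame x₀ hx v) _

lemma repG_extendGen (x₀ : M) (f : M → ℝ) (A₀ : Gen (Mod d)) {x : M}
    (hx : x ∈ (extChartAt (𝓡 d) x₀).source) : repG (extendGen x₀ f A₀) x₀ x = f x • A₀ := by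
  refine Prod.ext ?_ ?_
  · change chartDeriv x₀ x (f x • chartFrame x₀ x A₀.1) = f x • A₀.1
    rw [map_smul, chartDeriv_chartFrame x₀ hx]
  · ext v
    change f x * A₀.2 (chartDeriv x₀ x (chartFrame x₀ x v)) = f x * A₀.2 v
    rw [chartDeriv_chartFrame x₀ hx]

lemma extendForm_isSmooth {x₀ : M} {f : M → ℂ} (hf : ContMDiff (𝓡 d) 𝓘(ℝ, ℂ) ∞ f)
    (hs : tsupport f ⊆ (extChartAt (𝓡 d) x₀).source) (ρ₀ : Spinor (Mod d)) :
    (extendForm x₀ f ρ₀).IsSmooth := by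
  refine Form.isSmooth_iff.2 fun x => ?_
  by_cases hx : x ∈ (extChartAt (𝓡 d) x₀).source
  · refine (Form.smoothAt_iff x₀ hx).2 ((GenKahler.SmoothAt.smul (contDiffAt_of_contMDiffAt hx (hf x))
      (smoothAt_const ρ₀)).congr ?_)
    filter_upwards [eventually_chart x₀ hx (eventually_source x₀ hx)] with y hy
    exact (rep_extendForm x₀ f ρ₀ hy.2).symm
  · refine (form_smoothAt_zero x).congr ?_
    filter_upwards [(isClosed_tsupport f).isOpen_compl.mem_nhds fun h => hx (hs h)] with z hz
    rw [extendForm, image_eq_zero_of_notMem_tsupport hz]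
    exact (zero_smul ℂ (pullback (chartDeriv x₀ z) ρ₀)).symm

lemma extendGen_isSmooth {x₀ : M} {f : M → ℝ} (hf : ContMDiff (𝓡 d) 𝓘(ℝ, ℝ) ∞ f)
    (hs : tsupport f ⊆ (extChartAt (𝓡 d) x₀).source) (A₀ : Gen (Mod d)) :
    (extendGen x₀ f A₀).IsSmooth := by
  refine GenSec.isSmooth_iff.2 fun x => ?_
  by_cases hx : x ∈ (extChartAt (𝓡 d) x₀).source
  · refine (GenSec.smoothAt_iff x₀ hx).2 (ContDiffAt.congr_of_eventuallyEq
      ((contDiffAt_of_contMDiffAt hx (hf x)).smul (contDiffAt_const (c := A₀))) ?_)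
    filter_upwards [eventually_chart x₀ hx (eventually_source x₀ hx)] with y hy
    exact repG_extendGen x₀ f A₀ hy.2
  · refine ContDiffAt.congr_of_eventuallyEq (contDiffAt_const (c := 0)) ?_
    have : ∀ᶠ z in nhds x, f z = 0 := by
      filter_upwards [(isClosed_tsupport f).isOpen_compl.mem_nhds fun h => hx (hs h)] with z hz
      exact image_eq_zero_of_notMem_tsupport hz
    filter_upwards [eventually_chart x (mem_extChartAt_source (I := 𝓡 d) x) this] with y hy
    rw [locG, repG, extendGen, hy.2]
    refine Prod.ext ?_ ?_
    · change chartDeriv x _ ((0 : ℝ) • _) = 0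
      rw [zero_smul ℝ, map_zero]
    · ext v
      change (0 : ℝ) * _ = 0
      rw [zero_mul]

end Sections

/-! ### Derivation rules of the exterior derivative on `ℝᵈ` -/

section FlatDerivative

variable {d : ℕ} {α β : Mod d → Spinor (Mod d)} {x : Mod d}

lemma flatD_add (h : SmoothAt α x) (h' : SmoothAt β x) :
    flatD (fun y => α y + β y) x = flatD α x + flatD β x := by
  rw [flatD_eq (h.add h'), flatD_eq h, flatD_eq h', ← Finset.sum_add_distrib]
  exact Finset.sum_congr rfl fun i _ => by rw [partialForm_add h h', map_add]

/-- The covectors are the real and imaginary parts of `df`. They do not depend on `β`: the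
commutator of `d` with `f` is a complex Clifford element. -/
lemma flatD_fsmul {f : Mod d → ℂ} (hf : ContDiffAt ℝ ∞ f x) :
    ∃ ξ η : Mod d →L[ℝ] ℝ, ∀ β : Mod d → Spinor (Mod d), SmoothAt β x →
      flatD (fun y => f y • β y) x =
        f x • flatD β x + (cl (0, ξ) (β x) + Complex.I • cl (0, η) (β x)) := by
  refine ⟨∑ i, (fderiv ℝ f x (stdE d i)).re • stdF d i,
    ∑ i, (fderiv ℝ f x (stdE d i)).im • stdF d i, fun β h => ?_⟩
  have e : ∀ (g : Fin d → ℝ) (ρ : Spinor (Mod d)), cl (0, ∑ i, g i • stdF d i) ρ =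
      ∑ i, (g i : ℂ) • cl (0, stdF d i) ρ := fun g ρ => by
    have : ((0, ∑ i, g i • stdF d i) : Gen (Mod d)) = ∑ i, g i • ((0, stdF d i) : Gen (Mod d)) := by
      refine Prod.ext ?_ ?_
      · rw [Prod.fst_sum]; simp
      · rw [Prod.snd_sum]; simp
    rw [this, map_sum, LinearMap.sum_apply]
    refine Finset.sum_congr rfl fun i _ => ?_
    rw [c_real_smul]; rfl
  rw [flatD_eq (h.smul hf), flatD_eq h, e, e, Finset.smul_sum, Finset.smul_sum,
    ← Finset.sum_add_distrib, ← Finset.sum_add_distrib]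
  refine Finset.sum_congr rfl fun i _ => ?_
  rw [partialForm_smul hf h, map_add, map_smul, map_smul]
  conv_lhs => rw [← Complex.re_add_im (fderiv ℝ f x (stdE d i))]
  module

lemma SmoothAt.parity (h : SmoothAt α x) : SmoothAt (fun y => parity (α y)) x :=
  smoothAt_iff.2 fun k v => contDiffAt_const.mul (h.apply k v)

lemma partialForm_parity (h : SmoothAt α x) (i : Fin d) :
    partialForm i (fun y => parity (α y)) x = parity (partialForm i α x) := by
  refine Spinor.ext fun k v => ?_
  rw [partialForm_apply h.parity, parity_apply, ContinuousAlternatingMap.smul_apply,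
    partialForm_apply h]
  change fderiv ℝ (fun y => (-1 : ℂ) ^ k * α y k v) x (stdE d i) = _
  rw [fderiv_const_mul (h.differentiableAt_apply k v)]
  rfl

lemma flatD_parity (h : SmoothAt α x) :
    flatD (fun y => parity (α y)) x = -parity (flatD α x) := by
  rw [flatD_eq h.parity, flatD_eq h, map_sum, ← Finset.sum_neg_distrib]
  refine Finset.sum_congr rfl fun i _ => ?_
  rw [partialForm_parity h, cl_covector, cl_covector, parity_covector_wedge, neg_neg]

lemma partialForm_conjForm (h : SmoothAt α x) (i : Fin d) :
    partialForm i (fun y => conjForm (α y)) x = conjForm (partialForm i α x) := by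
  refine Spinor.ext fun k v => ?_
  rw [partialForm_apply h.conjForm, conjForm_apply, partialForm_apply h]
  exact DFunLike.congr_fun (Complex.conjCLE.comp_fderiv (f := fun y => α y k v) (x := x)) _

lemma flatD_conjForm (h : SmoothAt α x) :
    flatD (fun y => conjForm (α y)) x = conjForm (flatD α x) := by
  rw [flatD_eq h.conjForm, flatD_eq h]
  refine Eq.trans ?_ (map_sum (conjHom (Mod d)) _ _).symm
  refine Finset.sum_congr rfl fun i _ => ?_
  rw [partialForm_conjForm h]
  exact (conjForm_cl _ _).symm

lemma flatD_wedge (h : SmoothAt α x) (h' : SmoothAt β x) (hα : parity (α x) = -α x) :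
    flatD (fun y => wedge (α y) (β y)) x = wedge (flatD α x) (β x) - wedge (α x) (flatD β x) := by
  rw [flatD_eq (h.wedge h'), flatD_eq h, flatD_eq h']
  have e1 : wedge (∑ i, cl (0, stdF d i) (partialForm i α x)) (β x) =
      ∑ i, wedge (cl (0, stdF d i) (partialForm i α x)) (β x) :=
    map_sum (wedgeLin.flip (β x)) _ _
  have e2 : wedge (α x) (∑ i, cl (0, stdF d i) (partialForm i β x)) =
      ∑ i, wedge (α x) (cl (0, stdF d i) (partialForm i β x)) :=
    map_sum (wedgeLin (α x)) _ _
  rw [e1, e2, ← Finset.sum_sub_distrib]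
  refine Finset.sum_congr rfl fun i _ => ?_
  rw [partialForm_wedge h h', map_add, cl_covector, cl_covector, cl_covector, cl_covector,
    covector_wedge_assoc, (stdFrame d).wedge_covector_wedge, hα, wedge_neg_left, wedge_neg_right,
    sub_neg_eq_add]

lemma flatD_flatD (h : SmoothAt α x) : flatD (flatD α) x = 0 := by
  funext k
  rcases k with _ | _ | k
  · rfl
  · change extDeriv (fun y => (0 : Mod d [⋀^Fin 0]→L[ℝ] ℂ)) x = 0
    rw [← extDerivWithin_univ]
    ext v
    rw [extDerivWithin_univ, extDeriv_apply (by fun_prop)]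
    simp
  · exact extDeriv_extDeriv_apply (h k) (by
      rw [minSmoothness_of_isRCLikeNormedField]; exact ENat.LEInfty.out)

end FlatDerivative

/-! ### The twisted exterior derivative -/

section TwistedDerivative

variable {d : ℕ} {M : Type*} [TopologicalSpace M] [ChartedSpace (Mod d) M] [IsManifold (𝓡 d) ∞ M]
  {H : KForm d M ℝ 3}

/-- The standard frame of the model space as a frame of the tangent space. -/
def tanE (d : ℕ) {M : Type*} [TopologicalSpace M] [ChartedSpace (Mod d) M] (x : M) : Fin d → Tan d x := stdE d

/-- The dual of the standard frame as a coframe of the tangent space. -/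
def tanF (d : ℕ) {M : Type*} [TopologicalSpace M] [ChartedSpace (Mod d) M] (x : M) : Fin d → Tan d x →L[ℝ] ℝ := stdF d

lemma tanFrame (x : M) : IsDualFrame (tanE d x) (tanF d x) := stdFrame d

/-- The three-form `H` as a complex form of mixed degree. -/
def threeForm (H : KForm d M ℝ 3) : Form d M := fun x => homog 3 (complexify (H x))

lemma rep_threeForm (H : KForm d M ℝ 3) (x₀ : M) {y : Mod d}
    (hy : y ∈ (extChartAt (𝓡 d) x₀).target) :
    loc (threeForm H) x₀ y = homog 3 (complexify (localRep H x₀ y)) := by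
  rw [loc, rep, threeForm, pullback_homog, localRep, chartInvDeriv_eq_frame x₀ hy]
  rfl

lemma threeForm_isSmooth (hH : H.IsSmooth) : (threeForm H).IsSmooth := by
  refine Form.isSmooth_iff.2 fun x => ?_
  have hx := mem_extChartAt_target (I := 𝓡 d) x
  have he : ∀ᶠ y in nhds (extChartAt (𝓡 d) x x), y ∈ (extChartAt (𝓡 d) x).target :=
    (isOpen_extChartAt_target x).mem_nhds hx
  refine SmoothAt.congr (α := fun y => homog 3 (complexify (localRep H x y))) (fun k => ?_)
    (he.mono fun y hy => (rep_threeForm H x hy).symm)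
  have h := (hH x).contDiffAt ((isOpen_extChartAt_target x).mem_nhds hx)
  by_cases hk : k = 3
  · subst hk
    simp only [homog_same]
    exact contDiffAt_form_iff.2 fun v =>
      Complex.ofRealCLM.contDiff.contDiffAt.comp _ (contDiffAt_form_iff.1 h v)
  · simp only [homog_ne hk]
    exact contDiffAt_const

lemma threeForm_odd (H : KForm d M ℝ 3) (x : M) : parity (threeForm H x) = -threeForm H x :=
  homog_three_odd _

lemma conjForm_threeForm (H : KForm d M ℝ 3) (x : M) :
    conjForm (threeForm H x) = threeForm H x := by
  refine Spinor.ext fun k v => ?_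
  rw [conjForm_apply, threeForm]
  by_cases hk : k = 3
  · subst hk
    rw [homog_same]
    exact Complex.conj_ofReal _
  · rw [homog_ne hk]
    exact map_zero _

/-- The differential of the chart is invertible, so closedness of `H` means that the coordinate
derivative vanishes; the components of the complexified form have the same derivatives, viewed in
`ℂ`. -/
lemma extD_threeForm (hH : H.IsSmooth) (hc : ∀ x, KForm.extD H x = 0) (x : M) :
    Form.extD (threeForm H) x = 0 := by
  have hx := mem_extChartAt_target (I := 𝓡 d) x
  have hs := mem_extChartAt_source (I := 𝓡 d) x
  have he : ∀ᶠ y in nhds (extChartAt (𝓡 d) x x), y ∈ (extChartAt (𝓡 d) x).target :=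
    (isOpen_extChartAt_target x).mem_nhds hx
  have h := (hH x).contDiffAt ((isOpen_extChartAt_target x).mem_nhds hx)
  have hz : extDeriv (localRep H x) (extChartAt (𝓡 d) x x) = 0 := by
    ext v
    have := DFunLike.congr_fun (hc x) (fun i => chartFrame x x (v i))
    change extDeriv (localRep H x) (extChartAt (𝓡 d) x x)
      (fun i => chartDeriv x x (chartFrame x x (v i))) = 0 at this
    simp only [chartDeriv_chartFrame x hs] at this
    exact this
  refine eq_of_rep_eq (τ := 0) x hs ?_
  rw [rep_extD_self, flatD_congr (he.mono fun y hy => rep_threeForm H x hy)]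
  refine Eq.trans ?_ (map_zero (pullback _)).symm
  funext k
  rcases k with _ | k
  · rfl
  change extDeriv (fun y => homog 3 (complexify (localRep H x y)) k) (extChartAt (𝓡 d) x x) = 0
  by_cases hk : k = 3
  · subst hk
    simp only [homog_same]
    ext v
    have h1 := DFunLike.congr_fun hz v
    rw [extDeriv_apply (h.differentiableAt (by simp))] at h1
    have hd : DifferentiableAt ℝ (fun y => complexify (localRep H x y)) (extChartAt (𝓡 d) x x) :=
      (contDiffAt_form_iff.2 fun v =>
        Complex.ofRealCLM.contDiff.contDiffAt.comp _
          (contDiffAt_form_iff.1 h v)).differentiableAt (n := ∞) (by simp)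
    rw [extDeriv_apply hd]
    have h2 : ∀ w u, fderiv ℝ (fun y => complexify (localRep H x y) w) (extChartAt (𝓡 d) x x) u =
        ((fderiv ℝ (fun y => localRep H x y w) (extChartAt (𝓡 d) x x) u : ℝ) : ℂ) := fun w u =>
      DFunLike.congr_fun (Complex.ofRealCLM.hasFDerivAt.comp _ ((contDiffAt_form_iff.1 h
        w).differentiableAt (by simp)).hasFDerivAt).fderiv u
    simp only [h2]
    refine Eq.trans ?_ (congrArg Complex.ofReal h1)
    push_cast
    refine Finset.sum_congr rfl fun i _ => ?_
    simp
  · simp only [homog_ne hk]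
    ext v
    rw [extDeriv_apply (by fun_prop)]
    simp

lemma dH_apply (ρ : Form d M) (x : M) :
    dH H ρ x = Form.extD ρ x + wedge (threeForm H x) (ρ x) := rfl

lemma Form.IsSmooth.dH {ρ : Form d M} (hρ : ρ.IsSmooth) (hH : H.IsSmooth) :
    (dH H ρ).IsSmooth :=
  Form.isSmooth_iff.2 fun x => (Form.isSmooth_iff.1 hρ.extD x).add
    ((Form.isSmooth_iff.1 (threeForm_isSmooth hH) x).wedge (Form.isSmooth_iff.1 hρ x))

/-- The twisted exterior derivative in the chart at the point. -/
lemma rep_dH (ρ : Form d M) (x : M) : rep (dH H ρ) x x =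
    flatD (loc ρ x) (extChartAt (𝓡 d) x x) + wedge (rep (threeForm H) x x) (rep ρ x x) := by
  rw [← rep_extD_self, rep, dH_apply, map_add, pullback_wedge]
  rfl

lemma loc_self (ρ : Form d M) (x : M) : loc ρ x (extChartAt (𝓡 d) x x) = rep ρ x x := by
  rw [loc, extChartAt_to_inv]

lemma dH_add {ρ τ : Form d M} {x : M} (h : ρ.SmoothAt x) (h' : τ.SmoothAt x) :
    dH H (fun z => ρ z + τ z) x = dH H ρ x + dH H τ x := by
  refine eq_of_rep_eq (τ := fun x => dH H ρ x + dH H τ x) x (mem_extChartAt_source x) ?_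
  have e : loc (fun z => ρ z + τ z) x = fun y => loc ρ x y + loc τ x y :=
    funext fun y => map_add _ _ _
  have e2 : rep (fun z => ρ z + τ z) x x = rep ρ x x + rep τ x x := map_add _ _ _
  rw [rep_dH, e, flatD_add h h', e2, wedge_add_right]
  refine Eq.trans ?_ (map_add (pullback _) _ _).symm
  change _ = rep (dH H ρ) x x + rep (dH H τ) x x
  rw [rep_dH, rep_dH]
  abel

/-- The Leibniz rule for the product of a function and a form. -/
lemma dH_fsmul {f : M → ℂ} {x : M} (hf : ContMDiffAt (𝓡 d) 𝓘(ℝ, ℂ) ∞ f x) :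
    ∃ ξ η : Tan d x →L[ℝ] ℝ, ∀ ρ : Form d M, ρ.SmoothAt x → dH H (fun z => f z • ρ z) x =
      f x • dH H ρ x + (cl (0, ξ) (ρ x) + Complex.I • cl (0, η) (ρ x)) := by
  have hs := mem_extChartAt_source (I := 𝓡 d) x
  obtain ⟨ξ, η, h⟩ := flatD_fsmul (contDiffAt_of_contMDiffAt hs hf)
  refine ⟨ξ.comp (chartDeriv x x), η.comp (chartDeriv x x), fun ρ hρ => ?_⟩
  have e : loc (fun z => f z • ρ z) x = fun y =>
      (f ∘ (extChartAt (𝓡 d) x).symm) y • loc ρ x y := funext fun y => map_smul (pullback _) _ _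
  have e2 : rep (fun z => f z • ρ z) x x = f x • rep ρ x x := map_smul (pullback _) _ _
  have e3 : (f ∘ (extChartAt (𝓡 d) x).symm) (extChartAt (𝓡 d) x x) = f x := by
    rw [Function.comp_apply, extChartAt_to_inv]
  have h1 := h (loc ρ x) hρ
  rw [e3, loc_self, ← e] at h1
  have h2 : rep (dH H (fun z => f z • ρ z)) x x = f x • rep (dH H ρ) x x +
      (cl (0, ξ) (rep ρ x x) + Complex.I • cl (0, η) (rep ρ x x)) := by
    rw [rep_dH, h1, e2, rep_dH, wedge_smul_right, smul_add]
    abel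
  rw [← pullback_rep (dH H _) x hs, h2, map_add, map_add, map_smul, map_smul, pullback_rep _ x hs]
  have h3 : ∀ ζ : Mod d →L[ℝ] ℝ, pullback (chartDeriv x x) (cl (0, ζ) (rep ρ x x)) =
      cl (0, ζ.comp (chartDeriv x x)) (ρ x) := fun ζ => by
    conv_rhs => rw [← pullback_rep ρ x hs]
    have := pullback_cl (chartDeriv x x) 0 ζ (rep ρ x x)
    rwa [map_zero] at this
  rw [h3, h3]

lemma dH_smul (c : ℂ) {ρ : Form d M} {x : M} (h : ρ.SmoothAt x) :
    dH H (fun z => c • ρ z) x = c • dH H ρ x := by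
  refine eq_of_rep_eq (τ := fun x => c • dH H ρ x) x (mem_extChartAt_source x) ?_
  have e : loc (fun z => c • ρ z) x = fun y => c • loc ρ x y :=
    funext fun y => map_smul (pullback _) _ _
  have e2 : rep (fun z => c • ρ z) x x = c • rep ρ x x := map_smul (pullback _) _ _
  refine Eq.trans ?_ (map_smul (pullback _) _ _).symm
  change _ = c • rep (dH H ρ) x x
  rw [rep_dH, rep_dH, e, e2, wedge_smul_right, smul_add]
  congr 1
  rw [flatD_eq h, flatD_eq (GenKahler.SmoothAt.smul contDiffAt_const h), Finset.smul_sum]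
  refine Finset.sum_congr rfl fun i _ => ?_
  rw [partialForm_smul contDiffAt_const h, ← map_smul]
  congr 1
  rw [fderiv_fun_const, Pi.zero_apply, zero_apply, zero_smul ℂ (loc ρ x _), zero_add]

lemma dH_parity {ρ : Form d M} {x : M} (h : ρ.SmoothAt x) :
    dH H (fun z => parity (ρ z)) x = -parity (dH H ρ x) := by
  rw [← map_neg]
  refine eq_of_rep_eq (τ := fun x => parity (-dH H ρ x)) x (mem_extChartAt_source x) ?_
  have e : loc (fun z => parity (ρ z)) x = fun y => parity (loc ρ x y) :=
    funext fun y => pullback_parity _ _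
  have e2 : rep (fun z => parity (ρ z)) x x = parity (rep ρ x x) := pullback_parity _ _
  refine Eq.trans ?_ (pullback_parity _ _).symm
  rw [map_neg, map_neg]
  change _ = -parity (rep (dH H ρ) x x)
  have e3 : parity (rep (threeForm H) x x) = -rep (threeForm H) x x := by
    rw [rep, ← pullback_parity, threeForm_odd, map_neg]
  rw [rep_dH, rep_dH, e, e2, flatD_parity h, map_add, (stdFrame d).parity_wedge, e3,
    wedge_neg_left]
  abel

lemma dH_conjForm {ρ : Form d M} {x : M} (h : ρ.SmoothAt x) :
    dH H (fun z => conjForm (ρ z)) x = conjForm (dH H ρ x) := by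
  refine eq_of_rep_eq (τ := fun x => conjForm (dH H ρ x)) x (mem_extChartAt_source x) ?_
  have e : loc (fun z => conjForm (ρ z)) x = fun y => conjForm (loc ρ x y) :=
    funext fun y => pullback_conjForm _ _
  have e2 : rep (fun z => conjForm (ρ z)) x x = conjForm (rep ρ x x) := pullback_conjForm _ _
  refine Eq.trans ?_ (pullback_conjForm _ _).symm
  change _ = conjForm (rep (dH H ρ) x x)
  have e3 : conjForm (rep (threeForm H) x x) = rep (threeForm H) x x := by
    rw [rep, ← pullback_conjForm, conjForm_threeForm]
  rw [rep_dH, rep_dH, e, e2, flatD_conjForm h, conjForm_add, (stdFrame d).conjForm_wedge, e3]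

lemma extD_congr {ρ τ : Form d M} {x : M} (he : ∀ᶠ z in nhds x, ρ z = τ z) :
    Form.extD ρ x = Form.extD τ x := by
  refine eq_of_rep_eq x (mem_extChartAt_source x) ?_
  rw [rep_extD_self, rep_extD_self]
  refine flatD_congr ?_
  filter_upwards [eventually_chart x (mem_extChartAt_source (I := 𝓡 d) x) he] with y hy
  rw [loc, loc, rep, rep, hy.2]

lemma dH_congr {ρ τ : Form d M} {x : M} (he : ∀ᶠ z in nhds x, ρ z = τ z) :
    dH H ρ x = dH H τ x := by
  rw [dH_apply, dH_apply, extD_congr he, he.self_of_nhds]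

lemma loc_dH {ρ : Form d M} (h : ρ.IsSmooth) (x₀ : M) {y : Mod d}
    (hy : y ∈ (extChartAt (𝓡 d) x₀).target) :
    loc (dH H ρ) x₀ y = flatD (loc ρ x₀) y + wedge (loc (threeForm H) x₀ y) (loc ρ x₀ y) := by
  rw [← loc_extD h x₀ hy, loc, rep, dH_apply, map_add, pullback_wedge]
  rfl

/-- Since `H` is odd, the square is `d² + dH ∧ · + H ∧ H ∧ ·`, the cross terms `H ∧ d` cancelling.
Each of the three remaining terms vanishes. -/
lemma dH_dH (hH : H.IsSmooth) (hc : ∀ x, KForm.extD H x = 0) {ρ : Form d M} (h : ρ.IsSmooth)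
    (x : M) : dH H (dH H ρ) x = 0 := by
  have hs := mem_extChartAt_source (I := 𝓡 d) x
  have hx := mem_extChartAt_target (I := 𝓡 d) x
  have he : ∀ᶠ y in nhds (extChartAt (𝓡 d) x x), y ∈ (extChartAt (𝓡 d) x).target :=
    (isOpen_extChartAt_target x).mem_nhds hx
  have hη := threeForm_isSmooth hH
  refine eq_of_rep_eq (τ := 0) x hs (Eq.trans ?_ (map_zero (pullback _)).symm)
  have e3 : parity (loc (threeForm H) x (extChartAt (𝓡 d) x x)) =
      -loc (threeForm H) x (extChartAt (𝓡 d) x x) := by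
    rw [loc_self, rep, ← pullback_parity, threeForm_odd, map_neg]
  have e4 : flatD (loc (threeForm H) x) (extChartAt (𝓡 d) x x) = 0 := by
    rw [← rep_extD_self, rep, extD_threeForm hH hc, map_zero]
  have e5 : SmoothAt (flatD (loc ρ x)) (extChartAt (𝓡 d) x x) :=
    (h.extD.loc x hx).congr (he.mono fun y hy => loc_extD h x hy)
  rw [rep_dH, flatD_congr (he.mono fun y hy => loc_dH h x hy),
    flatD_add e5 ((hη.loc x hx).wedge (h.loc x hx)), flatD_flatD (h.loc x hx),
    flatD_wedge (hη.loc x hx) (h.loc x hx) e3, e4, ← loc_self, ← loc_self, loc_dH h x hx,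
    wedge_add_right, (stdFrame d).odd_wedge_odd_wedge e3]
  have : wedge 0 (loc ρ x (extChartAt (𝓡 d) x x)) = 0 := map_zero (wedgeLin.flip _)
  rw [this]
  abel

end TwistedDerivative

/-! ### Algebra of the double commutator and of derived brackets -/

section Algebra

variable {S : Type*} [AddCommGroup S] [Module ℂ S]

/-- Bracketing with `N` and bracketing with `F` commute when `N` and `F` do. With `F` a function
this reduces tensoriality of `adSq N d_H` to `adSq N [d_H, F] = 0`. -/
lemma adSq_commutator {N F : Module.End ℂ S} (hNF : N * F = F * N) (T : Module.End ℂ S) :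
    adSq N T * F - F * adSq N T = adSq N (T * F - F * T) := by
  have e1 : F * N = N * F := hNF.symm
  have e2 : ∀ X, F * (N * X) = N * (F * X) := fun X => by rw [← mul_assoc, e1, mul_assoc]
  unfold adSq
  simp only [mul_sub, sub_mul, add_mul, mul_add, mul_assoc, e1, e2]
  abel

lemma adSq_neg (N T : Module.End ℂ S) : adSq (-N) T = adSq N T := by
  unfold adSq
  simp only [mul_sub, sub_mul, mul_assoc, neg_mul, mul_neg]
  abel

lemma adSq_anticomm {N P T : Module.End ℂ S} (hN : N * P = P * N) (hT : T * P = -(P * T)) :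
    adSq N T * P = -(P * adSq N T) := by
  have e2 : ∀ X, P * (N * X) = N * (P * X) := fun X => by rw [← mul_assoc, ← hN, mul_assoc]
  have e3 : ∀ X, P * (T * X) = -(T * (P * X)) := fun X => by
    rw [← mul_assoc, eq_neg_of_add_eq_zero_right (a := T * P) (b := P * T) (by rw [hT]; abel),
      neg_mul, mul_assoc]
  have e4 : P * T = -(T * P) := by rw [hT, neg_neg]
  unfold adSq
  simp only [mul_sub, sub_mul, add_mul, mul_add, mul_assoc, e2, e3, e4, ← hN, mul_neg]
  abel

/-- If `N` raises the degree of `a`, `b` and of their derived bracket by one, then the derived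
bracket for `adSq N T` vanishes. -/
lemma dbr_adSq_eq_zero {N T a b : Module.End ℂ S} (ha : N * a - a * N = Complex.I • a)
    (hb : N * b - b * N = Complex.I • b)
    (hc : N * dbr T a b - dbr T a b * N = Complex.I • dbr T a b) : dbr (adSq N T) a b = 0 := by
  -- Bracketing with `N` is a derivation of the trilinear expression `dbr`. As `a` and `b` have
  -- weight `i`, replacing `T` by `[N, T]` applies `[N, ·] - 2 i` to the result. On a result of
  -- weight `i` this is `-i`, and `(-i)² + 1 = 0`.
  have key : ∀ T : Module.End ℂ S, dbr (N * T - T * N) a b =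
      (N * dbr T a b - dbr T a b * N) - (2 * Complex.I) • dbr T a b := fun T => by
    have h1 : (2 * Complex.I) • dbr T a b =
        dbr T (N * a - a * N) b + dbr T a (N * b - b * N) := by
      rw [ha, hb]
      unfold dbr
      simp only [mul_smul_comm, smul_mul_assoc, ← smul_add, ← smul_sub, ← two_smul ℂ,
        smul_smul]
    rw [h1]
    unfold dbr
    noncomm_ring
  have hadd : ∀ T T' : Module.End ℂ S, dbr (T + T') a b = dbr T a b + dbr T' a b :=
    fun T T' => by unfold dbr; noncomm_ring
  rw [adSq, hadd, key, key, hc]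
  have hI := Complex.I_mul_I
  simp only [mul_sub, sub_mul, mul_smul_comm, smul_mul_assoc]
  have e1 : N * dbr T a b = dbr T a b * N + Complex.I • dbr T a b := by rw [← hc]; abel
  rw [e1]
  simp only [smul_add, smul_sub, smul_smul]
  match_scalars <;> (ring_nf; try rw [Complex.I_sq]; try ring_nf)

end Algebra

/-! ### Operators on smooth forms, tensoriality, and extensions by bump functions -/

section Operators

variable {d : ℕ} {M : Type*} [TopologicalSpace M] [ChartedSpace (Mod d) M] [IsManifold (𝓡 d) ∞ M]
  {H : KForm d M ℝ 3}

variable (d M) in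
/-- The submodule of smooth forms. -/
def smoothForms : Submodule ℂ (Form d M) where
  carrier := {ρ | ρ.IsSmooth}
  add_mem' h h' := Form.isSmooth_iff.2 fun x =>
    (Form.isSmooth_iff.1 h x).add (Form.isSmooth_iff.1 h' x)
  zero_mem' := Form.isSmooth_iff.2 form_smoothAt_zero
  smul_mem' c _ h := Form.isSmooth_iff.2 fun x => (Form.isSmooth_iff.1 h x).smul c

variable (d M) in
/-- The space of smooth forms. -/
def SForm : Type _ := smoothForms d M

instance : AddCommGroup (SForm d M) := Submodule.addCommGroup (smoothForms d M)

instance : Module ℂ (SForm d M) := Submodule.module (smoothForms d M)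

/-- Evaluation of smooth forms at a point. -/
def evalAt (x : M) : SForm d M →ₗ[ℂ] Spinor (Tan d x) where
  toFun ρ := ρ.1 x
  map_add' _ _ := rfl
  map_smul' _ _ := rfl

lemma sform_ext {ρ τ : SForm d M} (h : ∀ x, evalAt x ρ = evalAt x τ) : ρ = τ :=
  Subtype.ext (funext h)

lemma SForm.smoothAt (ρ : SForm d M) (x : M) : Form.SmoothAt ρ.1 x := Form.isSmooth_iff.1 ρ.2 x

/-- The twisted exterior derivative on smooth forms. -/
def dEnd (hH : H.IsSmooth) : Module.End ℂ (SForm d M) where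
  toFun ρ := ⟨dH H ρ.1, ρ.2.dH hH⟩
  map_add' ρ τ := sform_ext fun x => dH_add (ρ.smoothAt x) (τ.smoothAt x)
  map_smul' c ρ := sform_ext fun x => dH_smul c (ρ.smoothAt x)

/-- Smooth fields of endomorphisms of the bundle of forms. -/
def IsSmoothEnd (Z : ∀ x : M, Module.End ℂ (Spinor (Tan d x))) : Prop :=
  ∀ ρ : Form d M, ρ.IsSmooth → Form.IsSmooth fun x => Z x (ρ x)

/-- The operator on smooth forms given by a smooth field of endomorphisms. -/
def fieldOp (Z : ∀ x : M, Module.End ℂ (Spinor (Tan d x))) (hZ : IsSmoothEnd Z) :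
    Module.End ℂ (SForm d M) where
  toFun ρ := ⟨fun x => Z x (ρ.1 x), hZ ρ.1 ρ.2⟩
  map_add' _ _ := sform_ext fun x => map_add (Z x) _ _
  map_smul' _ _ := sform_ext fun x => map_smul (Z x) _ _

/-- The operator `T` is given by the field `Z` of endomorphisms of the bundle of forms. -/
def ActsBy (T : Module.End ℂ (SForm d M)) (Z : ∀ x : M, Module.End ℂ (Spinor (Tan d x))) : Prop :=
  ∀ ρ x, evalAt x (T ρ) = Z x (evalAt x ρ)

variable {T T' : Module.End ℂ (SForm d M)} {Z Z' : ∀ x : M, Module.End ℂ (Spinor (Tan d x))}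

lemma actsBy_fieldOp (hZ : IsSmoothEnd Z) : ActsBy (fieldOp Z hZ) Z := fun _ _ => rfl

lemma ActsBy.mul (h : ActsBy T Z) (h' : ActsBy T' Z') : ActsBy (T * T') fun x => Z x * Z' x :=
  fun ρ x => by rw [Module.End.mul_apply, h, h']; rfl

lemma ActsBy.add (h : ActsBy T Z) (h' : ActsBy T' Z') : ActsBy (T + T') fun x => Z x + Z' x :=
  fun ρ x => by rw [LinearMap.add_apply, map_add, h, h']; rfl

lemma ActsBy.sub (h : ActsBy T Z) (h' : ActsBy T' Z') : ActsBy (T - T') fun x => Z x - Z' x :=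
  fun ρ x => by rw [LinearMap.sub_apply, map_sub, h, h']; rfl

lemma ActsBy.neg (h : ActsBy T Z) : ActsBy (-T) fun x => -Z x :=
  fun ρ x => by rw [LinearMap.neg_apply, map_neg, h]; rfl

lemma ActsBy.smul (c : ℂ) (h : ActsBy T Z) : ActsBy (c • T) fun x => c • Z x :=
  fun ρ x => by rw [LinearMap.smul_apply, map_smul, h]; rfl

lemma ActsBy.adSq (h : ActsBy T Z) (h' : ActsBy T' Z') :
    ActsBy (adSq T T') fun x => adSq (Z x) (Z' x) :=
  ((h.mul ((h.mul h').sub (h'.mul h))).sub (((h.mul h').sub (h'.mul h)).mul h)).add h'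

lemma ActsBy.dbr {a b : Module.End ℂ (SForm d M)} {A B : ∀ x : M, Module.End ℂ (Spinor (Tan d x))}
    (h : ActsBy T Z) (ha : ActsBy a A) (hb : ActsBy b B) :
    ActsBy (dbr T a b) fun x => dbr (Z x) (A x) (B x) :=
  (((h.mul ha).add (ha.mul h)).mul hb).sub (hb.mul ((h.mul ha).add (ha.mul h)))

lemma ActsBy.eq (h : ActsBy T Z) (h' : ActsBy T' Z') (hZ : ∀ x, Z x = Z' x) : T = T' :=
  LinearMap.ext fun ρ => sform_ext fun x => by rw [h, h', hZ]

lemma ActsBy.eq_zero (h : ActsBy T Z) (hZ : ∀ x, Z x = 0) : T = 0 :=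
  LinearMap.ext fun ρ => sform_ext fun x => by rw [h, hZ]; rfl

lemma isSmoothEnd_parity : IsSmoothEnd (d := d) (M := M) fun _ => parity := fun _ hρ =>
  Form.isSmooth_iff.2 fun x => (Form.isSmooth_iff.1 hρ x).parity

lemma isSmoothEnd_cl {A : GenSec d M} (hA : A.IsSmooth) : IsSmoothEnd fun x => cl (A x) :=
  fun _ hρ => Form.isSmooth_iff.2 fun x =>
    (Form.isSmooth_iff.1 hρ x).cl (GenSec.isSmooth_iff.1 hA x)

lemma isSmoothEnd_fmul {f : M → ℂ} (hf : ContMDiff (𝓡 d) 𝓘(ℝ, ℂ) ∞ f) :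
    IsSmoothEnd (d := d) fun x => f x • (1 : Module.End ℂ (Spinor (Tan d x))) := fun _ hρ =>
  Form.isSmooth_iff.2 fun x => (Form.isSmooth_iff.1 hρ x).fsmul (hf x)

/-- Clifford multiplication by a smooth section. -/
def clOp (A : GenSec d M) (hA : A.IsSmooth) : Module.End ℂ (SForm d M) :=
  fieldOp _ (isSmoothEnd_cl hA)

/-- Multiplication by a smooth function. -/
def fmul (f : M → ℂ) (hf : ContMDiff (𝓡 d) 𝓘(ℝ, ℂ) ∞ f) : Module.End ℂ (SForm d M) :=
  fieldOp _ (isSmoothEnd_fmul hf)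

lemma evalAt_fmul {f : M → ℂ} (hf : ContMDiff (𝓡 d) 𝓘(ℝ, ℂ) ∞ f) (ρ : SForm d M) (x : M) :
    evalAt x (fmul f hf ρ) = f x • evalAt x ρ := rfl

/-- Operators that are linear over the smooth functions. -/
def IsTensorial (T : Module.End ℂ (SForm d M)) : Prop :=
  ∀ (f : M → ℂ) (hf : ContMDiff (𝓡 d) 𝓘(ℝ, ℂ) ∞ f), T * fmul f hf = fmul f hf * T

lemma ActsBy.isTensorial (h : ActsBy T Z) : IsTensorial T := fun f hf =>
  (h.mul (actsBy_fieldOp (isSmoothEnd_fmul hf))).eq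
    ((actsBy_fieldOp (isSmoothEnd_fmul hf)).mul h) fun x => by
      rw [mul_smul_comm, smul_mul_assoc, mul_one, one_mul]

/-! ### Bump functions and extensions -/

variable [T2Space M]

/-- A bump function at a point, supported in the chart at that point. -/
def bumpAt (d : ℕ) {M : Type*} [TopologicalSpace M] [ChartedSpace (Mod d) M] (x : M) : M → ℝ :=
  (Classical.arbitrary (SmoothBumpFunction (𝓡 d) x) : SmoothBumpFunction (𝓡 d) x)

lemma contMDiff_bumpAt (x : M) : ContMDiff (𝓡 d) 𝓘(ℝ, ℝ) ∞ (bumpAt d x) :=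
  SmoothBumpFunction.contMDiff _

lemma tsupport_bumpAt (x : M) : tsupport (bumpAt d x) ⊆ (extChartAt (𝓡 d) x).source :=
  SmoothBumpFunction.tsupport_subset_extChartAt_source _

lemma bumpAt_self (x : M) : bumpAt d x x = 1 := SmoothBumpFunction.eq_one _

lemma bumpAt_eventually (x : M) : ∀ᶠ z in nhds x, bumpAt d x z = 1 :=
  SmoothBumpFunction.eventuallyEq_one _

lemma contMDiff_ofReal {f : M → ℝ} (hf : ContMDiff (𝓡 d) 𝓘(ℝ, ℝ) ∞ f) :
    ContMDiff (𝓡 d) 𝓘(ℝ, ℂ) ∞ fun x => (f x : ℂ) :=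
  Complex.ofRealCLM.contDiff.contMDiff.comp hf

lemma tsupport_ofReal (f : M → ℝ) : tsupport (fun x => (f x : ℂ)) = tsupport f := by
  unfold tsupport
  congr 1
  ext x
  simp

/-- Extension of a form at a point to a global smooth form. -/
def extForm (x : M) : Spinor (Tan d x) →ₗ[ℂ] SForm d M where
  toFun ρ := ⟨extendForm x (fun z => (bumpAt d x z : ℂ)) (pullback (chartFrame x x) ρ),
    extendForm_isSmooth (contMDiff_ofReal (contMDiff_bumpAt x))
      (by rw [tsupport_ofReal]; exact tsupport_bumpAt x) _⟩
  map_add' ρ τ := sform_ext fun z => by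
    change (bumpAt d x z : ℂ) • pullback (chartDeriv x z) (pullback (chartFrame x x) (ρ + τ)) =
      (bumpAt d x z : ℂ) • pullback (chartDeriv x z) (pullback (chartFrame x x) ρ) +
      (bumpAt d x z : ℂ) • pullback (chartDeriv x z) (pullback (chartFrame x x) τ)
    rw [map_add, map_add, smul_add]
  map_smul' c ρ := sform_ext fun z => by
    change (bumpAt d x z : ℂ) • pullback (chartDeriv x z) (pullback (chartFrame x x) (c • ρ)) =
      c • (bumpAt d x z : ℂ) • pullback (chartDeriv x z) (pullback (chartFrame x x) ρ)
    rw [map_smul, map_smul, smul_comm]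

lemma evalAt_extForm (x : M) (ρ : Spinor (Tan d x)) : evalAt x (extForm x ρ) = ρ := by
  change (bumpAt d x x : ℂ) • pullback (chartDeriv x x) (pullback (chartFrame x x) ρ) = ρ
  rw [bumpAt_self, Complex.ofReal_one, pullback_comp]
  refine (one_smul ℂ _).trans ?_
  exact pullback_of_id (fun v => chartFrame_chartDeriv x (mem_extChartAt_source x) v) _

/-- Extension of a generalized tangent vector at a point to a global smooth section. -/
def extGen (x : M) (A : Gen (Tan d x)) : GenSec d M :=
  extendGen x (bumpAt d x) (chartDeriv x x A.1, A.2.comp (chartFrame x x))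

lemma extGen_isSmooth (x : M) (A : Gen (Tan d x)) : (extGen x A).IsSmooth :=
  extendGen_isSmooth (contMDiff_bumpAt x) (tsupport_bumpAt x) _

lemma extGen_self (x : M) (A : Gen (Tan d x)) : extGen x A x = A := by
  have hs := mem_extChartAt_source (I := 𝓡 d) x
  rw [extGen, extendGen, bumpAt_self]
  refine Prod.ext ?_ ?_
  · change (1 : ℝ) • chartFrame x x (chartDeriv x x A.1) = A.1
    rw [chartFrame_chartDeriv x hs]
    exact one_smul ℝ _
  · ext v
    change (1 : ℝ) * A.2 (chartFrame x x (chartDeriv x x v)) = A.2 v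
    rw [chartFrame_chartDeriv x hs, one_mul]

lemma ActsBy.unique (h : ActsBy T Z) (h' : ActsBy T Z') (x : M) : Z x = Z' x :=
  LinearMap.ext fun ρ => by rw [← evalAt_extForm x ρ, ← h, ← h']

/-- Forms on `ℝᵈ` are determined by finitely many coefficients. -/
lemma exists_coefficients (d : ℕ) :
    ∃ R : (Σ k : Fin (d + 1), Fin k → Fin d) → Spinor (Mod d), ∀ ρ : Spinor (Mod d),
      ρ = ∑ κ, ρ κ.1 (stdE d ∘ κ.2) • R κ := by
  let L : Spinor (Mod d) →ₗ[ℂ] ((Σ k : Fin (d + 1), Fin k → Fin d) → ℂ) :=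
    { toFun := fun ρ κ => ρ κ.1 (stdE d ∘ κ.2)
      map_add' := fun _ _ => rfl
      map_smul' := fun _ _ => rfl }
  have hL : LinearMap.ker L = ⊥ := LinearMap.ker_eq_bot'.2 fun ρ hρ => by
    funext k
    by_cases hk : d < k
    · exact (stdFrame d).form_eq_zero hk _
    · exact (stdFrame d).form_ext fun I => congrFun hρ ⟨⟨k, by omega⟩, I⟩
  obtain ⟨R, hR⟩ := L.exists_leftInverse_of_injective hL
  refine ⟨fun κ => R (Pi.single κ 1), fun ρ => ?_⟩
  conv_lhs => rw [← LinearMap.id_apply (R := ℂ) ρ, ← hR, LinearMap.comp_apply,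
    pi_eq_sum_univ' (L ρ), map_sum]
  exact Finset.sum_congr rfl fun κ _ => map_smul _ _ _

lemma contMDiff_bump_mul (x : M) {c : M → ℂ} (hc : ∀ z ∈ (extChartAt (𝓡 d) x).source,
    ContMDiffAt (𝓡 d) 𝓘(ℝ, ℂ) ∞ c z) :
    ContMDiff (𝓡 d) 𝓘(ℝ, ℂ) ∞ fun z => (bumpAt d x z : ℂ) * c z := fun z => by
  by_cases hz : z ∈ (extChartAt (𝓡 d) x).source
  · simp only [← Complex.real_smul]
    exact ((contMDiff_bumpAt x) z).smul (hc z hz)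
  · refine (contMDiffAt_const (c := (0 : ℂ))).congr_of_eventuallyEq ?_
    filter_upwards [(isClosed_tsupport (bumpAt d x)).isOpen_compl.mem_nhds
      fun h => hz (tsupport_bumpAt x h)] with w hw
    rw [image_eq_zero_of_notMem_tsupport hw, Complex.ofReal_zero, zero_mul]

/-- With `χ` the bump function, `χ² ρ` is a finite sum of globally defined smooth functions times
globally defined smooth forms. The functions, which are the coefficients of `ρ` times `χ`, vanish at
`x` and pass through `T`. -/
lemma IsTensorial.eval_eq_zero (hT : IsTensorial T) {ρ : SForm d M} {x : M}
    (h : evalAt x ρ = 0) : evalAt x (T ρ) = 0 := by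
  obtain ⟨R, hR⟩ := exists_coefficients d
  have hb := contMDiff_ofReal (contMDiff_bumpAt (d := d) x)
  let c : (Σ k : Fin (d + 1), Fin k → Fin d) → M → ℂ := fun κ z => rep ρ.1 x z κ.1 (stdE d ∘ κ.2)
  have hc : ∀ κ, ContMDiff (𝓡 d) 𝓘(ℝ, ℂ) ∞ fun z => (bumpAt d x z : ℂ) * c κ z := fun κ =>
    contMDiff_bump_mul x fun z hz => contMDiffAt_of_contDiffAt hz
      (((Form.smoothAt_iff x hz).1 (ρ.smoothAt z)).apply κ.1 (stdE d ∘ κ.2))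
  let r : (Σ k : Fin (d + 1), Fin k → Fin d) → SForm d M := fun κ =>
    ⟨extendForm x (fun z => (bumpAt d x z : ℂ)) (R κ), extendForm_isSmooth hb
      (by rw [tsupport_ofReal]; exact tsupport_bumpAt x) _⟩
  -- Two bump factors are used: one makes the coefficients global functions, the other makes the
  -- coordinate forms global.
  have key : fmul _ hb (fmul _ hb ρ) = ∑ κ, fmul _ (hc κ) (r κ) := by
    refine sform_ext fun z => ?_
    rw [map_sum, evalAt_fmul, evalAt_fmul]
    by_cases hz : z ∈ (extChartAt (𝓡 d) x).source
    · have e : evalAt z ρ = ∑ κ, c κ z • pullback (chartDeriv x z) (R κ) := by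
        have h1 := pullback_rep ρ.1 x hz
        rw [hR (rep ρ.1 x z), map_sum] at h1
        refine h1.symm.trans (Finset.sum_congr rfl fun κ _ => map_smul _ _ _)
      rw [e, Finset.smul_sum, Finset.smul_sum]
      refine Finset.sum_congr rfl fun κ _ => ?_
      rw [evalAt_fmul]
      change _ = _ • (bumpAt d x z : ℂ) • pullback (chartDeriv x z) (R κ)
      rw [smul_smul, smul_smul, smul_smul]
      congr 1
      ring
    · have h0 : bumpAt d x z = 0 := image_eq_zero_of_notMem_tsupport fun h' => hz (tsupport_bumpAt x h')
      rw [h0, Complex.ofReal_zero, zero_smul ℂ (_ : Spinor (Tan d z))]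
      refine (Finset.sum_eq_zero fun κ _ => ?_).symm
      rw [evalAt_fmul, h0, Complex.ofReal_zero, zero_mul, zero_smul ℂ (_ : Spinor (Tan d z))]
  have hcomm : ∀ (f : M → ℂ) (hf : ContMDiff (𝓡 d) 𝓘(ℝ, ℂ) ∞ f) (τ : SForm d M),
      T (fmul f hf τ) = fmul f hf (T τ) := fun f hf τ => LinearMap.congr_fun (hT f hf) τ
  have h2 := congrArg (fun τ => evalAt x (T τ)) key
  simp only [hcomm, map_sum, evalAt_fmul, bumpAt_self, Complex.ofReal_one] at h2
  rw [one_smul ℂ (_ : Spinor (Tan d x)), one_smul ℂ (_ : Spinor (Tan d x))] at h2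
  rw [h2]
  refine Finset.sum_eq_zero fun κ _ => ?_
  have : c κ x = 0 := by
    have h3 : rep ρ.1 x x = 0 := by
      rw [rep, show ρ.1 x = 0 from h, map_zero]
    change rep ρ.1 x x κ.1 (stdE d ∘ κ.2) = 0
    rw [h3]; rfl
  rw [this, mul_zero, zero_smul ℂ (_ : Spinor (Tan d x))]

/-- A tensorial operator is given by a field of endomorphisms. -/
lemma IsTensorial.actsBy (hT : IsTensorial T) :
    ActsBy T fun x => evalAt x ∘ₗ T ∘ₗ extForm x := fun ρ x => by
  have h := hT.eval_eq_zero (ρ := ρ - extForm x (evalAt x ρ)) (x := x) (by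
    rw [map_sub, evalAt_extForm, sub_self])
  rw [map_sub, map_sub, sub_eq_zero] at h
  exact h

end Operators

section Algebra

variable {S : Type*} [AddCommGroup S] [Module ℂ S]

lemma comm_add_smul {N a b : Module.End ℂ S} (h₁ : N * a - a * N = -b) (h₂ : N * b - b * N = a) :
    N * (a + Complex.I • b) - (a + Complex.I • b) * N = Complex.I • (a + Complex.I • b) := by
  calc _ = (N * a - a * N) + Complex.I • (N * b - b * N) := by
        rw [mul_add, add_mul, mul_smul_comm, smul_mul_assoc, smul_sub]; abel
    _ = _ := by rw [h₁, h₂, smul_add, smul_smul, Complex.I_mul_I, neg_one_smul, add_comm]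

lemma adSq_add_smul (N a b : Module.End ℂ S) (z : ℂ) :
    adSq N (a + z • b) = adSq N a + z • adSq N b := by
  simp only [adSq, mul_add, add_mul, mul_sub, sub_mul, mul_smul_comm, smul_mul_assoc, smul_add,
    smul_sub]
  abel

variable {V : Type*} [AddCommGroup V] [Module ℝ V] [TopologicalSpace V] {d : ℕ}
  {c : Gen V →ₗ[ℝ] Module.End ℂ S} (e : Fin d → V) (ε : Fin d → V →L[ℝ] ℝ)
  (J : Gen V →ₗ[ℝ] Gen V)

lemma spinEnd_mul_comm {P : Module.End ℂ S} (hP : ∀ A, P * c A = -(c A * P)) :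
    spinEnd c e ε J * P = P * spinEnd c e ε J := by
  have h : ∀ A B, c A * c B * P = P * (c A * c B) := fun A B => by
    rw [← mul_assoc, hP, neg_mul, mul_assoc (c A) P, hP, mul_neg, neg_neg, mul_assoc]
  rw [spinEnd_eq, smul_mul_assoc, mul_smul_comm, Finset.sum_mul, Finset.mul_sum]
  congr 1
  exact Finset.sum_congr rfl fun i _ => by rw [add_mul, mul_add, h, h]

lemma spinEnd_neg : spinEnd c e ε (-J) = -spinEnd c e ε J := by
  rw [spinEnd_eq, spinEnd_eq, ← smul_neg, ← Finset.sum_neg_distrib]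
  congr 1
  refine Finset.sum_congr rfl fun i _ => ?_
  simp only [LinearMap.neg_apply, map_neg, neg_mul]
  rw [neg_add]

lemma spinEnd_apply (ρ : S) : spinEnd c e ε J ρ = (1 / 2 : ℂ) • ∑ k,
    (c (J (e k, 0)) (c (0, ε k) ρ) + c (J (0, ε k)) (c (e k, 0) ρ)) := by
  rw [spinEnd_eq, LinearMap.smul_apply, LinearMap.sum_apply]
  rfl

end Algebra

/-! ### Generalized complex structures and the degrees of `d_H` -/

section Structures

variable {d : ℕ} {M : Type*} [TopologicalSpace M] [ChartedSpace (Mod d) M] [IsManifold (𝓡 d) ∞ M]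
  {H : KForm d M ℝ 3} {J J₁ J₂ : GenEnd d M}

/-- The spin action of `J` on forms at `x`. -/
def fibN (J : GenEnd d M) (x : M) : Module.End ℂ (Spinor (Tan d x)) :=
  spinEnd cl (tanE d x) (tanF d x) (J x)

lemma spinAt_eq (J : GenEnd d M) (x : M) (ρ : Spinor (Tan d x)) : spinAt J x ρ = fibN J x ρ := by
  rw [fibN, spinEnd_apply]
  rfl

lemma fib_isCliffordModule (x : M) :
    IsCliffordModule (cl : Gen (Tan d x) →ₗ[ℝ] Module.End ℂ (Spinor (Tan d x))) :=
  (tanFrame x).isCliffordModule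

lemma isSpinOf_fibN {x : M} (hJ : IsSkew (J x)) : IsSpinOf cl (J x) (fibN J x) :=
  (fib_isCliffordModule x).spinEnd_comm (tanFrame x) hJ

lemma IsGeneralizedComplex.isSkew (h : IsGeneralizedComplex H J) (x : M) : IsSkew (J x) :=
  fun A B => by
    have h1 := h.orthogonal x (J x A) B
    rw [h.sq, ← neg_one_smul ℝ A, pairing_smul_left] at h1
    linarith

lemma IsGeneralizedComplex.isSpinOf (h : IsGeneralizedComplex H J) (x : M) :
    IsSpinOf cl (J x) (fibN J x) :=
  isSpinOf_fibN (h.isSkew x)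

lemma chartFrame_isDualFrame (x₀ : M) {x : M} (hx : x ∈ (extChartAt (𝓡 d) x₀).source) :
    IsDualFrame (V := Tan d x) (fun i => chartFrame x₀ x (stdE d i))
      (fun i => (stdF d i).comp (chartDeriv x₀ x)) where
  dual i j := by
    have := (stdFrame d).dual i j
    rw [← this]
    change stdF d _ (chartDeriv x₀ x (chartFrame x₀ x _)) = _
    rw [chartDeriv_chartFrame x₀ hx]
  span v := by
    have h := congrArg (chartFrame x₀ x) ((stdFrame d).span (chartDeriv x₀ x v))
    rw [chartFrame_chartDeriv x₀ hx, map_sum] at h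
    refine Eq.trans (Finset.sum_congr rfl fun i _ => ?_) h
    exact (map_smul _ _ _).symm

/-- The standard frame of the model space, used pointwise to define the spin action, need not vary
smoothly over `M`. Near `x` it is replaced by the coordinate frame of the chart at `x`, which
`spinEnd_frame` permits and bump functions extend to global sections. -/
lemma isSmoothEnd_fibN [T2Space M] (hJ : J.IsSmooth) : IsSmoothEnd (fibN J) := fun ρ hρ => by
  refine Form.isSmooth_iff.2 fun x => ?_
  have hs := mem_extChartAt_source (I := 𝓡 d) x
  let A : Fin d → GenSec d M := fun i => extendGen x (bumpAt d x) (stdE d i, 0)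
  let B : Fin d → GenSec d M := fun i => extendGen x (bumpAt d x) (0, stdF d i)
  have hA : ∀ i, (A i).IsSmooth := fun i =>
    extendGen_isSmooth (contMDiff_bumpAt x) (tsupport_bumpAt x) _
  have hB : ∀ i, (B i).IsSmooth := fun i =>
    extendGen_isSmooth (contMDiff_bumpAt x) (tsupport_bumpAt x) _
  have hJA : ∀ i, GenSec.IsSmooth fun z => J z (A i z) := fun i => hJ _ (hA i)
  have hJB : ∀ i, GenSec.IsSmooth fun z => J z (B i z) := fun i => hJ _ (hB i)
  have key : Form.SmoothAt (d := d) (fun z => (1 / 2 : ℂ) • ∑ i, (cl (J z (A i z)) (cl (B i z) (ρ z)) +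
      cl (J z (B i z)) (cl (A i z) (ρ z)))) x := by
    refine Form.SmoothAt.smul _ (Form.SmoothAt.sum _ (ρ := fun i z => cl (J z (A i z)) (cl (B i z) (ρ z)) +
      cl (J z (B i z)) (cl (A i z) (ρ z))) fun i => ?_)
    have h1 := Form.isSmooth_iff.1 (isSmoothEnd_cl (hJA i) _ (isSmoothEnd_cl (hB i) ρ hρ)) x
    have h2 := Form.isSmooth_iff.1 (isSmoothEnd_cl (hJB i) _ (isSmoothEnd_cl (hA i) ρ hρ)) x
    exact h1.add h2
  refine Form.SmoothAt.congr key ?_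
  filter_upwards [bumpAt_eventually (d := d) x, eventually_source x hs] with z hz hzs
  have eA : ∀ i, A i z = (chartFrame x z (stdE d i), 0) := fun i => by
    change bumpAt d x z • ((chartFrame x z (stdE d i), 0) : Gen (Tan d z)) = _
    rw [hz]
    exact one_smul ℝ _
  have eB : ∀ i, B i z = (0, (stdF d i).comp (chartDeriv x z)) := fun i => by
    change bumpAt d x z • ((chartFrame x z 0, (stdF d i).comp (chartDeriv x z)) :
      Gen (Tan d z)) = _
    rw [hz, map_zero]
    exact one_smul ℝ _
  rw [fibN, spinEnd_frame (tanFrame z) (chartFrame_isDualFrame x hzs), spinEnd_apply]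
  simp only [eA, eB]

/-- The spin action of a smooth field of endomorphisms on smooth forms. -/
def spinOp [T2Space M] (J : GenEnd d M) (hJ : J.IsSmooth) : Module.End ℂ (SForm d M) :=
  fieldOp _ (isSmoothEnd_fibN hJ)

lemma actsBy_spinOp [T2Space M] (hJ : J.IsSmooth) : ActsBy (spinOp J hJ) (fibN J) :=
  actsBy_fieldOp _

/-- The operator `A + i B` for smooth sections `A`, `B`. -/
def cclOp (A : CGenSec d M) (h₁ : A.1.IsSmooth) (h₂ : A.2.IsSmooth) :
    Module.End ℂ (SForm d M) := clOp A.1 h₁ + Complex.I • clOp A.2 h₂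

lemma actsBy_cclOp {A : CGenSec d M} (h₁ : A.1.IsSmooth) (h₂ : A.2.IsSmooth) :
    ActsBy (cclOp A h₁ h₂) fun x => cl (A.1 x) + Complex.I • cl (A.2 x) :=
  (actsBy_fieldOp (isSmoothEnd_cl h₁)).add ((actsBy_fieldOp (isSmoothEnd_cl h₂)).smul _)

lemma InEigenbundle.comm {A : CGenSec d M} (hA : InEigenbundle J A)
    (h : ∀ x, IsSpinOf cl (J x) (fibN J x)) (x : M) :
    fibN J x * (cl (A.1 x) + Complex.I • cl (A.2 x)) -
      (cl (A.1 x) + Complex.I • cl (A.2 x)) * fibN J x =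
        Complex.I • (cl (A.1 x) + Complex.I • cl (A.2 x)) := by
  have h1 := h x (A.1 x)
  have h2 := h x (A.2 x)
  rw [(hA x).1, map_neg] at h1
  rw [(hA x).2] at h2
  exact comm_add_smul h1 h2

/-- The sections `A`, `B` and their Courant bracket all lie in the `+i` eigenbundle and so have
weight `i` under `N`. That is the input of `dbr_adSq_eq_zero`. -/
lemma IsGeneralizedComplex.dbr_eq_zero [T2Space M] (h : IsGeneralizedComplex H J) (hH : H.IsSmooth)
    {A B : CGenSec d M} (hA₁ : A.1.IsSmooth) (hA₂ : A.2.IsSmooth) (hB₁ : B.1.IsSmooth)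
    (hB₂ : B.2.IsSmooth) (hA : InEigenbundle J A) (hB : InEigenbundle J B) :
    dbr (adSq (spinOp J h.smooth) (dEnd hH)) (cclOp A hA₁ hA₂) (cclOp B hB₁ hB₂) = 0 := by
  obtain ⟨C, hC, hCA⟩ := h.involutive A B hA₁ hA₂ hB₁ hB₂ hA hB
  have hN := actsBy_spinOp h.smooth
  have hspin := h.isSpinOf
  have comm : ∀ {E : CGenSec d M} {T : Module.End ℂ (SForm d M)}, InEigenbundle J E →
      ActsBy T (fun x => cl (E.1 x) + Complex.I • cl (E.2 x)) →
      spinOp J h.smooth * T - T * spinOp J h.smooth = Complex.I • T := fun hE hT =>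
    ((hN.mul hT).sub (hT.mul hN)).eq (hT.smul _) (hE.comm hspin)
  refine dbr_adSq_eq_zero (comm hA (actsBy_cclOp hA₁ hA₂)) (comm hB (actsBy_cclOp hB₁ hB₂))
    (comm hC fun ρ x => ?_)
  exact (congrFun (hCA ρ.1 ρ.2) x).symm

/-! ### The opposite structure -/

/-- The field of endomorphisms `-J`. -/
def oppEnd (J : GenEnd d M) : GenEnd d M := fun x => -J x

lemma fibN_oppEnd (J : GenEnd d M) (x : M) : fibN (oppEnd J) x = -fibN J x := by
  rw [fibN, fibN, oppEnd, spinEnd_neg]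

lemma ccliff_conj (A : CGenSec d M) (ρ : Form d M) :
    ccliff (A.1, fun x => -A.2 x) ρ = fun x => conjForm (ccliff A (fun z => conjForm (ρ z)) x) := by
  funext x
  change cl (A.1 x) (ρ x) + Complex.I • cl (-A.2 x) (ρ x) =
    conjForm (cl (A.1 x) (conjForm (ρ x)) + Complex.I • cl (A.2 x) (conjForm (ρ x)))
  rw [conjForm_add, conjForm_smul, conjForm_cl, conjForm_cl, conjForm_conjForm, map_neg,
    Complex.conj_I, LinearMap.neg_apply, smul_neg, neg_smul Complex.I (cl (A.2 x) (ρ x))]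

lemma Form.IsSmooth.ccliff {A : CGenSec d M} {ρ : Form d M} (hρ : ρ.IsSmooth)
    (h₁ : A.1.IsSmooth) (h₂ : A.2.IsSmooth) : (ccliff A ρ).IsSmooth :=
  (cclOp A h₁ h₂ ⟨ρ, hρ⟩).2

lemma Form.IsSmooth.conjForm {ρ : Form d M} (hρ : ρ.IsSmooth) :
    Form.IsSmooth fun x => conjForm (ρ x) :=
  Form.isSmooth_iff.2 fun x => (Form.isSmooth_iff.1 hρ x).conjForm

lemma dHComm_conj {A : CGenSec d M} (h₁ : A.1.IsSmooth) (h₂ : A.2.IsSmooth) {ρ : Form d M}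
    (hρ : ρ.IsSmooth) : dHComm H (A.1, fun x => -A.2 x) ρ =
      fun x => conjForm (dHComm H A (fun z => conjForm (ρ z)) x) := by
  funext x
  have h3 := hρ.conjForm.ccliff h₁ h₂
  have h4 : (fun z => conjForm (dH H (fun z => conjForm (ρ z)) z)) = dH H ρ := by
    funext z
    rw [← dH_conjForm (Form.isSmooth_iff.1 hρ.conjForm z)]
    simp only [conjForm_conjForm]
  change dH H (ccliff _ ρ) x + ccliff _ (dH H ρ) x = conjForm (dH H (ccliff A _) x + ccliff A _ x)
  rw [ccliff_conj, ccliff_conj, dH_conjForm (Form.isSmooth_iff.1 h3 x), conjForm_add, ← h4]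
  simp only [conjForm_conjForm]

lemma conjForm_sub' {V : Type*} [AddCommGroup V] [Module ℝ V] [TopologicalSpace V]
    (α β : Spinor V) : conjForm (α - β) = conjForm α - conjForm β := map_sub (conjHom V) α β

/-- `H` is real, so conjugation commutes with `d_H` and carries Courant brackets to Courant
brackets. It exchanges the eigenbundles `±i` of `J`; involutivity of the `-i` eigenbundle, needed
for the lowering elements, follows. -/
lemma IsGeneralizedComplex.opposite (h : IsGeneralizedComplex H J) :
    IsGeneralizedComplex H (oppEnd J) where
  smooth A hA := (h.smooth A hA).neg
  sq x A := by
    simp only [oppEnd, LinearMap.neg_apply, map_neg, neg_neg]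
    exact h.sq x A
  orthogonal x A B := by
    rw [← h.orthogonal x A B]
    simp only [oppEnd, LinearMap.neg_apply]
    rw [← neg_one_smul ℝ (J x A), ← neg_one_smul ℝ (J x B), pairing_smul_left,
      pairing_comm, pairing_smul_left, pairing_comm]
    ring
  involutive A B hA₁ hA₂ hB₁ hB₂ hA hB := by
    have conjE : ∀ {E : CGenSec d M}, InEigenbundle (oppEnd J) E →
        InEigenbundle J (E.1, fun x => -E.2 x) := fun {E} hE x => by
      have h1 := (hE x).1
      have h2 := (hE x).2
      simp only [oppEnd, LinearMap.neg_apply] at h1 h2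
      refine ⟨?_, ?_⟩
      · rw [neg_neg, ← neg_inj, h1]
      · rw [map_neg, h2]
    obtain ⟨C, hC, hCA⟩ := h.involutive (A.1, fun x => -A.2 x) (B.1, fun x => -B.2 x) hA₁ hA₂.neg hB₁
      hB₂.neg (conjE hA) (conjE hB)
    refine ⟨(C.1, fun x => -C.2 x), fun x => ?_, fun ρ hρ => ?_⟩
    · have h1 := (hC x).1
      have h2 := (hC x).2
      simp only [oppEnd, LinearMap.neg_apply, map_neg, neg_neg]
      exact ⟨by rw [h1, neg_neg], h2⟩
    · have hA' := dHComm_conj (H := H) hA₁ hA₂ hρ.conjForm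
      simp only [conjForm_conjForm] at hA'
      have hA2 := dHComm_conj (H := H) hA₁ hA₂ (hρ.ccliff hB₁ hB₂).conjForm
      simp only [conjForm_conjForm] at hA2
      rw [ccliff_conj]
      funext x
      rw [hCA _ hρ.conjForm, Pi.sub_apply, conjForm_sub', hA', ccliff_conj, ccliff_conj]
      simp only [conjForm_conjForm]
      rw [hA2]
      simp only [conjForm_conjForm]
      rfl

/-! ### The bidegrees of the twisted exterior derivative -/

lemma dEnd_parity (hH : H.IsSmooth) :
    dEnd hH * fieldOp _ (isSmoothEnd_parity (d := d) (M := M)) =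
      -(fieldOp _ (isSmoothEnd_parity (d := d) (M := M)) * dEnd hH) :=
  LinearMap.ext fun ρ => sform_ext fun x => dH_parity (ρ.smoothAt x)

lemma fibN_parity (J : GenEnd d M) (x : M) : fibN J x * parity = parity * fibN J x := by
  rw [fibN]
  exact spinEnd_mul_comm _ _ _ parity_cl

/-- The commutator with `f` is `adSq N [d_H, f]`, and `[d_H, f]` is Clifford multiplication by a
complex covector, which `adSq N` kills. -/
lemma IsGeneralizedComplex.adSq_isTensorial [T2Space M] (h : IsGeneralizedComplex H J)
    (hH : H.IsSmooth) : IsTensorial (adSq (spinOp J h.smooth) (dEnd hH)) := fun f hf => by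
  have hN := actsBy_spinOp h.smooth
  have hNF : spinOp J h.smooth * fmul f hf = fmul f hf * spinOp J h.smooth := hN.isTensorial f hf
  rw [← sub_eq_zero, adSq_commutator hNF]
  choose ξ η hξ using fun x => dH_fsmul (H := H) (hf x)
  have hT : ActsBy (dEnd hH * fmul f hf - fmul f hf * dEnd hH)
      fun x => cl (0, ξ x) + Complex.I • cl (0, η x) := fun ρ x => by
    change dH H (fun z => f z • ρ.1 z) x - f x • dH H ρ.1 x = _
    rw [hξ x ρ.1 (ρ.smoothAt x), add_sub_cancel_left]
    rfl
  refine (hN.adSq hT).eq_zero fun x => ?_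
  have h1 := (h.isSpinOf x).adSq_c (h.sq x) (0, ξ x)
  have h2 := (h.isSpinOf x).adSq_c (h.sq x) (0, η x)
  rw [adSq_add_smul, h1, h2, smul_zero, add_zero]

/-- Being tensorial, `adSq N d_H` is a field of endomorphisms. It is odd, and its brackets with two
raising or two lowering elements vanish by integrability of `J` and of `-J`, so
`IsCliffordModule.adSq_eq_zero` applies in each fibre. -/
lemma IsGeneralizedComplex.adSq_adSq [T2Space M] (h : IsGeneralizedComplex H J)
    (hH : H.IsSmooth) :
    adSq (spinOp J h.smooth) (adSq (spinOp J h.smooth) (dEnd hH)) = 0 := by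
  have hN := actsBy_spinOp h.smooth
  have hE := (h.adSq_isTensorial hH).actsBy
  refine (hN.adSq hE).eq_zero fun x => ?_
  have hP := actsBy_fieldOp (M := M) (isSmoothEnd_parity (d := d) (M := M))
  have hNP : spinOp J h.smooth * fieldOp _ isSmoothEnd_parity =
      fieldOp _ isSmoothEnd_parity * spinOp J h.smooth :=
    (hN.mul hP).eq (hP.mul hN) fun x => fibN_parity J x
  have hEP := adSq_anticomm hNP (dEnd_parity hH)
  have hZP := (hE.mul hP).unique (hEP ▸ (hP.mul hE).neg) x
  have h' := h.opposite
  have hop : spinOp (oppEnd J) h'.smooth = -spinOp J h.smooth :=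
    (actsBy_spinOp h'.smooth).eq hN.neg fun x => fibN_oppEnd J x
  have hzero : ActsBy (0 : Module.End ℂ (SForm d M)) fun _ => 0 := fun ρ x => map_zero _
  have hJs : ∀ A : GenSec d M, A.IsSmooth → GenSec.IsSmooth fun z => J z (A z) := h.smooth
  refine (fib_isCliffordModule x).adSq_eq_zero (tanFrame x) (h.isSpinOf x) (h.sq x) parity_cl
    parity_mul_self hZP (fun A B => ?_) (fun A B => ?_)
  -- Any `A` at `x` extends to a smooth section, and `A - i J A` of the extension is then a smooth
  -- section of the `+i` eigenbundle.
  · have hs := fun A : Gen (Tan d x) => extGen_isSmooth x A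
    have hs' := fun A : Gen (Tan d x) => (hJs _ (hs A)).neg
    have hin : ∀ A : Gen (Tan d x), InEigenbundle J (extGen x A, fun z => -J z (extGen x A z)) :=
      fun A z => ⟨(neg_neg _).symm, by rw [map_neg, h.sq, neg_neg]⟩
    have h0 := h.dbr_eq_zero hH (hs A) (hs' A) (hs B) (hs' B) (hin A) (hin B)
    have h1 := ((hE.dbr (actsBy_cclOp (hs A) (hs' A)) (actsBy_cclOp (hs B) (hs' B))).unique
      (h0 ▸ hzero) x)
    simp only [extGen_self, map_neg, smul_neg, ← sub_eq_add_neg] at h1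
    exact h1
  · have hs := fun A : Gen (Tan d x) => extGen_isSmooth x A
    have hs' := fun A : Gen (Tan d x) => hJs _ (hs A)
    have hin : ∀ A : Gen (Tan d x), InEigenbundle (oppEnd J)
        (extGen x A, fun z => J z (extGen x A z)) := fun A z => by
      refine ⟨rfl, ?_⟩
      simp only [oppEnd, LinearMap.neg_apply]
      rw [h.sq, neg_neg]
    have h0 := h'.dbr_eq_zero hH (hs A) (hs' A) (hs B) (hs' B) (hin A) (hin B)
    rw [hop, adSq_neg] at h0
    have h1 := ((hE.dbr (actsBy_cclOp (hs A) (hs' A)) (actsBy_cclOp (hs B) (hs' B))).unique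
      (h0 ▸ hzero) x)
    simp only [extGen_self] at h1
    exact h1

end Structures

lemma aeval_semiconj {S S' : Type*} [AddCommGroup S] [Module ℂ S] [AddCommGroup S'] [Module ℂ S']
    {N : Module.End ℂ S} {N' : Module.End ℂ S'} (f : S →ₗ[ℂ] S') (h : ∀ v, f (N v) = N' (f v))
    (p : Polynomial ℂ) (v : S) : f (Polynomial.aeval N p v) = Polynomial.aeval N' p (f v) := by
  induction p using Polynomial.induction_on generalizing v with
  | C a => simp [Module.algebraMap_end_apply]
  | add p q hp hq => simp only [map_add, LinearMap.add_apply, hp, hq]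
  | monomial n a ih =>
    rw [pow_succ, ← mul_assoc, map_mul (Polynomial.aeval N), map_mul (Polynomial.aeval N'), Polynomial.aeval_X, Polynomial.aeval_X,
      Module.End.mul_apply, Module.End.mul_apply, ih, h]

/-! ### The projections to the eigenbundles on smooth forms -/

section GradedForms

variable {d : ℕ} {M : Type*} [TopologicalSpace M] [ChartedSpace (Mod d) M] [IsManifold (𝓡 d) ∞ M]
  [T2Space M] {H : KForm d M ℝ 3} {J J₁ J₂ : GenEnd d M}

/-- The projection is a polynomial in the spin operator, so it preserves smooth forms and commutes
with evaluation at a point. -/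
lemma evalAt_wproj (hJ : J.IsSmooth) (k : ℤ) (ρ : SForm d M) (x : M) :
    evalAt x (wproj d (spinOp J hJ) k ρ) = wproj d (fibN J x) k (evalAt x ρ) :=
  aeval_semiconj (evalAt x) (fun ρ => actsBy_spinOp hJ ρ x) _ ρ

lemma evalAt_biproj (h₁ : J₁.IsSmooth) (h₂ : J₂.IsSmooth) (p q : ℤ) (ρ : SForm d M) (x : M) :
    evalAt x (biproj d (spinOp J₁ h₁) (spinOp J₂ h₂) p q ρ) =
      biproj d (fibN J₁ x) (fibN J₂ x) p q (evalAt x ρ) := by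
  rw [biproj, biproj, Module.End.mul_apply, Module.End.mul_apply, evalAt_wproj, evalAt_wproj]

lemma isGrading_spinOp (hJ : J.IsSmooth) (h : ∀ x, IsGrading d (fibN J x)) :
    IsGrading d (spinOp J hJ) := by
  refine IsGrading.of_proj (P := wproj d (spinOp J hJ)) (fun k ρ => sform_ext fun x => ?_)
    fun ρ => ?_
  · rw [actsBy_spinOp hJ, map_smul, evalAt_wproj]
    exact LinearMap.congr_fun ((h x).mul_wproj k) _
  · exact (LinearMap.sum_apply _ _ _).symm.trans
      (LinearMap.congr_fun (wproj_sum d (spinOp J hJ)) ρ)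

lemma isBigrading_spinOp (h₁ : J₁.IsSmooth) (h₂ : J₂.IsSmooth)
    (h : ∀ x, IsBigrading d (fibN J₁ x) (fibN J₂ x)) :
    IsBigrading d (spinOp J₁ h₁) (spinOp J₂ h₂) where
  fst := isGrading_spinOp h₁ fun x => (h x).fst
  snd := isGrading_spinOp h₂ fun x => (h x).snd
  comm := ((actsBy_spinOp h₁).mul (actsBy_spinOp h₂)).eq
    ((actsBy_spinOp h₂).mul (actsBy_spinOp h₁)) fun x => (h x).comm

lemma mem_eigenU {x : M} {k : ℤ} {ρ : Spinor (Tan d x)} :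
    ρ ∈ eigenU J x k ↔ ρ ∈ (fibN J x).eigenspace (Complex.I * (k : ℂ)) := by
  rw [Module.End.mem_eigenspace_iff, ← spinAt_eq]
  rfl

/-- The pointwise component, defined by a choice, is identified with the polynomial projection; this
is how components of smooth forms are seen to be smooth. -/
lemma proj₁_eq (hJ : J.IsSmooth) (h : ∀ x, IsGrading d (fibN J x)) (k : ℤ) (ρ : SForm d M) :
    proj₁ J k ρ.1 = (wproj d (spinOp J hJ) k ρ).1 := by
  funext x
  refine Eq.trans ?_ (evalAt_wproj hJ k ρ x).symm
  refine component_eq (eigenU J x) (wproj d (fibN J x)) (Finset.Icc (-d : ℤ) d)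
    (fun i v hv => (h x).wproj_apply_self (mem_eigenU.1 hv))
    (fun i j hij v hv => (h x).wproj_apply_ne hij.symm (mem_eigenU.1 hv))
    (fun i v => mem_eigenU.2 ((h x).wproj_mem i v)) (fun v => ?_) k _
  exact (LinearMap.sum_apply _ _ _).symm.trans (LinearMap.congr_fun (wproj_sum d (fibN J x)) v)

lemma mem_eigenUU {x : M} {p q : ℤ} {ρ : Spinor (Tan d x)} :
    ρ ∈ eigenUU J₁ J₂ x (p, q) ↔ ρ ∈ bispace (fibN J₁ x) (fibN J₂ x) p q :=
  and_congr mem_eigenU mem_eigenU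

lemma proj₂_eq (h₁ : J₁.IsSmooth) (h₂ : J₂.IsSmooth)
    (h : ∀ x, IsBigrading d (fibN J₁ x) (fibN J₂ x)) (p q : ℤ) (ρ : SForm d M) :
    proj₂ J₁ J₂ p q ρ.1 = (biproj d (spinOp J₁ h₁) (spinOp J₂ h₂) p q ρ).1 := by
  funext x
  refine Eq.trans ?_ (evalAt_biproj h₁ h₂ p q ρ x).symm
  refine component_eq (eigenUU J₁ J₂ x) (fun i => biproj d (fibN J₁ x) (fibN J₂ x) i.1 i.2)
    (Finset.Icc (-d : ℤ) d ×ˢ Finset.Icc (-d : ℤ) d)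
    (fun i v hv => (h x).biproj_self (mem_eigenUU.1 hv))
    (fun i j hij v hv => (h x).biproj_ne (mem_eigenUU.1 hv) (Ne.symm hij))
    (fun i v => mem_eigenUU.2 ((h x).biproj_mem i.1 i.2 v)) (fun v => ?_) (p, q) _
  rw [Finset.sum_product]
  exact biproj_sum_apply d _ _ v

lemma dPart₁_eq (hH : H.IsSmooth) (hJ : J.IsSmooth) (h : ∀ x, IsGrading d (fibN J x)) (r : ℤ)
    (ρ : SForm d M) : dPart₁ H J r ρ.1 = (gpart d (spinOp J hJ) r (dEnd hH) ρ).1 := by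
  funext x
  change _ = evalAt x _
  rw [dPart₁, gpart, LinearMap.sum_apply, map_sum, Finset.sum_apply]
  refine Finset.sum_congr rfl fun k _ => ?_
  rw [proj₁_eq hJ h]
  exact congrFun (proj₁_eq hJ h (k + r) (dEnd hH (wproj d (spinOp J hJ) k ρ))) x

lemma dPart₂_eq (hH : H.IsSmooth) (h₁ : J₁.IsSmooth) (h₂ : J₂.IsSmooth)
    (h : ∀ x, IsBigrading d (fibN J₁ x) (fibN J₂ x)) (r s : ℤ) (ρ : SForm d M) :
    dPart₂ H J₁ J₂ r s ρ.1 = (bipart d (spinOp J₁ h₁) (spinOp J₂ h₂) r s (dEnd hH) ρ).1 := by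
  funext x
  change _ = evalAt x _
  rw [dPart₂, bipart, LinearMap.sum_apply, map_sum, Finset.sum_apply]
  refine Finset.sum_congr rfl fun p _ => ?_
  rw [LinearMap.sum_apply, map_sum, Finset.sum_apply]
  refine Finset.sum_congr rfl fun q _ => ?_
  rw [proj₂_eq h₁ h₂ h]
  exact congrFun (proj₂_eq h₁ h₂ h (p + r) (q + s) (dEnd hH (biproj d (spinOp J₁ h₁)
    (spinOp J₂ h₂) p q ρ))) x

end GradedForms

/-! ### The four components of `d_H` -/

section GeneralizedKahler

variable {n : ℕ} {M : Type*} [TopologicalSpace M] [ChartedSpace (Mod (2 * n)) M]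
  [IsManifold (𝓡 (2 * n)) ∞ M] {H : KForm (2 * n) M ℝ 3} {J₁ J₂ : GenEnd (2 * n) M}

lemma IsGeneralizedKahler.isKahlerPair (h : IsGeneralizedKahler H J₁ J₂) (x : M) :
    IsKahlerPair (J₁ x) (J₂ x) where
  sq₁ := h.complex₁.sq x
  sq₂ := h.complex₂.sq x
  skew₁ := h.complex₁.isSkew x
  skew₂ := h.complex₂.isSkew x
  comm := h.commute x
  pos := h.positive x

lemma IsGeneralizedKahler.isBigrading (h : IsGeneralizedKahler H J₁ J₂) (x : M) :
    IsBigrading (2 * n) (fibN J₁ x) (fibN J₂ x) :=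
  (h.isKahlerPair x).isBigrading (tanFrame x) (fib_isCliffordModule x)

lemma IsGeneralizedKahler.isBigrading_spinOp [T2Space M] (h : IsGeneralizedKahler H J₁ J₂) :
    IsBigrading (2 * n) (spinOp J₁ h.complex₁.smooth) (spinOp J₂ h.complex₂.smooth) :=
  GenKahler.isBigrading_spinOp _ _ h.isBigrading

lemma IsGeneralizedKahler.dEnd_eq [T2Space M] (h : IsGeneralizedKahler H J₁ J₂) :
    dEnd h.smooth_H =
      bipart (2 * n) (spinOp J₁ h.complex₁.smooth) (spinOp J₂ h.complex₂.smooth) (-1) (-1)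
        (dEnd h.smooth_H) +
      bipart (2 * n) (spinOp J₁ h.complex₁.smooth) (spinOp J₂ h.complex₂.smooth) (-1) 1
        (dEnd h.smooth_H) +
      bipart (2 * n) (spinOp J₁ h.complex₁.smooth) (spinOp J₂ h.complex₂.smooth) 1 1
        (dEnd h.smooth_H) +
      bipart (2 * n) (spinOp J₁ h.complex₁.smooth) (spinOp J₂ h.complex₂.smooth) 1 (-1)
        (dEnd h.smooth_H) :=
  h.isBigrading_spinOp.eq_sum_bipart (h.complex₁.adSq_adSq h.smooth_H)
    (h.complex₂.adSq_adSq h.smooth_H)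

end GeneralizedKahler

open MeasureTheory

/-! ### Integration of top forms over an oriented manifold -/

section Integration

variable {d : ℕ} {M : Type*} [TopologicalSpace M] [ChartedSpace (Mod d) M] [IsManifold (𝓡 d) ∞ M]
  {o : ∀ x : M, Orientation ℝ (Tan d x) (Fin d)}

/-- The sign of the chart at `x₀`, at the point `x`. -/
def chartSign (o : ∀ x : M, Orientation ℝ (Tan d x) (Fin d)) (x₀ x : M) : ℝ :=
  frameSign (o x) fun i => chartFrame x₀ x (stdE d i)

/-- The coefficient of the top component of a form in the chart at `x₀`, corrected by the sign of
the chart. -/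
def topCoeff (o : ∀ x : M, Orientation ℝ (Tan d x) (Fin d)) (ρ : Form d M) (x₀ : M) (y : Mod d) :
    ℂ := (chartSign o x₀ ((extChartAt (𝓡 d) x₀).symm y) : ℂ) * loc ρ x₀ y d (stdE d)

/-- The integral of a form over the chart at `x₀`. -/
def chartIntegral (o : ∀ x : M, Orientation ℝ (Tan d x) (Fin d)) (ρ : Form d M) (x₀ : M) : ℂ :=
  ∫ y in (extChartAt (𝓡 d) x₀).target, topCoeff o ρ x₀ y

lemma topCoeff_smul (f : M → ℂ) (ρ : Form d M) (x₀ : M) (y : Mod d) :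
    topCoeff o (fun x => f x • ρ x) x₀ y =
      f ((extChartAt (𝓡 d) x₀).symm y) * topCoeff o ρ x₀ y := by
  have : loc (fun x => f x • ρ x) x₀ y = f ((extChartAt (𝓡 d) x₀).symm y) • loc ρ x₀ y :=
    map_smul (pullback _) _ _
  rw [topCoeff, this, topCoeff]
  change (chartSign o x₀ _ : ℂ) * (f _ * loc ρ x₀ y d (stdE d)) = _
  ring

lemma topCoeff_add (ρ τ : Form d M) (x₀ : M) (y : Mod d) :
    topCoeff o (fun x => ρ x + τ x) x₀ y = topCoeff o ρ x₀ y + topCoeff o τ x₀ y := by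
  have : loc (fun x => ρ x + τ x) x₀ y = loc ρ x₀ y + loc τ x₀ y := map_add (pullback _) _ _
  rw [topCoeff, this, topCoeff, topCoeff, ← mul_add]
  rfl

lemma topCoeff_eq_zero {ρ : Form d M} {x₀ : M} {y : Mod d}
    (h : ρ ((extChartAt (𝓡 d) x₀).symm y) = 0) : topCoeff o ρ x₀ y = 0 := by
  rw [topCoeff, loc, rep, h, map_zero]
  exact mul_zero _

lemma continuousOn_chartSign (ho : IsOrientation o) (x₀ : M) :
    ContinuousOn (fun y => chartSign o x₀ ((extChartAt (𝓡 d) x₀).symm y))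
      (extChartAt (𝓡 d) x₀).target :=
  (ho x₀).congr fun y hy => by
    beta_reduce
    rw [chartInvDeriv_eq_frame x₀ hy]; rfl

lemma chartSign_eq (o : ∀ x : M, Orientation ℝ (Tan d x) (Fin d)) {x₀ x : M}
    (hx : x ∈ (extChartAt (𝓡 d) x₀).source) :
    chartSign o x₀ x = 1 ∨ chartSign o x₀ x = -1 := by
  have hb := chartFrame_isDualFrame x₀ hx
  have h : (o x).someVector (fun i => chartFrame x₀ x (stdE d i)) ≠ 0 := by
    have := (AlternatingMap.map_basis_ne_zero_iff hb.basis (o x).someVector).2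
      (o x).someVector_ne_zero
    have e : (hb.basis : Fin d → Tan d x) = fun i => chartFrame x₀ x (stdE d i) :=
      funext fun i => hb.basis_apply i
    rwa [e] at this
  unfold chartSign frameSign
  rcases lt_or_gt_of_ne h with h | h
  · right; simp [sign_neg h]
  · left; simp [sign_pos h]

lemma eventually_chartSign (ho : IsOrientation o) {x₀ x : M}
    (hx : x ∈ (extChartAt (𝓡 d) x₀).source) :
    ∀ᶠ y in nhds (extChartAt (𝓡 d) x₀ x),
      chartSign o x₀ ((extChartAt (𝓡 d) x₀).symm y) = chartSign o x₀ x := by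
  have hy := (extChartAt (𝓡 d) x₀).map_source hx
  have hc := ((continuousOn_chartSign ho x₀).continuousAt
    ((isOpen_extChartAt_target x₀).mem_nhds hy))
  have h1 := Metric.tendsto_nhds.1 hc 1 one_pos
  filter_upwards [h1, (isOpen_extChartAt_target x₀).mem_nhds hy] with y hy1 hyt
  rw [(extChartAt (𝓡 d) x₀).left_inv hx, Real.dist_eq] at hy1
  rcases chartSign_eq o hx with e | e <;>
    rcases chartSign_eq o ((extChartAt (𝓡 d) x₀).map_target hyt) with e' | e' <;>
    rw [e, e'] at hy1 ⊢ <;> norm_num at hy1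

lemma continuousOn_topCoeff (ho : IsOrientation o) {ρ : Form d M} (hρ : ρ.IsSmooth) (x₀ : M) :
    ContinuousOn (topCoeff o ρ x₀) (extChartAt (𝓡 d) x₀).target := by
  refine ContinuousOn.mul (Complex.continuous_ofReal.comp_continuousOn
    (continuousOn_chartSign ho x₀)) fun y hy => ?_
  exact ((hρ.loc x₀ hy).apply d (stdE d)).continuousAt.continuousWithinAt

lemma isCompact_image_chart {x₀ : M} {K : Set M} (hK : IsCompact K)
    (hs : K ⊆ (extChartAt (𝓡 d) x₀).source) : IsCompact (extChartAt (𝓡 d) x₀ '' K) :=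
  hK.image_of_continuousOn ((continuousOn_extChartAt x₀).mono hs)

lemma image_chart_subset {x₀ : M} {K : Set M} (hs : K ⊆ (extChartAt (𝓡 d) x₀).source) :
    extChartAt (𝓡 d) x₀ '' K ⊆ (extChartAt (𝓡 d) x₀).target := by
  rintro _ ⟨z, hz, rfl⟩
  exact (extChartAt (𝓡 d) x₀).map_source (hs hz)

lemma symm_notMem {x₀ : M} {K : Set M} {y : Mod d} (hy : y ∈ (extChartAt (𝓡 d) x₀).target)
    (h : y ∉ extChartAt (𝓡 d) x₀ '' K) : (extChartAt (𝓡 d) x₀).symm y ∉ K := fun hK =>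
  h ⟨_, hK, (extChartAt (𝓡 d) x₀).right_inv hy⟩

lemma integrableOn_topCoeff (ho : IsOrientation o) {ρ : Form d M} (hρ : ρ.IsSmooth) {x₀ : M}
    {K : Set M} (hK : IsCompact K) (hs : K ⊆ (extChartAt (𝓡 d) x₀).source)
    (h0 : ∀ z ∉ K, ρ z = 0) : IntegrableOn (topCoeff o ρ x₀) (extChartAt (𝓡 d) x₀).target := by
  refine IntegrableOn.of_forall_sdiff_eq_zero (((continuousOn_topCoeff ho hρ x₀).mono
    (image_chart_subset hs)).integrableOn_compact (isCompact_image_chart hK hs))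
    (isOpen_extChartAt_target x₀).measurableSet fun y hy => ?_
  exact topCoeff_eq_zero (h0 _ (symm_notMem hy.1 hy.2))

/-! ### Independence of the chart -/

lemma alternating_comp {V : Type*} [AddCommGroup V] [Module ℝ V]
    (b : Module.Basis (Fin d) ℝ V) (f : V [⋀^Fin d]→ₗ[ℝ] ℝ) (A : V →ₗ[ℝ] V) :
    f (A ∘ b) = LinearMap.det A * f b := by
  rw [f.eq_smul_basis_det b, AlternatingMap.smul_apply, AlternatingMap.smul_apply, b.det_comp,
    smul_eq_mul, smul_eq_mul]
  ring

/-- The standard frame as a basis. -/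
def stdB (d : ℕ) : Module.Basis (Fin d) ℝ (Mod d) := (stdFrame d).basis

lemma stdB_coe (d : ℕ) : (stdB d : Fin d → Mod d) = stdE d :=
  funext fun i => (stdFrame d).basis_apply i

lemma form_top_comp (η : Mod d [⋀^Fin d]→L[ℝ] ℂ) (A : Mod d →L[ℝ] Mod d) :
    η (A ∘ stdE d) = (A.det : ℂ) * η (stdE d) := by
  have h1 := alternating_comp (stdB d) (Complex.reLm.compAlternatingMap η.toAlternatingMap) A
  have h2 := alternating_comp (stdB d) (Complex.imLm.compAlternatingMap η.toAlternatingMap) A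
  rw [stdB_coe] at h1 h2
  refine Complex.ext ?_ ?_
  · rw [Complex.re_ofReal_mul]; exact h1
  · rw [Complex.im_ofReal_mul]; exact h2

/-- A top form changes by the determinant of the coordinate change, and the sign of the chart by the
sign of that determinant. The product is the absolute value in the change of variables formula. -/
lemma topCoeff_change (ρ : Form d M) (x₀ x₁ : M) {y : Mod d}
    (hy : y ∈ (extChartAt (𝓡 d) x₁).target)
    (h₀ : (extChartAt (𝓡 d) x₁).symm y ∈ (extChartAt (𝓡 d) x₀).source) :
    topCoeff o ρ x₁ y = |(fderiv ℝ (chartChange x₁ x₀ : Mod d → Mod d) y).det| •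
      topCoeff o ρ x₀ (chartChange x₁ x₀ y) := by
  set x := (extChartAt (𝓡 d) x₁).symm y with hx
  have h₁ : x ∈ (extChartAt (𝓡 d) x₁).source := (extChartAt (𝓡 d) x₁).map_target hy
  have e := fderiv_chartChange x₁ x₀ h₁ h₀
  rw [hx, (extChartAt (𝓡 d) x₁).right_inv hy, ← hx] at e
  set A := fderiv ℝ (chartChange x₁ x₀ : Mod d → Mod d) y
  have e2 : (extChartAt (𝓡 d) x₀).symm (chartChange x₁ x₀ y) = x := by
    rw [chartChange, Function.comp_apply, (extChartAt (𝓡 d) x₀).left_inv h₀]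
  have hfr : ∀ v, chartFrame x₁ x v = chartFrame x₀ x (A v) := fun v => by
    rw [e]
    exact (chartFrame_chartDeriv x₀ h₀ _).symm
  have hl : loc ρ x₁ y d (stdE d) = (A.det : ℂ) * loc ρ x₀ (chartChange x₁ x₀ y) d (stdE d) := by
    rw [← form_top_comp, loc, loc, e2]
    change ρ x d (fun i => chartFrame x₁ x (stdE d i)) =
      ρ x d (fun i => chartFrame x₀ x (A (stdE d i)))
    simp only [hfr]
  have hs : chartSign o x₁ x = SignType.sign A.det * chartSign o x₀ x := by
    have h1 := alternating_comp (stdB d) (((o x).someVector).compLinearMap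
      (chartFrame (d := d) x₀ x).toLinearMap) A
    rw [stdB_coe] at h1
    have h2 : (o x).someVector (fun i => chartFrame x₁ x (stdE d i)) =
        A.det * (o x).someVector (fun i => chartFrame x₀ x (stdE d i)) := by
      simp only [hfr]
      exact h1
    rw [chartSign, chartSign, frameSign, frameSign, h2, sign_mul, SignType.coe_mul]
  rw [topCoeff, topCoeff, e2, hl, ← hx, hs, Complex.real_smul, ← sign_mul_self]
  push_cast
  ring

/-- Both integrals reduce to the images of the overlap of the two charts, between which the change
of variables formula applies. -/
lemma chartIntegral_eq {ρ : Form d M} {x₀ x₁ : M}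
    (h : ∀ z, z ∉ (extChartAt (𝓡 d) x₀).source ∩ (extChartAt (𝓡 d) x₁).source → ρ z = 0) :
    chartIntegral o ρ x₁ = chartIntegral o ρ x₀ := by
  have hopen : ∀ a b : M, IsOpen ((extChartAt (𝓡 d) a).target ∩
      (extChartAt (𝓡 d) a).symm ⁻¹' (extChartAt (𝓡 d) b).source) := fun a b =>
    (continuousOn_extChartAt_symm a).isOpen_inter_preimage (isOpen_extChartAt_target a)
      (isOpen_extChartAt_source b)
  set U := (extChartAt (𝓡 d) x₁).target ∩
    (extChartAt (𝓡 d) x₁).symm ⁻¹' (extChartAt (𝓡 d) x₀).source with hU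
  have himg : (chartChange x₁ x₀ : Mod d → Mod d) '' U = (extChartAt (𝓡 d) x₀).target ∩
      (extChartAt (𝓡 d) x₀).symm ⁻¹' (extChartAt (𝓡 d) x₁).source := by
    ext y
    constructor
    · rintro ⟨w, ⟨hw, hw'⟩, rfl⟩
      refine ⟨(extChartAt (𝓡 d) x₀).map_source hw', ?_⟩
      rw [Set.mem_preimage, chartChange, Function.comp_apply, (extChartAt (𝓡 d) x₀).left_inv hw']
      exact (extChartAt (𝓡 d) x₁).map_target hw
    · rintro ⟨hy, hy'⟩
      refine ⟨extChartAt (𝓡 d) x₁ ((extChartAt (𝓡 d) x₀).symm y),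
        ⟨(extChartAt (𝓡 d) x₁).map_source hy', ?_⟩, ?_⟩
      · rw [Set.mem_preimage, (extChartAt (𝓡 d) x₁).left_inv hy']
        exact (extChartAt (𝓡 d) x₀).map_target hy
      · rw [chartChange, Function.comp_apply, (extChartAt (𝓡 d) x₁).left_inv hy',
          (extChartAt (𝓡 d) x₀).right_inv hy]
  have hinj : Set.InjOn (chartChange x₁ x₀ : Mod d → Mod d) U := fun a ha b hb hab => by
    have h1 := (extChartAt (𝓡 d) x₀).injOn ha.2 hb.2 hab
    exact (extChartAt (𝓡 d) x₁).symm.injOn ha.1 hb.1 h1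
  have hderiv : ∀ y ∈ U, HasFDerivWithinAt (chartChange x₁ x₀ : Mod d → Mod d)
      (fderiv ℝ (chartChange x₁ x₀ : Mod d → Mod d) y) U y := fun y hy => by
    have := contDiffAt_chartChange x₁ x₀ ((extChartAt (𝓡 d) x₁).map_target hy.1) hy.2
    rw [(extChartAt (𝓡 d) x₁).right_inv hy.1] at this
    exact (this.differentiableAt (by simp)).hasFDerivAt.hasFDerivWithinAt
  have e1 : chartIntegral o ρ x₁ = ∫ y in U, topCoeff o ρ x₁ y :=
    setIntegral_eq_of_subset_of_forall_sdiff_eq_zero (isOpen_extChartAt_target x₁).measurableSet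
      Set.inter_subset_left fun y hy => topCoeff_eq_zero (h _ fun hz => hy.2 ⟨hy.1, hz.1⟩)
  have e0 : chartIntegral o ρ x₀ = ∫ y in (chartChange x₁ x₀ : Mod d → Mod d) '' U,
      topCoeff o ρ x₀ y := by
    rw [himg]
    exact setIntegral_eq_of_subset_of_forall_sdiff_eq_zero
      (isOpen_extChartAt_target x₀).measurableSet
      Set.inter_subset_left fun y hy => topCoeff_eq_zero (h _ fun hz => hy.2 ⟨hy.1, hz.2⟩)
  rw [e1, e0, integral_image_eq_integral_abs_det_fderiv_smul volume (hopen x₁ x₀).measurableSet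
    hderiv hinj]
  exact setIntegral_congr_fun (hopen x₁ x₀).measurableSet fun y hy =>
    topCoeff_change ρ x₀ x₁ hy.1 hy.2

/-! ### The integral of compactly supported forms -/

variable [T2Space M] [SigmaCompactSpace M]

lemma chartPartition_subordinate (x₀ : M) :
    tsupport (chartPartition d M x₀) ⊆ (extChartAt (𝓡 d) x₀).source := by
  rw [extChartAt_source]
  exact (SmoothPartitionOfUnity.exists_isSubordinate_chartAt_source (𝓡 d) M).choose_spec x₀

/-- The product of a form with a function of the partition of unity. -/
def partMul (ρ : Form d M) (x₀ : M) : Form d M := fun x => (chartPartition d M x₀ x : ℂ) • ρ x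

lemma partMul_isSmooth {ρ : Form d M} (h : ρ.IsSmooth) (x₀ : M) : (partMul ρ x₀).IsSmooth :=
  isSmoothEnd_fmul (contMDiff_ofReal (chartPartition d M x₀).contMDiff) ρ h

lemma integral_eq_finsum (ρ : Form d M) :
    integral o (fun x => ρ x d) = ∑ᶠ x₀, chartIntegral o (partMul ρ x₀) x₀ := by
  rw [integral]
  refine finsum_congr fun x₀ => setIntegral_congr_fun (isOpen_extChartAt_target x₀).measurableSet
    fun y hy => ?_
  beta_reduce
  rw [localRep_eq_loc ρ x₀ hy, chartInvDeriv_eq_frame x₀ hy]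
  refine Eq.trans ?_ (topCoeff_smul (fun x => (chartPartition d M x₀ x : ℂ)) ρ x₀ y).symm
  rw [topCoeff, Complex.ofReal_mul, mul_assoc]
  rfl

lemma exists_finset_partition {K : Set M} (hK : IsCompact K) :
    ∃ t : Finset M, (∀ x₀ ∉ t, ∀ z ∈ K, chartPartition d M x₀ z = 0) ∧
      ∀ z ∈ K, ∑ x₀ ∈ t, chartPartition d M x₀ z = 1 := by
  have hf := (chartPartition d M).locallyFinite.finite_nonempty_inter_compact hK
  have h1 : ∀ x₀ ∉ hf.toFinset, ∀ z ∈ K, chartPartition d M x₀ z = 0 := fun x₀ hx z hz => by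
    by_contra h
    exact hx (hf.mem_toFinset.2 ⟨z, h, hz⟩)
  refine ⟨hf.toFinset, h1, fun z hz => ?_⟩
  rw [← (chartPartition d M).sum_eq_one (Set.mem_univ z)]
  exact (finsum_eq_sum_of_support_subset _ fun x₀ hx => by
    by_contra h
    exact hx (h1 x₀ h z hz)).symm

lemma partMul_eq_zero {ρ : Form d M} {x₀ z : M} (h : chartPartition d M x₀ z = 0 ∨ ρ z = 0) :
    partMul ρ x₀ z = 0 := by
  rcases h with h | h
  · rw [partMul, h, Complex.ofReal_zero, zero_smul ℂ (ρ z)]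
  · rw [partMul, h]
    exact smul_zero (M := ℂ) (A := Spinor (Tan d z)) _

lemma integral_eq_sum {ρ : Form d M} {K : Set M} (h0 : ∀ z ∉ K, ρ z = 0) {t : Finset M}
    (ht : ∀ x₀ ∉ t, ∀ z ∈ K, chartPartition d M x₀ z = 0) :
    integral o (fun x => ρ x d) = ∑ x₀ ∈ t, chartIntegral o (partMul ρ x₀) x₀ := by
  rw [integral_eq_finsum]
  refine finsum_eq_sum_of_support_subset _ fun x₀ hx => ?_
  by_contra h
  refine hx (setIntegral_eq_zero_of_forall_eq_zero fun y _ => topCoeff_eq_zero ?_)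
  by_cases hz : (extChartAt (𝓡 d) x₀).symm y ∈ K
  · exact partMul_eq_zero (Or.inl (ht x₀ h _ hz))
  · exact partMul_eq_zero (Or.inr (h0 _ hz))

lemma partMul_support {ρ : Form d M} {K : Set M} (h0 : ∀ z ∉ K, ρ z = 0) (x₀ : M) :
    ∀ z ∉ K ∩ tsupport (chartPartition d M x₀), partMul ρ x₀ z = 0 := fun z hz => by
  by_cases h : z ∈ K
  · exact partMul_eq_zero (Or.inl (image_eq_zero_of_notMem_tsupport fun h' => hz ⟨h, h'⟩))
  · exact partMul_eq_zero (Or.inr (h0 z h))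

lemma chartIntegral_add (ho : IsOrientation o) {ρ τ : Form d M} (hρ : ρ.IsSmooth)
    (hτ : τ.IsSmooth) {x₀ : M} {K : Set M} (hK : IsCompact K)
    (hs : K ⊆ (extChartAt (𝓡 d) x₀).source) (h0 : ∀ z ∉ K, ρ z = 0) (h0' : ∀ z ∉ K, τ z = 0) :
    chartIntegral o (fun x => ρ x + τ x) x₀ = chartIntegral o ρ x₀ + chartIntegral o τ x₀ := by
  rw [chartIntegral]
  simp only [topCoeff_add]
  exact integral_add (integrableOn_topCoeff ho hρ hK hs h0) (integrableOn_topCoeff ho hτ hK hs h0')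

lemma integral_form_add (ho : IsOrientation o) {ρ τ : Form d M} (hρ : ρ.IsSmooth)
    (hτ : τ.IsSmooth) {K : Set M} (hK : IsCompact K) (h0 : ∀ z ∉ K, ρ z = 0)
    (h0' : ∀ z ∉ K, τ z = 0) : integral o (fun x => (ρ x + τ x) d) =
      integral o (fun x => ρ x d) + integral o (fun x => τ x d) := by
  obtain ⟨t, ht, -⟩ := exists_finset_partition (d := d) hK
  rw [integral_eq_sum h0 ht, integral_eq_sum h0' ht,
    integral_eq_sum (ρ := fun x => ρ x + τ x) (fun z hz => by rw [h0 z hz, h0' z hz, add_zero]) ht,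
    ← Finset.sum_add_distrib]
  refine Finset.sum_congr rfl fun x₀ _ => ?_
  have e : partMul (fun x => ρ x + τ x) x₀ = fun x => partMul ρ x₀ x + partMul τ x₀ x :=
    funext fun x => smul_add _ _ _
  rw [e]
  exact chartIntegral_add ho (partMul_isSmooth hρ x₀) (partMul_isSmooth hτ x₀)
    (hK.inter_right (isClosed_tsupport _))
    (Set.inter_subset_right.trans (chartPartition_subordinate x₀)) (partMul_support h0 x₀)
    (partMul_support h0' x₀)

lemma integral_form_smul (c : ℂ) (ρ : Form d M) :
    integral o (fun x => (c • ρ x) d) = c * integral o (fun x => ρ x d) := by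
  rw [integral_eq_finsum (fun x => c • ρ x), integral_eq_finsum, ← smul_eq_mul, smul_finsum]
  refine finsum_congr fun x₀ => ?_
  rw [chartIntegral, chartIntegral, smul_eq_mul, ← MeasureTheory.integral_const_mul]
  refine integral_congr_ae (Filter.Eventually.of_forall fun y => ?_)
  have e : partMul (fun x => c • ρ x) x₀ = fun x => (fun _ => c) x • partMul ρ x₀ x :=
    funext fun x => smul_comm _ _ _
  rw [e]
  exact topCoeff_smul _ _ _ _

/-- Each term of the partition of unity is moved to the chart at `x₀`, where the functions of the
partition add up to one on `K`. Thus the partition disappears for forms supported in one chart. -/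
lemma integral_of_chart (ho : IsOrientation o) {ρ : Form d M} (hρ : ρ.IsSmooth) {x₀ : M}
    {K : Set M} (hK : IsCompact K) (hs : K ⊆ (extChartAt (𝓡 d) x₀).source)
    (h0 : ∀ z ∉ K, ρ z = 0) : integral o (fun x => ρ x d) = chartIntegral o ρ x₀ := by
  obtain ⟨t, ht, h1⟩ := exists_finset_partition (d := d) hK
  rw [integral_eq_sum h0 ht]
  have e : ∀ i ∈ t, chartIntegral o (partMul ρ i) i = chartIntegral o (partMul ρ i) x₀ :=
    fun i _ => chartIntegral_eq fun z hz => partMul_support h0 i z fun hz' =>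
      hz ⟨hs hz'.1, chartPartition_subordinate i hz'.2⟩
  rw [Finset.sum_congr rfl e]
  simp only [chartIntegral]
  rw [← integral_finsetSum _ fun i _ => integrableOn_topCoeff ho (partMul_isSmooth hρ i) hK hs
    fun z hz => partMul_eq_zero (Or.inr (h0 z hz))]
  refine integral_congr_ae (Filter.Eventually.of_forall fun y => ?_)
  beta_reduce
  have e2 : ∀ i, topCoeff o (partMul ρ i) x₀ y =
      (chartPartition d M i ((extChartAt (𝓡 d) x₀).symm y) : ℂ) * topCoeff o ρ x₀ y := fun i =>
    topCoeff_smul _ _ _ _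
  simp only [e2]
  rw [← Finset.sum_mul]
  by_cases hz : (extChartAt (𝓡 d) x₀).symm y ∈ K
  · rw [← Complex.ofReal_sum, h1 _ hz, Complex.ofReal_one, one_mul]
  · rw [topCoeff_eq_zero (h0 _ hz), mul_zero]

end Integration

open MeasureTheory

/-! ### The divergence theorem on `ℝᵈ`, and `d` against the Mukai pairing -/

section Divergence

variable {d : ℕ}

/-- The integral of a directional derivative of a function with compact support in an open set. -/
lemma setIntegral_fderiv_eq_zero {U K : Set (Mod d)} (hU : IsOpen U) (hK : IsCompact K)
    (hKU : K ⊆ U) {f : Mod d → ℂ} (hf : ∀ y ∈ U, ContDiffAt ℝ ∞ f y) (h0 : ∀ y ∈ U \ K, f y = 0)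
    (v : Mod d) :
    IntegrableOn (fun y => fderiv ℝ f y v) U ∧ ∫ y in U, fderiv ℝ f y v = 0 := by
  set g : Mod d → ℂ := U.indicator f with hg
  have hgf : ∀ y ∈ U, g =ᶠ[nhds y] f := fun y hy => by
    filter_upwards [hU.mem_nhds hy] with z hz
    rw [hg, Set.indicator_of_mem hz]
  have hg0 : ∀ y ∉ K, g y = 0 := fun y hy => by
    by_cases hyU : y ∈ U
    · rw [hg, Set.indicator_of_mem hyU, h0 y ⟨hyU, hy⟩]
    · rw [hg, Set.indicator_of_notMem hyU]
  have hgz : ∀ y ∉ K, g =ᶠ[nhds y] fun _ => 0 := fun y hy => by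
    filter_upwards [hK.isClosed.isOpen_compl.mem_nhds hy] with z hz using hg0 z hz
  have hsmooth : ContDiff ℝ ∞ g := contDiff_iff_contDiffAt.2 fun y => by
    by_cases hy : y ∈ U
    · exact (hf y hy).congr_of_eventuallyEq (hgf y hy)
    · exact contDiffAt_const.congr_of_eventuallyEq (hgz y fun h => hy (hKU h))
  have hcs : HasCompactSupport g := HasCompactSupport.intro hK hg0
  have hcont : Continuous fun y => fderiv ℝ g y v :=
    (hsmooth.continuous_fderiv (by simp)).clm_apply continuous_const
  have hint : Integrable fun y => fderiv ℝ g y v :=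
    hcont.integrable_of_hasCompactSupport (hcs.fderiv_apply ℝ v)
  have hzero : ∫ y, fderiv ℝ g y v = 0 := by
    -- Integration by parts against the constant function `1`, after extension of `f` by zero.
    have h := integral_bilinear_hasLineDerivAt_right_eq_neg_left_of_integrable
      (μ := (volume : Measure (Mod d))) (f := fun _ => (1 : ℂ)) (f' := fun _ => 0) (g := g)
      (g' := fun y => fderiv ℝ g y v) (v := v) (B := ContinuousLinearMap.mul ℝ ℂ)
      (by simp) (by simpa using hint)
      (by simpa using hsmooth.continuous.integrable_of_hasCompactSupport hcs)
      (fun y _ => by simpa using (hasFDerivAt_const (1 : ℂ) y).hasLineDerivAt v)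
      (fun y _ => (hsmooth.differentiable (by simp) y).hasFDerivAt.hasLineDerivAt v)
    simpa using h
  have heq : ∀ y ∈ U, fderiv ℝ g y v = fderiv ℝ f y v := fun y hy => by
    rw [(hgf y hy).fderiv_eq]
  refine ⟨hint.integrableOn.congr_fun heq hU.measurableSet, ?_⟩
  rw [← setIntegral_congr_fun hU.measurableSet heq, ← hzero]
  refine setIntegral_eq_integral_of_forall_compl_eq_zero fun y hy => ?_
  rw [(hgz y fun h => hy (hKU h)).fderiv_eq]
  simp

variable {α β : Mod d → Spinor (Mod d)} {x : Mod d}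

lemma SmoothAt.reversal (h : SmoothAt α x) : SmoothAt (fun y => reversal (α y)) x :=
  smoothAt_iff.2 fun k v => contDiffAt_const.mul (h.apply k v)

lemma partialForm_reversal (h : SmoothAt α x) (i : Fin d) :
    partialForm i (fun y => reversal (α y)) x = reversal (partialForm i α x) := by
  refine Spinor.ext fun k v => ?_
  rw [partialForm_apply h.reversal, reversal_apply, ContinuousAlternatingMap.smul_apply,
    partialForm_apply h]
  change fderiv ℝ (fun y => (-1 : ℂ) ^ (k * (k - 1) / 2) * α y k v) x (stdE d i) = _
  rw [fderiv_const_mul (h.differentiableAt_apply k v)]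
  rfl

lemma partialForm_const (ρ : Spinor (Mod d)) (i : Fin d) :
    partialForm i (fun _ => ρ) x = 0 := by
  funext k
  change fderiv ℝ (fun _ => ρ k) x (stdE d i) = 0
  rw [fderiv_fun_const]
  rfl

lemma partialForm_cl_covector (h : SmoothAt α x) (ξ : Mod d →L[ℝ] ℝ) (i : Fin d) :
    partialForm i (fun y => cl (0, ξ) (α y)) x = cl (0, ξ) (partialForm i α x) := by
  simp only [cl_covector]
  rw [partialForm_wedge (smoothAt_const _) h, partialForm_const]
  have : wedge 0 (α x) = 0 := map_zero (wedgeLin.flip _)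
  rw [this, zero_add]

/-- The exterior derivative is symmetric for the Mukai pairing up to a divergence. -/
lemma mukai_flatD (hd : Even d) (h : SmoothAt α x) (h' : SmoothAt β x) (v : Fin d → Mod d) :
    mukai d (flatD α x) (β x) v - mukai d (α x) (flatD β x) v =
      ∑ i, fderiv ℝ (fun y => mukai d (cl (0, stdF d i) (α y)) (β y) v) x (stdE d i) := by
  rw [flatD_eq h, flatD_eq h']
  have e1 : mukai d (∑ i, cl (0, stdF d i) (partialForm i α x)) (β x) v =
      ∑ i, mukai d (cl (0, stdF d i) (partialForm i α x)) (β x) v := by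
    have := map_sum ((mukaiLin d (Mod d)).flip (β x))
      (fun i => cl (0, stdF d i) (partialForm i α x)) Finset.univ
    rw [LinearMap.flip_apply, mukaiLin_apply] at this
    rw [this, ContinuousAlternatingMap.sum_apply]
    rfl
  have e2 : mukai d (α x) (∑ i, cl (0, stdF d i) (partialForm i β x)) v =
      ∑ i, mukai d (α x) (cl (0, stdF d i) (partialForm i β x)) v := by
    have := map_sum (mukaiLin d (Mod d) (α x))
      (fun i => cl (0, stdF d i) (partialForm i β x)) Finset.univ
    rw [mukaiLin_apply] at this
    rw [this, ContinuousAlternatingMap.sum_apply]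
    rfl
  rw [e1, e2, ← Finset.sum_sub_distrib]
  refine Finset.sum_congr rfl fun i _ => ?_
  have hc : SmoothAt (fun y => cl (0, stdF d i) (α y)) x :=
    h.cl contDiffAt_const contDiffAt_const
  have h1 := partialForm_apply (hc.wedge h'.reversal) i d v
  rw [partialForm_wedge hc h'.reversal, partialForm_cl_covector h, partialForm_reversal h'] at h1
  refine Eq.trans ?_ h1
  change _ = mukai d _ _ v + mukai d _ _ v
  -- Moving the covector to the second argument produces the minus sign that turns the product rule
  -- into the difference of the two pairings.
  rw [(stdFrame d).mukai_cl hd (0, stdF d i) (α x)]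
  change _ = _ + -mukai d _ _ v
  rw [sub_eq_add_neg]

end Divergence

/-! ### Stokes' theorem in a chart -/

section Stokes

variable {d : ℕ} {M : Type*} [TopologicalSpace M] [ChartedSpace (Mod d) M] [IsManifold (𝓡 d) ∞ M]
  {o : ∀ x : M, Orientation ℝ (Tan d x) (Fin d)} {H : KForm d M ℝ 3}

lemma isSmooth_mukai {α β : Form d M} (hα : α.IsSmooth) (hβ : β.IsSmooth) :
    Form.IsSmooth fun x => wedge (α x) (reversal (β x)) :=
  Form.isSmooth_iff.2 fun x => (Form.isSmooth_iff.1 hα x).wedge (by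
    refine SmoothAt.congr (SmoothAt.reversal (Form.isSmooth_iff.1 hβ x))
      (Filter.Eventually.of_forall fun _ => (pullback_reversal _ _).symm))

lemma topCoeff_mukai (α β : Form d M) (x₀ : M) (y : Mod d) :
    topCoeff o (fun x => wedge (α x) (reversal (β x))) x₀ y =
      (chartSign o x₀ ((extChartAt (𝓡 d) x₀).symm y) : ℂ) *
        mukai d (loc α x₀ y) (loc β x₀ y) (stdE d) := by
  rw [topCoeff, loc, rep, pullback_wedge, pullback_reversal]
  rfl

lemma dH_eq_zero [T2Space M] {ρ : Form d M} {K : Set M} (hK : IsCompact K)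
    (h0 : ∀ z ∉ K, ρ z = 0) {z : M} (hz : z ∉ K) : dH H ρ z = 0 := by
  have he : ∀ᶠ w in nhds z, ρ w = (0 : ℂ) • ρ w := by
    filter_upwards [hK.isClosed.isOpen_compl.mem_nhds hz] with w hw
    rw [h0 w hw]
    exact (smul_zero (M := ℂ) (A := Spinor (Tan d w)) _).symm
  have hs : Form.SmoothAt ρ z := (form_smoothAt_zero z).congr (by
    filter_upwards [hK.isClosed.isOpen_compl.mem_nhds hz] with w hw using (h0 w hw).symm)
  rw [dH_congr he, dH_smul 0 hs]
  exact zero_smul ℂ (dH H ρ z)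

/-- The terms with `H` cancel because wedging with a 3-form is symmetric for the pairing; what
remains is the divergence of `mukai_flatD`. -/
lemma mukai_dH (hd : Even d) (α β : Form d M) (x₀ : M) {y : Mod d}
    (hy : y ∈ (extChartAt (𝓡 d) x₀).target) (hα : α.IsSmooth) (hβ : β.IsSmooth) :
    mukai d (loc (dH H α) x₀ y) (loc β x₀ y) (stdE d) -
      mukai d (loc α x₀ y) (loc (dH H β) x₀ y) (stdE d) =
    ∑ i, fderiv ℝ (fun y => mukai d (cl (0, stdF d i) (loc α x₀ y)) (loc β x₀ y) (stdE d)) y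
      (stdE d i) := by
  rw [← mukai_flatD hd (hα.loc x₀ hy) (hβ.loc x₀ hy), loc_dH hα x₀ hy, loc_dH hβ x₀ hy]
  have e : loc (threeForm H) x₀ y = homog 3 ((complexify
      (H ((extChartAt (𝓡 d) x₀).symm y))).compContinuousLinearMap
        (chartFrame x₀ ((extChartAt (𝓡 d) x₀).symm y))) := by
    rw [loc, rep, threeForm, pullback_homog]
  have h1 : mukai d (flatD (loc α x₀) y + wedge (loc (threeForm H) x₀ y) (loc α x₀ y))
      (loc β x₀ y) = mukai d (flatD (loc α x₀) y) (loc β x₀ y) +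
        mukai d (wedge (loc (threeForm H) x₀ y) (loc α x₀ y)) (loc β x₀ y) := by
    simp only [← mukaiLin_apply, map_add, LinearMap.add_apply]
  have h2 : mukai d (loc α x₀ y) (flatD (loc β x₀) y +
      wedge (loc (threeForm H) x₀ y) (loc β x₀ y)) = mukai d (loc α x₀ y) (flatD (loc β x₀) y) +
        mukai d (loc α x₀ y) (wedge (loc (threeForm H) x₀ y) (loc β x₀ y)) := by
    simp only [← mukaiLin_apply, map_add]
  rw [h1, h2, e, (stdFrame d).mukai_three_wedge hd]
  simp only [ContinuousAlternatingMap.add_apply]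
  ring

lemma chartIntegral_stokes (ho : IsOrientation o) (hd : Even d) {α β : Form d M}
    (hα : α.IsSmooth) (hβ : β.IsSmooth) {x₀ : M} {K : Set M}
    (hK : IsCompact K) (hs : K ⊆ (extChartAt (𝓡 d) x₀).source)
    (h0 : (∀ z ∉ K, α z = 0) ∨ ∀ z ∉ K, β z = 0) :
    chartIntegral o (fun x => wedge (dH H α x) (reversal (β x)) -
      wedge (α x) (reversal (dH H β x))) x₀ = 0 := by
  have ht := isOpen_extChartAt_target (I := 𝓡 d) x₀
  let m : Fin d → Mod d → ℂ := fun i y =>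
    mukai d (cl (0, stdF d i) (loc α x₀ y)) (loc β x₀ y) (stdE d)
  let f : Fin d → Mod d → ℂ := fun i y =>
    (chartSign o x₀ ((extChartAt (𝓡 d) x₀).symm y) : ℂ) * m i y
  have hm : ∀ i, ∀ y ∈ (extChartAt (𝓡 d) x₀).target, ContDiffAt ℝ ∞ (m i) y := fun i y hy =>
    (((hα.loc x₀ hy).cl contDiffAt_const contDiffAt_const).wedge (hβ.loc x₀ hy).reversal).apply d _
  -- The sign of the chart is locally constant, so it passes through the derivatives and `f i` is as
  -- smooth as `m i`.
  have hsign : ∀ y ∈ (extChartAt (𝓡 d) x₀).target, ∀ i, f i =ᶠ[nhds y] fun w =>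
      (chartSign o x₀ ((extChartAt (𝓡 d) x₀).symm y) : ℂ) * m i w := fun y hy i => by
    have h := eventually_chartSign ho ((extChartAt (𝓡 d) x₀).map_target hy)
    rw [(extChartAt (𝓡 d) x₀).right_inv hy] at h
    filter_upwards [h] with w hw
    simp only [f, hw]
  have key := fun i => setIntegral_fderiv_eq_zero ht (isCompact_image_chart hK hs)
    (image_chart_subset hs) (f := f i)
    (fun y hy => (contDiffAt_const.mul (hm i y hy)).congr_of_eventuallyEq (hsign y hy i))
    (fun y hy => by
      have hz := symm_notMem hy.1 hy.2
      have : m i y = 0 := by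
        rcases h0 with h | h
        · have e : loc α x₀ y = 0 := by rw [loc, rep, h _ hz, map_zero]
          simp only [m, e, ← mukaiLin_apply, map_zero, LinearMap.zero_apply]
          rfl
        · have e : loc β x₀ y = 0 := by rw [loc, rep, h _ hz, map_zero]
          simp only [m, e, ← mukaiLin_apply, map_zero]
          rfl
      simp only [f, this, mul_zero]) (stdE d i)
  have hsum : ∫ y in (extChartAt (𝓡 d) x₀).target, ∑ i, fderiv ℝ (f i) y (stdE d i) = 0 := by
    rw [integral_finsetSum _ fun i _ => (key i).1]
    exact Finset.sum_eq_zero fun i _ => (key i).2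
  rw [← hsum, chartIntegral]
  refine setIntegral_congr_fun ht.measurableSet fun y hy => ?_
  beta_reduce
  have e1 : (fun x => wedge (dH H α x) (reversal (β x)) - wedge (α x) (reversal (dH H β x))) =
      fun x => wedge (dH H α x) (reversal (β x)) +
        (fun _ => (-1 : ℂ)) x • wedge (α x) (reversal (dH H β x)) := by
    funext x
    rw [neg_one_smul ℂ (wedge (α x) (reversal (dH H β x))), sub_eq_add_neg]
  rw [e1, topCoeff_add, topCoeff_smul, topCoeff_mukai, topCoeff_mukai]
  have e2 : ∀ i, fderiv ℝ (f i) y (stdE d i) =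
      (chartSign o x₀ ((extChartAt (𝓡 d) x₀).symm y) : ℂ) * fderiv ℝ (m i) y (stdE d i) :=
    fun i => by
      rw [(hsign y hy i).fderiv_eq, fderiv_const_mul ((hm i y hy).differentiableAt (by simp))]
      rfl
  simp only [e2]
  rw [← Finset.mul_sum, ← mukai_dH (H := H) hd α β x₀ hy hα hβ]
  ring

end Stokes

open MeasureTheory

/-! ### Transposes for the integrated Mukai pairing -/

section Transpose

variable {d : ℕ} {M : Type*} [TopologicalSpace M] [ChartedSpace (Mod d) M] [IsManifold (𝓡 d) ∞ M]
  {o : ∀ x : M, Orientation ℝ (Tan d x) (Fin d)} {H : KForm d M ℝ 3}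

/-- The form `ρ` vanishes at all points outside of `K`. -/
def VanishesOff (ρ : SForm d M) (K : Set M) : Prop := ∀ z ∉ K, evalAt z ρ = 0

/-- The form `α ∧ σ(β)`, whose top component is the Mukai pairing. -/
def mukaiForm : SForm d M →ₗ[ℂ] SForm d M →ₗ[ℂ] SForm d M :=
  LinearMap.mk₂ ℂ (fun α β => ⟨fun x => wedge (α.1 x) (reversal (β.1 x)), isSmooth_mukai α.2 β.2⟩)
    (fun _ _ _ => sform_ext fun _ => wedge_add_left _ _ _)
    (fun _ _ _ => sform_ext fun _ => wedge_smul_left _ _ _)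
    (fun _ _ _' => sform_ext fun x => (congrArg _ ((reversalLin (Tan d x)).map_add _ _)).trans
      (wedge_add_right _ _ _))
    (fun c _ _ => sform_ext fun x => (congrArg _ ((reversalLin (Tan d x)).map_smul c _)).trans
      (wedge_smul_right _ _ _))

lemma evalAt_mukaiForm (α β : SForm d M) (x : M) :
    evalAt x (mukaiForm α β) = wedge (evalAt x α) (reversal (evalAt x β)) := rfl

lemma VanishesOff.mukaiForm {α β : SForm d M} {K : Set M}
    (h : VanishesOff α K ∨ VanishesOff β K) : VanishesOff (mukaiForm α β) K := fun z hz => by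
  rw [evalAt_mukaiForm]
  rcases h with h | h
  · rw [h z hz]
    exact map_zero (wedgeLin.flip _)
  · rw [h z hz]
    have : reversal (0 : Spinor (Tan d z)) = 0 := map_zero (reversalLin _)
    rw [this]
    exact map_zero (wedgeLin _)

/-- Operators that do not enlarge compact supports. -/
def IsLocalOp (T : SForm d M → SForm d M) : Prop :=
  ∀ ρ K, IsCompact K → VanishesOff ρ K → VanishesOff (T ρ) K

lemma isLocalOp_dEnd [T2Space M] (hH : H.IsSmooth) : IsLocalOp (dEnd hH : SForm d M → SForm d M) :=
  fun _ _ hK h _ hz => dH_eq_zero hK h hz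

lemma ActsBy.isLocalOp {T : Module.End ℂ (SForm d M)} {Z : ∀ x : M, Module.End ℂ (Spinor (Tan d x))}
    (h : ActsBy T Z) : IsLocalOp (T : SForm d M → SForm d M) := fun ρ K _ h0 z hz => by
  rw [h ρ z, h0 z hz, map_zero]

lemma VanishesOff.add {ρ τ : SForm d M} {K : Set M} (h : VanishesOff ρ K) (h' : VanishesOff τ K) :
    VanishesOff (ρ + τ) K := fun z hz => by rw [map_add, h z hz, h' z hz, add_zero]

lemma VanishesOff.smul {ρ : SForm d M} {K : Set M} (c : ℂ) (h : VanishesOff ρ K) :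
    VanishesOff (c • ρ) K := fun z hz => by
  rw [map_smul, h z hz]
  exact smul_zero (M := ℂ) (A := Spinor (Tan d z)) _

lemma VanishesOff.sum {ι : Type*} {t : Finset ι} {ρ : ι → SForm d M} {K : Set M}
    (h : ∀ i ∈ t, VanishesOff (ρ i) K) : VanishesOff (∑ i ∈ t, ρ i) K := fun z hz => by
  rw [map_sum]
  exact Finset.sum_eq_zero fun i hi => h i hi z hz

variable [T2Space M] [SigmaCompactSpace M]

/-- The integral of the top component of a form. -/
def intForm (o : ∀ x : M, Orientation ℝ (Tan d x) (Fin d)) (ρ : SForm d M) : ℂ :=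
  integral o fun x => ρ.1 x d

lemma intForm_add (ho : IsOrientation o) {ρ τ : SForm d M} {K : Set M} (hK : IsCompact K)
    (h : VanishesOff ρ K) (h' : VanishesOff τ K) :
    intForm o (ρ + τ) = intForm o ρ + intForm o τ :=
  integral_form_add ho ρ.2 τ.2 hK h h'

lemma intForm_smul (c : ℂ) (ρ : SForm d M) : intForm o (c • ρ) = c * intForm o ρ :=
  integral_form_smul c ρ.1

lemma intForm_zero : intForm o (0 : SForm d M) = 0 := by
  rw [← zero_smul ℂ (0 : SForm d M), intForm_smul, zero_mul]

lemma intForm_sum (ho : IsOrientation o) {ι : Type*} {t : Finset ι} {ρ : ι → SForm d M} {K : Set M}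
    (hK : IsCompact K) (h : ∀ i ∈ t, VanishesOff (ρ i) K) :
    intForm o (∑ i ∈ t, ρ i) = ∑ i ∈ t, intForm o (ρ i) := by
  classical
  induction t using Finset.induction_on with
  | empty => rw [Finset.sum_empty, Finset.sum_empty, intForm_zero]
  | insert a s ha ih =>
    rw [Finset.sum_insert ha, Finset.sum_insert ha,
      intForm_add ho hK (h a (Finset.mem_insert_self a s))
        (VanishesOff.sum fun i hi => h i (Finset.mem_insert_of_mem hi)),
      ih fun i hi => h i (Finset.mem_insert_of_mem hi)]

/-- A local operator with image of integral zero on the forms supported in charts has image of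
integral zero on all compactly supported forms. -/
lemma intForm_eq_zero_of_local (ho : IsOrientation o) {F : SForm d M →ₗ[ℂ] SForm d M}
    (hF : IsLocalOp (F : SForm d M → SForm d M))
    (hc : ∀ (x₀ : M) (ρ : SForm d M) (K : Set M), IsCompact K →
      K ⊆ (extChartAt (𝓡 d) x₀).source → VanishesOff ρ K → intForm o (F ρ) = 0)
    {ρ : SForm d M} {K : Set M} (hK : IsCompact K) (h : VanishesOff ρ K) :
    intForm o (F ρ) = 0 := by
  obtain ⟨t, -, h1⟩ := exists_finset_partition (d := d) hK
  let p : M → SForm d M := fun i => ⟨partMul ρ.1 i, partMul_isSmooth ρ.2 i⟩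
  have hp : ∀ i, VanishesOff (p i) K := fun i z hz => partMul_eq_zero (Or.inr (h z hz))
  have e : ρ = ∑ i ∈ t, p i := sform_ext fun z => by
    by_cases hz : z ∈ K
    · have e1 : ∀ i, evalAt z (p i) = (chartPartition d M i z : ℂ) • evalAt z ρ := fun i => rfl
      rw [map_sum]
      simp only [e1]
      rw [← Finset.sum_smul, ← Complex.ofReal_sum, h1 z hz, Complex.ofReal_one]
      exact (one_smul ℂ (evalAt z ρ)).symm
    · rw [h z hz, VanishesOff.sum (fun i _ => hp i) z hz]
  rw [e, map_sum, intForm_sum ho hK fun i _ => hF _ K hK (hp i)]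
  exact Finset.sum_eq_zero fun i _ => hc i (p i) _ (hK.inter_right (isClosed_tsupport _))
    (Set.inter_subset_right.trans (chartPartition_subordinate i)) (partMul_support h i)

/-- Stokes' theorem for the Mukai pairing. -/
lemma intForm_stokes (ho : IsOrientation o) (hd : Even d) (hH : H.IsSmooth) {α β : SForm d M}
    {K : Set M} (hK : IsCompact K) (h : VanishesOff α K ∨ VanishesOff β K) :
    intForm o (mukaiForm (dEnd hH α) β) = intForm o (mukaiForm α (dEnd hH β)) := by
  have hl := isLocalOp_dEnd (d := d) (M := M) hH
  have hchart : ∀ (x₀ : M) (α β : SForm d M) (K : Set M), IsCompact K →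
      K ⊆ (extChartAt (𝓡 d) x₀).source → (VanishesOff α K ∨ VanishesOff β K) →
      intForm o (mukaiForm (dEnd hH α) β - mukaiForm α (dEnd hH β)) = 0 := by
    intro x₀ α β K hK hs h
    rw [← chartIntegral_stokes (H := H) ho hd α.2 β.2 hK hs h]
    refine integral_of_chart ho (mukaiForm (dEnd hH α) β - mukaiForm α (dEnd hH β)).2 hK hs ?_
    have h1 : VanishesOff (mukaiForm (dEnd hH α) β) K :=
      VanishesOff.mukaiForm (h.imp (hl α K hK) id)
    have h2 : VanishesOff (mukaiForm α (dEnd hH β)) K :=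
      VanishesOff.mukaiForm (h.imp id (hl β K hK))
    intro z hz
    have := (h1.add (h2.smul (-1))) z hz
    rwa [neg_one_smul, ← sub_eq_add_neg] at this
  have key : intForm o (mukaiForm (dEnd hH α) β - mukaiForm α (dEnd hH β)) = 0 := by
    rcases h with h | h
    -- With the other argument fixed, the difference of the two pairings is a local linear operator
    -- in the compactly supported one. A partition of unity then reduces the claim to a single
    -- chart.
    · let F : SForm d M →ₗ[ℂ] SForm d M :=
        (mukaiForm.flip β) ∘ₗ (dEnd hH) - mukaiForm.flip (dEnd hH β)
      refine intForm_eq_zero_of_local (F := F) ho ?_ (fun x₀ ρ K hK hs h =>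
        hchart x₀ ρ β K hK hs (Or.inl h)) hK h
      intro ρ K hK h
      have := (VanishesOff.mukaiForm (β := β) (Or.inl (hl ρ K hK h))).add
        ((VanishesOff.mukaiForm (β := dEnd hH β) (Or.inl h)).smul (-1))
      rwa [neg_one_smul, ← sub_eq_add_neg] at this
    · let F : SForm d M →ₗ[ℂ] SForm d M :=
        mukaiForm (dEnd hH α) - (mukaiForm α) ∘ₗ (dEnd hH)
      refine intForm_eq_zero_of_local (F := F) ho ?_ (fun x₀ ρ K hK hs h =>
        hchart x₀ α ρ K hK hs (Or.inr h)) hK h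
      intro ρ K hK h
      have := (VanishesOff.mukaiForm (α := dEnd hH α) (Or.inr h)).add
        ((VanishesOff.mukaiForm (α := α) (Or.inr (hl ρ K hK h))).smul (-1))
      rwa [neg_one_smul, ← sub_eq_add_neg] at this
  have h1 : VanishesOff (mukaiForm (dEnd hH α) β) K :=
    VanishesOff.mukaiForm (h.imp (hl α K hK) id)
  have h2 : VanishesOff (mukaiForm α (dEnd hH β)) K :=
    VanishesOff.mukaiForm (h.imp id (hl β K hK))
  rw [sub_eq_add_neg, ← neg_one_smul ℂ (mukaiForm α (dEnd hH β)),
    intForm_add ho hK h1 (h2.smul (-1)), intForm_smul] at key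
  linear_combination key

/-- `T'` is the transpose of `T` for the integrated Mukai pairing. -/
structure IsTranspose (o : ∀ x : M, Orientation ℝ (Tan d x) (Fin d))
    (T T' : Module.End ℂ (SForm d M)) : Prop where
  isLocal : IsLocalOp (T : SForm d M → SForm d M)
  isLocal' : IsLocalOp (T' : SForm d M → SForm d M)
  pair : ∀ α β K, IsCompact K → (VanishesOff α K ∨ VanishesOff β K) →
    intForm o (mukaiForm (T α) β) = intForm o (mukaiForm α (T' β))

variable {T T' U U' : Module.End ℂ (SForm d M)}

lemma isTranspose_dEnd (ho : IsOrientation o) (hd : Even d) (hH : H.IsSmooth) :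
    IsTranspose o (dEnd hH) (dEnd hH) :=
  ⟨isLocalOp_dEnd hH, isLocalOp_dEnd hH, fun _ _ _ hK h => intForm_stokes ho hd hH hK h⟩

lemma IsTranspose.mul (h : IsTranspose o T T') (h' : IsTranspose o U U') :
    IsTranspose o (T * U) (U' * T') where
  isLocal ρ K hK h0 := h.isLocal _ K hK (h'.isLocal ρ K hK h0)
  isLocal' ρ K hK h0 := h'.isLocal' _ K hK (h.isLocal' ρ K hK h0)
  pair α β K hK h0 := by
    rw [Module.End.mul_apply, Module.End.mul_apply, h.pair _ _ K hK (h0.imp (h'.isLocal α K hK) id),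
      h'.pair _ _ K hK (h0.imp id (h.isLocal' β K hK))]

lemma IsTranspose.add (ho : IsOrientation o) (h : IsTranspose o T T') (h' : IsTranspose o U U') :
    IsTranspose o (T + U) (T' + U') where
  isLocal ρ K hK h0 := (h.isLocal ρ K hK h0).add (h'.isLocal ρ K hK h0)
  isLocal' ρ K hK h0 := (h.isLocal' ρ K hK h0).add (h'.isLocal' ρ K hK h0)
  pair α β K hK h0 := by
    rw [LinearMap.add_apply, LinearMap.add_apply, map_add, map_add, LinearMap.add_apply,
      intForm_add ho hK (VanishesOff.mukaiForm (h0.imp (h.isLocal α K hK) id))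
        (VanishesOff.mukaiForm (h0.imp (h'.isLocal α K hK) id)),
      intForm_add ho hK (VanishesOff.mukaiForm (h0.imp id (h.isLocal' β K hK)))
        (VanishesOff.mukaiForm (h0.imp id (h'.isLocal' β K hK))), h.pair _ _ K hK h0,
      h'.pair _ _ K hK h0]

lemma isTranspose_zero : IsTranspose o (0 : Module.End ℂ (SForm d M)) 0 where
  isLocal _ _ _ _ z _ := map_zero (evalAt z)
  isLocal' _ _ _ _ z _ := map_zero (evalAt z)
  pair α β _ _ _ := by
    rw [LinearMap.zero_apply, LinearMap.zero_apply, map_zero, map_zero, LinearMap.zero_apply]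

lemma IsTranspose.sum (ho : IsOrientation o) {ι : Type*} {t : Finset ι}
    {T T' : ι → Module.End ℂ (SForm d M)} (h : ∀ i ∈ t, IsTranspose o (T i) (T' i)) :
    IsTranspose o (∑ i ∈ t, T i) (∑ i ∈ t, T' i) := by
  classical
  induction t using Finset.induction_on with
  | empty => exact isTranspose_zero
  | insert a s ha ih =>
    rw [Finset.sum_insert ha, Finset.sum_insert ha]
    exact (h a (Finset.mem_insert_self a s)).add ho
      (ih fun i hi => h i (Finset.mem_insert_of_mem hi))

lemma isTranspose_of_actsBy {Z Z' : ∀ x : M, Module.End ℂ (Spinor (Tan d x))} (h : ActsBy T Z)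
    (h' : ActsBy T' Z') (hZ : ∀ x a b, mukai d (Z x a) b = mukai d a (Z' x b)) :
    IsTranspose o T T' where
  isLocal := h.isLocalOp
  isLocal' := h'.isLocalOp
  pair α β _ _ _ := congrArg (integral o) (funext fun x => by
    have := hZ x (evalAt x α) (evalAt x β)
    rw [← h, ← h'] at this
    exact this)

end Transpose

/-! ### Transposes and relations of homogeneous operators -/

section Algebra

variable {S : Type*} [AddCommGroup S] [Module ℂ S] {d : ℕ} {N₁ N₂ : Module.End ℂ S}

/-- Each Clifford element is skew, so transposing a product of two reverses its order without a
sign. Reversing the order in the sum defining the spin action changes its sign, because the scalar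
anticommutators cancel by skewness of `J`. -/
lemma IsCliffordModule.pairing_spinEnd {V R : Type*} [AddCommGroup V] [Module ℝ V]
    [TopologicalSpace V] [AddCommGroup R] [Module ℂ R] {c : Gen V →ₗ[ℝ] Module.End ℂ S}
    (hc : IsCliffordModule c) {m : S →ₗ[ℂ] S →ₗ[ℂ] R} (hm : ∀ A a b, m (c A a) b = -m a (c A b))
    {J : Gen V →ₗ[ℝ] Gen V} (hJ : IsSkew J) (e : Fin d → V) (ε : Fin d → V →L[ℝ] ℝ) (a b : S) :
    m (spinEnd c e ε J a) b = -m a (spinEnd c e ε J b) := by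
  have h0 : ∀ k, (c (J (e k, 0)) * c (0, ε k) + c (J (0, ε k)) * c (e k, 0)) +
      (c (0, ε k) * c (J (e k, 0)) + c (e k, 0) * c (J (0, ε k))) = 0 := fun k => by
    have h1 := hc.rel (J (e k, 0)) (0, ε k)
    have h2 := hc.rel (J (0, ε k)) (e k, 0)
    rw [hJ, pairing_comm] at h1
    calc _ = (c (J (e k, 0)) * c (0, ε k) + c (0, ε k) * c (J (e k, 0))) +
        (c (J (0, ε k)) * c (e k, 0) + c (e k, 0) * c (J (0, ε k))) := by abel
      _ = 0 := by rw [h1, h2, ← add_smul, ← Complex.ofReal_add]; simp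
  have h1 : spinEnd c e ε J = -((1 / 2 : ℂ) • ∑ k,
      (c (0, ε k) * c (J (e k, 0)) + c (e k, 0) * c (J (0, ε k)))) := by
    rw [spinEnd_eq, ← smul_neg, ← Finset.sum_neg_distrib]
    congr 1
    exact Finset.sum_congr rfl fun k _ => eq_neg_of_add_eq_zero_left (h0 k)
  conv_rhs => rw [h1]
  rw [spinEnd_eq]
  simp only [LinearMap.smul_apply, LinearMap.neg_apply, LinearMap.sum_apply, LinearMap.add_apply,
    Module.End.mul_apply, map_smul, map_neg, map_sum, map_add, hm, neg_neg]

/-- Symmetric operators with respect to a pairing for which the bigrading is skew have symmetric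
homogeneous parts. -/
lemma IsBigrading.sum_biproj_transpose (h : IsBigrading d N₁ N₂) (r s : ℤ) (T : Module.End ℂ S) :
    ∑ p ∈ Finset.Icc (-d : ℤ) d, ∑ q ∈ Finset.Icc (-d : ℤ) d,
      biproj d N₁ N₂ (-p) (-q) * (T * biproj d N₁ N₂ (-(p + r)) (-(q + s))) =
    bipart d N₁ N₂ r s T := h.ext fun a b v hv => by
  rw [h.bipart_apply r s T hv]
  simp only [LinearMap.sum_apply, Module.End.mul_apply]
  -- A vector of bidegree `(a, b)` survives the right-hand projection only if `p + r = -a` and `q +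
  -- s = -b`.
  have h0 : ∀ p q, (p, q) ≠ (-a - r, -b - s) →
      biproj d N₁ N₂ (-p) (-q) (T (biproj d N₁ N₂ (-(p + r)) (-(q + s)) v)) = 0 := fun p q hpq => by
    rw [h.biproj_ne hv fun he => hpq ?_, map_zero, map_zero]
    rw [Prod.mk.injEq] at he ⊢
    omega
  by_cases hab : -a - r ∈ Finset.Icc (-d : ℤ) d ∧ -b - s ∈ Finset.Icc (-d : ℤ) d
  · rw [Finset.sum_eq_single_of_mem _ hab.1, Finset.sum_eq_single_of_mem _ hab.2]
    · have e1 : -(-a - r + r) = a := by ring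
      have e2 : -(-b - s + s) = b := by ring
      have e3 : -(-a - r) = a + r := by ring
      have e4 : -(-b - s) = b + s := by ring
      rw [e1, e2, e3, e4, h.biproj_self hv]
    · intro q _ hq
      exact h0 _ _ fun he => hq (Prod.ext_iff.1 he).2
    · intro p _ hp
      exact Finset.sum_eq_zero fun q _ => h0 _ _ fun he => hp (Prod.ext_iff.1 he).1
  -- The range is symmetric about `0`: if the only relevant pair of indices lies outside it, so does
  -- the target bidegree `(a + r, b + s)`, and both sides are zero.
  · rw [h.biproj_eq_zero, LinearMap.zero_apply]
    · refine Finset.sum_eq_zero fun p hp => Finset.sum_eq_zero fun q hq => h0 _ _ fun he => hab ?_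
      obtain ⟨rfl, rfl⟩ := Prod.mk.inj he
      exact ⟨hp, hq⟩
    · simp only [Finset.mem_Icc] at hab ⊢
      omega

lemma IsBigrading.bipart_semiconj (h : IsBigrading d N₁ N₂) (f : S →+ S)
    (hf : ∀ (z : ℂ) v, f (z • v) = (starRingEnd ℂ) z • f v) (h₁ : ∀ v, f (N₁ v) = N₁ (f v))
    (h₂ : ∀ v, f (N₂ v) = N₂ (f v)) {T : Module.End ℂ S} (hT : ∀ v, f (T v) = T (f v)) (r s : ℤ)
    (v : S) : f (bipart d N₁ N₂ r s T v) = bipart d N₁ N₂ (-r) (-s) T (f v) := by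
  have key : ∀ p q v, v ∈ bispace N₁ N₂ p q →
      f (bipart d N₁ N₂ r s T v) = bipart d N₁ N₂ (-r) (-s) T (f v) := fun p q v hv => by
    have hfv : f v ∈ bispace N₁ N₂ (-p) (-q) := by
      rw [← h.biproj_self hv, h.biproj_semiconj f hf h₁ h₂]
      exact h.biproj_mem _ _ _
    rw [h.bipart_apply r s T hv, h.bipart_apply (-r) (-s) T hfv, h.biproj_semiconj f hf h₁ h₂, hT,
      neg_add, neg_add]
  rw [← biproj_sum_apply d N₁ N₂ v]
  simp only [map_sum]
  exact Finset.sum_congr rfl fun p _ => Finset.sum_congr rfl fun q _ =>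
    key p q _ (h.biproj_mem p q v)

lemma bipart_comm_of_comm {Z T : Module.End ℂ S} (h₁ : Z * N₁ = N₁ * Z) (h₂ : Z * N₂ = N₂ * Z)
    (hT : Z * T = T * Z) (r s : ℤ) :
    Z * bipart d N₁ N₂ r s T = bipart d N₁ N₂ r s T * Z := by
  have hb : ∀ p q, Commute Z (biproj d N₁ N₂ p q) := fun p q =>
    Commute.mul_right (wproj_comm_of_comm h₁ p) (wproj_comm_of_comm h₂ q)
  exact Commute.sum_right _ _ _ fun p _ => Commute.sum_right _ _ _ fun q _ =>
    ((hb _ _).mul_right hT).mul_right (hb _ _)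

/-- Operators of different bidegrees are independent. -/
lemma IsBigrading.eq_zero_of_sum_eq_zero (h : IsBigrading d N₁ N₂) {ι : Type*} [Fintype ι]
    {r s : ι → ℤ} (hrs : Function.Injective fun i => (r i, s i)) {T : ι → Module.End ℂ S}
    (hT : ∀ i, HasBidegree N₁ N₂ (r i) (s i) (T i)) (h0 : ∑ i, T i = 0) (i : ι) : T i = 0 :=
  h.ext fun p q v hv => by
    have h1 := congrArg (biproj d N₁ N₂ (p + r i) (q + s i)) (LinearMap.congr_fun h0 v)
    rw [LinearMap.sum_apply, map_sum, Finset.sum_eq_single_of_mem i (Finset.mem_univ i),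
      h.biproj_self (hT i p q v hv), LinearMap.zero_apply, map_zero] at h1
    · exact h1
    · intro j _ hj
      refine h.biproj_ne (hT j p q v hv) fun he => hj (hrs ?_)
      rw [Prod.mk.injEq] at he ⊢
      omega

lemma sum_products {R : Type*} [Ring R] (a b a' b' : R) :
    ∑ i, (![a * a, b * b, a' * a', b' * b', a * b' + b' * a, a' * b + b * a', a * b + b * a,
      a' * b' + b' * a', (a * a' + a' * a) + (b * b' + b' * b)] : Fin 9 → R) i =
      (a' + b' + a + b) * (a' + b' + a + b) := by
  simp only [Fin.sum_univ_succ, Fin.sum_univ_zero, Matrix.cons_val_zero, Matrix.cons_val_succ]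
  noncomm_ring

/-- The square splits into nine groups of distinct bidegrees, each of which must vanish. Bidegree
`(0, 0)` is the only one to which two anticommutators contribute, so only their sum vanishes there.
-/
lemma IsBigrading.square_relations (h : IsBigrading d N₁ N₂) {a b a' b' : Module.End ℂ S}
    (ha : HasBidegree N₁ N₂ 1 1 a) (hb : HasBidegree N₁ N₂ 1 (-1) b)
    (ha' : HasBidegree N₁ N₂ (-1) (-1) a') (hb' : HasBidegree N₁ N₂ (-1) 1 b')
    (h0 : (a' + b' + a + b) * (a' + b' + a + b) = 0) :
    (a * a = 0 ∧ b * b = 0 ∧ a' * a' = 0 ∧ b' * b' = 0) ∧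
      a * b' + b' * a = 0 ∧ a' * b + b * a' = 0 ∧ a * b + b * a = 0 ∧ a' * b' + b' * a' = 0 ∧
      (a * a' + a' * a) + (b * b' + b' * b) = 0 := by
  let T : Fin 9 → Module.End ℂ S := ![a * a, b * b, a' * a', b' * b', a * b' + b' * a,
    a' * b + b * a', a * b + b * a, a' * b' + b' * a', (a * a' + a' * a) + (b * b' + b' * b)]
  let r : Fin 9 → ℤ := ![2, 2, -2, -2, 0, 0, 2, -2, 0]
  let s : Fin 9 → ℤ := ![2, -2, -2, 2, 2, -2, 0, 0, 0]
  have mul : ∀ {r s r' s' r'' s'' : ℤ} {T T' : Module.End ℂ S}, HasBidegree N₁ N₂ r s T →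
      HasBidegree N₁ N₂ r' s' T' → (hr : r + r' = r'' := by decide) →
      (hs : s + s' = s'' := by decide) → HasBidegree N₁ N₂ r'' s'' (T * T') := by
    rintro r s r' s' _ _ T T' hT hT' rfl rfl
    exact hT.mul hT'
  have hT : ∀ i, HasBidegree N₁ N₂ (r i) (s i) (T i) := fun i => by
    fin_cases i
    · change HasBidegree N₁ N₂ 2 2 (a * a)
      exact mul ha ha
    · change HasBidegree N₁ N₂ 2 (-2) (b * b)
      exact mul hb hb
    · change HasBidegree N₁ N₂ (-2) (-2) (a' * a')
      exact mul ha' ha'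
    · change HasBidegree N₁ N₂ (-2) 2 (b' * b')
      exact mul hb' hb'
    · change HasBidegree N₁ N₂ 0 2 (a * b' + b' * a)
      exact (mul ha hb').add (mul hb' ha)
    · change HasBidegree N₁ N₂ 0 (-2) (a' * b + b * a')
      exact (mul ha' hb).add (mul hb ha')
    · change HasBidegree N₁ N₂ 2 0 (a * b + b * a)
      exact (mul ha hb).add (mul hb ha)
    · change HasBidegree N₁ N₂ (-2) 0 (a' * b' + b' * a')
      exact (mul ha' hb').add (mul hb' ha')
    · change HasBidegree N₁ N₂ 0 0 ((a * a' + a' * a) + (b * b' + b' * b))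
      exact ((mul ha ha').add (mul ha' ha)).add ((mul hb hb').add (mul hb' hb))
  have key := h.eq_zero_of_sum_eq_zero (r := r) (s := s) (by decide) hT
    ((sum_products a b a' b').trans h0)
  exact ⟨⟨key 0, key 1, key 2, key 3⟩, key 4, key 5, key 6, key 7, key 8⟩

end Algebra

/-! ### Laplacians in terms of the relations -/

section Laplacians

variable {R : Type*} [Ring R] {a b a' b' : R}

/-- Here `a`, `b`, `a'`, `b'` stand for `∂̄₊`, `∂̄₋`, `∂₊`, `∂₋`, with adjoints `-a'`, `b'`, `-a`,
`b`. With `X = b + b'` and `Y = a + a'` the Laplacian of `X + Y` is `2 X² - 2 Y²`, where `X² = {b,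
b'}` and `Y² = {a, a'} = -X²`. -/
lemma laplacian_total (hs : a * a = 0 ∧ b * b = 0 ∧ a' * a' = 0 ∧ b' * b' = 0)
    (h : (a * a' + a' * a) + (b * b' + b' * b) = 0) :
    (a' + b' + a + b) * (-a + b + -a' + b') + (-a + b + -a' + b') * (a' + b' + a + b) =
      4 • (b * b' + b' * b) := by
  obtain ⟨h1, h2, h3, h4⟩ := hs
  calc _ = 2 • (b * b + b' * b' + (b * b' + b' * b)) - 2 • (a * a + a' * a' + (a * a' + a' * a)) := by
        noncomm_ring
    _ = _ := by
        rw [h1, h2, h3, h4, eq_neg_of_add_eq_zero_left h]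
        abel

/-- In the applications `p` is of plus type with adjoint `-p'` and `q` of minus type with adjoint
`q'`. The mixed anticommutators vanish, and the two remaining ones are opposite. -/
lemma laplacian_pair {p q p' q' : R} (h1 : p * q' + q' * p = 0) (h2 : p' * q + q * p' = 0)
    (h : (p * p' + p' * p) + (q * q' + q' * q) = 0) :
    (p + q) * (-p' + q') + (-p' + q') * (p + q) = 2 • (q * q' + q' * q) := by
  calc _ = (p * q' + q' * p) - (p' * q + q * p') + ((q * q' + q' * q) - (p * p' + p' * p)) := by
        noncomm_ring
    _ = _ := by
        rw [h1, h2, eq_neg_of_add_eq_zero_left h]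
        abel

lemma laplacian_single (h : (a * a' + a' * a) + (b * b' + b' * b) = 0) :
    a * -a' + -a' * a = b * b' + b' * b := by
  rw [← sub_eq_zero, ← neg_eq_zero, ← h]
  noncomm_ring

end Laplacians

open MeasureTheory

/-! ### The Born–Infeld product and the star operator on smooth forms -/

section Star

variable {n : ℕ} {M : Type*} [TopologicalSpace M] [ChartedSpace (Mod (2 * n)) M]
  [IsManifold (𝓡 (2 * n)) ∞ M] {H : KForm (2 * n) M ℝ 3} {J₁ J₂ : GenEnd (2 * n) M}
  {o : ∀ x : M, Orientation ℝ (Tan (2 * n) x) (Fin (2 * n))}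

/-- The sign of the orientation relative to the one defined by the generalized Kähler structure. -/
def IsGeneralizedKahler.starSign (h : IsGeneralizedKahler H J₁ J₂)
    (o : ∀ x : M, Orientation ℝ (Tan (2 * n) x) (Fin (2 * n))) (x : M) : ℝ :=
  ((h.isKahlerPair x).revStar_eq (tanFrame x) (o x)).choose

lemma IsGeneralizedKahler.starSign_eq (h : IsGeneralizedKahler H J₁ J₂) (x : M) :
    h.starSign o x = 1 ∨ h.starSign o x = -1 :=
  ((h.isKahlerPair x).revStar_eq (tanFrame x) (o x)).choose_spec.1

lemma IsGeneralizedKahler.revStar_eq (h : IsGeneralizedKahler H J₁ J₂) (x : M)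
    (ρ : Spinor (Tan (2 * n) x)) : revStar (o x) (metricInvolution J₁ J₂ x) ρ =
      (h.starSign o x : ℂ) • starOp (2 * n) (fibN J₁ x) (fibN J₂ x) ρ :=
  ((h.isKahlerPair x).revStar_eq (tanFrame x) (o x)).choose_spec.2.1 ρ

lemma IsGeneralizedKahler.starSign_mul (h : IsGeneralizedKahler H J₁ J₂) (x : M)
    (w : Fin (2 * n) → Tan (2 * n) x) : ∃ t : ℝ, 0 < t ∧ (h.starSign o x : ℂ) *
      starOp (2 * n) (fibN J₁ x) (fibN J₂ x) (unitForm (Tan (2 * n) x)) (2 * n) w =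
        (((Equiv.Perm.sign (Fin.revPerm : Equiv.Perm (Fin (2 * n))) : ℤ) * t *
          (o x).someVector w : ℝ) : ℂ) :=
  ((h.isKahlerPair x).revStar_eq (tanFrame x) (o x)).choose_spec.2.2 w

lemma unitForm_isSmooth {d : ℕ} [ChartedSpace (Mod d) M] [IsManifold (𝓡 d) ∞ M] :
    Form.IsSmooth (d := d) fun x : M => unitForm (Tan d x) :=
  Form.isSmooth_iff.2 fun x => (smoothAt_const (unitForm (Mod d))).congr
    (Filter.Eventually.of_forall fun y => by
      rw [loc, rep, unitForm, unitForm, pullback_homog]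
      rfl)

variable [T2Space M]

/-- The operator `i^(p+q)` on forms of bidegree `(p, q)`. -/
def IsGeneralizedKahler.starEnd (h : IsGeneralizedKahler H J₁ J₂) :
    Module.End ℂ (SForm (2 * n) M) :=
  starOp (2 * n) (spinOp J₁ h.complex₁.smooth) (spinOp J₂ h.complex₂.smooth)

lemma IsGeneralizedKahler.actsBy_starEnd (h : IsGeneralizedKahler H J₁ J₂) :
    ActsBy h.starEnd fun x => starOp (2 * n) (fibN J₁ x) (fibN J₂ x) := fun ρ x => by
  simp only [starEnd, starOp, degOp, LinearMap.sum_apply, LinearMap.smul_apply, map_sum, map_smul,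
    evalAt_biproj]

lemma pos_of_mul_eq {z κ t v m : ℝ} (hκ : κ = 1 ∨ κ = -1) (ht : 0 < t)
    (hv : v ≠ 0) (h : z * m = κ * t * v) : 0 < z * κ * (m * (SignType.sign v : ℝ)) := by
  have hs := (sign_cast_eq hv).2
  have hv' : 0 < |v| := abs_pos.2 hv
  have e : z * κ * (m * (SignType.sign v : ℝ)) = (κ * κ) * t * (|v|⁻¹ * (v * v)) := by
    rw [hs]
    linear_combination κ * |v|⁻¹ * v * h
  rw [e]
  have : κ * κ = 1 := by rcases hκ with h | h <;> rw [h] <;> norm_num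
  rw [this, ← abs_mul_abs_self v]
  positivity

/-- In a chart let `m` be the top coefficient of the smooth form `i^(p+q) · 1`. By `starSign_mul`
the product of the sign, of `m`, of the chart sign and of a constant is positive. So `m` has no
zeros there and keeps its sign near `x`; the chart sign is locally constant, and hence so is
`starSign`. -/
lemma IsGeneralizedKahler.eventually_starSign (h : IsGeneralizedKahler H J₁ J₂)
    (ho : IsOrientation o) (x : M) : ∀ᶠ z in nhds x, h.starSign o z = h.starSign o x := by
  set κ : ℝ := ((Equiv.Perm.sign (Fin.revPerm : Equiv.Perm (Fin (2 * n))) : ℤ) : ℝ) with hκ'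
  have hκ : κ = 1 ∨ κ = -1 := by
    rcases Int.units_eq_one_or (Equiv.Perm.sign (Fin.revPerm : Equiv.Perm (Fin (2 * n)))) with h | h
      <;> simp [hκ', h]
  let ρ : SForm (2 * n) M := h.starEnd ⟨_, unitForm_isSmooth⟩
  let m : M → ℝ := fun z => (rep ρ.1 x z (2 * n) (stdE (2 * n))).re
  have hs := mem_extChartAt_source (I := 𝓡 (2 * n)) x
  have hpos : ∀ z ∈ (extChartAt (𝓡 (2 * n)) x).source,
      0 < h.starSign o z * κ * (m z * chartSign o x z) := fun z hz => by
    obtain ⟨t, ht, h1⟩ := h.starSign_mul (o := o) z fun i => chartFrame x z (stdE (2 * n) i)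
    refine pos_of_mul_eq hκ ht ?_ ?_
    · exact (AlternatingMap.map_basis_ne_zero_iff (chartFrame_isDualFrame x hz).basis
        (o z).someVector).2 (o z).someVector_ne_zero ∘ fun h => by
          convert h using 2
          exact funext fun i => (chartFrame_isDualFrame x hz).basis_apply i
    · have h2 := congrArg Complex.re h1
      rw [Complex.re_ofReal_mul, Complex.ofReal_re] at h2
      have h3 : ρ.1 z = starOp (2 * n) (fibN J₁ z) (fibN J₂ z) (unitForm (Tan (2 * n) z)) :=
        h.actsBy_starEnd _ z
      rw [← h3] at h2
      exact h2
  have hcont : ContinuousAt m x := by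
    have h1 : ContinuousAt (fun y => (loc ρ.1 x y (2 * n) (stdE (2 * n))).re)
        (extChartAt (𝓡 (2 * n)) x x) :=
      Complex.continuous_re.continuousAt.comp
        (SmoothAt.apply (ρ.smoothAt x) (2 * n) (stdE (2 * n))).continuousAt
    refine (h1.comp (continuousAt_extChartAt x)).congr ?_
    filter_upwards [eventually_source x hs] with z hz
    simp only [Function.comp_apply, loc, (extChartAt (𝓡 (2 * n)) x).left_inv hz, m]
  have hmx : m x ≠ 0 := fun h0 => by
    have := hpos x hs
    rw [h0, zero_mul, mul_zero] at this
    exact lt_irrefl _ this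
  have e1 : ∀ᶠ z in nhds x, 0 < m z * m x :=
    (hcont.mul continuousAt_const).eventually (lt_mem_nhds (mul_self_pos.2 hmx))
  have e2 := (continuousAt_extChartAt (I := 𝓡 (2 * n)) x).eventually (eventually_chartSign ho hs)
  filter_upwards [e1, e2, eventually_source x hs] with z h1 h2 hz
  rw [(extChartAt (𝓡 (2 * n)) x).left_inv hz] at h2
  have p1 := hpos z hz
  have p2 := hpos x hs
  rw [h2] at p1
  have hkk : κ * κ = 1 := by rcases hκ with h | h <;> rw [h] <;> norm_num
  have hcc : chartSign o x x * chartSign o x x = 1 := by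
    rcases chartSign_eq o hs with h | h <;> rw [h] <;> norm_num
  have p3 : 0 < h.starSign o z * h.starSign o x * (m z * m x) := by
    have := mul_pos p1 p2
    have e : h.starSign o z * κ * (m z * chartSign o x x) *
        (h.starSign o x * κ * (m x * chartSign o x x)) = h.starSign o z * h.starSign o x *
          (m z * m x) * (κ * κ) * (chartSign o x x * chartSign o x x) := by ring
    rwa [e, hkk, hcc, mul_one, mul_one] at this
  have p4 := pos_of_mul_pos_left p3 h1.le
  rcases h.starSign_eq (o := o) z with hz | hz <;> rcases h.starSign_eq (o := o) x with hx | hx <;>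
    rw [hz, hx] at p4 ⊢ <;> norm_num at p4

lemma IsGeneralizedKahler.contMDiff_starSign (h : IsGeneralizedKahler H J₁ J₂)
    (ho : IsOrientation o) : ContMDiff (𝓡 (2 * n)) 𝓘(ℝ, ℂ) ∞ fun x => (h.starSign o x : ℂ) :=
  fun x => (contMDiffAt_const (c := (h.starSign o x : ℂ))).congr_of_eventuallyEq
    ((h.eventually_starSign ho x).mono fun z hz => by beta_reduce; rw [hz])

/-- Multiplication by the orientation sign. -/
def IsGeneralizedKahler.signEnd (h : IsGeneralizedKahler H J₁ J₂) (ho : IsOrientation o) :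
    Module.End ℂ (SForm (2 * n) M) := fmul _ (h.contMDiff_starSign ho)

lemma IsGeneralizedKahler.signEnd_dEnd (h : IsGeneralizedKahler H J₁ J₂) (ho : IsOrientation o) :
    h.signEnd ho * dEnd h.smooth_H = dEnd h.smooth_H * h.signEnd ho :=
  LinearMap.ext fun ρ => sform_ext fun x => by
    change (h.starSign o x : ℂ) • dH H ρ.1 x = dH H (fun z => (h.starSign o z : ℂ) • ρ.1 z) x
    rw [← dH_smul _ (ρ.smoothAt x)]
    exact dH_congr ((h.eventually_starSign ho x).mono fun z hz => by rw [hz])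

lemma IsGeneralizedKahler.signEnd_mul_self (h : IsGeneralizedKahler H J₁ J₂)
    (ho : IsOrientation o) : h.signEnd ho * h.signEnd ho = 1 :=
  LinearMap.ext fun ρ => sform_ext fun x => by
    change (h.starSign o x : ℂ) • (h.starSign o x : ℂ) • evalAt x ρ = evalAt x ρ
    rw [smul_smul, ← Complex.ofReal_mul]
    have : h.starSign o x * h.starSign o x = 1 := by
      rcases h.starSign_eq (o := o) x with h | h <;> rw [h] <;> norm_num
    rw [this, Complex.ofReal_one]
    exact one_smul ℂ (evalAt x ρ)

variable (n M) in
/-- Complex conjugation of smooth forms. -/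
def conjOp : SForm (2 * n) M →+ SForm (2 * n) M where
  toFun ρ := ⟨fun x => conjForm (ρ.1 x), ρ.2.conjForm⟩
  map_zero' := sform_ext fun _ => conjForm_zero
  map_add' _ _ := sform_ext fun _ => conjForm_add _ _

lemma conjOp_smul (z : ℂ) (ρ : SForm (2 * n) M) :
    conjOp n M (z • ρ) = (starRingEnd ℂ) z • conjOp n M ρ :=
  sform_ext fun _ => conjForm_smul _ _

lemma conjOp_conjOp (ρ : SForm (2 * n) M) : conjOp n M (conjOp n M ρ) = ρ :=
  sform_ext fun _ => conjForm_conjForm _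

lemma conjOp_dEnd (hH : H.IsSmooth) (ρ : SForm (2 * n) M) :
    conjOp n M (dEnd hH ρ) = dEnd hH (conjOp n M ρ) :=
  sform_ext fun x => (dH_conjForm (ρ.smoothAt x)).symm

lemma conjOp_spinOp {J : GenEnd (2 * n) M} (hJ : J.IsSmooth) (ρ : SForm (2 * n) M) :
    conjOp n M (spinOp J hJ ρ) = spinOp J hJ (conjOp n M ρ) :=
  sform_ext fun x => conjForm_spinEnd (J x) (ρ.1 x)

/-- The operator `β ↦ σ(∗) β̄`. -/
def IsGeneralizedKahler.starBar (h : IsGeneralizedKahler H J₁ J₂) (ho : IsOrientation o) :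
    SForm (2 * n) M →+ SForm (2 * n) M :=
  (h.signEnd ho * h.starEnd).toAddMonoidHom.comp (conjOp n M)

lemma IsGeneralizedKahler.starBar_apply (h : IsGeneralizedKahler H J₁ J₂) (ho : IsOrientation o)
    (β : SForm (2 * n) M) : h.starBar ho β = h.signEnd ho (h.starEnd (conjOp n M β)) := rfl

lemma IsGeneralizedKahler.starBar_injective (h : IsGeneralizedKahler H J₁ J₂)
    (ho : IsOrientation o) : Function.Injective (h.starBar ho) := by
  refine Function.Injective.comp (g := h.signEnd ho * h.starEnd) (f := conjOp n M) ?_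
    (Function.LeftInverse.injective conjOp_conjOp)
  refine Function.LeftInverse.injective (g := starInv (2 * n) (spinOp J₁ h.complex₁.smooth)
    (spinOp J₂ h.complex₂.smooth) * h.signEnd ho) fun ρ => ?_
  change starInv (2 * n) _ _ ((h.signEnd ho * h.signEnd ho) (h.starEnd ρ)) = ρ
  rw [h.signEnd_mul_self ho]
  exact LinearMap.congr_fun h.isBigrading_spinOp.starInv_mul_starOp ρ

lemma IsGeneralizedKahler.evalAt_starBar (h : IsGeneralizedKahler H J₁ J₂) (ho : IsOrientation o)
    (β : SForm (2 * n) M) (x : M) : evalAt x (h.starBar ho β) =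
      revStar (o x) (metricInvolution J₁ J₂ x) (conjForm (β.1 x)) := by
  rw [h.revStar_eq]
  change (h.starSign o x : ℂ) • evalAt x (h.starEnd (conjOp n M β)) = _
  rw [h.actsBy_starEnd]
  rfl

/-- The homogeneous parts of the twisted exterior derivative. -/
def IsGeneralizedKahler.part (h : IsGeneralizedKahler H J₁ J₂) (r s : ℤ) :
    Module.End ℂ (SForm (2 * n) M) :=
  bipart (2 * n) (spinOp J₁ h.complex₁.smooth) (spinOp J₂ h.complex₂.smooth) r s
    (dEnd h.smooth_H)

/-- Conjugation turns the part of bidegree `(-r, -s)` into that of bidegree `(r, s)`, the star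
operator passes it at the cost of `i^(r+s)`, and the orientation sign commutes with it, being
locally constant. -/
lemma IsGeneralizedKahler.part_starBar (h : IsGeneralizedKahler H J₁ J₂) (ho : IsOrientation o)
    (r s : ℤ) {ε : ℂ} (hε : ε * Complex.I ^ (r + s) = 1) (β : SForm (2 * n) M) :
    h.part r s (h.starBar ho β) = ε • h.starBar ho (h.part (-r) (-s) β) := by
  have hb := h.isBigrading_spinOp
  have e1 : h.signEnd ho * h.part r s = h.part r s * h.signEnd ho :=
    bipart_comm_of_comm
      ((actsBy_spinOp h.complex₁.smooth).isTensorial _ (h.contMDiff_starSign ho)).symm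
      ((actsBy_spinOp h.complex₂.smooth).isTensorial _ (h.contMDiff_starSign ho)).symm
      (h.signEnd_dEnd ho) r s
  have e2 : h.starEnd * h.part r s = Complex.I ^ (r + s) • (h.part r s * h.starEnd) :=
    hb.starOp_mul (hb.hasBidegree_bipart r s _)
  have e3 : conjOp n M (h.part (-r) (-s) β) = h.part r s (conjOp n M β) := by
    have := hb.bipart_semiconj (conjOp n M) conjOp_smul (conjOp_spinOp _) (conjOp_spinOp _)
      (conjOp_dEnd h.smooth_H) (-r) (-s) β
    rwa [neg_neg, neg_neg] at this
  have e4 : h.part r s (h.starEnd (conjOp n M β)) =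
      ε • h.starEnd (h.part r s (conjOp n M β)) := by
    rw [← Module.End.mul_apply h.starEnd, e2, LinearMap.smul_apply, smul_smul, hε, one_smul]
    rfl
  rw [h.starBar_apply, h.starBar_apply, e3, ← Module.End.mul_apply (h.part r s), ← e1,
    Module.End.mul_apply, e4, map_smul]

variable [SigmaCompactSpace M]

lemma bornInfeld_eq (h : IsGeneralizedKahler H J₁ J₂) (ho : IsOrientation o)
    (α β : SForm (2 * n) M) : bornInfeld o (metricInvolution J₁ J₂) α.1 β.1 =
      intForm o (mukaiForm α (h.starBar ho β)) :=
  congrArg (integral o) (funext fun x => by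
    rw [← h.evalAt_starBar ho β x]
    rfl)

/-- Transposition replaces the projection to bidegree `(p, q)` by that to `(-p, -q)` and fixes
`d_H`. The transposed sum is the same part of `d_H` after reindexing, by
`IsBigrading.sum_biproj_transpose`. -/
lemma IsGeneralizedKahler.isTranspose_part (h : IsGeneralizedKahler H J₁ J₂)
    (ho : IsOrientation o) (r s : ℤ) : IsTranspose o (h.part r s) (h.part r s) := by
  have hd : Even (2 * n) := even_two_mul n
  have hm : ∀ {J : GenEnd (2 * n) M} (x : M), IsSkew (J x) → ∀ a b : Spinor (Tan (2 * n) x),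
      mukaiLin (2 * n) _ (fibN J x a) b = -mukaiLin (2 * n) _ a (fibN J x b) := fun x hJ a b =>
    (fib_isCliffordModule x).pairing_spinEnd ((tanFrame x).mukai_cl hd) hJ _ _ a b
  have hb : ∀ p q, IsTranspose o
      (biproj (2 * n) (spinOp J₁ h.complex₁.smooth) (spinOp J₂ h.complex₂.smooth) p q)
      (biproj (2 * n) (spinOp J₁ h.complex₁.smooth) (spinOp J₂ h.complex₂.smooth) (-p) (-q)) :=
    fun p q => isTranspose_of_actsBy (evalAt_biproj _ _ p q) (evalAt_biproj _ _ (-p) (-q))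
      fun x a b => (h.isBigrading x).pairing_biproj (hm x (h.complex₁.isSkew x))
        (hm x (h.complex₂.isSkew x)) p q a b
  have key := IsTranspose.sum ho (t := Finset.Icc (-(2 * n : ℕ) : ℤ) (2 * n : ℕ)) fun p _ =>
    IsTranspose.sum ho (t := Finset.Icc (-(2 * n : ℕ) : ℤ) (2 * n : ℕ)) fun q _ =>
      ((hb (p + r) (q + s)).mul (isTranspose_dEnd ho hd h.smooth_H)).mul (hb p q)
  rw [h.isBigrading_spinOp.sum_biproj_transpose r s (dEnd h.smooth_H)] at key
  exact key

end Star

open MeasureTheory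

/-! ### Nondegeneracy of the integrated Mukai pairing -/

section Nondegenerate

variable {d : ℕ} {M : Type*} [TopologicalSpace M] [ChartedSpace (Mod d) M] [IsManifold (𝓡 d) ∞ M]
  [T2Space M] [SigmaCompactSpace M] {o : ∀ x : M, Orientation ℝ (Tan d x) (Fin d)}

lemma isCompact_tsupport_bumpAt (x : M) : IsCompact (tsupport (bumpAt d x)) :=
  SmoothBumpFunction.hasCompactSupport _

lemma mukai_smul_left (c : ℂ) (α β : Spinor (Mod d)) :
    mukai d (c • α) β = c • mukai d α β := by
  rw [← mukaiLin_apply, map_smul, LinearMap.smul_apply, mukaiLin_apply]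

/-- If `c` is the pairing of `ρ₀` with `γ` in the chart, multiplied by the chart sign, the test form
`χ c̄ ρ₀` with a bump function `χ` has integrand `χ |c|² ≥ 0`. A continuous nonnegative function
with integral zero vanishes, and `χ = 1` at the centre. -/
lemma mukai_rep_eq_zero (ho : IsOrientation o) {γ : SForm d M}
    (h : ∀ (α : SForm d M) (K : Set M), IsCompact K → VanishesOff α K →
      intForm o (mukaiForm α γ) = 0) (x₀ : M) (ρ₀ : Spinor (Mod d)) :
    mukai d ρ₀ (rep γ.1 x₀ x₀) (stdE d) = 0 := by
  have hs := mem_extChartAt_source (I := 𝓡 d) x₀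
  let c : M → ℂ := fun z => (chartSign o x₀ z : ℂ) * mukai d ρ₀ (rep γ.1 x₀ z) (stdE d)
  have hc : ∀ z ∈ (extChartAt (𝓡 d) x₀).source, ContMDiffAt (𝓡 d) 𝓘(ℝ, ℂ) ∞ c z := fun z hz => by
    refine contMDiffAt_of_contDiffAt hz ?_
    have h1 : SmoothAt (fun y => wedge ρ₀ (reversal (loc γ.1 x₀ y))) (extChartAt (𝓡 d) x₀ z) :=
      (smoothAt_const ρ₀).wedge ((Form.smoothAt_iff x₀ hz).1 (γ.smoothAt z)).reversal
    refine ((contDiffAt_const (c := (chartSign o x₀ z : ℂ))).mul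
      (h1.apply d (stdE d))).congr_of_eventuallyEq ?_
    filter_upwards [eventually_chartSign ho hz] with y hy
    simp only [Function.comp_apply, c, hy]
    rfl
  have hcc : ∀ z ∈ (extChartAt (𝓡 d) x₀).source,
      ContMDiffAt (𝓡 d) 𝓘(ℝ, ℂ) ∞ (fun z => (starRingEnd ℂ) (c z)) z := fun z hz =>
    (Complex.conjCLE.contDiff.contMDiff.contMDiffAt).comp z (hc z hz)
  have hsupp : ∀ z ∉ tsupport (bumpAt d x₀), (bumpAt d x₀ z : ℂ) * (starRingEnd ℂ) (c z) = 0 :=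
    fun z hz => by rw [image_eq_zero_of_notMem_tsupport hz, Complex.ofReal_zero, zero_mul]
  have hts : tsupport (fun z => (bumpAt d x₀ z : ℂ) * (starRingEnd ℂ) (c z)) ⊆
      tsupport (bumpAt d x₀) := closure_minimal (fun z hz => by
        by_contra h'
        exact hz (hsupp z h')) (isClosed_tsupport _)
  let α : SForm d M := ⟨extendForm x₀ _ ρ₀, extendForm_isSmooth (contMDiff_bump_mul x₀ hcc)
    (hts.trans (tsupport_bumpAt x₀)) ρ₀⟩
  have hα : VanishesOff α (tsupport (bumpAt d x₀)) := fun z hz => by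
    change ((bumpAt d x₀ z : ℂ) * (starRingEnd ℂ) (c z)) • pullback (chartDeriv x₀ z) ρ₀ = 0
    rw [hsupp z hz]
    exact zero_smul ℂ (pullback (chartDeriv x₀ z) ρ₀)
  have hK := isCompact_tsupport_bumpAt (d := d) x₀
  have h0 := h α _ hK hα
  have hv : VanishesOff (mukaiForm α γ) _ := VanishesOff.mukaiForm (Or.inl hα)
  rw [intForm, integral_of_chart ho (mukaiForm α γ).2 hK (tsupport_bumpAt x₀) hv,
    chartIntegral] at h0
  let g : Mod d → ℝ := fun y => bumpAt d x₀ ((extChartAt (𝓡 d) x₀).symm y) *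
    Complex.normSq (c ((extChartAt (𝓡 d) x₀).symm y))
  have hg : ∀ y ∈ (extChartAt (𝓡 d) x₀).target, topCoeff o (mukaiForm α γ).1 x₀ y = (g y : ℂ) :=
    fun y hy => by
      refine (topCoeff_mukai α.1 γ.1 x₀ y).trans ?_
      have e : loc α.1 x₀ y = ((bumpAt d x₀ ((extChartAt (𝓡 d) x₀).symm y) : ℂ) *
          (starRingEnd ℂ) (c ((extChartAt (𝓡 d) x₀).symm y))) • ρ₀ :=
        rep_extendForm x₀ _ ρ₀ ((extChartAt (𝓡 d) x₀).map_target hy)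
      rw [e, mukai_smul_left, Complex.ofReal_mul, ← Complex.mul_conj]
      change _ * (_ * mukai d ρ₀ (rep γ.1 x₀ _) (stdE d)) = _
      simp only [c]
      ring
  have hU := isOpen_extChartAt_target (I := 𝓡 d) x₀
  have hint := integrableOn_topCoeff ho (mukaiForm α γ).2 hK (tsupport_bumpAt x₀) hv
  have hgint : IntegrableOn g (extChartAt (𝓡 d) x₀).target :=
    (hint.congr_fun hg hU.measurableSet).re
  have hgcont : ContinuousOn g (extChartAt (𝓡 d) x₀).target :=
    (Complex.continuous_re.comp_continuousOn (continuousOn_topCoeff ho (mukaiForm α γ).2 x₀)).congr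
      fun y hy => by rw [Function.comp_apply, hg y hy, Complex.ofReal_re]
  rw [setIntegral_congr_fun hU.measurableSet hg, integral_complex_ofReal] at h0
  have hg0 : ∀ y, 0 ≤ g y := fun y =>
    mul_nonneg (SmoothBumpFunction.nonneg _) (Complex.normSq_nonneg _)
  have hae := (integral_eq_zero_iff_of_nonneg hg0 hgint).1 (Complex.ofReal_eq_zero.1 h0)
  have hz := Measure.eqOn_open_of_ae_eq hae hU hgcont continuousOn_const
    ((extChartAt (𝓡 d) x₀).map_source hs)
  simp only [g, (extChartAt (𝓡 d) x₀).left_inv hs, bumpAt_self, one_mul, Pi.zero_apply,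
    Complex.normSq_eq_zero, c, mul_eq_zero, Complex.ofReal_eq_zero] at hz
  refine hz.resolve_left fun h => ?_
  rcases chartSign_eq o hs with h' | h' <;> rw [h'] at h <;> norm_num at h

/-- The integrated Mukai pairing is nondegenerate. -/
lemma eq_zero_of_intForm (ho : IsOrientation o) (hd : Even d) {γ : SForm d M}
    (h : ∀ (α : SForm d M) (K : Set M), IsCompact K → VanishesOff α K →
      intForm o (mukaiForm α γ) = 0) : γ = 0 := sform_ext fun x => by
  refine eq_of_rep_eq (ρ := γ.1) (τ := 0) x (mem_extChartAt_source x)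
    (Eq.trans ?_ (map_zero (pullback _)).symm)
  refine (stdFrame d).eq_zero_of_mukai hd fun ρ₀ => ?_
  apply ContinuousAlternatingMap.toAlternatingMap_injective
  refine Module.Basis.ext_alternating (stdFrame d).basis fun I hI => ?_
  -- A top form is determined by its values on injective families of basis vectors; each is a
  -- permutation of the standard frame.
  have e : (fun i => (stdFrame d).basis (I i)) =
      stdE d ∘ Equiv.ofBijective I (Finite.injective_iff_bijective.1 hI) :=
    funext fun i => (stdFrame d).basis_apply _
  rw [e, AlternatingMap.map_perm]
  refine (congrArg _ (mukai_rep_eq_zero ho h x ρ₀)).trans ?_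
  simp

end Nondegenerate

/-! ### Born–Infeld adjoints: existence and uniqueness -/

section Adjoints

variable {n : ℕ} {M : Type*} [TopologicalSpace M] [ChartedSpace (Mod (2 * n)) M]
  [IsManifold (𝓡 (2 * n)) ∞ M] {H : KForm (2 * n) M ℝ 3} {J₁ J₂ : GenEnd (2 * n) M}
  {o : ∀ x : M, Orientation ℝ (Tan (2 * n) x) (Fin (2 * n))}

lemma HasCompactSupp.vanishesOff {ρ : SForm (2 * n) M} :
    VanishesOff ρ (closure {x | ρ.1 x ≠ 0}) := fun z hz => by
  by_contra h
  exact hz (subset_closure h)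

/-- The operator `D` on forms restricts to the operator `T` on smooth forms. -/
def Represents (D : Form (2 * n) M → Form (2 * n) M) (T : Module.End ℂ (SForm (2 * n) M)) : Prop :=
  ∀ ρ : SForm (2 * n) M, D ρ.1 = (T ρ).1

variable [T2Space M] [SigmaCompactSpace M]

/-- `T'` is the Born–Infeld adjoint of `T`. -/
structure IsGeneralizedKahler.IsAdjoint (h : IsGeneralizedKahler H J₁ J₂) (ho : IsOrientation o)
    (T T' : Module.End ℂ (SForm (2 * n) M)) : Prop where
  transpose : IsTranspose o T T
  comm : ∀ β, T (h.starBar ho β) = h.starBar ho (T' β)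

variable {T T' U U' : Module.End ℂ (SForm (2 * n) M)} {h : IsGeneralizedKahler H J₁ J₂}
  {ho : IsOrientation o}

lemma IsGeneralizedKahler.IsAdjoint.add (hT : h.IsAdjoint ho T T') (hU : h.IsAdjoint ho U U') :
    h.IsAdjoint ho (T + U) (T' + U') where
  transpose := hT.transpose.add ho hU.transpose
  comm β := by rw [LinearMap.add_apply, LinearMap.add_apply, map_add, hT.comm, hU.comm]

lemma IsGeneralizedKahler.isAdjoint_part (h : IsGeneralizedKahler H J₁ J₂) (ho : IsOrientation o)
    {r s : ℤ} (hrs : r + s = 0) : h.IsAdjoint ho (h.part r s) (h.part (-r) (-s)) where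
  transpose := h.isTranspose_part ho r s
  comm β := by
    rw [h.part_starBar ho r s (ε := 1) (by rw [hrs, zpow_zero, one_mul]), one_smul]

lemma IsGeneralizedKahler.isAdjoint_part_neg (h : IsGeneralizedKahler H J₁ J₂)
    (ho : IsOrientation o) {r s : ℤ} (hrs : r + s = 2 ∨ r + s = -2) :
    h.IsAdjoint ho (h.part r s) (-h.part (-r) (-s)) where
  transpose := h.isTranspose_part ho r s
  comm β := by
    have hI : Complex.I ^ (2 : ℤ) = -1 := by
      rw [show (2 : ℤ) = ((2 : ℕ) : ℤ) from rfl, zpow_natCast, Complex.I_sq]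
    rw [h.part_starBar ho r s (ε := -1), neg_one_smul, LinearMap.neg_apply, map_neg]
    rcases hrs with hrs | hrs
    · rw [hrs, hI]; norm_num
    · rw [hrs, zpow_neg, hI]; norm_num

/-- Write `h(α, β) = ∫ ⟨α, S β⟩` with `S β = σ(∗) β̄`. As `T` is its own transpose, `h(T α, β) = ∫
⟨α, T S β⟩`, and `T S = S T'`. The operator `S` is pointwise, so it preserves compact supports. -/
lemma IsGeneralizedKahler.IsAdjoint.isFormalAdjoint (hT : h.IsAdjoint ho T T')
    {D D' : Form (2 * n) M → Form (2 * n) M} (hD : Represents D T) (hD' : Represents D' T') :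
    IsFormalAdjoint o (metricInvolution J₁ J₂) D D' := by
  refine ⟨fun β hβ => by rw [hD' ⟨β, hβ⟩]; exact (T' ⟨β, hβ⟩).2, fun α β hα hβ hc => ?_⟩
  obtain ⟨α, rfl⟩ : ∃ α' : SForm (2 * n) M, α'.1 = α := ⟨⟨α, hα⟩, rfl⟩
  obtain ⟨β, rfl⟩ : ∃ β' : SForm (2 * n) M, β'.1 = β := ⟨⟨β, hβ⟩, rfl⟩
  have hS : ∀ K, VanishesOff β K → VanishesOff (h.starBar ho β) K := fun K hK z hz => by
    have : β.1 z = 0 := hK z hz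
    rw [h.evalAt_starBar, h.revStar_eq, this, conjForm_zero, map_zero]
    exact smul_zero (M := ℂ) (A := Spinor (Tan (2 * n) z)) _
  rw [hD, hD', bornInfeld_eq h ho, bornInfeld_eq h ho, ← hT.comm]
  rcases hc with hc | hc
  · exact hT.transpose.pair _ _ _ hc (Or.inl HasCompactSupp.vanishesOff)
  · exact hT.transpose.pair _ _ _ hc (Or.inr (hS _ HasCompactSupp.vanishesOff))

/-- Two adjoints have the same pairing with every compactly supported form, so nondegeneracy and
injectivity of `β ↦ σ(∗) β̄` identify them. Hence `adjoint`, although chosen arbitrarily among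
adjoints, is determined on smooth forms. -/
lemma isFormalAdjoint_unique (h : IsGeneralizedKahler H J₁ J₂) (ho : IsOrientation o)
    {D D' D'' : Form (2 * n) M → Form (2 * n) M}
    (h' : IsFormalAdjoint o (metricInvolution J₁ J₂) D D')
    (h'' : IsFormalAdjoint o (metricInvolution J₁ J₂) D D'') {β : Form (2 * n) M}
    (hβ : β.IsSmooth) : D' β = D'' β := by
  let β' : SForm (2 * n) M := ⟨D' β, h'.1 β hβ⟩
  let β'' : SForm (2 * n) M := ⟨D'' β, h''.1 β hβ⟩
  suffices hs : h.starBar ho β' - h.starBar ho β'' = 0 from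
    congrArg Subtype.val (h.starBar_injective ho (sub_eq_zero.1 hs))
  refine eq_zero_of_intForm ho (even_two_mul n) fun α K hK hα => ?_
  have hc : HasCompactSupp α.1 := hK.of_isClosed_subset isClosed_closure
    (closure_minimal (fun z hz => by_contra fun hz' => hz (hα z hz')) hK.isClosed)
  have e1 := h'.2 α.1 β α.2 hβ (Or.inl hc)
  rw [h''.2 α.1 β α.2 hβ (Or.inl hc)] at e1
  have e2 : intForm o (mukaiForm α (h.starBar ho β'')) =
      intForm o (mukaiForm α (h.starBar ho β')) :=
    (bornInfeld_eq h ho α β'').symm.trans (e1.trans (bornInfeld_eq h ho α β'))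
  rw [map_sub, sub_eq_add_neg, ← neg_one_smul ℂ (mukaiForm α (h.starBar ho β'')),
    intForm_add ho hK (VanishesOff.mukaiForm (Or.inl hα))
      ((VanishesOff.mukaiForm (Or.inl hα)).smul (-1)), intForm_smul, e2]
  ring

open Classical in
lemma IsGeneralizedKahler.IsAdjoint.adjoint_spec (hT : h.IsAdjoint ho T T')
    {D : Form (2 * n) M → Form (2 * n) M} (hD : Represents D T) :
    IsFormalAdjoint o (metricInvolution J₁ J₂) D (adjoint o (metricInvolution J₁ J₂) D) ∧
      Represents (adjoint o (metricInvolution J₁ J₂) D) T' := by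
  -- A formal adjoint is constrained only on smooth forms; elsewhere the value `0` is arbitrary.
  let D' : Form (2 * n) M → Form (2 * n) M := fun β => if hβ : β.IsSmooth then (T' ⟨β, hβ⟩).1 else 0
  have hD' : Represents D' T' := fun ρ => dif_pos ρ.2
  have h1 := hT.isFormalAdjoint hD hD'
  have h2 : IsFormalAdjoint o (metricInvolution J₁ J₂) D (adjoint o (metricInvolution J₁ J₂) D) :=
    Classical.epsilon_spec (p := IsFormalAdjoint o (metricInvolution J₁ J₂) D) ⟨D', h1⟩
  exact ⟨h2, fun ρ => (isFormalAdjoint_unique h ho h2 h1 ρ.2).trans (hD' ρ)⟩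

lemma IsGeneralizedKahler.IsAdjoint.laplacian_eq (hT : h.IsAdjoint ho T T')
    {D : Form (2 * n) M → Form (2 * n) M} (hD : Represents D T) (ρ : SForm (2 * n) M) :
    laplacian o (metricInvolution J₁ J₂) D ρ.1 = ((T * T' + T' * T) ρ).1 := by
  have h' := (hT.adjoint_spec hD).2
  rw [laplacian, h', hD, hD, h']
  rfl

end Adjoints

/-! ### The operators of the proposition as sums of homogeneous parts -/

section KahlerIdentities

variable {n : ℕ} {M : Type*} [TopologicalSpace M] [ChartedSpace (Mod (2 * n)) M]
  [IsManifold (𝓡 (2 * n)) ∞ M] [T2Space M] {H : KForm (2 * n) M ℝ 3} {J₁ J₂ : GenEnd (2 * n) M}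
  {o : ∀ x : M, Orientation ℝ (Tan (2 * n) x) (Fin (2 * n))}

lemma represents_dH (hH : H.IsSmooth) : Represents (dH H) (dEnd (M := M) hH) := fun _ => rfl

lemma IsGeneralizedKahler.represents_part (h : IsGeneralizedKahler H J₁ J₂) (r s : ℤ) :
    Represents (dPart₂ H J₁ J₂ r s) (h.part r s) :=
  dPart₂_eq h.smooth_H _ _ h.isBigrading r s

lemma IsGeneralizedKahler.hasBidegree_part (h : IsGeneralizedKahler H J₁ J₂) (r s : ℤ) :
    HasBidegree (spinOp J₁ h.complex₁.smooth) (spinOp J₂ h.complex₂.smooth) r s (h.part r s) :=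
  h.isBigrading_spinOp.hasBidegree_bipart r s _

lemma IsGeneralizedKahler.dEnd_eq_sum (h : IsGeneralizedKahler H J₁ J₂) :
    dEnd h.smooth_H = h.part (-1) (-1) + h.part (-1) 1 + h.part 1 1 + h.part 1 (-1) := h.dEnd_eq

lemma IsGeneralizedKahler.dEnd_sq (h : IsGeneralizedKahler H J₁ J₂) :
    dEnd (M := M) h.smooth_H * dEnd h.smooth_H = 0 :=
  LinearMap.ext fun ρ => sform_ext fun x => dH_dH h.smooth_H h.closed_H ρ.2 x

/-- `∂̄₁` collects the parts of `d_H` that raise the first index, whatever they do to the second;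
`∂₁`, `∂̄₂`, `∂₂` are obtained in the same way. -/
lemma IsGeneralizedKahler.represents_delbar₁ (h : IsGeneralizedKahler H J₁ J₂) :
    Represents (delbar H J₁) (h.part 1 1 + h.part 1 (-1)) := fun ρ => by
  have hb := h.isBigrading_spinOp
  rw [delbar, dPart₁_eq h.smooth_H h.complex₁.smooth (fun x => (h.isBigrading x).fst),
    h.dEnd_eq_sum, gpart_add, gpart_add, gpart_add,
    hb.gpart_fst_ne (h.hasBidegree_part (-1) (-1)) (by decide),
    hb.gpart_fst_ne (h.hasBidegree_part (-1) 1) (by decide),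
    hb.gpart_fst_self (h.hasBidegree_part 1 1),
    hb.gpart_fst_self (h.hasBidegree_part 1 (-1)), zero_add, zero_add]

lemma IsGeneralizedKahler.represents_del₁ (h : IsGeneralizedKahler H J₁ J₂) :
    Represents (del H J₁) (h.part (-1) (-1) + h.part (-1) 1) := fun ρ => by
  have hb := h.isBigrading_spinOp
  rw [del, dPart₁_eq h.smooth_H h.complex₁.smooth (fun x => (h.isBigrading x).fst),
    h.dEnd_eq_sum, gpart_add, gpart_add, gpart_add,
    hb.gpart_fst_self (h.hasBidegree_part (-1) (-1)),
    hb.gpart_fst_self (h.hasBidegree_part (-1) 1),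
    hb.gpart_fst_ne (h.hasBidegree_part 1 1) (by decide),
    hb.gpart_fst_ne (h.hasBidegree_part 1 (-1)) (by decide), add_zero, add_zero]

lemma IsGeneralizedKahler.represents_delbar₂ (h : IsGeneralizedKahler H J₁ J₂) :
    Represents (delbar H J₂) (h.part 1 1 + h.part (-1) 1) := fun ρ => by
  have hb := h.isBigrading_spinOp
  rw [delbar, dPart₁_eq h.smooth_H h.complex₂.smooth (fun x => (h.isBigrading x).snd),
    h.dEnd_eq_sum, gpart_add, gpart_add, gpart_add,
    hb.gpart_snd_ne (h.hasBidegree_part (-1) (-1)) (by decide),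
    hb.gpart_snd_self (h.hasBidegree_part (-1) 1),
    hb.gpart_snd_self (h.hasBidegree_part 1 1),
    hb.gpart_snd_ne (h.hasBidegree_part 1 (-1)) (by decide), zero_add, add_zero,
    add_comm (h.part (-1) 1)]

lemma IsGeneralizedKahler.represents_del₂ (h : IsGeneralizedKahler H J₁ J₂) :
    Represents (del H J₂) (h.part (-1) (-1) + h.part 1 (-1)) := fun ρ => by
  have hb := h.isBigrading_spinOp
  rw [del, dPart₁_eq h.smooth_H h.complex₂.smooth (fun x => (h.isBigrading x).snd),
    h.dEnd_eq_sum, gpart_add, gpart_add, gpart_add,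
    hb.gpart_snd_self (h.hasBidegree_part (-1) (-1)),
    hb.gpart_snd_ne (h.hasBidegree_part (-1) 1) (by decide),
    hb.gpart_snd_ne (h.hasBidegree_part 1 1) (by decide),
    hb.gpart_snd_self (h.hasBidegree_part 1 (-1)), add_zero, add_zero]

end KahlerIdentities

end GenKahler
end

theorem mainTheorem4 (n : ℕ) {M : Type*} [TopologicalSpace M]
    [ChartedSpace (EuclideanSpace ℝ (Fin (2 * n))) M] [IsManifold (𝓡 (2 * n)) ∞ M]
    [T2Space M] [SigmaCompactSpace M]
    (o : ∀ x : M, Orientation ℝ (TangentSpace (𝓡 (2 * n)) x) (Fin (2 * n)))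
    (ho : GenKahler.IsOrientation o)
    (H : GenKahler.KForm (2 * n) M ℝ 3) (J₁ J₂ : GenKahler.GenEnd (2 * n) M)
    (hGK : GenKahler.IsGeneralizedKahler H J₁ J₂)
    (G : GenKahler.GenEnd (2 * n) M) (hG : G = GenKahler.metricInvolution J₁ J₂) :
    -- the decomposition of the twisted exterior derivative
    (∀ ρ : GenKahler.Form (2 * n) M, ρ.IsSmooth →
      GenKahler.dH H ρ = GenKahler.delPlus H J₁ J₂ ρ + GenKahler.delMinus H J₁ J₂ ρ +
        GenKahler.delbarPlus H J₁ J₂ ρ + GenKahler.delbarMinus H J₁ J₂ ρ) ∧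
    -- all the operators involved have an adjoint
    (∀ D ∈ [GenKahler.dH H, GenKahler.delbar H J₁, GenKahler.delbar H J₂,
        GenKahler.del H J₁, GenKahler.del H J₂,
        GenKahler.delbarPlus H J₁ J₂, GenKahler.delbarMinus H J₁ J₂,
        GenKahler.delPlus H J₁ J₂, GenKahler.delMinus H J₁ J₂],
      GenKahler.IsFormalAdjoint o G D (GenKahler.adjoint o G D)) ∧
    ∀ ρ : GenKahler.Form (2 * n) M, ρ.IsSmooth →
      -- the generalized Kähler identities
      GenKahler.adjoint o G (GenKahler.delbarPlus H J₁ J₂) ρ = -GenKahler.delPlus H J₁ J₂ ρ ∧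
      GenKahler.adjoint o G (GenKahler.delbarMinus H J₁ J₂) ρ = GenKahler.delMinus H J₁ J₂ ρ ∧
      -- the equality of the Laplacians
      (∀ D ∈ [GenKahler.delbar H J₁, GenKahler.delbar H J₂,
          GenKahler.del H J₁, GenKahler.del H J₂],
        GenKahler.laplacian o G (GenKahler.dH H) ρ = (2 : ℂ) • GenKahler.laplacian o G D ρ) ∧
      (∀ D ∈ [GenKahler.delbarPlus H J₁ J₂, GenKahler.delbarMinus H J₁ J₂,
          GenKahler.delPlus H J₁ J₂, GenKahler.delMinus H J₁ J₂],
        GenKahler.laplacian o G (GenKahler.dH H) ρ = (4 : ℂ) • GenKahler.laplacian o G D ρ) := by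
  subst hG
  -- The sign of the adjoint depends on `r + s`: it is `-1` for the plus operators, where `r + s =
  -- ±2`, and `+1` for the minus operators, where `r + s = 0`.
  have aA := hGK.isAdjoint_part_neg ho (r := 1) (s := 1) (Or.inl rfl)
  have aB := hGK.isAdjoint_part ho (r := 1) (s := -1) rfl
  have aA' := hGK.isAdjoint_part_neg ho (r := -1) (s := -1) (Or.inr rfl)
  have aB' := hGK.isAdjoint_part ho (r := -1) (s := 1) rfl
  have rA : GenKahler.Represents (GenKahler.delbarPlus H J₁ J₂) _ := hGK.represents_part 1 1
  have rB : GenKahler.Represents (GenKahler.delbarMinus H J₁ J₂) _ := hGK.represents_part 1 (-1)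
  have rA' : GenKahler.Represents (GenKahler.delPlus H J₁ J₂) _ := hGK.represents_part (-1) (-1)
  have rB' : GenKahler.Represents (GenKahler.delMinus H J₁ J₂) _ := hGK.represents_part (-1) 1
  have rD := GenKahler.represents_dH hGK.smooth_H
  have r1 := hGK.represents_delbar₁
  have r2 := hGK.represents_delbar₂
  have r3 := hGK.represents_del₁
  have r4 := hGK.represents_del₂
  obtain ⟨hs, h1, h2, h3, h4, h5⟩ := hGK.isBigrading_spinOp.square_relations
    (hGK.hasBidegree_part 1 1) (hGK.hasBidegree_part 1 (-1)) (hGK.hasBidegree_part (-1) (-1))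
    (hGK.hasBidegree_part (-1) 1) (by rw [← hGK.dEnd_eq_sum]; exact hGK.dEnd_sq)
  rw [hGK.dEnd_eq_sum] at rD
  rw [neg_neg] at aB aA' aB'
  -- From here on `a`, `b`, `a'`, `b'` are `∂̄₊`, `∂̄₋`, `∂₊`, `∂₋`, and only their relations and
  -- adjoints matter.
  generalize hGK.part 1 1 = a at *
  generalize hGK.part 1 (-1) = b at *
  generalize hGK.part (-1) (-1) = a' at *
  generalize hGK.part (-1) 1 = b' at *
  have aD := ((aA'.add aB').add aA).add aB
  have a1 := aA.add aB
  have a2 := aA.add aB'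
  have a3 := aA'.add aB'
  have a4 := aA'.add aB
  have h5' : (a' * a + a * a') + (b * b' + b' * b) = 0 := by rw [add_comm (a' * a), h5]
  -- Every Laplacian becomes a multiple of `b b' + b' b`: the factor is `4` for `d_H`, `2` for the
  -- operators of a single structure, and `1` for the four components.
  have l := GenKahler.laplacian_total hs h5
  have l1 := GenKahler.laplacian_pair h1 h2 h5
  have l2 := GenKahler.laplacian_pair h3 h4 ((congrArg _ (add_comm _ _)).trans h5)
  have l3 := GenKahler.laplacian_pair (p := a') (q := b') (p' := a) (q' := b)
    ((add_comm _ _).trans (by rw [add_comm, h2])) (by rw [h1]) (by rw [add_comm (b' * b), h5'])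
  have l4 := GenKahler.laplacian_pair h4 h3 h5'
  have lA := GenKahler.laplacian_single h5
  have lA' := GenKahler.laplacian_single h5'
  have key : ∀ (k : ℕ) {T T' : Module.End ℂ (GenKahler.SForm (2 * n) M)}, T = k • T' →
      ∀ ρ, (T ρ).1 = (k : ℂ) • (T' ρ).1 := fun k T T' h ρ => by
    rw [h, ← Nat.cast_smul_eq_nsmul ℂ]
    rfl
  refine ⟨fun ρ hρ => ?_, ?_, fun ρ hρ => ?_⟩
  · obtain ⟨ρ, rfl⟩ : ∃ τ : GenKahler.SForm (2 * n) M, τ.1 = ρ := ⟨⟨ρ, hρ⟩, rfl⟩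
    rw [rD, rA, rB, rA', rB']
    rfl
  · simp only [List.forall_mem_cons, List.not_mem_nil, false_imp_iff, implies_true, and_true]
    exact ⟨(aD.adjoint_spec rD).1, (a1.adjoint_spec r1).1, (a2.adjoint_spec r2).1,
      (a3.adjoint_spec r3).1, (a4.adjoint_spec r4).1, (aA.adjoint_spec rA).1,
      (aB.adjoint_spec rB).1, (aA'.adjoint_spec rA').1, (aB'.adjoint_spec rB').1⟩
  · obtain ⟨ρ, rfl⟩ : ∃ τ : GenKahler.SForm (2 * n) M, τ.1 = ρ := ⟨⟨ρ, hρ⟩, rfl⟩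
    refine ⟨((aA.adjoint_spec rA).2 ρ).trans (congrArg Neg.neg (rA' ρ)).symm,
      ((aB.adjoint_spec rB).2 ρ).trans (rB' ρ).symm, ?_, ?_⟩
    · simp only [List.forall_mem_cons, List.not_mem_nil, false_imp_iff, implies_true, and_true]
      rw [aD.laplacian_eq rD, a1.laplacian_eq r1, a2.laplacian_eq r2, a3.laplacian_eq r3,
        a4.laplacian_eq r4, l, l1, l2, l3, l4, add_comm (b' * b)]
      have := key 2 (T := 4 • (b * b' + b' * b)) (T' := 2 • (b * b' + b' * b))
        (smul_smul 2 2 (b * b' + b' * b)).symm ρ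
      exact ⟨this, this, this, this⟩
    · simp only [List.forall_mem_cons, List.not_mem_nil, false_imp_iff, implies_true, and_true]
      rw [aD.laplacian_eq rD, aA.laplacian_eq rA, aB.laplacian_eq rB, aA'.laplacian_eq rA',
        aB'.laplacian_eq rB', l, lA, lA', add_comm (b' * b)]
      have := key 4 (T := 4 • (b * b' + b' * b)) (T' := b * b' + b' * b) rfl ρ
      exact ⟨this, this, this, this⟩
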